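/- Let $p$ be a prime, and let $(\varepsilon^{(n)})_{n\ge 0}$ be a compatible system of primitive $p^n$-th roots of unity in $\overline{\mathbb Q}_p$ (so $(\varepsilon^{(n+1)})^p=\varepsilon^{(n)}$). For real $r\ge p-1$ let $\mathcal R^{r}$ be the ring of Laurent series $\sum_{i\in\mathbb Z}a_iT^i$, $a_i\in\mathbb Q_p$, converging on $p^{-1/r}\le |T|<1$, let $\mathcal R=\bigcup_r\mathcal R^r$ be the Robba ring over $\mathbb{Q}_p$, and let $t=\log(1+T)$. Let $\varphi(T)=(1+T)^p-1$, and let $\Gamma=\mathrm{Gal}(\overline{\mathbb Q}_p/\mathbb Q_p)/\ker\chi$ ($\chi$ the cyclotomic character) act by $\gamma(T)=(1+T)^{\chi(\gamma)}-1$. Put $n(r)=\log(r/(p-1))/\log p+1$, let $\lceil n(r)\rceil$ be the least integer $\geq n(r)$, and write $K_n=\mathbb Q_p(\varepsilon^{(n)})$. For integers $n\ge n(r)$ let $\iota_n:\mathcal R^r\to K_n[[t]]$ be the map $T\mapsto \varepsilon^{(n)}e^{t/p^n}-1$; it induces $\iota_n:\mathcal R^r/(t^k)\to K_n[t]/(t^k)$.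 Let $\Gamma$ act on $K_n[[t]]$ through its Galois action on $K_n$ and $\gamma(t)=\chi(\gamma)t$. A generalized $(\varphi,\Gamma)$-module is a finitely presented $\mathcal R$-module $D$ with commuting semilinear actions of $\varphi$ and of the group $\Gamma$ such that $1\otimes\varphi:\varphi^*D\to D$ is an isomorphism; it is a $(\varphi,\Gamma)$-module if it is free over $\mathcal{R}$, and pure $t^k$-torsion if it is a free $\mathcal R/(t^k)$-module. **(0)** For all $k\ge 0$ and $r\geq p-1$ there is a unique ring homomorphism $\delta:K_{\lceil n(r)\rceil}[t]/(t^k)\to\mathcal R^r/(t^k)$ such that $\iota_n\circ\delta$ is the inclusion into $K_n[t]/(t^k)$ for every $n\ge n(r)$. It is $\Gamma$-equivariant. Through it, $\mathcal R^r/(t^k)$-modules are regarded as $K_{\lceil n(r)\rceil}[t]/(t^k)$-modules. **(I)** Let $S$ be a pure $t^k$-torsion $(\varphi,\Gamma)$-module with an $\mathcal R/(t^k)$-basis $e_1,\dots,e_d$. For $r_0$ large enough there are matrices $A,B,C_\gamma$ ($\gamma\in\Gamma$) over $\mathcal R^{r_0}/(t^k)$ whose members $A$ and $C_\gamma$ map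 to the matrices of $\varphi$ and $\gamma$ in this basis, and which satisfy $AB=BA=1$, $C_1=1$, $C_{\gamma\gamma'}=C_\gamma\,\gamma(C_{\gamma'})$ over $\mathcal R^{r_0}/(t^k)$ and $A\,\varphi(C_\gamma)=C_\gamma\,\gamma(A)$ over $\mathcal R^{pr_0}/(t^k)$. Given any such $r_0$ and matrices, let, for $r\ge r_0$, $S_r$ be the free $\mathcal R^r/(t^k)$-module on $e_1,\dots,e_d$, with the actions of $\Gamma$ on $S_r$ and of $\varphi:S_r\to S_{pr}$ given by these matrices, and put $S^n=S_r\otimes_{\mathcal R^r/(t^k),\iota_n}K_n[t]/(t^k)$ for $n\geq n(r)$. Then, for all $r\geq r_0$, $1\otimes\varphi:\mathcal R^{pr}/(t^k)\otimes_{\varphi,\mathcal R^{r}/(t^k)}S_r\to S_{pr}$ is an isomorphism; for $n\ge n(r)$, $S^n$ is free of rank $d$ over $K_n[t]/(t^k)$ and has a semilinear action of $\Gamma$ for which $S_r\to S^n$ is $\Gamma$-equivariant; for $r'\ge r$ and $n\geq n(r')$ the natural map $S_r\to S_{r'}$ induces an isomorphism between the modules $S^n$ formed from $r$ and from $r'$;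 and $\varphi$ induces an injective semilinear map $\varphi_n:S^n\to S^{n+1}$ with $K_{n+1}[t]/(t^k)\otimes_{K_n[t]/(t^k)} S^n\cong S^{n+1}$. Moreover: 1. the natural maps induce an isomorphism $S_r\cong\prod_{n\ge n(r)}S^n$ of $K_{\lceil n(r)\rceil}[t]/(t^k)$-modules, compatible with the actions of $\Gamma$; 2. under it, for $r'\ge r$, the natural map $S_r\to S_{r'}$ is the truncation $(x_n)_{n\ge n(r)}\mapsto(x_n)_{n\ge n(r')}$; 3. under it, $\varphi:S_r\to S_{pr}$ is the shift $(x_n)_{n\ge n(r)}\mapsto(y_n)_{n\ge n(r)+1}$ with $y_{n+1}=\varphi_n(x_n)$. **(II)** Let $E\subseteq D$ be $(\varphi,\Gamma)$-modules of the same rank $d$, with $\varphi$ and $\Gamma$ on $E$ induced from $D$. Then $t^kD\subseteq E$ for some $k$. For all sufficiently large $r$ there is a unique $\mathcal R^r$-submodule $D_r\subseteq D$ that is generated by an $\mathcal R$-basis $b_1,\dots,b_d$ of $D$ such that $\varphi(b_1),\dots,\varphi(b_d)$ generate the $\mathcal R^{pr}$-module $\mathcal R^{pr}D_r$, and that is stable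 under $\Gamma$; likewise a unique $E_r\subseteq E$; and $E_r\subseteq D_r$. Put $D^{+,n}_{\rm dif}(D)=D_r\otimes_{\mathcal R^r,\iota_n}K_n[[t]]$, and likewise for $E$. For all sufficiently large $r$ and all $n\ge n(r)$, the map $D^{+,n}_{\rm dif}(E)\to D^{+,n}_{\rm dif}(D)$ is injective, and $Q^n=D^{+,n}_{\rm dif}(D)/D^{+,n}_{\rm dif}(E)$ has a semilinear action of $\Gamma$ for which $D_r/E_r\to Q^n$ is equivariant; for $r'\ge r$ and $n\geq n(r')$ the modules $Q^n$ formed from $r$ and $r'$ are identified by the natural map; and $\varphi$ induces an injective semilinear map $\varphi_n:Q^n\to Q^{n+1}$ with $K_{n+1}[[t]]\otimes_{K_n[[t]]}Q^n\cong Q^{n+1}$. Moreover, for all sufficiently large $r$: 1. localization induces an isomorphism $D_r/E_r\cong\prod_{n\ge n(r)}Q^n$, compatible with the actions of $\Gamma$; if $t^kD\subseteq E$, then $t^k$ kills both sides and the isomorphism is $K_{\lceil n(r)\rceil}[t]/(t^k)$-linear; 2. under it, for $r'\ge r$, the natural map $D_r/E_r\to D_{r'}/E_{r'}$ is the truncation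 $(x_n)_{n\ge n(r)}\mapsto(x_n)_{n\ge n(r')}$; 3. under it, $\varphi:D_r/E_r\to D_{pr}/E_{pr}$ is the shift $(x_n)_{n\ge n(r)}\mapsto(y_n)_{n\ge n(r)+1}$ with $y_{n+1}=\varphi_n(x_n)$. -/

import Mathlib

set_option linter.unusedSectionVars false

noncomputable section

open Filter Topology

namespace PhiGamma

/-! ## Two-sided series over a complete ultrametric field -/

section Laurent

variable {F : Type*} [NormedField F]

/-- The Laurent series `∑ f k * T ^ k` converges at the points of absolute value `ρ`. -/
def ConvAt (ρ : ℝ) (f : ℤ → F) : Prop :=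
  Tendsto (fun k => ‖f k‖ * ρ ^ k) cofinite (𝓝 0)

/-- Coefficients of the product of two Laurent series. -/
def lmul (f g : ℤ → F) : ℤ → F := fun k => ∑' i, f i * g (k - i)

variable {ρ : ℝ} {f g h : ℤ → F}

theorem tendsto_bdd {ι : Type*} {a : ι → ℝ} (ha : Tendsto a cofinite (𝓝 0)) :
    ∃ C, 0 ≤ C ∧ ∀ i, |a i| ≤ C := by
  have h1 : ∀ᶠ i in cofinite, |a i| ≤ 1 := by
    have := (tendsto_zero_iff_abs_tendsto_zero _).1 ha
    exact (this.eventually (eventually_le_nhds zero_lt_one))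
  have h2 : {i | ¬ |a i| ≤ 1}.Finite := h1
  refine ⟨1 + ∑ i ∈ h2.toFinset, |a i|, by positivity, fun i => ?_⟩
  by_cases hi : |a i| ≤ 1
  · exact hi.trans (le_add_of_nonneg_right (by positivity))
  · have : |a i| ≤ ∑ i ∈ h2.toFinset, |a i| :=
      Finset.single_le_sum (f := fun i => |a i|) (fun _ _ => abs_nonneg _) (by simpa using hi)
    linarith

theorem ConvAt.add [IsUltrametricDist F] (hf : ConvAt ρ f) (hg : ConvAt ρ g) (hρ : 0 < ρ) :
    ConvAt ρ (f + g) := by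
  unfold ConvAt at *
  refine squeeze_zero (fun k => by positivity) (fun k => ?_) (by simpa using Tendsto.add hf hg)
  rw [← add_mul]
  exact mul_le_mul_of_nonneg_right (norm_add_le _ _) (by positivity)

theorem ConvAt.neg (hf : ConvAt ρ f) : ConvAt ρ (-f) := by
  simpa [ConvAt] using hf

theorem convAt_single (ρ : ℝ) (n : ℤ) (a : F) : ConvAt ρ (Pi.single n a) := by
  refine tendsto_nhds_of_eventually_eq ?_
  have : {n}ᶜ ∈ (cofinite : Filter ℤ) := (Set.finite_singleton n).compl_mem_cofinite
  filter_upwards [this] with k hk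
  have hk' : k ≠ n := hk
  simp [Pi.single_eq_of_ne hk']

theorem convAt_zero (ρ : ℝ) : ConvAt ρ (0 : ℤ → F) := by simp [ConvAt]

theorem ConvAt.prod (hf : ConvAt ρ f) (hg : ConvAt ρ g) :
    Tendsto (fun x : ℤ × ℤ => (‖f x.1‖ * ρ ^ x.1) * (‖g x.2‖ * ρ ^ x.2)) cofinite (𝓝 0) :=
  tendsto_mul_cofinite_nhds_zero hf hg

theorem tendsto_of_mul_const {ι : Type*} {a : ι → F} {c : ℝ} (hc : 0 < c)
    (h : Tendsto (fun i => ‖a i‖ * c) cofinite (𝓝 0)) : Tendsto a cofinite (𝓝 0) := by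
  rw [tendsto_zero_iff_norm_tendsto_zero]
  have := h.mul_const c⁻¹
  simpa [hc.ne'] using this

theorem lmul_comm (f g : ℤ → F) : lmul f g = lmul g f := by
  funext k
  unfold PhiGamma.lmul
  rw [← (Equiv.subLeft k).tsum_eq]
  refine tsum_congr fun i => ?_
  simp [mul_comm]

theorem single_lmul (f : ℤ → F) (n : ℤ) (a : F) (k : ℤ) :
    lmul (Pi.single n a) f k = a * f (k - n) := by
  unfold PhiGamma.lmul
  rw [tsum_eq_single n]
  · simp
  · intro i hi
    simp [Pi.single_eq_of_ne hi]

theorem lmul_aux (hρ : 0 < ρ) (hf : ConvAt ρ f) (hg : ConvAt ρ g) :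
    Tendsto (fun x : ℤ × ℤ => ‖f x.1 * g (x.2 - x.1)‖ * ρ ^ x.2) cofinite (𝓝 0) := by
  have := (hf.prod hg).comp (Function.Injective.tendsto_cofinite
    (f := fun x : ℤ × ℤ => (x.1, x.2 - x.1)) (fun x y hxy => by
      simp only [Prod.mk.injEq] at hxy
      ext <;> omega))
  refine this.congr fun x => ?_
  simp only [Function.comp]
  rw [norm_mul, show ρ ^ x.2 = ρ ^ x.1 * ρ ^ (x.2 - x.1) by rw [← zpow_add₀ hρ.ne']; ring_nf]
  ring

/-! ### Substitution: `U k` is the Laurent series of the `k`-th power of the substituted element -/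

variable {U : ℤ → ℤ → F} {σ : ℝ}

/-- The series `∑ f k * U k`, coefficient by coefficient. -/
def lsub (U : ℤ → ℤ → F) (f : ℤ → F) : ℤ → F := fun j => ∑' k, f k * U k j

theorem sub_aux (hσ : 0 < σ) (hρ : 0 < ρ) (hf : ConvAt σ f)
    (H1 : ∀ k j, ‖U k j‖ * ρ ^ j ≤ σ ^ k) (H2 : ∀ k, ConvAt ρ (U k)) :
    Tendsto (fun x : ℤ × ℤ => ‖f x.1 * U x.1 x.2‖ * ρ ^ x.2) cofinite (𝓝 0) := by
  rw [Metric.tendsto_nhds]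
  intro ε hε
  have h1 : {k : ℤ | ¬ dist (‖f k‖ * σ ^ k) 0 < ε}.Finite := (Metric.tendsto_nhds.1 hf) ε hε
  have h2 : ∀ k, {j : ℤ | ¬ dist (‖f k * U k j‖ * ρ ^ j) 0 < ε}.Finite := by
    intro k
    have : Tendsto (fun j => ‖f k * U k j‖ * ρ ^ j) cofinite (𝓝 0) := by
      have := Tendsto.const_mul ‖f k‖ (H2 k)
      simpa [norm_mul, mul_assoc] using this
    exact (Metric.tendsto_nhds.1 this) ε hε
  refine Set.Finite.subset (h1.biUnion fun k _ => (h2 k).image fun j => (k, j)) ?_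
  rintro ⟨k, j⟩ hkj
  simp only [Set.mem_iUnion]
  refine ⟨k, ?_, j, hkj, rfl⟩
  intro hk
  apply hkj
  change dist (‖f k * U k j‖ * ρ ^ j) 0 < ε
  rw [Real.dist_0_eq_abs, abs_of_nonneg (by positivity)] at hk ⊢
  refine lt_of_le_of_lt ?_ hk
  rw [norm_mul, mul_assoc]
  exact mul_le_mul_of_nonneg_left (H1 k j) (norm_nonneg _)

theorem lsub_single (n : ℤ) (a : F) (j : ℤ) : lsub U (Pi.single n a) j = a * U n j := by
  unfold PhiGamma.lsub
  rw [tsum_eq_single n]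
  · simp
  · intro i hi
    simp [Pi.single_eq_of_ne hi]

variable [IsUltrametricDist F] [CompleteSpace F]

/-- Summation of a family of Laurent series. -/
theorem convAt_tsum {κ : Type*} {a : κ → ℤ → F} (hρ : 0 < ρ)
    (h : Tendsto (fun x : κ × ℤ => ‖a x.1 x.2‖ * ρ ^ x.2) cofinite (𝓝 0)) :
    (∀ j, Summable fun k => a k j) ∧ ConvAt ρ (fun j => ∑' k, a k j) := by
  constructor
  · intro j
    refine NonarchimedeanAddGroup.summable_of_tendsto_cofinite_zero
      (tendsto_of_mul_const (c := ρ ^ j) (by positivity) ?_)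
    exact h.comp (Function.Injective.tendsto_cofinite (f := fun k : κ => (k, j))
      (fun x y hxy => by simpa using hxy))
  · unfold ConvAt
    rw [Metric.tendsto_nhds]
    intro ε hε
    have h1 := (Metric.tendsto_nhds.1 h) (ε / 2) (by positivity)
    have h2 : {x : κ × ℤ | ¬ dist (‖a x.1 x.2‖ * ρ ^ x.2) 0 < ε / 2}.Finite := h1
    refine ((h2.image Prod.snd).subset ?_)
    intro j hj
    by_contra hcon
    apply hj
    have h3 : ∀ k, ‖a k j‖ ≤ (ε / 2) * (ρ ^ j)⁻¹ := by
      intro k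
      have : dist (‖a k j‖ * ρ ^ j) 0 < ε / 2 := by
        by_contra h4
        exact hcon ⟨(k, j), h4, rfl⟩
      rw [Real.dist_0_eq_abs, abs_of_nonneg (by positivity)] at this
      rw [← div_eq_mul_inv, le_div_iff₀ (by positivity)]
      exact this.le
    have h5 : ‖∑' k, a k j‖ ≤ (ε / 2) * (ρ ^ j)⁻¹ :=
      IsUltrametricDist.norm_tsum_le_of_forall_le_of_nonneg (by positivity) h3
    change dist _ _ < ε
    rw [Real.dist_0_eq_abs, abs_of_nonneg (by positivity)]
    rw [← div_eq_mul_inv, le_div_iff₀ (by positivity)] at h5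
    linarith

theorem summable_lmul (hρ : 0 < ρ) (hf : ConvAt ρ f) (hg : ConvAt ρ g) (k : ℤ) :
    Summable fun i => f i * g (k - i) :=
  (convAt_tsum hρ (a := fun i k => f i * g (k - i)) (lmul_aux hρ hf hg)).1 k

theorem ConvAt.lmul (hρ : 0 < ρ) (hf : ConvAt ρ f) (hg : ConvAt ρ g) : ConvAt ρ (lmul f g) :=
  (convAt_tsum hρ (a := fun i k => f i * g (k - i)) (lmul_aux hρ hf hg)).2

theorem lmul_add (hρ : 0 < ρ) (hf : ConvAt ρ f) (hg : ConvAt ρ g) (hh : ConvAt ρ h) :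
    lmul f (g + h) = lmul f g + lmul f h := by
  funext k
  simp only [PhiGamma.lmul, Pi.add_apply, mul_add]
  exact (summable_lmul hρ hf hg k).tsum_add (summable_lmul hρ hf hh k)

theorem summable3 (hρ : 0 < ρ) (hf : ConvAt ρ f) (hg : ConvAt ρ g) (hh : ConvAt ρ h) (k : ℤ) :
    Summable fun x : ℤ × ℤ => f x.1 * g x.2 * h (k - x.1 - x.2) := by
  refine NonarchimedeanAddGroup.summable_of_tendsto_cofinite_zero
    (tendsto_of_mul_const (c := ρ ^ k) (by positivity) ?_)
  obtain ⟨C, hC, hb⟩ := tendsto_bdd hh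
  refine squeeze_zero (fun k => by positivity) (fun x => ?_)
    (by simpa using (hf.prod hg).mul_const C)
  have h1 := (le_abs_self _).trans (hb (k - x.1 - x.2))
  rw [norm_mul, norm_mul, show ρ ^ k = ρ ^ x.1 * ρ ^ x.2 * ρ ^ (k - x.1 - x.2) by
    rw [← zpow_add₀ hρ.ne', ← zpow_add₀ hρ.ne']; ring_nf]
  calc _ = (‖f x.1‖ * ρ ^ x.1) * (‖g x.2‖ * ρ ^ x.2) *
        (‖h (k - x.1 - x.2)‖ * ρ ^ (k - x.1 - x.2)) := by ring
    _ ≤ _ := mul_le_mul_of_nonneg_left h1 (by positivity)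

theorem lmul_assoc (hρ : 0 < ρ) (hf : ConvAt ρ f) (hg : ConvAt ρ g) (hh : ConvAt ρ h) :
    lmul (lmul f g) h = lmul f (lmul g h) := by
  funext k
  have hs := summable3 hρ hf hg hh k
  have hs' : Summable (Function.uncurry fun i j => f j * g (i - j) * h (k - i)) := by
    have := hs.comp_injective (i := fun x : ℤ × ℤ => (x.2, x.1 - x.2)) (fun x y hxy => by
      simp only [Prod.mk.injEq] at hxy
      ext <;> omega)
    refine this.congr fun x => ?_
    simp [Function.uncurry]
  calc lmul (lmul f g) h k = ∑' i, ∑' j, f j * g (i - j) * h (k - i) := by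
        unfold PhiGamma.lmul
        refine tsum_congr fun i => ?_
        rw [tsum_mul_right]
    _ = ∑' j, ∑' i, f j * g (i - j) * h (k - i) := (hs'.tsum_comm).symm
    _ = ∑' j, ∑' l, f j * g l * h (k - j - l) := by
        refine tsum_congr fun j => ?_
        rw [← (Equiv.addLeft j).tsum_eq]
        refine tsum_congr fun l => ?_
        simp [sub_sub]
    _ = lmul f (lmul g h) k := by
        unfold PhiGamma.lmul
        refine tsum_congr fun j => ?_
        rw [← tsum_mul_left]
        refine tsum_congr fun l => ?_
        ring

theorem summable_lsub (hσ : 0 < σ) (hρ : 0 < ρ) (hf : ConvAt σ f)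
    (H1 : ∀ k j, ‖U k j‖ * ρ ^ j ≤ σ ^ k) (H2 : ∀ k, ConvAt ρ (U k)) (j : ℤ) :
    Summable fun k => f k * U k j :=
  (convAt_tsum hρ (a := fun k j => f k * U k j) (sub_aux hσ hρ hf H1 H2)).1 j

theorem ConvAt.lsub (hσ : 0 < σ) (hρ : 0 < ρ) (hf : ConvAt σ f)
    (H1 : ∀ k j, ‖U k j‖ * ρ ^ j ≤ σ ^ k) (H2 : ∀ k, ConvAt ρ (U k)) : ConvAt ρ (lsub U f) :=
  (convAt_tsum hρ (a := fun k j => f k * U k j) (sub_aux hσ hρ hf H1 H2)).2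

theorem lsub_add (hσ : 0 < σ) (hρ : 0 < ρ) (hf : ConvAt σ f) (hg : ConvAt σ g)
    (H1 : ∀ k j, ‖U k j‖ * ρ ^ j ≤ σ ^ k) (H2 : ∀ k, ConvAt ρ (U k)) :
    lsub U (f + g) = lsub U f + lsub U g := by
  funext j
  simp only [PhiGamma.lsub, Pi.add_apply, add_mul]
  exact (summable_lsub hσ hρ hf H1 H2 j).tsum_add (summable_lsub hσ hρ hg H1 H2 j)

theorem lsub_lmul (hσ : 0 < σ) (hρ : 0 < ρ) (hf : ConvAt σ f) (hg : ConvAt σ g)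
    (H1 : ∀ k j, ‖U k j‖ * ρ ^ j ≤ σ ^ k) (H2 : ∀ k, ConvAt ρ (U k))
    (H3 : ∀ k l, lmul (U k) (U l) = U (k + l)) :
    lsub U (lmul f g) = lmul (lsub U f) (lsub U g) := by
  funext j
  have hP := sub_aux hσ hρ hf H1 H2
  have hQ := sub_aux hσ hρ hg H1 H2
  have hs4 : Summable (Function.uncurry fun (i : ℤ) (x : ℤ × ℤ) =>
      (f x.1 * U x.1 i) * (g x.2 * U x.2 (j - i))) := by
    refine NonarchimedeanAddGroup.summable_of_tendsto_cofinite_zero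
      (tendsto_of_mul_const (c := ρ ^ j) (by positivity) ?_)
    have := (tendsto_mul_cofinite_nhds_zero hP hQ).comp (Function.Injective.tendsto_cofinite
      (f := fun x : ℤ × (ℤ × ℤ) => ((x.2.1, x.1), (x.2.2, j - x.1))) (fun x y hxy => by
        simp only [Prod.mk.injEq] at hxy
        ext
        · exact hxy.1.2
        · exact hxy.1.1
        · exact hxy.2.1))
    refine this.congr fun x => ?_
    simp only [Function.comp, Function.uncurry]
    rw [norm_mul (f x.2.1 * U x.2.1 x.1), show ρ ^ j = ρ ^ x.1 * ρ ^ (j - x.1) by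
      rw [← zpow_add₀ hρ.ne']; ring_nf]
    ring
  have hinner : ∀ x : ℤ × ℤ, ∑' i, (f x.1 * U x.1 i) * (g x.2 * U x.2 (j - i)) =
      f x.1 * g x.2 * U (x.1 + x.2) j := by
    intro x
    rw [← H3, PhiGamma.lmul, ← tsum_mul_left]
    exact tsum_congr fun i => by ring
  have hs2 : Summable fun x : ℤ × ℤ => f x.1 * g x.2 * U (x.1 + x.2) j := by
    have := hs4.prod_symm.prod
    refine this.congr fun x => ?_
    rw [← hinner]
    rfl
  have hs2' : Summable (Function.uncurry fun m k => f k * g (m - k) * U m j) := by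
    have := hs2.comp_injective (i := fun x : ℤ × ℤ => (x.2, x.1 - x.2)) (fun x y hxy => by
      simp only [Prod.mk.injEq] at hxy
      ext <;> omega)
    refine this.congr fun x => ?_
    simp [Function.uncurry]
  calc lsub U (lmul f g) j = ∑' m, ∑' k, f k * g (m - k) * U m j := by
        unfold PhiGamma.lsub PhiGamma.lmul
        exact tsum_congr fun m => by rw [tsum_mul_right]
    _ = ∑' k, ∑' m, f k * g (m - k) * U m j := (hs2'.tsum_comm).symm
    _ = ∑' k, ∑' l, f k * g l * U (k + l) j := by
        refine tsum_congr fun k => ?_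
        rw [← (Equiv.addLeft k).tsum_eq]
        refine tsum_congr fun l => ?_
        simp
    _ = ∑' x : ℤ × ℤ, f x.1 * g x.2 * U (x.1 + x.2) j := (hs2.tsum_prod).symm
    _ = ∑' x : ℤ × ℤ, ∑' i, (f x.1 * U x.1 i) * (g x.2 * U x.2 (j - i)) :=
        tsum_congr fun x => (hinner x).symm
    _ = ∑' i, ∑' x : ℤ × ℤ, (f x.1 * U x.1 i) * (g x.2 * U x.2 (j - i)) := hs4.tsum_comm
    _ = lmul (lsub U f) (lsub U g) j := by
        unfold PhiGamma.lsub PhiGamma.lmul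
        refine tsum_congr fun i => ?_
        have h1 := summable_lsub hσ hρ hf H1 H2 i
        have h2 := summable_lsub hσ hρ hg H1 H2 (j - i)
        exact (h1.tsum_mul_tsum h2 (hs4.prod_factor i)).symm

end Laurent

open PowerSeries

/-! ## The Robba ring over `ℚ_p` -/

section Robba

variable (p : ℕ) [hp : Fact p.Prime]

/-- `f` converges on the annulus `p ^ (-1 / r) ≤ |T| < 1`. -/
def ConvOn (r : ℝ) (f : ℤ → ℚ_[p]) : Prop :=
  ∀ ρ : ℝ, (p : ℝ) ^ (-1 / r) ≤ ρ → ρ < 1 → ConvAt ρ f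

theorem radius_pos (r : ℝ) : 0 < (p : ℝ) ^ (-1 / r) :=
  Real.rpow_pos_of_pos (by exact_mod_cast hp.1.pos) _

variable {p} in
theorem ConvOn.mono {r r' : ℝ} (h0 : 0 < r) (h : r ≤ r') {f : ℤ → ℚ_[p]} (hf : ConvOn p r f) :
    ConvOn p r' f := by
  intro ρ h1 h2
  refine hf ρ (le_trans ?_ h1) h2
  refine Real.rpow_le_rpow_of_exponent_le (by exact_mod_cast hp.1.one_le) ?_
  rw [neg_div, neg_div, neg_le_neg_iff]
  exact one_div_le_one_div_of_le h0 h

/-- The additive group of Laurent series converging on `p ^ (-1 / r) ≤ |T| < 1` for some `r`. -/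
def robbaAddSubgroup : AddSubgroup (ℤ → ℚ_[p]) where
  carrier := {f | ∃ r : ℝ, 0 < r ∧ ConvOn p r f}
  zero_mem' := ⟨1, one_pos, fun ρ _ _ => convAt_zero ρ⟩
  add_mem' := by
    rintro f g ⟨r, hr, hf⟩ ⟨s, hs, hg⟩
    refine ⟨max r s, lt_max_of_lt_left hr, fun ρ h1 h2 => ?_⟩
    exact (hf.mono hr (le_max_left _ _) ρ h1 h2).add (hg.mono hs (le_max_right _ _) ρ h1 h2)
      ((radius_pos p _).trans_le h1)
  neg_mem' := by
    rintro f ⟨r, hr, hf⟩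
    exact ⟨r, hr, fun ρ h1 h2 => (hf ρ h1 h2).neg⟩

/-- The Robba ring over `ℚ_p`, in the variable `T` (which is `π = [ε] - 1`). -/
def Robba : Type := robbaAddSubgroup p

instance : AddCommGroup (Robba p) := inferInstanceAs (AddCommGroup (robbaAddSubgroup p))

variable {p}

/-- The coefficients of an element of the Robba ring. -/
def Robba.coe (f : Robba p) : ℤ → ℚ_[p] := f.1

@[ext] theorem Robba.ext {f g : Robba p} (h : f.coe = g.coe) : f = g := Subtype.ext h

theorem Robba.conv (f : Robba p) : ∃ r : ℝ, 0 < r ∧ ConvOn p r f.coe := f.2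

theorem Robba.conv₂ (f g : Robba p) :
    ∃ r : ℝ, 0 < r ∧ ConvOn p r f.coe ∧ ConvOn p r g.coe := by
  obtain ⟨r, hr, hf⟩ := f.conv
  obtain ⟨s, hs, hg⟩ := g.conv
  exact ⟨max r s, lt_max_of_lt_left hr, hf.mono hr (le_max_left _ _), hg.mono hs (le_max_right _ _)⟩

theorem Robba.conv₃ (f g h : Robba p) :
    ∃ ρ : ℝ, 0 < ρ ∧ ConvAt ρ f.coe ∧ ConvAt ρ g.coe ∧ ConvAt ρ h.coe := by
  obtain ⟨r, hr, hf, hg⟩ := f.conv₂ g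
  obtain ⟨s, hs, hh⟩ := h.conv
  have hm : 0 < max r s := lt_max_of_lt_left hr
  have h1 : (p : ℝ) ^ (-1 / max r s) < 1 :=
    Real.rpow_lt_one_of_one_lt_of_neg (by exact_mod_cast hp.1.one_lt)
      (div_neg_of_neg_of_pos (by norm_num) hm)
  exact ⟨_, radius_pos p _, hf.mono hr (le_max_left _ _) _ le_rfl h1,
    hg.mono hr (le_max_left _ _) _ le_rfl h1, hh.mono hs (le_max_right _ _) _ le_rfl h1⟩

theorem ConvOn.lmul {r : ℝ} {f g : ℤ → ℚ_[p]} (hf : ConvOn p r f) (hg : ConvOn p r g) :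
    ConvOn p r (lmul f g) := fun ρ h1 h2 =>
  (hf ρ h1 h2).lmul ((radius_pos p _).trans_le h1) (hg ρ h1 h2)

instance : Mul (Robba p) := ⟨fun f g => ⟨lmul f.coe g.coe, by
  obtain ⟨r, hr, hf, hg⟩ := f.conv₂ g
  exact ⟨r, hr, hf.lmul hg⟩⟩⟩

/-- The monomial `a * T ^ n`. -/
def Robba.single (n : ℤ) (a : ℚ_[p]) : Robba p :=
  ⟨Pi.single n a, 1, one_pos, fun ρ _ _ => convAt_single ρ n a⟩

instance : One (Robba p) := ⟨Robba.single 0 1⟩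

theorem Robba.coe_mul (f g : Robba p) : (f * g).coe = lmul f.coe g.coe := rfl
theorem Robba.coe_add (f g : Robba p) : (f + g).coe = f.coe + g.coe := rfl
theorem Robba.coe_one : (1 : Robba p).coe = Pi.single 0 1 := rfl
theorem Robba.coe_zero : (0 : Robba p).coe = 0 := rfl
theorem Robba.coe_neg (f : Robba p) : (-f).coe = -f.coe := rfl
theorem Robba.coe_single (n : ℤ) (a : ℚ_[p]) : (Robba.single n a).coe = Pi.single n a := rfl

theorem Robba.mul_comm_aux (f g : Robba p) : f * g = g * f := Robba.ext (lmul_comm _ _)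

theorem Robba.one_mul_aux (f : Robba p) : 1 * f = f := by
  ext k
  rw [Robba.coe_mul, Robba.coe_one, single_lmul, one_mul, sub_zero]

theorem Robba.mul_add_aux (f g h : Robba p) : f * (g + h) = f * g + f * h := by
  obtain ⟨ρ, hρ, hf, hg, hh⟩ := f.conv₃ g h
  exact Robba.ext (lmul_add hρ hf hg hh)

instance : CommRing (Robba p) where
  __ := (inferInstance : AddCommGroup (Robba p))
  mul_comm := Robba.mul_comm_aux
  mul_assoc f g h := by
    obtain ⟨ρ, hρ, hf, hg, hh⟩ := f.conv₃ g h
    exact Robba.ext (lmul_assoc hρ hf hg hh)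
  one_mul := Robba.one_mul_aux
  mul_one f := by rw [Robba.mul_comm_aux, Robba.one_mul_aux]
  left_distrib := Robba.mul_add_aux
  right_distrib f g h := by
    rw [Robba.mul_comm_aux, Robba.mul_add_aux, Robba.mul_comm_aux h f, Robba.mul_comm_aux h g]
  zero_mul f := by
    have := Robba.mul_add_aux f 0 0
    rw [add_zero, left_eq_add, Robba.mul_comm_aux] at this
    exact this
  mul_zero f := by
    have := Robba.mul_add_aux f 0 0
    rwa [add_zero, left_eq_add] at this

/-- The subring of the Robba ring of series converging on `p ^ (-1 / r) ≤ |T| < 1`. -/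
def RobbaR (p : ℕ) [Fact p.Prime] (r : ℝ) : Subring (Robba p) where
  carrier := {f | ConvOn p r f.coe}
  zero_mem' := fun ρ _ _ => convAt_zero ρ
  one_mem' := fun ρ _ _ => convAt_single ρ 0 1
  add_mem' := fun hf hg ρ h1 h2 =>
    (hf ρ h1 h2).add (hg ρ h1 h2) ((radius_pos p _).trans_le h1)
  mul_mem' := fun hf hg => ConvOn.lmul hf hg
  neg_mem' := fun hf ρ h1 h2 => (hf ρ h1 h2).neg

theorem RobbaR_mono {r r' : ℝ} (h0 : 0 < r) (h : r ≤ r') : RobbaR p r ≤ RobbaR p r' :=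
  fun _ hf => ConvOn.mono h0 h hf

end Robba

/-! ## Powers of a substituted element -/

section SubCoeff

variable {F : Type*} [NormedField F]

/-- The coefficients of the Laurent series `T ^ a * g(T ^ s)`, for a power series `g`, an integer
`a` and a sign `s`. -/
def laur (g : F⟦X⟧) (a : ℤ) (s : ℤˣ) (j : ℤ) : F :=
  if 0 ≤ (s : ℤ) * (j - a) then coeff ((s : ℤ) * (j - a)).toNat g else 0

theorem laur_apply (g : F⟦X⟧) (a : ℤ) (s : ℤˣ) (i : ℕ) :
    laur g a s (a + s * i) = coeff i g := by
  have : (s : ℤ) * (a + s * i - a) = i := by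
    rw [add_sub_cancel_left, ← mul_assoc, Int.units_coe_mul_self, one_mul]
  simp only [laur, this, Int.natCast_nonneg, if_true, Int.toNat_natCast]

theorem laur_mul (g h : F⟦X⟧) (a b : ℤ) (s : ℤˣ) :
    lmul (laur g a s) (laur h b s) = laur (g * h) (a + b) s := by
  have hss : (s : ℤ) * s = 1 := Int.units_coe_mul_self s
  funext j
  unfold PhiGamma.lmul
  set n : ℤ := (s : ℤ) * (j - (a + b)) with hn
  have hj : j = (a + b) + s * n := by
    rw [hn, ← mul_assoc, hss]; ring
  by_cases hn0 : 0 ≤ n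
  · obtain ⟨m, hm⟩ := Int.eq_ofNat_of_zero_le hn0
    rw [hj, hm, laur_apply, coeff_mul, Finset.Nat.sum_antidiagonal_eq_sum_range_succ_mk]
    rw [tsum_eq_sum (s := (Finset.range (m + 1)).image fun i : ℕ => a + s * (i : ℤ))]
    · rw [Finset.sum_image]
      · refine Finset.sum_congr rfl fun i hi => ?_
        rw [Finset.mem_range] at hi
        rw [laur_apply, show a + b + (s : ℤ) * m - (a + s * (i : ℤ)) =
          b + s * ((m - i : ℕ) : ℤ) by rw [Nat.cast_sub (by omega)]; ring, laur_apply]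
      · intro x _ y _ hxy
        have h2 : (s : ℤ) * x = s * y := by simpa using hxy
        have := congrArg (fun z => (s : ℤ) * z) h2
        simp only [← mul_assoc, hss, one_mul] at this
        exact_mod_cast this
    · intro i hi
      by_contra hne
      have h1 := left_ne_zero_of_mul hne
      have h2 := right_ne_zero_of_mul hne
      simp only [laur, ne_eq, ite_eq_right_iff, not_forall] at h1 h2
      obtain ⟨h1, -⟩ := h1
      obtain ⟨h2, -⟩ := h2
      obtain ⟨c, hc⟩ := Int.eq_ofNat_of_zero_le h1
      apply hi
      rw [Finset.mem_image]
      refine ⟨c, ?_, ?_⟩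
      · rw [Finset.mem_range]
        have : (s : ℤ) * (a + b + s * m - i - b) = m - c := by
          rw [← hc]
          linear_combination (m : ℤ) * hss
        rw [this] at h2
        omega
      · rw [← hc, ← mul_assoc, hss]
        ring
  · rw [show laur (g * h) (a + b) s j = 0 by
      simp only [laur]
      rw [if_neg (by rwa [← hn])]]
    convert tsum_zero with i
    by_contra hne
    have h1 := left_ne_zero_of_mul hne
    have h2 := right_ne_zero_of_mul hne
    simp only [laur, ne_eq, ite_eq_right_iff, not_forall] at h1 h2
    obtain ⟨h1, -⟩ := h1
    obtain ⟨h2, -⟩ := h2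
    apply hn0
    rw [hn, show (s : ℤ) * (j - (a + b)) = s * (i - a) + s * (j - i - b) by ring]
    exact add_nonneg h1 h2

/-- For a unit `V` of `F⟦X⟧`, an integer `e` and a sign `s`, the coefficients of the
`k`-th power of the Laurent series `T ^ e * V(T ^ s)`. -/
def subCoeff (V : (F⟦X⟧)ˣ) (e : ℤ) (s : ℤˣ) (k : ℤ) : ℤ → F :=
  laur ((V ^ k : (F⟦X⟧)ˣ) : F⟦X⟧) (e * k) s

theorem subCoeff_apply (V : (F⟦X⟧)ˣ) (e : ℤ) (s : ℤˣ) (k : ℤ) (i : ℕ) :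
    subCoeff V e s k (e * k + s * i) = coeff i ((V ^ k : (F⟦X⟧)ˣ) : F⟦X⟧) := laur_apply _ _ _ _

theorem subCoeff_mul (V : (F⟦X⟧)ˣ) (e : ℤ) (s : ℤˣ) (k l : ℤ) :
    lmul (subCoeff V e s k) (subCoeff V e s l) = subCoeff V e s (k + l) := by
  unfold subCoeff
  rw [laur_mul, zpow_add, Units.val_mul, mul_add]

/-- All coefficients of `g` satisfy `‖g i‖ ≤ c * M ^ i`. -/
def Bd (c M : ℝ) (g : F⟦X⟧) : Prop := ∀ i : ℕ, ‖coeff i g‖ ≤ c * M ^ i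

theorem Bd.one {M : ℝ} (hM : 0 ≤ M) : Bd 1 M (1 : F⟦X⟧) := by
  intro i
  rw [coeff_one]
  split_ifs with h
  · simp [h]
  · simpa using pow_nonneg hM i

variable [IsUltrametricDist F]

theorem Bd.mul {c c' M : ℝ} (hc : 0 ≤ c) (hc' : 0 ≤ c') (hM : 0 ≤ M) {g g' : F⟦X⟧}
    (h : Bd c M g) (h' : Bd c' M g') : Bd (c * c') M (g * g') := by
  intro i
  rw [coeff_mul]
  refine IsUltrametricDist.norm_sum_le_of_forall_le_of_nonneg (by positivity) fun x hx => ?_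
  rw [Finset.HasAntidiagonal.mem_antidiagonal] at hx
  rw [norm_mul, ← hx, pow_add]
  calc _ ≤ (c * M ^ x.1) * (c' * M ^ x.2) :=
        mul_le_mul (h _) (h' _) (norm_nonneg _) (by positivity)
    _ = _ := by ring

theorem Bd.inv {c M : ℝ} (hc : 0 < c) (hM : 0 ≤ M) (V : (F⟦X⟧)ˣ)
    (h0 : ‖constantCoeff (V : F⟦X⟧)‖ = c) (h : Bd c M (V : F⟦X⟧)) :
    Bd c⁻¹ M ((V⁻¹ : (F⟦X⟧)ˣ) : F⟦X⟧) := by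
  intro i
  induction i using Nat.strong_induction_on with
  | _ i ih =>
    have h1 : (V : F⟦X⟧) * ((V⁻¹ : (F⟦X⟧)ˣ) : F⟦X⟧) = 1 := V.mul_inv
    have h2 := congrArg (coeff i) h1
    rw [coeff_mul, ← Finset.add_sum_erase _ _ (a := (0, i)) (by simp),
      coeff_zero_eq_constantCoeff] at h2
    have h3 : ‖∑ x ∈ (Finset.HasAntidiagonal.antidiagonal i).erase (0, i),
        coeff x.1 (V : F⟦X⟧) * coeff x.2 ((V⁻¹ : (F⟦X⟧)ˣ) : F⟦X⟧)‖ ≤ M ^ i := by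
      refine IsUltrametricDist.norm_sum_le_of_forall_le_of_nonneg (by positivity) fun x hx => ?_
      rw [Finset.mem_erase, Finset.HasAntidiagonal.mem_antidiagonal] at hx
      have hlt : x.2 < i := by
        rcases x with ⟨a, b⟩
        simp only [ne_eq, Prod.mk.injEq] at hx
        simp only
        by_contra hcon
        exact hx.1 ⟨by omega, by omega⟩
      rw [norm_mul, ← hx.2, pow_add]
      calc _ ≤ (c * M ^ x.1) * (c⁻¹ * M ^ x.2) :=
            mul_le_mul (h _) (ih _ hlt) (norm_nonneg _) (by positivity)
        _ = _ := by field_simp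
    have h4 : ‖(coeff i (1 : F⟦X⟧))‖ ≤ M ^ i := by simpa using Bd.one (F := F) hM i
    have h5 : ‖constantCoeff (V : F⟦X⟧) * coeff i ((V⁻¹ : (F⟦X⟧)ˣ) : F⟦X⟧)‖ ≤ M ^ i := by
      rw [← eq_sub_iff_add_eq] at h2
      rw [h2, sub_eq_add_neg]
      exact (IsUltrametricDist.norm_add_le_max _ _).trans (max_le h4 (by rwa [norm_neg]))
    rw [norm_mul, h0] at h5
    rw [inv_mul_eq_div, le_div_iff₀ hc, mul_comm]
    exact h5

theorem Bd.zpow {c M : ℝ} (hc : 0 < c) (hM : 0 ≤ M) (V : (F⟦X⟧)ˣ)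
    (h0 : ‖constantCoeff (V : F⟦X⟧)‖ = c) (h : Bd c M (V : F⟦X⟧)) (k : ℤ) :
    Bd (c ^ k) M ((V ^ k : (F⟦X⟧)ˣ) : F⟦X⟧) := by
  induction k using Int.induction_on with
  | zero => simpa using Bd.one hM
  | succ k ih =>
    rw [zpow_add_one, Units.val_mul, zpow_add_one₀ hc.ne']
    exact Bd.mul (by positivity) hc.le hM ih h
  | pred k ih =>
    rw [zpow_sub_one, Units.val_mul, zpow_sub_one₀ hc.ne']
    exact Bd.mul (by positivity) (by positivity) hM ih (Bd.inv hc hM V h0 h)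

theorem subCoeff_bd {c M ρ : ℝ} (hc : 0 < c) (hM : 0 ≤ M) (hρ : 0 < ρ) (V : (F⟦X⟧)ˣ)
    (h0 : ‖constantCoeff (V : F⟦X⟧)‖ = c) (h : Bd c M (V : F⟦X⟧)) (e : ℤ) (s : ℤˣ)
    (hs : M * ρ ^ (s : ℤ) < 1) :
    (∀ k j, ‖subCoeff V e s k j‖ * ρ ^ j ≤ (c * ρ ^ e) ^ k) ∧
      ∀ k, ConvAt ρ (subCoeff V e s k) := by
  have hss : (s : ℤ) * s = 1 := Int.units_coe_mul_self s
  have key : ∀ k (i : ℕ), ‖subCoeff V e s k (e * k + s * i)‖ * ρ ^ (e * k + s * i) ≤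
      (c * ρ ^ e) ^ k * (M * ρ ^ (s : ℤ)) ^ i := by
    intro k i
    rw [subCoeff_apply]
    calc _ ≤ (c ^ k * M ^ i) * ρ ^ (e * k + s * i) :=
          mul_le_mul_of_nonneg_right (Bd.zpow hc hM V h0 h k i) (by positivity)
      _ = _ := by
          rw [zpow_add₀ hρ.ne', mul_zpow, mul_pow, zpow_mul, zpow_mul, zpow_natCast]
          ring
  have hzero : ∀ k j, (¬ 0 ≤ (s : ℤ) * (j - e * k)) → subCoeff V e s k j = 0 := by
    intro k j hkj
    simp only [subCoeff, laur]
    rw [if_neg hkj]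
  have hrep : ∀ k j, 0 ≤ (s : ℤ) * (j - e * k) → ∃ i : ℕ, j = e * k + s * i := by
    intro k j hkj
    obtain ⟨i, hi⟩ := Int.eq_ofNat_of_zero_le hkj
    exact ⟨i, by rw [← hi, ← mul_assoc, hss]; ring⟩
  have hb0 : 0 ≤ M * ρ ^ (s : ℤ) := by positivity
  constructor
  · intro k j
    by_cases hkj : 0 ≤ (s : ℤ) * (j - e * k)
    · obtain ⟨i, rfl⟩ := hrep k j hkj
      exact (key k i).trans (mul_le_of_le_one_right (by positivity) (pow_le_one₀ hb0 hs.le))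
    · rw [hzero k j hkj]
      simp only [norm_zero, zero_mul]
      positivity
  · intro k
    have h1 : Tendsto (fun i : ℕ => (c * ρ ^ e) ^ k * (M * ρ ^ (s : ℤ)) ^ i) cofinite (𝓝 0) := by
      rw [Nat.cofinite_eq_atTop]
      simpa using (tendsto_pow_atTop_nhds_zero_of_lt_one hb0 hs).const_mul ((c * ρ ^ e) ^ k)
    unfold ConvAt
    rw [Metric.tendsto_nhds]
    intro ε hε
    have h2 : {i : ℕ | ¬ dist ((c * ρ ^ e) ^ k * (M * ρ ^ (s : ℤ)) ^ i) 0 < ε}.Finite :=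
      (Metric.tendsto_nhds.1 h1) ε hε
    refine (h2.image fun i : ℕ => e * k + s * (i : ℤ)).subset ?_
    intro j hj
    by_cases hkj : 0 ≤ (s : ℤ) * (j - e * k)
    · obtain ⟨i, rfl⟩ := hrep k j hkj
      refine ⟨i, fun hcon => hj ?_, rfl⟩
      refine lt_of_le_of_lt ?_ hcon
      rw [Real.dist_0_eq_abs, Real.dist_0_eq_abs, abs_of_nonneg (by positivity),
        abs_of_nonneg (by positivity)]
      exact key k i
    · exfalso
      apply hj
      change dist _ _ < ε
      rw [hzero k j hkj]
      simpa using hε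

end SubCoeff

/-! ## Frobenius, the action of `ℤ_p ^ ×`, and the element `t` -/

section Operators

variable {p : ℕ} [hp : Fact p.Prime]

/-- Substitution `T ↦ T ^ e * V(T ^ s)` on the Robba ring. -/
def substHom (V : (ℚ_[p]⟦X⟧)ˣ) (e : ℤ) (s : ℤˣ) (M : ℝ) (hM : 0 ≤ M)
    (h0 : ‖constantCoeff (V : ℚ_[p]⟦X⟧)‖ = 1) (hB : Bd 1 M (V : ℚ_[p]⟦X⟧))
    (hr : ∀ r : ℝ, 0 < r → ∃ r' : ℝ, 0 < r' ∧ ∀ ρ : ℝ, (p : ℝ) ^ (-1 / r') ≤ ρ → ρ < 1 →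
      ((p : ℝ) ^ (-1 / r) ≤ ρ ^ e ∧ ρ ^ e < 1) ∧ M * ρ ^ (s : ℤ) < 1) :
    Robba p →+* Robba p :=
  have key : ∀ f g : Robba p, ∃ r' : ℝ, 0 < r' ∧ ∀ ρ : ℝ, (p : ℝ) ^ (-1 / r') ≤ ρ → ρ < 1 →
      0 < ρ ∧ ConvAt (1 * ρ ^ e) f.coe ∧ ConvAt (1 * ρ ^ e) g.coe ∧ M * ρ ^ (s : ℤ) < 1 := by
    intro f g
    obtain ⟨r, hr0, hf, hg⟩ := f.conv₂ g
    obtain ⟨r', hr', H⟩ := hr r hr0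
    refine ⟨r', hr', fun ρ h1 h2 => ⟨(radius_pos p _).trans_le h1, ?_, ?_, (H ρ h1 h2).2⟩⟩
    · rw [one_mul]; exact hf _ (H ρ h1 h2).1.1 (H ρ h1 h2).1.2
    · rw [one_mul]; exact hg _ (H ρ h1 h2).1.1 (H ρ h1 h2).1.2
  have key2 : ∀ f g : Robba p, ∃ ρ : ℝ, 0 < ρ ∧ ConvAt (1 * ρ ^ e) f.coe ∧
      ConvAt (1 * ρ ^ e) g.coe ∧ M * ρ ^ (s : ℤ) < 1 := by
    intro f g
    obtain ⟨r', hr', H⟩ := key f g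
    exact ⟨_, H _ le_rfl (Real.rpow_lt_one_of_one_lt_of_neg (by exact_mod_cast hp.1.one_lt)
      (div_neg_of_neg_of_pos (by norm_num) hr'))⟩
  { toFun := fun f => ⟨lsub (subCoeff V e s) f.coe, by
      obtain ⟨r', hr', H⟩ := key f f
      refine ⟨r', hr', fun ρ h1 h2 => ?_⟩
      obtain ⟨hρ, hf, -, hs⟩ := H ρ h1 h2
      obtain ⟨H1, H2⟩ := subCoeff_bd one_pos hM hρ V h0 hB e s hs
      exact ConvAt.lsub (by positivity) hρ hf H1 H2⟩
    map_one' := by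
      refine Robba.ext (funext fun j => ?_)
      refine (lsub_single 0 1 j).trans ?_
      rw [one_mul, Robba.coe_one]
      simp only [subCoeff, zpow_zero, Units.val_one, mul_zero, laur, sub_zero]
      by_cases hj : j = 0
      · simp [hj]
      · rw [Pi.single_eq_of_ne hj]
        split_ifs with h
        · rw [coeff_one, if_neg]
          have : (s : ℤ) * j ≠ 0 := mul_ne_zero s.ne_zero hj
          omega
        · rfl
    map_mul' := fun f g => by
      obtain ⟨ρ, hρ, hf, hg, hs⟩ := key2 f g
      obtain ⟨H1, H2⟩ := subCoeff_bd one_pos hM hρ V h0 hB e s hs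
      exact Robba.ext (lsub_lmul (by positivity) hρ hf hg H1 H2 (subCoeff_mul V e s))
    map_zero' := Robba.ext (funext fun j => by
      change ∑' k, (0 : ℚ_[p]) * _ = (0 : ℚ_[p])
      simp)
    map_add' := fun f g => by
      obtain ⟨ρ, hρ, hf, hg, hs⟩ := key2 f g
      obtain ⟨H1, H2⟩ := subCoeff_bd one_pos hM hρ V h0 hB e s hs
      exact Robba.ext (lsub_add (by positivity) hρ hf hg H1 H2) }

theorem convOn_substHom {V : (ℚ_[p]⟦X⟧)ˣ} {e : ℤ} {s : ℤˣ} {M : ℝ} {hM : 0 ≤ M}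
    {h0 : ‖constantCoeff (V : ℚ_[p]⟦X⟧)‖ = 1} {hB : Bd 1 M (V : ℚ_[p]⟦X⟧)} {hr}
    {r r' : ℝ} (H : ∀ ρ : ℝ, (p : ℝ) ^ (-1 / r') ≤ ρ → ρ < 1 →
      ((p : ℝ) ^ (-1 / r) ≤ ρ ^ e ∧ ρ ^ e < 1) ∧ M * ρ ^ (s : ℤ) < 1)
    {f : Robba p} (hf : f ∈ RobbaR p r) : substHom V e s M hM h0 hB hr f ∈ RobbaR p r' := by
  intro ρ h1 h2
  have hρ : 0 < ρ := (radius_pos p _).trans_le h1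
  obtain ⟨H1, H2⟩ := subCoeff_bd one_pos hM hρ V h0 hB e s (H ρ h1 h2).2
  refine ConvAt.lsub (σ := 1 * ρ ^ e) (by positivity) hρ ?_ H1 H2
  rw [one_mul]
  exact hf _ (H ρ h1 h2).1.1 (H ρ h1 h2).1.2

variable (p) in
/-- The power series `(1 + X) ^ p - X ^ p`, so that `(1 + T) ^ p - 1 = T ^ p * V(T⁻¹)`. -/
def frobUnit : (ℚ_[p]⟦X⟧)ˣ :=
  ((isUnit_iff_constantCoeff (φ := (1 + X) ^ p - X ^ p)).2
    (by simp [zero_pow hp.1.ne_zero])).unit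

theorem frobUnit_coe : (frobUnit p : ℚ_[p]⟦X⟧) = (1 + X) ^ p - X ^ p :=
  IsUnit.unit_spec _

theorem coeff_one_add_X_pow' (n i : ℕ) :
    coeff i ((1 + X : ℚ_[p]⟦X⟧) ^ n) = (n.choose i : ℚ_[p]) := by
  have : (1 + X : ℚ_[p]⟦X⟧) ^ n = ((1 + Polynomial.X : Polynomial ℚ_[p]) ^ n : Polynomial ℚ_[p]) := by
    simp
  rw [this, Polynomial.coeff_coe, Polynomial.coeff_one_add_X_pow]

variable (p) in
/-- The absolute value of `ζ - 1` for a primitive `p`-th root of unity `ζ`. -/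
def frobRadius : ℝ := (p : ℝ) ^ (-1 / ((p : ℝ) - 1))

theorem frobUnit_bd : Bd 1 (frobRadius p) (frobUnit p : ℚ_[p]⟦X⟧) := by
  have hp1 : (1 : ℝ) < p := by exact_mod_cast hp.1.one_lt
  have hθ : 0 < frobRadius p := radius_pos p _
  intro i
  rw [frobUnit_coe, map_sub, coeff_one_add_X_pow', coeff_X_pow, one_mul]
  rcases lt_trichotomy i p with hi | hi | hi
  · rw [if_neg hi.ne, sub_zero]
    rcases Nat.eq_zero_or_pos i with h0 | h0
    · simp [h0]
    · have hd : (p : ℤ) ∣ ((p.choose i : ℕ) : ℤ) := by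
        exact_mod_cast hp.1.dvd_choose_self h0.ne' hi
      have h1 := (Padic.norm_int_le_pow_iff_dvd (p := p) ((p.choose i : ℕ) : ℤ) 1).2
        (by simpa using hd)
      have h2 : ((p : ℝ) ^ (-((1 : ℕ) : ℤ))) ≤ frobRadius p ^ i := by
        rw [frobRadius, ← Real.rpow_natCast, ← Real.rpow_mul (by positivity), ← Real.rpow_intCast]
        refine Real.rpow_le_rpow_of_exponent_le hp1.le ?_
        have h3 : (i : ℝ) ≤ p - 1 := by
          have : (i : ℝ) + 1 ≤ p := by exact_mod_cast hi
          linarith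
        rw [div_mul_eq_mul_div, le_div_iff₀ (by linarith)]
        push_cast
        linarith
      exact_mod_cast h1.trans h2
  · rw [if_pos hi, hi]
    simp only [Nat.choose_self, Nat.cast_one, sub_self, norm_zero]
    positivity
  · rw [if_neg hi.ne', Nat.choose_eq_zero_of_lt hi]
    simp only [Nat.cast_zero, sub_self, norm_zero]
    positivity

theorem frob_radius_aux {r r' : ℝ} (h0 : 0 < r) (h1 : p * r ≤ r') (h2 : (p : ℝ) - 1 < r') (ρ : ℝ)
    (h3 : (p : ℝ) ^ (-1 / r') ≤ ρ) (h4 : ρ < 1) :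
    ((p : ℝ) ^ (-1 / r) ≤ ρ ^ (p : ℤ) ∧ ρ ^ (p : ℤ) < 1) ∧
      frobRadius p * ρ ^ (((-1 : ℤˣ) : ℤˣ) : ℤ) < 1 := by
  have hp1 : (1 : ℝ) < p := by exact_mod_cast hp.1.one_lt
  have hρ : 0 < ρ := (radius_pos p _).trans_le h3
  refine ⟨⟨?_, ?_⟩, ?_⟩
  · rw [zpow_natCast]
    refine le_trans ?_ (pow_le_pow_left₀ (radius_pos p _).le h3 p)
    rw [← Real.rpow_natCast, ← Real.rpow_mul (by positivity)]
    refine Real.rpow_le_rpow_of_exponent_le hp1.le ?_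
    have hr' : 0 < r' := by linarith
    rw [div_mul_eq_mul_div, div_le_div_iff₀ h0 hr']
    linarith
  · rw [zpow_natCast]
    exact pow_lt_one₀ hρ.le h4 hp.1.ne_zero
  · have : frobRadius p < ρ := by
      refine lt_of_lt_of_le ?_ h3
      refine Real.rpow_lt_rpow_of_exponent_lt hp1 ?_
      have hr' : 0 < r' := by linarith
      rw [div_lt_div_iff₀ (by linarith) hr']
      linarith
    rw [Units.val_neg, Units.val_one, zpow_neg_one, ← div_eq_mul_inv, div_lt_one hρ]
    exact this

theorem frobUnit_norm : ‖constantCoeff (frobUnit p : ℚ_[p]⟦X⟧)‖ = 1 := by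
  simp [frobUnit_coe, zero_pow hp.1.ne_zero]

variable (p) in
/-- The Frobenius `φ`, the substitution `T ↦ (1 + T) ^ p - 1`. -/
def frob : Robba p →+* Robba p :=
  substHom (frobUnit p) p (-1) (frobRadius p) (radius_pos p _).le frobUnit_norm frobUnit_bd
    (fun r hr => ⟨max (p * r) p, lt_max_of_lt_right (by exact_mod_cast hp.1.pos),
      frob_radius_aux hr (le_max_left _ _) (lt_max_of_lt_right (by linarith))⟩)

/-- The unit power series `((1 + X) ^ a - 1) / X`, for `a ∈ ℤ_p ^ ×`. -/
def gamUnit (a : ℤ_[p]ˣ) : (ℚ_[p]⟦X⟧)ˣ :=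
  ((isUnit_iff_constantCoeff
    (φ := PowerSeries.mk fun i => ((Ring.choose (a : ℤ_[p]) (i + 1) : ℤ_[p]) : ℚ_[p]))).2 (by
    rw [← coeff_zero_eq_constantCoeff_apply, coeff_mk, zero_add, Ring.choose_one_right]
    rw [isUnit_iff_ne_zero]
    simp)).unit

theorem gamUnit_coe (a : ℤ_[p]ˣ) : (gamUnit a : ℚ_[p]⟦X⟧) =
    PowerSeries.mk fun i => ((Ring.choose (a : ℤ_[p]) (i + 1) : ℤ_[p]) : ℚ_[p]) :=
  IsUnit.unit_spec _

theorem gamUnit_norm (a : ℤ_[p]ˣ) : ‖constantCoeff (gamUnit a : ℚ_[p]⟦X⟧)‖ = 1 := by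
  rw [gamUnit_coe, ← coeff_zero_eq_constantCoeff_apply, coeff_mk, zero_add, Ring.choose_one_right]
  exact PadicInt.norm_units a

theorem gamUnit_bd (a : ℤ_[p]ˣ) : Bd 1 1 (gamUnit a : ℚ_[p]⟦X⟧) := by
  intro i
  rw [gamUnit_coe, coeff_mk]
  simpa using PadicInt.norm_le_one _

theorem gam_radius_aux {r : ℝ} (ρ : ℝ) (h3 : (p : ℝ) ^ (-1 / r) ≤ ρ) (h4 : ρ < 1) :
    ((p : ℝ) ^ (-1 / r) ≤ ρ ^ (1 : ℤ) ∧ ρ ^ (1 : ℤ) < 1) ∧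
      1 * ρ ^ ((1 : ℤˣ) : ℤ) < 1 := by
  simp [h3, h4]

/-- The action of `a ∈ ℤ_p ^ ×`, the substitution `T ↦ (1 + T) ^ a - 1`. -/
def gam (a : ℤ_[p]ˣ) : Robba p →+* Robba p :=
  substHom (gamUnit a) 1 1 1 zero_le_one (gamUnit_norm a) (gamUnit_bd a)
    (fun r hr => ⟨r, hr, gam_radius_aux⟩)

theorem frob_mem {r : ℝ} (hr : (p : ℝ) - 1 ≤ r) {f : Robba p} (hf : f ∈ RobbaR p r) :
    frob p f ∈ RobbaR p (p * r) := by
  have hp1 : (1 : ℝ) < p := by exact_mod_cast hp.1.one_lt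
  exact convOn_substHom (frob_radius_aux (by linarith) le_rfl (by nlinarith)) hf

theorem gam_mem (a : ℤ_[p]ˣ) {r : ℝ} {f : Robba p} (hf : f ∈ RobbaR p r) :
    gam a f ∈ RobbaR p r :=
  convOn_substHom gam_radius_aux hf

/-! ### The element `t = log (1 + T)` -/

theorem norm_log_coeff_le (n : ℕ) : ‖coeff n (log ℚ_[p])‖ ≤ n := by
  rw [coeff_log]
  split_ifs with h
  · simp [h]
  · simp only [eq_ratCast, Rat.cast_div, Rat.cast_pow, Rat.cast_neg, Rat.cast_one, Rat.cast_natCast,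
      norm_div, norm_pow, norm_neg, norm_one, one_pow]
    have hn : (n : ℚ_[p]) ≠ 0 := by exact_mod_cast h
    rw [Padic.norm_eq_zpow_neg_valuation hn, Padic.valuation_natCast, zpow_neg, one_div, inv_inv,
      zpow_natCast]
    exact_mod_cast Nat.le_of_dvd (Nat.pos_of_ne_zero h) pow_padicValNat_dvd

theorem convAt_log {ρ : ℝ} (h0 : 0 < ρ) (h1 : ρ < 1) : ConvAt ρ (laur (log ℚ_[p]) 0 1) := by
  have h2 : Tendsto (fun n : ℕ => (n : ℝ) * ρ ^ n) cofinite (𝓝 0) := by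
    rw [Nat.cofinite_eq_atTop]
    exact tendsto_self_mul_const_pow_of_lt_one h0.le h1
  unfold ConvAt
  rw [Metric.tendsto_nhds]
  intro ε hε
  have h3 : {n : ℕ | ¬ dist ((n : ℝ) * ρ ^ n) 0 < ε}.Finite := (Metric.tendsto_nhds.1 h2) ε hε
  refine (h3.image fun n : ℕ => (n : ℤ)).subset ?_
  intro j hj
  by_cases h : 0 ≤ j
  · obtain ⟨n, rfl⟩ := Int.eq_ofNat_of_zero_le h
    refine ⟨n, fun hcon => hj (lt_of_le_of_lt ?_ hcon), rfl⟩
    rw [Real.dist_0_eq_abs, Real.dist_0_eq_abs, abs_of_nonneg (by positivity),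
      abs_of_nonneg (by positivity), zpow_natCast]
    refine mul_le_mul_of_nonneg_right ?_ (by positivity)
    have := laur_apply (log ℚ_[p]) 0 1 n
    simp only [Units.val_one, one_mul, zero_add] at this
    rw [this]
    exact norm_log_coeff_le n
  · exfalso
    apply hj
    change dist _ _ < ε
    simp [laur, h, hε]

variable (p) in
/-- The element `t = log (1 + T)` of the Robba ring. -/
def tElt : Robba p :=
  ⟨laur (log ℚ_[p]) 0 1, 1, one_pos, fun _ h1 h2 => convAt_log ((radius_pos p _).trans_le h1) h2⟩

theorem tElt_mem (r : ℝ) : tElt p ∈ RobbaR p r :=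
  fun _ h1 h2 => convAt_log ((radius_pos p _).trans_le h1) h2

theorem log_subst {Q : ℚ_[p]⟦X⟧} {c : ℚ_[p]} (h0 : constantCoeff Q = 0)
    (h : (1 + X) * d⁄dX ℚ_[p] Q = C c * (1 + Q)) :
    (log ℚ_[p]).subst Q = C c * log ℚ_[p] := by
  have hs : HasSubst Q := HasSubst.of_constantCoeff_zero' h0
  have hlog : (1 + X) * d⁄dX ℚ_[p] (log ℚ_[p]) = 1 := by
    rw [deriv_log]
    ext n
    rw [add_mul, one_mul, map_add, coeff_mk]
    cases n with
    | zero => simp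
    | succ n =>
      rw [coeff_succ_X_mul, coeff_mk, coeff_one, if_neg (Nat.succ_ne_zero n), ← map_add]
      simp [pow_succ]
  have hsub : (1 + Q) * (d⁄dX ℚ_[p] (log ℚ_[p])).subst Q = 1 := by
    have := congrArg (PowerSeries.subst Q) hlog
    rw [← coe_substAlgHom hs, map_mul, map_add, map_one, substAlgHom_X] at this
    rw [← coe_substAlgHom hs]
    exact this
  refine derivative.ext ?_ ?_
  · rw [derivative_subst hs]
    have hd : d⁄dX ℚ_[p] (C c * log ℚ_[p]) = C c * d⁄dX ℚ_[p] (log ℚ_[p]) := by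
      rw [← smul_eq_C_mul, Derivation.map_smul, smul_eq_C_mul]
    rw [hd]
    set A := (d⁄dX ℚ_[p] (log ℚ_[p])).subst Q
    set B := d⁄dX ℚ_[p] (log ℚ_[p])
    linear_combination (A * B) * h - (A * d⁄dX ℚ_[p] Q) * hlog + (C c * B) * hsub
  · have := constantCoeff_subst_eq_zero (a := Q) h0 (log ℚ_[p]) constantCoeff_log
    rw [map_mul, constantCoeff_log, mul_zero]
    exact this

theorem lsub_log {Q : ℚ_[p]⟦X⟧} {c : ℚ_[p]} (h0 : constantCoeff Q = 0)
    (h : (1 + X) * d⁄dX ℚ_[p] Q = C c * (1 + Q)) {U : ℤ → ℤ → ℚ_[p]}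
    (hU : ∀ k : ℕ, U k = laur (Q ^ k) 0 1) (j : ℤ) :
    lsub U (laur (log ℚ_[p]) 0 1) j = c * laur (log ℚ_[p]) 0 1 j := by
  have hs : HasSubst Q := HasSubst.of_constantCoeff_zero' h0
  have hl : ∀ n : ℕ, laur (log ℚ_[p]) 0 1 n = coeff n (log ℚ_[p]) := by
    intro n
    simpa using laur_apply (log ℚ_[p]) 0 1 n
  have e1 : lsub U (laur (log ℚ_[p]) 0 1) j = ∑' n : ℕ, coeff n (log ℚ_[p]) * U n j := by
    unfold lsub
    rw [← Function.Injective.tsum_eq (g := fun n : ℕ => (n : ℤ)) Nat.cast_injective]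
    · exact tsum_congr fun n => by rw [hl]
    · intro k hk
      by_contra hcon
      apply hk
      have : ¬ 0 ≤ k := fun h => hcon ⟨k.toNat, by simp [h]⟩
      simp [laur, this]
  rw [e1]
  by_cases hj : 0 ≤ j
  · obtain ⟨m, rfl⟩ := Int.eq_ofNat_of_zero_le hj
    have hm : ∀ n : ℕ, U n m = coeff m (Q ^ n) := by
      intro n
      rw [hU]
      simpa using laur_apply (Q ^ n) 0 1 m
    have h2 := congrArg (coeff m) (log_subst h0 h)
    rw [coeff_subst' hs, coeff_C_mul] at h2
    rw [hl, ← h2, ← tsum_eq_finsum (L := SummationFilter.unconditional _)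
      (coeff_subst_finite' hs _ _)]
    exact tsum_congr fun n => by rw [hm, smul_eq_mul]
  · have hm : ∀ n : ℕ, U n j = 0 := by
      intro n
      rw [hU]
      simp [laur, hj]
    simp [hm, laur, hj]

theorem laur_one (s : ℤˣ) : laur (1 : ℚ_[p]⟦X⟧) 0 s = Pi.single 0 1 := by
  funext j
  simp only [laur, sub_zero]
  by_cases hj : j = 0
  · simp [hj]
  · rw [Pi.single_eq_of_ne hj]
    split_ifs with h
    · rw [coeff_one, if_neg]
      have : (s : ℤ) * j ≠ 0 := mul_ne_zero s.ne_zero hj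
      omega
    · rfl

theorem subCoeff_natCast {V : (ℚ_[p]⟦X⟧)ˣ} {e : ℤ} {s : ℤˣ} {Q : ℚ_[p]⟦X⟧}
    (h1 : subCoeff V e s 1 = laur Q 0 1) (k : ℕ) : subCoeff V e s k = laur (Q ^ k) 0 1 := by
  induction k with
  | zero =>
    simp only [subCoeff, Nat.cast_zero, zpow_zero, Units.val_one, mul_zero, pow_zero, laur_one]
  | succ k ih =>
    rw [Nat.cast_succ, ← subCoeff_mul, ih, h1, laur_mul, pow_succ, add_zero]

theorem Robba.single_mul_coe (a : ℚ_[p]) (f : Robba p) (j : ℤ) :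
    (Robba.single 0 a * f).coe j = a * f.coe j := by
  rw [Robba.coe_mul, Robba.coe_single, single_lmul, sub_zero]

theorem laur_zero_apply (g : ℚ_[p]⟦X⟧) (j : ℤ) :
    laur g 0 1 j = if 0 ≤ j then coeff j.toNat g else 0 := by
  simp [laur]

theorem frob_tElt : frob p (tElt p) = Robba.single 0 p * tElt p := by
  ext j
  rw [Robba.single_mul_coe]
  refine lsub_log (Q := (1 + X) ^ p - 1) (by simp) ?_ (subCoeff_natCast ?_) j
  · rw [map_sub, derivative_pow, map_add, derivative_one, derivative_X, sub_zero, zero_add, mul_one,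
      map_natCast, add_sub_cancel]
    have h1 : (1 + X : ℚ_[p]⟦X⟧) ^ p = (1 + X) ^ (p - 1) * (1 + X) := by
      rw [← pow_succ, Nat.sub_add_cancel hp.1.one_le]
    rw [h1]
    ring
  · funext j
    rw [laur_zero_apply]
    simp only [subCoeff, zpow_one, mul_one, laur, Units.val_neg, Units.val_one, frobUnit_coe,
      map_sub, coeff_one_add_X_pow', coeff_X_pow, coeff_one]
    by_cases h0 : 0 ≤ j
    · obtain ⟨m, rfl⟩ := Int.eq_ofNat_of_zero_le h0
      by_cases hm : m ≤ p
      · have e1 : (-1 * ((m : ℤ) - p)) = ((p - m : ℕ) : ℤ) := by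
          rw [Nat.cast_sub hm]; ring
        simp only [e1, Int.natCast_nonneg, if_true, Int.toNat_natCast, Nat.choose_symm hm]
        congr 1
        have := hp.1.pos
        by_cases hm0 : m = 0
        · simp [hm0]
        · rw [if_neg (by omega), if_neg hm0]
      · rw [if_neg (by omega), if_pos h0, Int.toNat_natCast, Nat.choose_eq_zero_of_lt (by omega),
          if_neg (by omega)]
        simp
    · rw [if_neg h0, if_pos (by omega), Nat.choose_eq_zero_of_lt (by omega), if_neg (by omega)]
      simp

theorem choose_succ_mul (a : ℤ_[p]) (n : ℕ) :
    ((n : ℤ_[p]) + 1) * Ring.choose a (n + 1) = Ring.choose a n * (a - n) := by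
  have := Ring.choose_smul_choose a (n := n + 1) (k := n) (Nat.le_succ n)
  rw [Nat.choose_succ_self_right, Nat.add_sub_cancel_left, Ring.choose_one_right, nsmul_eq_mul] at this
  exact_mod_cast this

theorem gam_tElt (a : ℤ_[p]ˣ) :
    gam a (tElt p) = Robba.single 0 ((a : ℤ_[p]) : ℚ_[p]) * tElt p := by
  ext j
  rw [Robba.single_mul_coe]
  refine lsub_log (Q := X * (gamUnit a : ℚ_[p]⟦X⟧)) (by simp) ?_ (subCoeff_natCast ?_) j
  · have hQ : ∀ n, coeff n (1 + X * (gamUnit a : ℚ_[p]⟦X⟧)) =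
        ((Ring.choose (a : ℤ_[p]) n : ℤ_[p]) : ℚ_[p]) := by
      intro n
      cases n with
      | zero => simp
      | succ n => simp [coeff_succ_X_mul, gamUnit_coe, coeff_one]
    have hd : d⁄dX ℚ_[p] (X * (gamUnit a : ℚ_[p]⟦X⟧)) =
        d⁄dX ℚ_[p] (1 + X * (gamUnit a : ℚ_[p]⟦X⟧)) := by
      rw [map_add, derivative_one, zero_add]
    rw [hd]
    ext n
    rw [coeff_C_mul, add_mul, one_mul, map_add, coeff_derivative, hQ, hQ]
    cases n with
    | zero => simp
    | succ n =>
      rw [coeff_succ_X_mul, coeff_derivative, hQ]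
      have := congrArg (fun x : ℤ_[p] => (x : ℚ_[p])) (choose_succ_mul (a : ℤ_[p]) (n + 1))
      push_cast at this ⊢
      linear_combination this
  · funext j
    rw [laur_zero_apply]
    simp only [subCoeff, zpow_one, mul_one, laur, Units.val_one, one_mul]
    by_cases h0 : 0 < j
    · obtain ⟨m, rfl⟩ := Int.eq_succ_of_zero_lt h0
      rw [if_pos (by omega), if_pos (by omega)]
      simp [coeff_succ_X_mul]
    · rw [if_neg (by omega)]
      split_ifs with h1
      · have : j = 0 := by omega
        simp [this]
      · rfl

end Operators

/-! ## The cyclotomic fields `ℚ_p(ε^(n))` and the group `Γ` -/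

section Cyclotomic

/-- A compatible system of primitive `p ^ n`-th roots of unity `ε^(n)` in an algebraic closure
of `ℚ_p`. -/
structure EpsSeq (p : ℕ) [Fact p.Prime] where
  /-- the root of unity `ε^(n)` -/
  val : ℕ → PadicAlgCl p
  prim : ∀ n, IsPrimitiveRoot (val n) (p ^ n)
  compat : ∀ n, val (n + 1) ^ p = val n

variable {p : ℕ} [hp : Fact p.Prime] (ε : EpsSeq p)

theorem EpsSeq.pow_pow (n i : ℕ) : ε.val (n + i) ^ p ^ i = ε.val n := by
  induction i with
  | zero => simp
  | succ i ih => rw [pow_succ', pow_mul, ← add_assoc, ε.compat, ih]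

/-- The field `ℚ_p(ε^(n))`. -/
abbrev Kn (n : ℕ) : IntermediateField ℚ_[p] (PadicAlgCl p) :=
  IntermediateField.adjoin ℚ_[p] {ε.val n}

instance (n : ℕ) : FiniteDimensional ℚ_[p] (Kn ε n) :=
  IntermediateField.adjoin.finiteDimensional
    (Algebra.IsAlgebraic.isAlgebraic (R := ℚ_[p]) (ε.val n)).isIntegral

instance (n : ℕ) : CompleteSpace (Kn ε n) := FiniteDimensional.complete ℚ_[p] (Kn ε n)

/-- `ε^(n)` as an element of `ℚ_p(ε^(n))`. -/
def epsK (n : ℕ) : Kn ε n := ⟨ε.val n, IntermediateField.mem_adjoin_simple_self ℚ_[p] _⟩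

theorem epsK_prim (n : ℕ) : IsPrimitiveRoot (epsK ε n) (p ^ n) :=
  IsPrimitiveRoot.of_map_of_injective (f := (Kn ε n).val) (by exact ε.prim n)
    (Kn ε n).val.injective

theorem Kn_mono {n m : ℕ} (h : n ≤ m) : Kn ε n ≤ Kn ε m := by
  rw [IntermediateField.adjoin_le_iff, Set.singleton_subset_iff]
  obtain ⟨i, rfl⟩ := Nat.exists_eq_add_of_le h
  rw [← ε.pow_pow n i]
  exact pow_mem (IntermediateField.mem_adjoin_simple_self ℚ_[p] (ε.val (n + i))) _

/-- The inclusion of `ℚ_p(ε^(n))` in `ℚ_p(ε^(m))`, for `n ≤ m`. -/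
def inclK {n m : ℕ} (h : n ≤ m) : Kn ε n →+* Kn ε m :=
  (IntermediateField.inclusion (Kn_mono ε h)).toRingHom

theorem norm_eps (n : ℕ) : ‖epsK ε n‖ = 1 := by
  have h := congrArg norm (epsK_prim ε n).pow_eq_one
  rw [norm_pow, norm_one] at h
  exact (pow_eq_one_iff_of_nonneg (norm_nonneg _) (pow_ne_zero _ hp.1.ne_zero)).1 h

theorem norm_pow_sub_one_le {K : Type*} [NormedField K] [IsUltrametricDist K] {x : K}
    (hx : ‖x‖ = 1) (i : ℕ) : ‖x ^ i - 1‖ ≤ ‖x - 1‖ := by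
  rw [← geom_sum_mul, norm_mul]
  refine mul_le_of_le_one_left (norm_nonneg _) ?_
  refine IsUltrametricDist.norm_sum_le_of_forall_le_of_nonneg zero_le_one fun j _ => ?_
  rw [norm_pow, hx, one_pow]

theorem prod_norm (n : ℕ) (hn : 1 ≤ n) :
    ∏ μ ∈ primitiveRoots (p ^ n) (Kn ε n), ‖μ - 1‖ = (p : ℝ)⁻¹ := by
  obtain ⟨m, rfl⟩ := Nat.exists_eq_add_of_le' hn
  have h1 := Polynomial.eval_one_cyclotomic_prime_pow (R := Kn ε (m + 1)) (p := p) m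
  rw [Polynomial.cyclotomic_eq_prod_X_sub_primitiveRoots (epsK_prim ε (m + 1)),
    Polynomial.eval_prod] at h1
  have h2 := congrArg norm h1
  rw [norm_prod] at h2
  simp only [Polynomial.eval_sub, Polynomial.eval_X, Polynomial.eval_C] at h2
  rw [← Padic.norm_p (p := p), ← norm_algebraMap' (Kn ε (m + 1)) (p : ℚ_[p]), map_natCast, ← h2]
  exact Finset.prod_congr rfl fun μ _ => norm_sub_rev _ _

theorem norm_eps_sub_one_lt (n : ℕ) (hn : 1 ≤ n) : ‖epsK ε n - 1‖ < 1 := by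
  by_contra hcon
  push Not at hcon
  have h1 := prod_norm ε n hn
  have h2 : (1 : ℝ) ≤ ∏ μ ∈ primitiveRoots (p ^ n) (Kn ε n), ‖μ - 1‖ := by
    rw [← Finset.prod_const_one (s := primitiveRoots (p ^ n) (Kn ε n))]
    refine Finset.prod_le_prod (fun _ _ => zero_le_one) fun μ hμ => hcon.trans ?_
    have hpos : 0 < p ^ n := pow_pos hp.1.pos n
    rw [mem_primitiveRoots hpos] at hμ
    obtain ⟨i, -, hi⟩ := hμ.eq_pow_of_pow_eq_one (epsK_prim ε n).pow_eq_one
    rw [← hi]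
    refine norm_pow_sub_one_le ?_ i
    have h := congrArg norm hμ.pow_eq_one
    rw [norm_pow, norm_one] at h
    exact (pow_eq_one_iff_of_nonneg (norm_nonneg _) hpos.ne').1 h
  rw [h1] at h2
  have : (p : ℝ)⁻¹ < 1 := inv_lt_one_of_one_lt₀ (by exact_mod_cast hp.1.one_lt)
  linarith

theorem inv_le_norm_pow (n : ℕ) (hn : 1 ≤ n) :
    (p : ℝ)⁻¹ ≤ ‖epsK ε n - 1‖ ^ (p ^ (n - 1) * (p - 1)) := by
  rw [← prod_norm ε n hn, ← Nat.totient_prime_pow hp.1 hn, ← (epsK_prim ε n).card_primitiveRoots]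
  rw [← Finset.prod_const]
  refine Finset.prod_le_prod (fun _ _ => norm_nonneg _) fun μ hμ => ?_
  rw [mem_primitiveRoots (pow_pos hp.1.pos n)] at hμ
  have : NeZero (p ^ n) := ⟨(pow_pos hp.1.pos n).ne'⟩
  obtain ⟨i, -, hi⟩ := (epsK_prim ε n).eq_pow_of_pow_eq_one hμ.pow_eq_one
  rw [← hi]
  exact norm_pow_sub_one_le (norm_eps ε n) i

variable (p) in
/-- The number `n(r) = log (r / (p - 1)) / log p + 1`. -/
def nOf (r : ℝ) : ℝ := Real.log (r / ((p : ℝ) - 1)) / Real.log p + 1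

theorem one_le_of_nOf_le {r : ℝ} (hr : (p : ℝ) - 1 ≤ r) {n : ℕ} (hn : nOf p r ≤ n) : 1 ≤ n := by
  have hp1 : (1 : ℝ) < p := by exact_mod_cast hp.1.one_lt
  have h1 : 0 ≤ Real.log (r / ((p : ℝ) - 1)) :=
    Real.log_nonneg (by rwa [le_div_iff₀ (by linarith), one_mul])
  have h2 : 0 ≤ Real.log (r / ((p : ℝ) - 1)) / Real.log p := div_nonneg h1 (Real.log_pos hp1).le
  unfold nOf at hn
  have : (1 : ℝ) ≤ n := by linarith
  exact_mod_cast this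

theorem radius_le_norm {r : ℝ} (hr : (p : ℝ) - 1 ≤ r) {n : ℕ} (hn : nOf p r ≤ n) :
    (p : ℝ) ^ (-1 / r) ≤ ‖epsK ε n - 1‖ := by
  have hp1 : (1 : ℝ) < p := by exact_mod_cast hp.1.one_lt
  have hn1 := one_le_of_nOf_le hr hn
  have hr0 : 0 < r := by linarith
  have h1 := inv_le_norm_pow ε n hn1
  set N := p ^ (n - 1) * (p - 1) with hN
  have h2 : r ≤ N := by
    unfold nOf at hn
    have h3 : Real.log (r / ((p : ℝ) - 1)) ≤ ((n - 1 : ℕ) : ℝ) * Real.log p := by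
      rw [← div_le_iff₀ (Real.log_pos hp1), Nat.cast_sub hn1]
      push_cast
      linarith
    rw [← Real.log_pow, Real.log_le_log_iff (div_pos hr0 (by linarith)) (by positivity),
      div_le_iff₀ (by linarith)] at h3
    rw [hN, Nat.cast_mul, Nat.cast_pow, Nat.cast_sub hp.1.one_le]
    simpa using h3
  have hN0 : (0 : ℝ) < N := by linarith
  have h4 : (p : ℝ) ^ (-1 / (N : ℝ)) ≤ ‖epsK ε n - 1‖ := by
    refine le_of_pow_le_pow_left₀ (n := N) (by exact_mod_cast hN0.ne') (norm_nonneg _) ?_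
    rw [← Real.rpow_natCast, ← Real.rpow_mul (by positivity), div_mul_cancel₀ _ hN0.ne',
      Real.rpow_neg_one]
    exact h1
  refine le_trans ?_ h4
  refine Real.rpow_le_rpow_of_exponent_le hp1.le ?_
  rw [div_le_div_iff₀ hr0 hN0]
  linarith

/-! ### The group `Γ` -/

variable (p) in
/-- The cyclotomic character of `Gal(ℚ̄_p / ℚ_p)`. -/
def chiG : (PadicAlgCl p ≃ₐ[ℚ_[p]] PadicAlgCl p) →* ℤ_[p]ˣ :=
  (cyclotomicCharacter (PadicAlgCl p) p).comp
    (MulSemiringAction.toRingAut (PadicAlgCl p ≃ₐ[ℚ_[p]] PadicAlgCl p) (PadicAlgCl p))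

theorem chiG_spec (g : PadicAlgCl p ≃ₐ[ℚ_[p]] PadicAlgCl p) (n : ℕ) :
    g (ε.val n) = ε.val n ^ ((chiG p g : ℤ_[p]).toZModPow n).val :=
  cyclotomicCharacter.spec p (n := n) (MulSemiringAction.toRingAut _ _ g) (ε.val n)
    (ε.prim n).pow_eq_one

variable (p) in
/-- `Γ`, the quotient of `Gal(ℚ̄_p / ℚ_p)` by the kernel of the cyclotomic character. -/
abbrev Gam : Type := (PadicAlgCl p ≃ₐ[ℚ_[p]] PadicAlgCl p) ⧸ (chiG p).ker

variable (p) in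
/-- The cyclotomic character of `Γ`. -/
def chi : Gam p →* ℤ_[p]ˣ := QuotientGroup.kerLift (chiG p)

theorem map_mem_Kn (g : PadicAlgCl p ≃ₐ[ℚ_[p]] PadicAlgCl p) (n : ℕ) (x : Kn ε n) :
    g x ∈ Kn ε n := by
  have : Kn ε n ≤ (Kn ε n).comap g.toAlgHom := by
    rw [IntermediateField.adjoin_le_iff, Set.singleton_subset_iff]
    change g (ε.val n) ∈ Kn ε n
    rw [chiG_spec]
    exact pow_mem (IntermediateField.mem_adjoin_simple_self ℚ_[p] (ε.val n)) _
  exact this x.2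

/-- The restriction to `ℚ_p(ε^(n))` of an element of the Galois group. -/
def galK (n : ℕ) : (PadicAlgCl p ≃ₐ[ℚ_[p]] PadicAlgCl p) →* (Kn ε n →ₐ[ℚ_[p]] Kn ε n) where
  toFun g := ((g : PadicAlgCl p →ₐ[ℚ_[p]] PadicAlgCl p).comp (Kn ε n).val).codRestrict
    (Kn ε n).toSubalgebra (fun x => map_mem_Kn ε g n x)
  map_one' := rfl
  map_mul' _ _ := rfl

/-- The action of `Γ` on `ℚ_p(ε^(n))`. -/
def gamK (n : ℕ) : Gam p →* (Kn ε n →ₐ[ℚ_[p]] Kn ε n) :=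
  QuotientGroup.lift (chiG p).ker (galK ε n) (by
    intro g hg
    rw [MonoidHom.mem_ker] at hg ⊢
    have h1 : g (ε.val n) = ε.val n := by
      rw [chiG_spec, hg, Units.val_one, map_one]
      rcases Nat.eq_zero_or_pos n with h0 | h0
      · subst h0
        have := (ε.prim 0).pow_eq_one
        rw [pow_zero, pow_one] at this
        rw [this, one_pow]
      · have : Fact (1 < p ^ n) := ⟨Nat.one_lt_pow h0.ne' hp.1.one_lt⟩
        rw [ZMod.val_one, pow_one]
    refine AlgHom.ext fun x => Subtype.ext ?_
    obtain ⟨x, hx⟩ := x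
    change g x = x
    induction hx using IntermediateField.adjoin_induction with
    | mem y hy => rw [Set.mem_singleton_iff.1 hy, h1]
    | algebraMap y => exact g.commutes y
    | add y z _ _ hy hz => rw [map_add, hy, hz]
    | inv y _ hy => rw [map_inv₀, hy]
    | mul y z _ _ hy hz => rw [map_mul, hy, hz])

end Cyclotomic

/-! ## The localization maps `ι_n` -/

section Iota

variable {p : ℕ} [hp : Fact p.Prime] (ε : EpsSeq p)

/-- The power series `ε^(n) * exp (X / p ^ n) - 1`. -/
def iotaSer (n : ℕ) : (Kn ε n)⟦X⟧ :=
  C (epsK ε n) * rescale ((p : Kn ε n) ^ n)⁻¹ (exp (Kn ε n)) - 1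

theorem constantCoeff_iotaSer (n : ℕ) : constantCoeff (iotaSer ε n) = epsK ε n - 1 := by
  rw [iotaSer, map_sub, map_mul, constantCoeff_C, map_one, ← coeff_zero_eq_constantCoeff_apply,
    coeff_rescale, coeff_exp]
  simp

theorem norm_natCast_Kn (n m : ℕ) : ‖(m : Kn ε n)‖ = ‖(m : ℚ_[p])‖ := by
  rw [← norm_algebraMap' (Kn ε n) (m : ℚ_[p]), map_natCast]

theorem norm_factorial_ge (i : ℕ) : ((p : ℝ) ^ i)⁻¹ ≤ ‖((i.factorial : ℕ) : ℚ_[p])‖ := by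
  have h0 : (i.factorial : ℚ_[p]) ≠ 0 := by exact_mod_cast i.factorial_ne_zero
  rw [Padic.norm_eq_zpow_neg_valuation h0, Padic.valuation_natCast, zpow_neg, zpow_natCast]
  have hp1 : (1 : ℝ) ≤ p := by exact_mod_cast hp.1.one_le
  refine inv_anti₀ (by positivity) (pow_le_pow_right₀ hp1 ?_)
  rcases Nat.eq_zero_or_pos i with h | h
  · simp [h]
  · have h1 := sub_one_mul_padicValNat_factorial_lt_of_ne_zero p h.ne'
    have h2 : 1 ≤ p - 1 := Nat.le_sub_one_of_lt hp.1.one_lt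
    nlinarith

theorem eps_sub_one_ne_zero {n : ℕ} (hn : 1 ≤ n) : epsK ε n - 1 ≠ 0 := by
  intro h
  have h1 := (epsK_prim ε n).pow_eq_one_iff_dvd 1
  rw [pow_one, ← sub_eq_zero] at h1
  have h2 := Nat.dvd_one.1 (h1.1 h)
  exact (Nat.one_lt_pow (by omega) hp.1.one_lt).ne' h2

theorem iotaSer_bd {n : ℕ} (hn : 1 ≤ n) :
    Bd ‖epsK ε n - 1‖ ((p : ℝ) ^ (n + 1) / ‖epsK ε n - 1‖) (iotaSer ε n) := by
  have hα : 0 < ‖epsK ε n - 1‖ := norm_pos_iff.2 (eps_sub_one_ne_zero ε hn)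
  have hα1 := (norm_eps_sub_one_lt ε n hn).le
  have hp0 : (0 : ℝ) < p := by exact_mod_cast hp.1.pos
  intro i
  rcases Nat.eq_zero_or_pos i with h | h
  · subst h
    rw [coeff_zero_eq_constantCoeff_apply, constantCoeff_iotaSer, pow_zero, mul_one]
  · rw [iotaSer, map_sub, coeff_C_mul, coeff_rescale, coeff_one, if_neg h.ne', sub_zero, norm_mul,
      norm_eps, one_mul, norm_mul, coeff_exp, norm_pow, norm_inv, norm_pow, norm_natCast_Kn,
      Padic.norm_p, inv_pow, inv_pow, inv_pow, inv_inv]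
    have e1 : ‖(algebraMap ℚ (Kn ε n)) (1 / (i.factorial : ℚ))‖ ≤ (p : ℝ) ^ i := by
      rw [map_div₀, map_one, map_natCast, norm_div, norm_one, norm_natCast_Kn, one_div]
      exact inv_le_of_inv_le₀ (by positivity) (norm_factorial_ge i)
    have e2 : (‖epsK ε n - 1‖ : ℝ) ^ i ≤ ‖epsK ε n - 1‖ := by
      simpa using pow_le_pow_of_le_one hα.le hα1 h
    rw [div_pow, mul_div_assoc', le_div_iff₀ (by positivity)]
    calc _ ≤ (((p : ℝ) ^ n) ^ i * (p : ℝ) ^ i) * ‖epsK ε n - 1‖ := by gcongr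
      _ = _ := by rw [← mul_pow, ← pow_succ, mul_comm]

/-- The unit power series `ε^(n) * exp (X / p ^ n) - 1`, for `n ≥ 1`. -/
def iotaUnit {n : ℕ} (hn : 1 ≤ n) : ((Kn ε n)⟦X⟧)ˣ :=
  ((isUnit_iff_constantCoeff (φ := iotaSer ε n)).2 (by
    rw [constantCoeff_iotaSer]
    exact (eps_sub_one_ne_zero ε hn).isUnit)).unit

theorem iotaUnit_coe {n : ℕ} (hn : 1 ≤ n) : (iotaUnit ε hn : (Kn ε n)⟦X⟧) = iotaSer ε n :=
  IsUnit.unit_spec _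

/-- The power series `∑ f k * V ^ k`, for a unit power series `V`. -/
def evalSer {F : Type*} [NormedField F] (V : (F⟦X⟧)ˣ) (f : ℤ → F) : F⟦X⟧ :=
  PowerSeries.mk fun i => ∑' k : ℤ, f k * coeff i ((V ^ k : (F⟦X⟧)ˣ) : F⟦X⟧)

theorem lsub_eq_evalSer {F : Type*} [NormedField F] (V : (F⟦X⟧)ˣ) (f : ℤ → F) :
    lsub (subCoeff V 0 1) f = laur (evalSer V f) 0 1 := by
  funext j
  by_cases hj : 0 ≤ j
  · obtain ⟨i, rfl⟩ := Int.eq_ofNat_of_zero_le hj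
    simp [lsub, subCoeff, laur, evalSer]
  · simp [lsub, subCoeff, laur, hj]

theorem laur_injective {F : Type*} [NormedField F] {g h : F⟦X⟧}
    (H : laur g 0 1 = laur h 0 1) : g = h := by
  ext i
  have h1 := laur_apply g 0 1 i
  rw [H, laur_apply] at h1
  exact h1.symm

section

variable {F : Type*} [NormedField F] [IsUltrametricDist F]

theorem evalSer_prep {c M : ℝ} (hc : 0 < c) (hM : 0 ≤ M) (V : (F⟦X⟧)ˣ)
    (h0 : ‖constantCoeff (V : F⟦X⟧)‖ = c) (h : Bd c M (V : F⟦X⟧)) : ∃ ρ : ℝ, 0 < ρ ∧ (∀ k j, ‖subCoeff V 0 1 k j‖ * ρ ^ j ≤ c ^ k) ∧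
    ∀ k, ConvAt ρ (subCoeff V 0 1 k) := by
  refine ⟨(M + 1)⁻¹, by positivity, ?_⟩
  have := subCoeff_bd hc hM (ρ := (M + 1)⁻¹) (by positivity) V h0 h 0 1 (by
    rw [Units.val_one, zpow_one, ← div_eq_mul_inv, div_lt_one (by positivity)]
    linarith)
  simpa using this

theorem evalSer_add [CompleteSpace F] {c M : ℝ} (hc : 0 < c) (hM : 0 ≤ M) (V : (F⟦X⟧)ˣ)
    (h0 : ‖constantCoeff (V : F⟦X⟧)‖ = c) (h : Bd c M (V : F⟦X⟧))
    {f g : ℤ → F} (hf : ConvAt c f) (hg : ConvAt c g) :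
    evalSer V (f + g) = evalSer V f + evalSer V g := by
  obtain ⟨ρ, hρ, H1, H2⟩ := evalSer_prep hc hM V h0 h
  apply laur_injective
  rw [← lsub_eq_evalSer, lsub_add hc hρ hf hg H1 H2, lsub_eq_evalSer, lsub_eq_evalSer]
  funext j
  simp only [laur, Pi.add_apply]
  split_ifs <;> simp

theorem evalSer_lmul [CompleteSpace F] {c M : ℝ} (hc : 0 < c) (hM : 0 ≤ M) (V : (F⟦X⟧)ˣ)
    (h0 : ‖constantCoeff (V : F⟦X⟧)‖ = c) (h : Bd c M (V : F⟦X⟧))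
    {f g : ℤ → F} (hf : ConvAt c f) (hg : ConvAt c g) :
    evalSer V (lmul f g) = evalSer V f * evalSer V g := by
  obtain ⟨ρ, hρ, H1, H2⟩ := evalSer_prep hc hM V h0 h
  apply laur_injective
  rw [← lsub_eq_evalSer, lsub_lmul hc hρ hf hg H1 H2 (subCoeff_mul V 0 1), lsub_eq_evalSer,
    lsub_eq_evalSer, laur_mul, add_zero]

end

/-- The coefficients of an element of the Robba ring, in `ℚ_p(ε^(n))`. -/
def coeK (n : ℕ) (f : Robba p) : ℤ → Kn ε n := fun k => algebraMap ℚ_[p] (Kn ε n) (f.coe k)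

variable {ε} in
theorem convAt_coeK {r : ℝ} (hr : (p : ℝ) - 1 ≤ r) {n : ℕ} (hn : nOf p r ≤ n) {f : Robba p}
    (hf : f ∈ RobbaR p r) : ConvAt ‖epsK ε n - 1‖ (coeK ε n f) := by
  have := hf _ (radius_le_norm ε hr hn) (norm_eps_sub_one_lt ε n (one_le_of_nOf_le hr hn))
  refine this.congr fun k => ?_
  rw [coeK, norm_algebraMap']

theorem coeK_mul {r : ℝ} (hr : 0 < r) (n : ℕ) {f g : Robba p} (hf : f ∈ RobbaR p r)
    (hg : g ∈ RobbaR p r) : coeK ε n (f * g) = lmul (coeK ε n f) (coeK ε n g) := by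
  funext k
  have h1 : (p : ℝ) ^ (-1 / r) < 1 :=
    Real.rpow_lt_one_of_one_lt_of_neg (by exact_mod_cast hp.1.one_lt)
      (div_neg_of_neg_of_pos (by norm_num) hr)
  have := (summable_lmul (radius_pos p r) (hf _ le_rfl h1) (hg _ le_rfl h1) k).hasSum.map
    (algebraMap ℚ_[p] (Kn ε n)) (continuous_algebraMap _ _)
  rw [coeK, Robba.coe_mul]
  refine Eq.trans this.tsum_eq.symm ?_
  unfold lmul
  exact tsum_congr fun i => by simp [coeK]

/-- The localization map `ι_n`, the substitution `T ↦ ε^(n) * exp (X / p ^ n) - 1`. -/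
def iota {r : ℝ} (hr : (p : ℝ) - 1 ≤ r) {n : ℕ} (hn : nOf p r ≤ n) :
    RobbaR p r →+* (Kn ε n)⟦X⟧ :=
  have hn1 := one_le_of_nOf_le hr hn
  have hr0 : 0 < r := by
    have : (1 : ℝ) < p := by exact_mod_cast hp.1.one_lt
    linarith
  have hα : 0 < ‖epsK ε n - 1‖ := norm_pos_iff.2 (eps_sub_one_ne_zero ε hn1)
  have hM : 0 ≤ (p : ℝ) ^ (n + 1) / ‖epsK ε n - 1‖ := by positivity
  have h0 : ‖constantCoeff (iotaUnit ε hn1 : (Kn ε n)⟦X⟧)‖ = ‖epsK ε n - 1‖ := by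
    rw [iotaUnit_coe, constantCoeff_iotaSer]
  have h : Bd ‖epsK ε n - 1‖ ((p : ℝ) ^ (n + 1) / ‖epsK ε n - 1‖)
      (iotaUnit ε hn1 : (Kn ε n)⟦X⟧) := by
    rw [iotaUnit_coe]
    exact iotaSer_bd ε hn1
  have hadd : ∀ f g : RobbaR p r, evalSer (iotaUnit ε hn1) (coeK ε n (f + g : RobbaR p r)) =
      evalSer (iotaUnit ε hn1) (coeK ε n f) + evalSer (iotaUnit ε hn1) (coeK ε n g) := by
    intro f g
    rw [← evalSer_add hα hM _ h0 h (convAt_coeK hr hn f.2) (convAt_coeK hr hn g.2)]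
    congr 1
    funext k
    exact map_add (algebraMap ℚ_[p] (Kn ε n)) _ _
  { toFun := fun f => evalSer (iotaUnit ε hn1) (coeK ε n f)
    map_one' := by
      ext i
      have : coeK ε n ((1 : RobbaR p r) : Robba p) = Pi.single 0 1 := by
        funext k
        change algebraMap ℚ_[p] (Kn ε n) ((1 : Robba p).coe k) = _
        rw [Robba.coe_one]
        by_cases hk : k = 0
        · simp [hk]
        · simp [hk]
      rw [this, evalSer, coeff_mk, tsum_eq_single 0]
      · simp
      · intro k hk
        simp [hk]
    map_mul' := fun f g => by
      rw [← evalSer_lmul hα hM _ h0 h (convAt_coeK hr hn f.2) (convAt_coeK hr hn g.2),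
        ← coeK_mul ε hr0 n f.2 g.2]
      rfl
    map_zero' := by
      have := hadd 0 0
      rw [add_zero, left_eq_add] at this
      exact this
    map_add' := hadd }

theorem iota_apply {r : ℝ} (hr : (p : ℝ) - 1 ≤ r) {n : ℕ} (hn : nOf p r ≤ n) (f : RobbaR p r)
    (i : ℕ) : coeff i (iota ε hr hn f) = ∑' k : ℤ, algebraMap ℚ_[p] (Kn ε n) ((f : Robba p).coe k) *
      coeff i ((iotaUnit ε (one_le_of_nOf_le hr hn) ^ k : ((Kn ε n)⟦X⟧)ˣ) : (Kn ε n)⟦X⟧) := by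
  change coeff i (evalSer _ _) = _
  rw [evalSer, coeff_mk]
  rfl

end Iota

/-! ### The image of `t` under `ι_n` -/

section IotaT

variable {p : ℕ} [hp : Fact p.Prime]

theorem inv_natCast_norm_le (n : ℕ) : ‖(n : ℚ_[p])‖⁻¹ ≤ n := by
  rcases Nat.eq_zero_or_pos n with h | h
  · simp [h]
  · have hn : (n : ℚ_[p]) ≠ 0 := by exact_mod_cast h.ne'
    rw [Padic.norm_eq_zpow_neg_valuation hn, Padic.valuation_natCast, zpow_neg, inv_inv,
      zpow_natCast]
    exact_mod_cast Nat.le_of_dvd h pow_padicValNat_dvd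

theorem choose_pow_div (m k : ℕ) : ((p ^ m).choose (k + 1) : ℚ_[p]) / (p : ℚ_[p]) ^ m =
    ((p ^ m - 1).choose k : ℚ_[p]) / ((k + 1 : ℕ) : ℚ_[p]) := by
  have hpm : (p : ℚ_[p]) ^ m ≠ 0 := pow_ne_zero _ (by exact_mod_cast hp.1.ne_zero)
  have hk : ((k + 1 : ℕ) : ℚ_[p]) ≠ 0 := by exact_mod_cast Nat.succ_ne_zero k
  rw [div_eq_div_iff hpm hk]
  have h1 := Nat.add_one_mul_choose_eq (p ^ m - 1) k
  rw [Nat.sub_add_cancel (Nat.one_le_pow _ _ hp.1.pos)] at h1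
  have h2 : ((p ^ m : ℕ) : ℚ_[p]) * ((p ^ m - 1).choose k : ℕ) =
    ((p ^ m).choose (k + 1) : ℕ) * ((k + 1 : ℕ) : ℚ_[p]) := by exact_mod_cast h1
  rw [← h2, Nat.cast_pow, mul_comm]

theorem tendsto_choose (k : ℕ) :
    Tendsto (fun m : ℕ => ((p ^ m - 1).choose k : ℚ_[p])) atTop (𝓝 ((-1) ^ k)) := by
  induction k with
  | zero => simp
  | succ k ih =>
    have h1 : Tendsto (fun m : ℕ => (p : ℚ_[p]) ^ m) atTop (𝓝 0) :=
      tendsto_pow_atTop_nhds_zero_of_norm_lt_one Padic.norm_p_lt_one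
    have h2 := (h1.mul (ih.div_const ((k + 1 : ℕ) : ℚ_[p]))).sub ih
    rw [zero_mul, zero_sub] at h2
    rw [pow_succ, mul_neg_one]
    refine h2.congr fun m => ?_
    rw [← choose_pow_div, mul_div_cancel₀ _ (pow_ne_zero _ (by exact_mod_cast hp.1.ne_zero))]
    have h3 := Nat.choose_succ_succ (p ^ m - 1) k
    rw [Nat.succ_eq_add_one, Nat.sub_add_cancel (Nat.one_le_pow _ _ hp.1.pos)] at h3
    rw [h3]
    push_cast
    ring

/-- The logarithm vanishes at the roots of unity of `p`-power order. -/
theorem tsum_log_eq_zero {K : Type*} [NormedField K] [NormedAlgebra ℚ_[p] K] [CompleteSpace K]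
    {z : K} (hz : ‖z‖ < 1) {n : ℕ} (h1 : (1 + z) ^ p ^ n = 1) :
    ∑' k : ℕ, algebraMap ℚ_[p] K (coeff k (log ℚ_[p])) * z ^ k = 0 := by
  have hcont : Continuous (algebraMap ℚ_[p] K) := continuous_algebraMap _ _
  let c : ℕ → ℕ → K := fun m k =>
    algebraMap ℚ_[p] K (if k = 0 then 0 else ((p ^ m).choose k : ℚ_[p]) / (p : ℚ_[p]) ^ m) * z ^ k
  have hlim : Tendsto (fun m => ∑' k, c m k) atTop
      (𝓝 (∑' k : ℕ, algebraMap ℚ_[p] K (coeff k (log ℚ_[p])) * z ^ k)) := by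
    refine tendsto_tsum_of_dominated_convergence (bound := fun k : ℕ => (k : ℝ) * ‖z‖ ^ k) ?_ ?_ ?_
    · simpa using summable_pow_mul_geometric_of_norm_lt_one 1 (r := ‖z‖) (by simpa using hz)
    · intro k
      refine Tendsto.mul_const _ ((hcont.tendsto _).comp ?_)
      cases k with
      | zero => simp [coeff_log]
      | succ k =>
        rw [coeff_log, if_neg (Nat.succ_ne_zero k)]
        simp only [Nat.succ_ne_zero, if_false, choose_pow_div]
        have h2 := (tendsto_choose (p := p) k).div_const ((k + 1 : ℕ) : ℚ_[p])
        convert h2 using 2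
        simp [pow_succ]
    · refine Filter.Eventually.of_forall fun m k => ?_
      rw [norm_mul, norm_pow, norm_algebraMap']
      refine mul_le_mul_of_nonneg_right ?_ (by positivity)
      cases k with
      | zero => simp
      | succ k =>
        rw [if_neg (Nat.succ_ne_zero k), choose_pow_div, norm_div, div_eq_mul_inv]
        refine (mul_le_of_le_one_left (by positivity) ?_).trans (inv_natCast_norm_le _)
        exact_mod_cast Padic.norm_int_le_one (p := p) ((p ^ m - 1).choose k : ℤ)
  have hzero : ∀ m, n ≤ m → ∑' k, c m k = 0 := by
    intro m hm
    rw [tsum_eq_sum (s := Finset.range (p ^ m + 1))]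
    · obtain ⟨i, rfl⟩ := Nat.exists_eq_add_of_le hm
      have h2 : (1 + z) ^ p ^ (n + i) = 1 := by rw [pow_add, pow_mul, h1, one_pow]
      rw [add_comm, add_pow, Finset.sum_range_succ'] at h2
      simp only [one_pow, mul_one, pow_zero, Nat.choose_zero_right, Nat.cast_one] at h2
      rw [add_eq_right] at h2
      rw [Finset.sum_range_succ']
      simp only [c, if_true, map_zero, zero_mul, add_zero, Nat.succ_ne_zero, if_false]
      have h3 : ∀ k, algebraMap ℚ_[p] K
          (((p ^ (n + i)).choose (k + 1) : ℚ_[p]) / (p : ℚ_[p]) ^ (n + i)) * z ^ (k + 1) =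
          (z ^ (k + 1) * ((p ^ (n + i)).choose (k + 1) : ℕ)) *
            algebraMap ℚ_[p] K ((p : ℚ_[p]) ^ (n + i))⁻¹ := by
        intro k
        rw [div_eq_mul_inv, map_mul, map_natCast]
        ring
      rw [Finset.sum_congr rfl fun k _ => h3 k, ← Finset.sum_mul, h2, zero_mul]
    · intro k hk
      rw [Finset.mem_range, not_lt] at hk
      simp only [c, Nat.choose_eq_zero_of_lt (show p ^ m < k by omega)]
      simp
  exact tendsto_nhds_unique hlim
    (tendsto_const_nhds.congr' (by
      filter_upwards [Filter.eventually_ge_atTop n] with m hm using (hzero m hm).symm))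

variable (ε : EpsSeq p)

theorem constantCoeff_iota_t {r : ℝ} (hr : (p : ℝ) - 1 ≤ r) {n : ℕ} (hn : nOf p r ≤ n) :
    constantCoeff (iota ε hr hn ⟨tElt p, tElt_mem r⟩) = 0 := by
  have hn1 := one_le_of_nOf_le hr hn
  rw [← coeff_zero_eq_constantCoeff_apply, iota_apply,
    ← tsum_log_eq_zero (norm_eps_sub_one_lt ε n hn1) (n := n)
      (by rw [add_sub_cancel, (epsK_prim ε n).pow_eq_one]),
    ← Function.Injective.tsum_eq (g := fun n : ℕ => (n : ℤ)) Nat.cast_injective]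
  · refine tsum_congr fun k => ?_
    change algebraMap ℚ_[p] (Kn ε n) (laur (log ℚ_[p]) 0 1 k) * _ = _
    rw [laur_zero_apply, if_pos (by omega), Int.toNat_natCast, zpow_natCast, Units.val_pow_eq_pow_val,
      coeff_zero_eq_constantCoeff_apply, map_pow, iotaUnit_coe, constantCoeff_iotaSer]
  · intro k hk
    by_contra hcon
    apply hk
    have h0 : ¬ 0 ≤ k := fun h => hcon ⟨k.toNat, by simp [h]⟩
    change algebraMap ℚ_[p] (Kn ε n) (laur (log ℚ_[p]) 0 1 k) * _ = _
    rw [laur_zero_apply, if_neg h0, map_zero, zero_mul]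

theorem iota_t_mem {r : ℝ} (hr : (p : ℝ) - 1 ≤ r) {n : ℕ} (hn : nOf p r ≤ n) :
    X ∣ iota ε hr hn ⟨tElt p, tElt_mem r⟩ :=
  X_dvd_iff.2 (constantCoeff_iota_t ε hr hn)

end IotaT

/-! ## Extension of scalars along a ring homomorphism -/

section Ext

variable {A B : Type*} [CommRing A] [CommRing B] (σ : A →+* B)
variable (M : Type*) [AddCommGroup M] [Module A M]

/-- The ring `B`, viewed as an `A`-algebra via `σ`. -/
def Via (_σ : A →+* B) : Type _ := B

instance : CommRing (Via σ) := inferInstanceAs (CommRing B)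

instance : Algebra A (Via σ) := RingHom.toAlgebra (S := Via σ) σ

/-- The extension of scalars `B ⊗_{A, σ} M`. -/
def Ext : Type _ := TensorProduct A (Via σ) M

instance : AddCommGroup (Ext σ M) := inferInstanceAs (AddCommGroup (TensorProduct A (Via σ) M))

instance : Module B (Ext σ M) :=
  inferInstanceAs (Module (Via σ) (TensorProduct A (Via σ) M))

variable {M}

/-- The map `x ↦ 1 ⊗ x`. -/
def Ext.of : M →ₛₗ[σ] Ext σ M where
  toFun x := TensorProduct.tmul A (1 : Via σ) x
  map_add' x y := TensorProduct.tmul_add 1 x y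
  map_smul' a x := by
    change TensorProduct.tmul A (1 : Via σ) (a • x) =
      (algebraMap A (Via σ) a) • TensorProduct.tmul A (1 : Via σ) x
    rw [TensorProduct.tmul_smul, algebraMap_smul]

variable {N : Type*} [AddCommGroup N]

/-- The base change of an `A`-linear map. -/
def Ext.map [Module A N] (g : M →ₗ[A] N) : Ext σ M →ₗ[B] Ext σ N :=
  (LinearMap.baseChange (Via σ) g : TensorProduct A (Via σ) M →ₗ[Via σ] TensorProduct A (Via σ) N)

theorem Ext.map_of [Module A N] (g : M →ₗ[A] N) (x : M) :
    Ext.map σ g (Ext.of σ x) = Ext.of σ (g x) := rfl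

variable (N) in
/-- The `B`-module `N`, with the `A`-module structure coming from `σ`. -/
def Res (_σ : A →+* B) : Type _ := N

instance : AddCommGroup (Res N σ) := inferInstanceAs (AddCommGroup N)

instance [Module B N] : Module (Via σ) (Res N σ) := inferInstanceAs (Module B N)

instance [Module B N] : Module A (Res N σ) :=
  Module.compHom (R := Via σ) (Res N σ) (algebraMap A (Via σ))

instance [Module B N] : IsScalarTower A (Via σ) (Res N σ) :=
  ⟨fun a b x => by
    rw [Algebra.smul_def, mul_smul]
    rfl⟩

variable {σ} in
/-- The linearization `1 ⊗ f : B ⊗_{A, σ} M → N` of a semilinear map `f : M → N`. -/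
def Ext.lift [Module B N] (f : M →ₛₗ[σ] N) : Ext σ M →ₗ[B] N :=
  let f' : M →ₗ[A] Res N σ :=
    { toFun := f
      map_add' := f.map_add
      map_smul' := fun a x => map_smulₛₗ f a x }
  (LinearMap.liftBaseChange (Via σ) f' : TensorProduct A (Via σ) M →ₗ[Via σ] Res N σ)

theorem Ext.lift_smul_of [Module B N] (f : M →ₛₗ[σ] N) (b : B) (x : M) :
    Ext.lift f (b • Ext.of σ x) = b • f x := by
  rw [map_smul]
  congr 1
  exact (LinearMap.liftBaseChange_tmul (A := Via σ) (N := Res N σ) _ _ _).trans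
    (one_smul B (f x))

/-- The homomorphism `A / (a) → B / (b)` induced by `σ`, if `b` divides `σ a`. -/
def quotMap (a : A) (b : B) (h : b ∣ σ a) : A ⧸ Ideal.span {a} →+* B ⧸ Ideal.span {b} :=
  Ideal.quotientMap _ σ (by
    rw [Ideal.span_singleton_le_iff_mem, Ideal.mem_comap, Ideal.mem_span_singleton]
    exact h)

end Ext

/-! ## The rings `R^r / (t ^ k)` and `ℚ_p(ε^(n))[t] / (t ^ k)` -/

section Rings

variable (p : ℕ) [hp : Fact p.Prime]

/-- The radii `r ≥ p - 1`. -/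
abbrev Radius : Type := {r : ℝ // (p : ℝ) - 1 ≤ r}

variable {p}

theorem Radius.pos (r : Radius p) : 0 < (r : ℝ) := by
  have : (1 : ℝ) < p := by exact_mod_cast hp.1.one_lt
  linarith [r.2]

/-- The radius `p * r`. -/
def Radius.frob (r : Radius p) : Radius p :=
  ⟨p * r, by
    have : (1 : ℝ) < p := by exact_mod_cast hp.1.one_lt
    nlinarith [r.2, r.pos]⟩

theorem Radius.le_frob (r : Radius p) : r ≤ r.frob := by
  have : (1 : ℝ) < p := by exact_mod_cast hp.1.one_lt
  change (r : ℝ) ≤ p * r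
  nlinarith [r.pos]

theorem Radius.nOf_frob (r : Radius p) : nOf p r.frob = nOf p r + 1 := by
  have h1 : (1 : ℝ) < p := by exact_mod_cast hp.1.one_lt
  have h2 : 0 < (r : ℝ) / ((p : ℝ) - 1) := div_pos r.pos (by linarith)
  have h3 : (r.frob : ℝ) / ((p : ℝ) - 1) = p * ((r : ℝ) / ((p : ℝ) - 1)) := by
    rw [← mul_div_assoc]; rfl
  rw [nOf, nOf, h3, Real.log_mul (by linarith) h2.ne', add_div, div_self (Real.log_pos h1).ne']
  ring

theorem Radius.nOf_mono {r r' : Radius p} (h : r ≤ r') : nOf p r ≤ nOf p r' := by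
  have h1 : (1 : ℝ) < p := by exact_mod_cast hp.1.one_lt
  have h2 : 0 < (r : ℝ) / ((p : ℝ) - 1) := div_pos r.pos (by linarith)
  have h3 : (r : ℝ) ≤ r' := h
  have h4 := Real.log_pos h1
  unfold nOf
  gcongr

/-- The element `t` of `R^r`. -/
def tR (r : Radius p) : RobbaR p r := ⟨tElt p, tElt_mem _⟩

/-- The restriction `R^r → R^r'`, for `r ≤ r'`. -/
def resR {r r' : Radius p} (h : r ≤ r') : RobbaR p r →+* RobbaR p r' :=
  Subring.inclusion (RobbaR_mono r.pos h)

/-- The Frobenius `φ : R^r → R^(pr)`. -/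
def frobR (r : Radius p) : RobbaR p r →+* RobbaR p r.frob :=
  ((frob p).comp (RobbaR p r).subtype).codRestrict _ fun x => frob_mem r.2 x.2

/-- The action of `a ∈ ℤ_p ^ ×` on `R^r`. -/
def gamR (r : Radius p) (a : ℤ_[p]ˣ) : RobbaR p r →+* RobbaR p r :=
  ((gam a).comp (RobbaR p r).subtype).codRestrict _ fun x => gam_mem a x.2

theorem single_mem (r : ℝ) (n : ℤ) (a : ℚ_[p]) : Robba.single n a ∈ RobbaR p r :=
  fun ρ _ _ => convAt_single ρ n a

theorem dvd_frobR (r : Radius p) (k : ℕ) : tR r.frob ^ k ∣ frobR r (tR r ^ k) := by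
  rw [map_pow]
  refine pow_dvd_pow_of_dvd ⟨⟨_, single_mem _ 0 p⟩, Subtype.ext ?_⟩ k
  rw [mul_comm]
  exact frob_tElt

theorem dvd_gamR (r : Radius p) (a : ℤ_[p]ˣ) (k : ℕ) : tR r ^ k ∣ gamR r a (tR r ^ k) := by
  rw [map_pow]
  refine pow_dvd_pow_of_dvd ⟨⟨_, single_mem _ 0 ((a : ℤ_[p]) : ℚ_[p])⟩, Subtype.ext ?_⟩ k
  rw [mul_comm]
  exact gam_tElt a

variable (p) in
/-- The ring `R / (t ^ k)`. -/
abbrev RQuot (k : ℕ) : Type := Robba p ⧸ Ideal.span {tElt p ^ k}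

/-- The ring `R^r / (t ^ k)`. -/
abbrev RQ (k : ℕ) (r : Radius p) : Type := RobbaR p r ⧸ Ideal.span {tR r ^ k}

/-- The natural map `R^r / (t ^ k) → R / (t ^ k)`. -/
def toRQuot (k : ℕ) (r : Radius p) : RQ k r →+* RQuot p k :=
  quotMap (RobbaR p r).subtype _ _ dvd_rfl

/-- The natural map `R^r / (t ^ k) → R^r' / (t ^ k)`, for `r ≤ r'`. -/
def resQ (k : ℕ) {r r' : Radius p} (h : r ≤ r') : RQ k r →+* RQ k r' :=
  quotMap (resR h) _ _ dvd_rfl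

/-- The map `φ : R^r / (t ^ k) → R^(pr) / (t ^ k)`. -/
def frobQ (k : ℕ) (r : Radius p) : RQ k r →+* RQ k r.frob :=
  quotMap (frobR r) _ _ (dvd_frobR r k)

/-- The action of `Γ` on `R^r / (t ^ k)`. -/
def gamQ (k : ℕ) (r : Radius p) (γ : Gam p) : RQ k r →+* RQ k r :=
  quotMap (gamR r (chi p γ)) _ _ (dvd_gamR r _ k)

variable (ε : EpsSeq p)

/-- The ring `ℚ_p(ε^(n))[t] / (t ^ k)`, where the variable is written `X`. -/
abbrev KT (k n : ℕ) : Type := (Kn ε n)⟦X⟧ ⧸ Ideal.span {(X : (Kn ε n)⟦X⟧) ^ k}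

/-- The inclusion `ℚ_p(ε^(n))[[t]] → ℚ_p(ε^(m))[[t]]`, for `n ≤ m`. -/
def inclPS {n m : ℕ} (h : n ≤ m) : (Kn ε n)⟦X⟧ →+* (Kn ε m)⟦X⟧ := PowerSeries.map (inclK ε h)

/-- The action of `Γ` on `ℚ_p(ε^(n))[[t]]`, with `γ(t) = χ(γ) t`. -/
def gamPS (n : ℕ) (γ : Gam p) : (Kn ε n)⟦X⟧ →+* (Kn ε n)⟦X⟧ :=
  (rescale (algebraMap ℚ_[p] (Kn ε n) ((chi p γ : ℤ_[p]) : ℚ_[p]))).comp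
    (PowerSeries.map (gamK ε n γ : Kn ε n →+* Kn ε n))

/-- The inclusion `ℚ_p(ε^(n))[t] / (t ^ k) → ℚ_p(ε^(m))[t] / (t ^ k)`, for `n ≤ m`. -/
def inclKT (k : ℕ) {n m : ℕ} (h : n ≤ m) : KT ε k n →+* KT ε k m :=
  quotMap (inclPS ε h) _ _ (by rw [map_pow, inclPS, map_X])

/-- The action of `Γ` on `ℚ_p(ε^(n))[t] / (t ^ k)`. -/
def gamKT (k n : ℕ) (γ : Gam p) : KT ε k n →+* KT ε k n :=
  quotMap (gamPS ε n γ) _ _ (by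
    rw [map_pow]
    refine pow_dvd_pow_of_dvd ?_ k
    rw [gamPS, RingHom.comp_apply, map_X, rescale_X]
    exact dvd_mul_left _ _)

/-- The localization map `ι_n : R^r / (t ^ k) → ℚ_p(ε^(n))[t] / (t ^ k)`. -/
def iotaQ (k : ℕ) (r : Radius p) {n : ℕ} (hn : nOf p r ≤ n) : RQ k r →+* KT ε k n :=
  quotMap (iota ε r.2 hn) _ _ (by
    rw [map_pow]
    exact pow_dvd_pow_of_dvd (iota_t_mem ε r.2 hn) k)

variable (p) in
/-- The set of the integers `n ≥ n(r)`. -/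
abbrev Idx (r : Radius p) : Type := {n : ℕ // nOf p r ≤ n}

theorem Radius.nOf_frob_le {r : Radius p} {n : ℕ} (hn : nOf p r ≤ n) :
    nOf p r.frob ≤ (n + 1 : ℕ) := by
  rw [r.nOf_frob, Nat.cast_add, Nat.cast_one]
  linarith

variable (p) in
/-- The least integer `n ≥ n(r)`. -/
def nMin (r : Radius p) : ℕ := ⌈nOf p r⌉₊

theorem nMin_le {r : Radius p} {n : ℕ} (hn : nOf p r ≤ n) : nMin p r ≤ n := Nat.ceil_le.2 hn

end Rings

/-! ## Generalized `(φ, Γ)`-modules -/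

section Modules

variable {p : ℕ} [hp : Fact p.Prime]

variable (p) in
/-- The structure of a generalized `(φ, Γ)`-module on a module `D` over the Robba ring `R`:
the module is finitely presented, it has commuting semilinear actions of `φ` and `Γ`, and
the linearization `φ^* D → D` of `φ` is an isomorphism. -/
structure GenPhiGamma (D : Type*) [AddCommGroup D] [Module (Robba p) D] where
  finitePresentation : Module.FinitePresentation (Robba p) D
  /-- the Frobenius -/
  phi : D →ₛₗ[frob p] D
  /-- the action of `Γ` -/
  act : Gam p →* AddMonoid.End D
  act_smul : ∀ (γ : Gam p) (f : Robba p) (x : D), act γ (f • x) = gam (chi p γ) f • act γ x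
  act_phi : ∀ (γ : Gam p) (x : D), act γ (phi x) = phi (act γ x)
  bijective : Function.Bijective (Ext.lift phi)

/-! ### Pure `t ^ k`-torsion modules: the modules `S_r` -/

section Torsion

/-- Let `e` be a basis over `R / (t ^ k)` of a pure `t ^ k`-torsion `(φ, Γ)`-module `S`. A model of
`S` over `R^(r₀) / (t ^ k)` consists of the matrix `A` of `φ`, its inverse `B` and the matrices
`C γ` of the elements `γ` of `Γ`, with entries in `R^(r₀) / (t ^ k)`, satisfying there the
relations that say that `A B = B A = 1` and that the actions of `φ` and of `Γ` commute. -/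
structure TorsionModel {k d : ℕ} {S : Type*} [AddCommGroup S] [Module (Robba p) S]
    [Module (RQuot p k) S] (hS : GenPhiGamma p S) (e : Module.Basis (Fin d) (RQuot p k) S)
    (r₀ : Radius p) where
  /-- the matrix of `φ` -/
  A : Matrix (Fin d) (Fin d) (RQ k r₀)
  /-- the inverse of `A` -/
  B : Matrix (Fin d) (Fin d) (RQ k r₀)
  /-- the matrices of the elements of `Γ` -/
  C : Gam p → Matrix (Fin d) (Fin d) (RQ k r₀)
  phi_basis : ∀ j, hS.phi (e j) = ∑ i, toRQuot k r₀ (A i j) • e i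
  act_basis : ∀ γ j, hS.act γ (e j) = ∑ i, toRQuot k r₀ (C γ i j) • e i
  mul_eq_one : A * B = 1
  mul_eq_one' : B * A = 1
  C_one : C 1 = 1
  C_mul : ∀ γ γ', C (γ * γ') = C γ * (C γ').map (gamQ k r₀ γ)
  comm : ∀ γ, A.map (resQ k r₀.le_frob) * (C γ).map (frobQ k r₀) =
    (C γ).map (resQ k r₀.le_frob) * (A.map (resQ k r₀.le_frob)).map (gamQ k r₀.frob γ)

/-- The free `R^r / (t ^ k)`-module `S_r` with basis `e_1, …, e_d`. -/
abbrev TMod (k d : ℕ) (r : Radius p) : Type := Fin d → RQ k r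

/-- The natural map `S_r → S_r'`, for `r ≤ r'`. -/
def TMod.res (k d : ℕ) {r r' : Radius p} (h : r ≤ r') : TMod k d r →ₛₗ[resQ k h] TMod k d r' where
  toFun x i := resQ k h (x i)
  map_add' _ _ := funext fun _ => map_add _ _ _
  map_smul' _ _ := funext fun _ => map_mul _ _ _

/-- The semilinear map with a given matrix. -/
def matMap {A B : Type*} [CommRing A] [CommRing B] (σ : A →+* B) {d : ℕ}
    (P : Matrix (Fin d) (Fin d) B) : (Fin d → A) →ₛₗ[σ] (Fin d → B) where
  toFun x := P.mulVec fun i => σ (x i)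
  map_add' x y := by
    rw [← Matrix.mulVec_add]
    congr 1
    exact funext fun _ => map_add _ _ _
  map_smul' a x := by
    rw [← Matrix.mulVec_smul]
    congr 1
    exact funext fun _ => map_mul _ _ _

variable {k d : ℕ} {S : Type*} [AddCommGroup S] [Module (Robba p) S] [Module (RQuot p k) S]
  {hS : GenPhiGamma p S} {e : Module.Basis (Fin d) (RQuot p k) S} {r₀ : Radius p}

/-- The Frobenius `φ : S_r → S_(pr)`. -/
def TorsionModel.phi (M : TorsionModel hS e r₀) {r : Radius p} (h : r₀ ≤ r) :
    TMod k d r →ₛₗ[frobQ k r] TMod k d r.frob :=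
  matMap (frobQ k r) (M.A.map (resQ k (h.trans r.le_frob)))

/-- The action of `γ ∈ Γ` on `S_r`. -/
def TorsionModel.act (M : TorsionModel hS e r₀) {r : Radius p} (h : r₀ ≤ r) (γ : Gam p) :
    TMod k d r →ₛₗ[gamQ k r γ] TMod k d r :=
  matMap (gamQ k r γ) ((M.C γ).map (resQ k h))

variable (ε : EpsSeq p)

/-- The module `S^n`, the extension of scalars of `S_r` to `ℚ_p(ε^(n))[t] / (t ^ k)`. -/
abbrev TLoc (k d : ℕ) (r : Radius p) {n : ℕ} (hn : nOf p r ≤ n) : Type :=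
  Ext (iotaQ ε k r hn) (TMod k d r)

/-- The natural map `S_r → S^n`. -/
abbrev TLoc.of (k d : ℕ) (r : Radius p) {n : ℕ} (hn : nOf p r ≤ n) :
    TMod k d r →ₛₗ[iotaQ ε k r hn] TLoc ε k d r hn :=
  Ext.of (iotaQ ε k r hn)

end Torsion

/-! ### `(φ, Γ)`-modules: the modules `D_r` -/

section Models

variable {D : Type*} [AddCommGroup D] [Module (Robba p) D]

/-- `M` is the module `D_r`: it is generated over `R^r` by a basis of `D` whose image under `φ`
generates `R^(pr) ⊗ M` over `R^(pr)`, and it is stable under `Γ`. -/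
structure IsModel (hD : GenPhiGamma p D) (d : ℕ) (r : Radius p)
    (M : Submodule (RobbaR p r) D) : Prop where
  exists_basis : ∃ b : Module.Basis (Fin d) (Robba p) D,
    Submodule.span (RobbaR p r) (Set.range b) = M ∧
      Submodule.span (RobbaR p r.frob) (Set.range fun i => hD.phi (b i)) =
        Submodule.span (RobbaR p r.frob) (M : Set D)
  act_mem : ∀ γ, ∀ x ∈ M, hD.act γ x ∈ M

variable {E : Type*} [AddCommGroup E] [Module (Robba p) E]

/-- A pair `E_r ⊆ D_r`, for an embedding `j : E → D` of `(φ, Γ)`-modules of rank `d`. -/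
structure QuotModel (hD : GenPhiGamma p D) (hE : GenPhiGamma p E) (j : E →ₗ[Robba p] D) (d : ℕ)
    (r : Radius p) where
  /-- the module `D_r` -/
  MD : Submodule (RobbaR p r) D
  /-- the module `E_r` -/
  ME : Submodule (RobbaR p r) E
  isModelD : IsModel hD d r MD
  isModelE : IsModel hE d r ME
  le : ∀ x ∈ ME, j x ∈ MD

variable {hD : GenPhiGamma p D} {hE : GenPhiGamma p E} {j : E →ₗ[Robba p] D} {d : ℕ}
  {r : Radius p}

/-- The inclusion `E_r → D_r`. -/
def QuotModel.incl (Q : QuotModel hD hE j d r) : Q.ME →ₗ[RobbaR p r] Q.MD :=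
  ((j.restrictScalars (RobbaR p r)).comp Q.ME.subtype).codRestrict Q.MD fun x => Q.le x x.2

/-- The quotient `D_r / E_r`. -/
abbrev QuotModel.Quo (Q : QuotModel hD hE j d r) : Type _ := Q.MD ⧸ LinearMap.range Q.incl

variable (ε : EpsSeq p)

/-- The map `D_dif^(+,n)(E) → D_dif^(+,n)(D)`, where
`D_dif^(+,n)(D) = ℚ_p(ε^(n))[[t]] ⊗_(ι_n) D_r`. -/
abbrev QuotModel.dif (Q : QuotModel hD hE j d r) {n : ℕ} (hn : nOf p r ≤ n) :
    Ext (iota ε r.2 hn) Q.ME →ₗ[(Kn ε n)⟦X⟧] Ext (iota ε r.2 hn) Q.MD :=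
  Ext.map (iota ε r.2 hn) Q.incl

/-- The quotient `D_dif^(+,n)(D) / D_dif^(+,n)(E)`. -/
abbrev QuotModel.Loc (Q : QuotModel hD hE j d r) {n : ℕ} (hn : nOf p r ≤ n) : Type _ :=
  Ext (iota ε r.2 hn) Q.MD ⧸ LinearMap.range (Q.dif ε hn)

/-- The localization map `D_r / E_r → D_dif^(+,n)(D) / D_dif^(+,n)(E)`. -/
def QuotModel.of (Q : QuotModel hD hE j d r) {n : ℕ} (hn : nOf p r ≤ n) :
    Q.Quo →ₛₗ[iota ε r.2 hn] Q.Loc ε hn :=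
  (LinearMap.range Q.incl).liftQ
    ((LinearMap.range (Q.dif ε hn)).mkQ.comp (Ext.of (iota ε r.2 hn))) (by
      rintro _ ⟨x, rfl⟩
      rw [LinearMap.mem_ker, LinearMap.comp_apply, Submodule.mkQ_apply,
        Submodule.Quotient.mk_eq_zero]
      exact ⟨Ext.of _ x, Ext.map_of _ _ _⟩)

/-- The class in `D_r / E_r` of an element of `D_r`. -/
abbrev QuotModel.cls (Q : QuotModel hD hE j d r) {x : D} (hx : x ∈ Q.MD) : Q.Quo :=
  Submodule.Quotient.mk ⟨x, hx⟩

end Models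

end Modules

end PhiGamma

end

open PhiGamma PowerSeries

noncomputable section

open Filter Topology

namespace PhiGamma

open PowerSeries

/-! ## Rings of Laurent series converging on a set of radii -/

section LaurentRing

/-- Nonempty sets of positive radii. -/
abbrev Radii : Type := {S : Set ℝ // S.Nonempty ∧ ∀ ρ ∈ S, 0 < ρ}

variable {F : Type*} [NormedField F] [IsUltrametricDist F]

variable (F) in
/-- The Laurent series converging at all the radii in `S`, as an additive group. -/
def convGroup (S : Radii) : AddSubgroup (ℤ → F) where
  carrier := {f | ∀ ρ ∈ S.1, ConvAt ρ f}
  zero_mem' := fun ρ _ => convAt_zero ρ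
  add_mem' := fun hf hg ρ h => (hf ρ h).add (hg ρ h) (S.2.2 ρ h)
  neg_mem' := fun hf ρ h => (hf ρ h).neg

variable (F) in
/-- The ring of Laurent series converging at all the radii in `S`. -/
def LaurRing (S : Radii) : Type _ := convGroup F S

instance (S : Radii) : AddCommGroup (LaurRing F S) := inferInstanceAs (AddCommGroup (convGroup F S))

variable {S : Radii}

/-- The coefficients of a Laurent series. -/
def LaurRing.coe (f : LaurRing F S) : ℤ → F := f.1

/-- A Laurent series with given coefficients. -/
def LaurRing.of (f : ℤ → F) (hf : ∀ ρ ∈ S.1, ConvAt ρ f) : LaurRing F S := ⟨f, hf⟩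

@[simp] theorem LaurRing.coe_of (f : ℤ → F) (hf : ∀ ρ ∈ S.1, ConvAt ρ f) :
    (LaurRing.of f hf).coe = f := rfl

@[ext] theorem LaurRing.ext {f g : LaurRing F S} (h : f.coe = g.coe) : f = g := Subtype.ext h

theorem LaurRing.conv (f : LaurRing F S) {ρ : ℝ} (hρ : ρ ∈ S.1) : ConvAt ρ f.coe := f.2 ρ hρ

variable [CompleteSpace F]

instance : Mul (LaurRing F S) := ⟨fun f g => LaurRing.of (lmul f.coe g.coe)
  fun _ h => (f.conv h).lmul (S.2.2 _ h) (g.conv h)⟩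

/-- The monomial `a * T ^ n`. -/
def LaurRing.single (S : Radii) (n : ℤ) (a : F) : LaurRing F S :=
  LaurRing.of (Pi.single n a) fun ρ _ => convAt_single ρ n a

instance : One (LaurRing F S) := ⟨LaurRing.single S 0 1⟩

theorem LaurRing.coe_mul (f g : LaurRing F S) : (f * g).coe = lmul f.coe g.coe := rfl
theorem LaurRing.coe_add (f g : LaurRing F S) : (f + g).coe = f.coe + g.coe := rfl
theorem LaurRing.coe_sub (f g : LaurRing F S) : (f - g).coe = f.coe - g.coe := rfl
theorem LaurRing.coe_one : (1 : LaurRing F S).coe = Pi.single 0 1 := rfl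
theorem LaurRing.coe_zero : (0 : LaurRing F S).coe = 0 := rfl
theorem LaurRing.coe_single (n : ℤ) (a : F) : (LaurRing.single S n a).coe = Pi.single n a := rfl

theorem LaurRing.mul_comm_aux (f g : LaurRing F S) : f * g = g * f :=
  LaurRing.ext (lmul_comm _ _)

theorem LaurRing.one_mul_aux (f : LaurRing F S) : 1 * f = f := by
  ext k
  rw [LaurRing.coe_mul, LaurRing.coe_one, single_lmul, one_mul, sub_zero]

theorem LaurRing.mul_add_aux (f g h : LaurRing F S) : f * (g + h) = f * g + f * h := by
  obtain ⟨ρ, hρ⟩ := S.2.1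
  exact LaurRing.ext (lmul_add (S.2.2 _ hρ) (f.conv hρ) (g.conv hρ) (h.conv hρ))

instance : CommRing (LaurRing F S) where
  __ := (inferInstance : AddCommGroup (LaurRing F S))
  mul_comm := LaurRing.mul_comm_aux
  mul_assoc f g h := by
    obtain ⟨ρ, hρ⟩ := S.2.1
    exact LaurRing.ext (lmul_assoc (S.2.2 _ hρ) (f.conv hρ) (g.conv hρ) (h.conv hρ))
  one_mul := LaurRing.one_mul_aux
  mul_one f := by rw [LaurRing.mul_comm_aux, LaurRing.one_mul_aux]
  left_distrib := LaurRing.mul_add_aux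
  right_distrib f g h := by
    rw [LaurRing.mul_comm_aux, LaurRing.mul_add_aux, LaurRing.mul_comm_aux h f,
      LaurRing.mul_comm_aux h g]
  zero_mul f := by
    have := LaurRing.mul_add_aux f 0 0
    rw [add_zero, left_eq_add, LaurRing.mul_comm_aux] at this
    exact this
  mul_zero f := by
    have := LaurRing.mul_add_aux f 0 0
    rwa [add_zero, left_eq_add] at this

/-- Restriction to a smaller set of radii. -/
def LaurRing.res {S S' : Radii} (h : S'.1 ⊆ S.1) : LaurRing F S →+* LaurRing F S' where
  toFun f := LaurRing.of f.coe fun _ hρ => f.conv (h hρ)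
  map_one' := rfl
  map_mul' _ _ := rfl
  map_zero' := rfl
  map_add' _ _ := rfl

/-- The coefficient maps. -/
def LaurRing.coeffHom (S : Radii) (k : ℤ) : LaurRing F S →+ F where
  toFun f := f.coe k
  map_zero' := rfl
  map_add' _ _ := rfl

theorem LaurRing.coe_sum {ι : Type*} (s : Finset ι) (f : ι → LaurRing F S) (k : ℤ) :
    (∑ i ∈ s, f i).coe k = ∑ i ∈ s, (f i).coe k := map_sum (LaurRing.coeffHom S k) f s

theorem LaurRing.single_mul_coe (n : ℤ) (a : F) (f : LaurRing F S) (k : ℤ) :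
    (LaurRing.single S n a * f).coe k = a * f.coe (k - n) := by
  rw [LaurRing.coe_mul, LaurRing.coe_single, single_lmul]

theorem norm_lmul_le {ρ A B : ℝ} (hρ : 0 < ρ) (hA : 0 ≤ A) (hB : 0 ≤ B) {f g : ℤ → F}
    (hf : ∀ k, ‖f k‖ * ρ ^ k ≤ A) (hg : ∀ k, ‖g k‖ * ρ ^ k ≤ B) (k : ℤ) :
    ‖lmul f g k‖ * ρ ^ k ≤ A * B := by
  rw [← le_div_iff₀ (by positivity)]
  refine IsUltrametricDist.norm_tsum_le_of_forall_le_of_nonneg (by positivity) fun i => ?_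
  rw [le_div_iff₀ (by positivity), norm_mul]
  calc ‖f i‖ * ‖g (k - i)‖ * ρ ^ k = (‖f i‖ * ρ ^ i) * (‖g (k - i)‖ * ρ ^ (k - i)) := by
        rw [show ρ ^ k = ρ ^ i * ρ ^ (k - i) by rw [← zpow_add₀ hρ.ne']; ring_nf]; ring
    _ ≤ A * B := mul_le_mul (hf i) (hg _) (by positivity) hA

/-- A nonzero convergent Laurent series has a largest term; both the first and the last index of
such a term exist. -/
theorem exists_dominant {ρ : ℝ} (hρ : 0 < ρ) {f : ℤ → F} (hf : ConvAt ρ f) (h0 : f ≠ 0) :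
    ∃ N N' : ℤ, f N ≠ 0 ∧ f N' ≠ 0 ∧ (∀ j, ‖f j‖ * ρ ^ j ≤ ‖f N‖ * ρ ^ N) ∧
      (∀ j, ‖f j‖ * ρ ^ j ≤ ‖f N'‖ * ρ ^ N') ∧
      (∀ j < N, ‖f j‖ * ρ ^ j < ‖f N‖ * ρ ^ N) ∧ ∀ j > N', ‖f j‖ * ρ ^ j < ‖f N'‖ * ρ ^ N' := by
  obtain ⟨i, hi⟩ : ∃ i, f i ≠ 0 := by
    by_contra hcon
    push Not at hcon
    exact h0 (funext hcon)
  set a : ℤ → ℝ := fun j => ‖f j‖ * ρ ^ j with ha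
  have hai : 0 < a i := mul_pos (norm_pos_iff.2 hi) (by positivity)
  have hfin : ∀ c, 0 < c → {j | c ≤ a j}.Finite := by
    intro c hc
    have := (Metric.tendsto_nhds.1 hf) c hc
    refine Set.Finite.subset this fun j hj => ?_
    change ¬ dist (a j) 0 < c
    rw [Real.dist_0_eq_abs, abs_of_nonneg (by positivity), not_lt]
    exact hj
  obtain ⟨m, hm, hmax⟩ := Set.exists_max_image _ a (hfin _ hai) ⟨i, le_refl (a i)⟩
  have hmm : ∀ j, a j ≤ a m := by
    intro j
    by_cases hj : a i ≤ a j
    · exact hmax j hj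
    · exact (not_le.1 hj).le.trans hm
  have ham : 0 < a m := hai.trans_le hm
  obtain ⟨N, hN, hNmin⟩ := Set.exists_min_image _ id (hfin _ ham) ⟨m, le_refl (a m)⟩
  obtain ⟨N', hN', hNmax⟩ := Set.exists_max_image _ id (hfin _ ham) ⟨m, le_refl (a m)⟩
  have hne : ∀ j, a m ≤ a j → f j ≠ 0 := by
    intro j hj h
    have : a j = 0 := by simp [ha, h]
    linarith
  refine ⟨N, N', hne _ hN, hne _ hN', fun j => (hmm j).trans hN, fun j => (hmm j).trans hN', ?_, ?_⟩
  · intro j hj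
    by_contra hcon
    exact absurd (hNmin j (hN.trans (not_lt.1 hcon))) (not_le.2 hj)
  · intro j hj
    by_contra hcon
    exact absurd (hNmax j (hN'.trans (not_lt.1 hcon))) (not_le.2 hj)

theorem exists_lt_of_tendsto {ι : Type*} {a : ι → ℝ} (ha : Tendsto a cofinite (𝓝 0)) {c : ℝ}
    (hc : 0 < c) (s : Set ι) (h : ∀ i ∈ s, a i < c) : ∃ c', 0 < c' ∧ c' < c ∧ ∀ i ∈ s, a i ≤ c' := by
  have h1 : {i | ¬ a i < c / 2}.Finite :=
    ha.eventually (eventually_lt_nhds (show (0 : ℝ) < c / 2 by positivity))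
  rcases (({i | ¬ a i < c / 2} ∩ s).eq_empty_or_nonempty) with h2 | h2
  · refine ⟨c / 2, by positivity, by linarith, fun i hi => ?_⟩
    by_contra hcon
    have : i ∈ {i | ¬ a i < c / 2} ∩ s := ⟨fun h => hcon h.le, hi⟩
    rw [h2] at this
    exact this
  · obtain ⟨m, hm, hmax⟩ := Set.exists_max_image _ a (h1.inter_of_left s) h2
    refine ⟨max (c / 2) (a m), lt_max_of_lt_left (by positivity), max_lt (by linarith) (h m hm.2),
      fun i hi => ?_⟩
    by_cases hi2 : a i < c / 2
    · exact hi2.le.trans (le_max_left _ _)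
    · exact (hmax i ⟨hi2, hi⟩).trans (le_max_right _ _)

theorem lmul_ne_zero {ρ : ℝ} (hρ : 0 < ρ) {f g : ℤ → F} (hf : ConvAt ρ f) (hg : ConvAt ρ g)
    (hf0 : f ≠ 0) (hg0 : g ≠ 0) : lmul f g ≠ 0 := by
  obtain ⟨N, -, hN, -, hN1, -, hN2, -⟩ := exists_dominant hρ hf hf0
  obtain ⟨M, -, hM, -, hM1, -, hM2, -⟩ := exists_dominant hρ hg hg0
  have hfN : 0 < ‖f N‖ * ρ ^ N := mul_pos (norm_pos_iff.2 hN) (by positivity)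
  have hgM : 0 < ‖g M‖ * ρ ^ M := mul_pos (norm_pos_iff.2 hM) (by positivity)
  have key : ∀ i ∈ {i | i ≠ N}, ‖f i * g (N + M - i)‖ < ‖f N * g M‖ := by
    intro i hi
    have h1 : ‖f i * g (N + M - i)‖ * ρ ^ (N + M) =
        (‖f i‖ * ρ ^ i) * (‖g (N + M - i)‖ * ρ ^ (N + M - i)) := by
      rw [norm_mul, show ρ ^ (N + M) = ρ ^ i * ρ ^ (N + M - i) by
        rw [← zpow_add₀ hρ.ne']; ring_nf]
      ring
    have h2 : ‖f N * g M‖ * ρ ^ (N + M) = (‖f N‖ * ρ ^ N) * (‖g M‖ * ρ ^ M) := by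
      rw [norm_mul, zpow_add₀ hρ.ne']; ring
    refine lt_of_mul_lt_mul_right (a := ρ ^ (N + M)) ?_ (by positivity)
    rw [h1, h2]
    rcases lt_or_gt_of_ne hi with h | h
    · exact (mul_le_mul_of_nonneg_left (hM1 _) (by positivity)).trans_lt
        (mul_lt_mul_of_pos_right (hN2 i h) hgM)
    · exact mul_lt_mul' (hN1 i) (hM2 _ (by omega)) (by positivity) hfN
  have hs := summable_lmul hρ hf hg (N + M)
  have hpos : 0 < ‖f N * g M‖ := norm_pos_iff.2 (mul_ne_zero hN hM)
  obtain ⟨c, hc0, hc, hle⟩ := exists_lt_of_tendsto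
    (tendsto_zero_iff_norm_tendsto_zero.1 hs.tendsto_cofinite_zero) hpos _ key
  intro h
  have h1 := congrFun h (N + M)
  unfold lmul at h1
  rw [hs.tsum_eq_add_tsum_ite N, add_sub_cancel_left, Pi.zero_apply, add_eq_zero_iff_eq_neg] at h1
  have h2 : ‖∑' i, ite (i = N) 0 (f i * g (N + M - i))‖ ≤ c := by
    refine IsUltrametricDist.norm_tsum_le_of_forall_le_of_nonneg hc0.le fun i => ?_
    split_ifs with hi
    · simpa using hc0.le
    · exact hle i hi
  rw [h1, norm_neg] at hc
  linarith

instance : IsDomain (LaurRing F S) := by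
  have : Nontrivial (LaurRing F S) := ⟨⟨0, 1, fun h => by
    have := congrFun (congrArg LaurRing.coe h) 0
    simp [LaurRing.coe_one, LaurRing.coe_zero] at this⟩⟩
  have : NoZeroDivisors (LaurRing F S) := ⟨by
    intro f g h
    by_contra hcon
    push Not at hcon
    obtain ⟨ρ, hρ⟩ := S.2.1
    refine lmul_ne_zero (S.2.2 _ hρ) (f.conv hρ) (g.conv hρ) (fun h => hcon.1 (LaurRing.ext h))
      (fun h => hcon.2 (LaurRing.ext h)) ?_
    rw [← LaurRing.coe_mul, h, LaurRing.coe_zero]⟩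
  exact NoZeroDivisors.to_isDomain _

theorem zpow_le_zpow_left_of_nonpos {a b : ℝ} {n : ℤ} (hn : n ≤ 0) (ha : 0 < a) (h : a ≤ b) :
    b ^ n ≤ a ^ n := by
  have := inv_anti₀ (zpow_pos ha _) (zpow_le_zpow_left₀ (neg_nonneg.2 hn) ha.le h)
  rwa [zpow_neg, zpow_neg, inv_inv, inv_inv] at this

theorem tendsto_cofinite_prod {κ ι : Type*} {a : κ × ι → ℝ} {b : κ → ℝ} (h0 : ∀ x, 0 ≤ a x)
    (h1 : ∀ i, Tendsto (fun j => a (i, j)) cofinite (𝓝 0)) (h2 : ∀ᶠ i in cofinite, ∀ j, a (i, j) ≤ b i)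
    (hb : Tendsto b cofinite (𝓝 0)) : Tendsto a cofinite (𝓝 0) := by
  rw [Metric.tendsto_nhds]
  intro ε hε
  have e1 : {i : κ | ¬ (b i < ε ∧ ∀ j, a (i, j) ≤ b i)}.Finite :=
    (hb.eventually (eventually_lt_nhds hε)).and h2
  have e2 : ∀ i, {j : ι | ¬ a (i, j) < ε}.Finite := fun i =>
    (h1 i).eventually (eventually_lt_nhds hε)
  refine Set.Finite.subset (e1.biUnion fun i _ => (e2 i).image fun j => (i, j)) ?_
  rintro ⟨i, j⟩ hij
  have hij' : ¬ a (i, j) < ε := by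
    intro h
    apply hij
    change dist _ _ < ε
    rwa [Real.dist_0_eq_abs, abs_of_nonneg (h0 _)]
  simp only [Set.mem_iUnion]
  refine ⟨i, ?_, j, hij', rfl⟩
  rintro ⟨h3, h4⟩
  exact hij' ((h4 j).trans_lt h3)

end LaurentRing

/-! ## Weierstrass division on a closed annulus -/

section Weierstrass

variable {F : Type*} [NormedField F] [IsUltrametricDist F] [CompleteSpace F]

/-- A closed interval of radii. -/
def icc {ρ₁ ρ₂ : ℝ} (h0 : 0 < ρ₁) (h : ρ₁ ≤ ρ₂) : Radii :=
  ⟨Set.Icc ρ₁ ρ₂, ⟨ρ₁, le_rfl, h⟩, fun _ hρ => h0.trans_le hρ.1⟩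

variable {ρ₁ ρ₂ : ℝ} {h0 : 0 < ρ₁} {h12 : ρ₁ ≤ ρ₂}

/-- The series `f` has dominant terms of index `N₁` at the radius `ρ₁` and of index `N₂` at the
radius `ρ₂`, where `N₁` is the least and `N₂` is the greatest possible index. -/
structure Dominant (ρ₁ ρ₂ : ℝ) (f : ℤ → F) (N₁ N₂ : ℤ) : Prop where
  ne₁ : f N₁ ≠ 0
  ne₂ : f N₂ ≠ 0
  le₁ : ∀ j, ‖f j‖ * ρ₁ ^ j ≤ ‖f N₁‖ * ρ₁ ^ N₁
  le₂ : ∀ j, ‖f j‖ * ρ₂ ^ j ≤ ‖f N₂‖ * ρ₂ ^ N₂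
  lt₁ : ∀ j < N₁, ‖f j‖ * ρ₁ ^ j < ‖f N₁‖ * ρ₁ ^ N₁
  lt₂ : ∀ j > N₂, ‖f j‖ * ρ₂ ^ j < ‖f N₂‖ * ρ₂ ^ N₂

theorem exists_dominant_icc (f : LaurRing F (icc h0 h12)) (hf : f ≠ 0) :
    ∃ N₁ N₂, Dominant ρ₁ ρ₂ f.coe N₁ N₂ := by
  have hf' : f.coe ≠ 0 := fun h => hf (LaurRing.ext h)
  obtain ⟨N, -, hN, -, hN1, -, hN2, -⟩ :=
    exists_dominant h0 (f.conv (show ρ₁ ∈ Set.Icc ρ₁ ρ₂ from ⟨le_rfl, h12⟩)) hf'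
  obtain ⟨-, M, -, hM, -, hM1, -, hM2⟩ :=
    exists_dominant (h0.trans_le h12) (f.conv (show ρ₂ ∈ Set.Icc ρ₁ ρ₂ from ⟨h12, le_rfl⟩)) hf'
  exact ⟨N, M, hN, hM, hN1, hM1, hN2, hM2⟩

/-- The comparison of two terms of a series at two radii. -/
theorem zpow_div_mul (h0 : 0 < ρ₁) (h2 : 0 < ρ₂) (a : ℝ) (k : ℤ) :
    a * ρ₂ ^ k = a * ρ₁ ^ k * (ρ₂ / ρ₁) ^ k := by
  rw [div_zpow]
  have := (zpow_pos h0 k).ne'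
  field_simp

theorem Dominant.le {f : ℤ → F} {N₁ N₂ : ℤ} (D : Dominant ρ₁ ρ₂ f N₁ N₂) (h0 : 0 < ρ₁)
    (h12 : ρ₁ ≤ ρ₂) : N₁ ≤ N₂ := by
  by_contra hcon
  push Not at hcon
  have h2 : 0 < ρ₂ := h0.trans_le h12
  have e1 := D.lt₁ _ hcon
  have e2 := D.lt₂ _ hcon
  rw [zpow_div_mul h0 h2, zpow_div_mul h0 h2 ‖f N₂‖] at e2
  have h1 : 1 ≤ ρ₂ / ρ₁ := (one_le_div h0).2 h12
  have e3 := zpow_le_zpow_right₀ h1 hcon.le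
  have e4 : ‖f N₂‖ * ρ₁ ^ N₂ * (ρ₂ / ρ₁) ^ N₂ ≤ ‖f N₁‖ * ρ₁ ^ N₁ * (ρ₂ / ρ₁) ^ N₁ := by
    gcongr
  linarith

/-- Outside `[N₁, N₂]` the terms are uniformly smaller, at both radii. -/
theorem Dominant.exists_ratio {f : LaurRing F (icc h0 h12)} {N₁ N₂ : ℤ}
    (D : Dominant ρ₁ ρ₂ f.coe N₁ N₂) : ∃ θ : ℝ, 0 < θ ∧ θ < 1 ∧ ∀ j, (j < N₁ ∨ N₂ < j) →
      ‖f.coe j‖ * ρ₁ ^ j ≤ θ * (‖f.coe N₁‖ * ρ₁ ^ N₁) ∧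
      ‖f.coe j‖ * ρ₂ ^ j ≤ θ * (‖f.coe N₂‖ * ρ₂ ^ N₂) := by
  have h2 : 0 < ρ₂ := h0.trans_le h12
  set F1 := ‖f.coe N₁‖ * ρ₁ ^ N₁ with hF1
  set F2 := ‖f.coe N₂‖ * ρ₂ ^ N₂ with hF2
  have p1 : 0 < F1 := mul_pos (norm_pos_iff.2 D.ne₁) (by positivity)
  have p2 : 0 < F2 := mul_pos (norm_pos_iff.2 D.ne₂) (by positivity)
  obtain ⟨c, c0, c1, hc⟩ := exists_lt_of_tendsto
    (f.conv (show ρ₁ ∈ Set.Icc ρ₁ ρ₂ from ⟨le_rfl, h12⟩)) p1 {j | j < N₁} D.lt₁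
  obtain ⟨d, d0, d1, hd⟩ := exists_lt_of_tendsto
    (f.conv (show ρ₂ ∈ Set.Icc ρ₁ ρ₂ from ⟨h12, le_rfl⟩)) p2 {j | N₂ < j} D.lt₂
  have h1 : 1 ≤ ρ₂ / ρ₁ := (one_le_div h0).2 h12
  refine ⟨max (c / F1) (d / F2), lt_max_of_lt_left (by positivity),
    max_lt ((div_lt_one p1).2 c1) ((div_lt_one p2).2 d1), ?_⟩
  rintro j (hj | hj)
  · have e1 : ‖f.coe j‖ * ρ₁ ^ j ≤ max (c / F1) (d / F2) * F1 := by
      refine (hc j hj).trans ?_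
      rw [← div_le_iff₀ p1]
      exact le_max_left _ _
    refine ⟨e1, ?_⟩
    rw [zpow_div_mul h0 h2]
    calc _ ≤ (max (c / F1) (d / F2) * F1) * (ρ₂ / ρ₁) ^ N₁ := by
          gcongr
      _ = max (c / F1) (d / F2) * (‖f.coe N₁‖ * ρ₂ ^ N₁) := by
          rw [zpow_div_mul h0 h2, hF1]; ring
      _ ≤ _ := by
          gcongr
          exact D.le₂ _
  · have e1 : ‖f.coe j‖ * ρ₂ ^ j ≤ max (c / F1) (d / F2) * F2 := by
      refine (hd j hj).trans ?_
      rw [← div_le_iff₀ p2]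
      exact le_max_right _ _
    refine ⟨?_, e1⟩
    have h1' : 0 < ρ₂ / ρ₁ := by positivity
    rw [zpow_div_mul h2 h0, ← inv_div, inv_zpow']
    calc _ ≤ (max (c / F1) (d / F2) * F2) * (ρ₂ / ρ₁) ^ (-N₂) := by
          gcongr
      _ = max (c / F1) (d / F2) * (‖f.coe N₂‖ * ρ₁ ^ N₂) := by
          rw [zpow_div_mul h2 h0, ← inv_div ρ₂, inv_zpow', hF2]; ring
      _ ≤ _ := by
          gcongr
          exact D.le₁ _

/-- The hypotheses and notation for the division algorithm. -/
structure DivData (f : LaurRing F (icc h0 h12)) (N₁ N₂ : ℤ) (θ : ℝ) : Prop where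
  dom : Dominant ρ₁ ρ₂ f.coe N₁ N₂
  pos : 0 < θ
  lt_one : θ < 1
  ratio : ∀ j, (j < N₁ ∨ N₂ < j) →
    ‖f.coe j‖ * ρ₁ ^ j ≤ θ * (‖f.coe N₁‖ * ρ₁ ^ N₁) ∧
    ‖f.coe j‖ * ρ₂ ^ j ≤ θ * (‖f.coe N₂‖ * ρ₂ ^ N₂)

/-- The weight of `T ^ k` in dividends and remainders. -/
def wt (ρ₁ ρ₂ : ℝ) (f : ℤ → F) (N₁ N₂ : ℤ) (k : ℤ) : ℝ :=
  max (ρ₁ ^ k / (‖f N₁‖ * ρ₁ ^ N₁)) (ρ₂ ^ k / (‖f N₂‖ * ρ₂ ^ N₂))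

/-- `g` is congruent modulo `f` to a series with exponents in `[N₁, N₂)`, up to a small error. -/
def Reduces (f : LaurRing F (icc h0 h12)) (N₁ N₂ : ℤ) (θ c : ℝ) (g : LaurRing F (icc h0 h12)) :
    Prop :=
  ∃ q s e : LaurRing F (icc h0 h12), g = f * q + s + e ∧
    (∀ j, ‖q.coe j‖ * max (ρ₁ ^ j) (ρ₂ ^ j) ≤ c) ∧
    (∀ j, (j < N₁ ∨ N₂ ≤ j) → s.coe j = 0) ∧
    (∀ j, ‖s.coe j‖ * wt ρ₁ ρ₂ f.coe N₁ N₂ j ≤ c) ∧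
    (∀ j, ‖e.coe j‖ * wt ρ₁ ρ₂ f.coe N₁ N₂ j ≤ θ * c)

variable {f : LaurRing F (icc h0 h12)} {N₁ N₂ : ℤ} {θ : ℝ}

theorem wt_pos (D : DivData f N₁ N₂ θ) (k : ℤ) : 0 < wt ρ₁ ρ₂ f.coe N₁ N₂ k :=
  lt_max_of_lt_left (div_pos (by positivity)
    (mul_pos (norm_pos_iff.2 D.dom.ne₁) (by positivity)))

theorem norm_add_mul_le {x y : F} {v c : ℝ} (hv : 0 ≤ v) (hx : ‖x‖ * v ≤ c) (hy : ‖y‖ * v ≤ c) :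
    ‖x + y‖ * v ≤ c := by
  rcases le_total ‖x‖ ‖y‖ with h | h
  · refine (mul_le_mul_of_nonneg_right ((IsUltrametricDist.norm_add_le_max _ _).trans ?_) hv).trans hy
    exact max_le h le_rfl
  · refine (mul_le_mul_of_nonneg_right ((IsUltrametricDist.norm_add_le_max _ _).trans ?_) hv).trans hx
    exact max_le le_rfl h

theorem Reduces.add (D : DivData f N₁ N₂ θ) {c : ℝ} {g g' : LaurRing F (icc h0 h12)}
    (h : Reduces f N₁ N₂ θ c g) (h' : Reduces f N₁ N₂ θ c g') : Reduces f N₁ N₂ θ c (g + g') := by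
  obtain ⟨q, s, e, h1, h2, h3, h4, h5⟩ := h
  obtain ⟨q', s', e', h1', h2', h3', h4', h5'⟩ := h'
  have hw := fun j => (wt_pos D j).le
  refine ⟨q + q', s + s', e + e', by rw [h1, h1']; ring, fun j => ?_, fun j hj => ?_, fun j => ?_,
    fun j => ?_⟩
  · exact norm_add_mul_le (le_max_of_le_left (by positivity)) (h2 j) (h2' j)
  · rw [LaurRing.coe_add, Pi.add_apply, h3 j hj, h3' j hj, add_zero]
  · exact norm_add_mul_le (hw j) (h4 j) (h4' j)
  · exact norm_add_mul_le (hw j) (h5 j) (h5' j)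

theorem Reduces.single_mul (D : DivData f N₁ N₂ θ) {c c' : ℝ} {g : LaurRing F (icc h0 h12)}
    (h : Reduces f N₁ N₂ θ c g) (a : F) (hc : ‖a‖ * c ≤ c') :
    Reduces f N₁ N₂ θ c' (LaurRing.single _ 0 a * g) := by
  obtain ⟨q, s, e, h1, h2, h3, h4, h5⟩ := h
  have key : ∀ (x : F) (v d : ℝ), ‖x‖ * v ≤ d → ‖a * x‖ * v ≤ ‖a‖ * d := by
    intro x v d hx
    rw [norm_mul, mul_assoc]
    exact mul_le_mul_of_nonneg_left hx (norm_nonneg _)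
  refine ⟨LaurRing.single _ 0 a * q, LaurRing.single _ 0 a * s, LaurRing.single _ 0 a * e,
    by rw [h1]; ring, fun j => ?_, fun j hj => ?_, fun j => ?_, fun j => ?_⟩ <;>
    rw [LaurRing.single_mul_coe, sub_zero]
  · exact (key _ _ _ (h2 j)).trans hc
  · rw [h3 j hj, mul_zero]
  · exact (key _ _ _ (h4 j)).trans hc
  · refine (key _ _ _ (h5 j)).trans ?_
    rw [mul_left_comm]
    exact mul_le_mul_of_nonneg_left hc D.pos.le

theorem Reduces.of_small {c : ℝ} (hc : 0 ≤ c) {e : LaurRing F (icc h0 h12)}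
    (h : ∀ j, ‖e.coe j‖ * wt ρ₁ ρ₂ f.coe N₁ N₂ j ≤ θ * c) : Reduces f N₁ N₂ θ c e := by
  refine ⟨0, 0, e, by ring, fun j => ?_, fun j _ => rfl, fun j => ?_, h⟩ <;>
  simp [LaurRing.coe_zero, hc]

theorem Reduces.sum (D : DivData f N₁ N₂ θ) {c : ℝ} (hc : 0 ≤ c) {ι : Type*} (t : Finset ι)
    (g : ι → LaurRing F (icc h0 h12)) (h : ∀ i ∈ t, Reduces f N₁ N₂ θ c (g i)) :
    Reduces f N₁ N₂ θ c (∑ i ∈ t, g i) := by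
  classical
  induction t using Finset.induction_on with
  | empty =>
    rw [Finset.sum_empty]
    exact Reduces.of_small hc (by simpa [LaurRing.coe_zero] using mul_nonneg D.pos.le hc)
  | insert a t ha ih =>
    rw [Finset.sum_insert ha]
    exact Reduces.add D (h a (Finset.mem_insert_self _ _))
      (ih fun i hi => h i (Finset.mem_insert_of_mem hi))

theorem wt_shift_le (D : DivData f N₁ N₂ θ) (x : F) (a j : ℤ) {κ : ℝ}
    (h1 : ‖f.coe j‖ * ρ₁ ^ j ≤ κ * (‖f.coe N₁‖ * ρ₁ ^ N₁))
    (h2 : ‖f.coe j‖ * ρ₂ ^ j ≤ κ * (‖f.coe N₂‖ * ρ₂ ^ N₂)) :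
    ‖x * f.coe j‖ * wt ρ₁ ρ₂ f.coe N₁ N₂ (a + j) ≤ κ * (‖x‖ * max (ρ₁ ^ a) (ρ₂ ^ a)) := by
  have hρ2 : 0 < ρ₂ := h0.trans_le h12
  have p1 : 0 < ‖f.coe N₁‖ * ρ₁ ^ N₁ := mul_pos (norm_pos_iff.2 D.dom.ne₁) (by positivity)
  have p2 : 0 < ‖f.coe N₂‖ * ρ₂ ^ N₂ := mul_pos (norm_pos_iff.2 D.dom.ne₂) (by positivity)
  have hκ : 0 ≤ κ := nonneg_of_mul_nonneg_left (le_trans (by positivity) h1) p1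
  unfold wt
  rw [mul_max_of_nonneg _ _ (norm_nonneg _), norm_mul]
  refine max_le ?_ ?_
  · rw [← mul_div_assoc, div_le_iff₀ p1, zpow_add₀ h0.ne']
    calc _ = (‖x‖ * ρ₁ ^ a) * (‖f.coe j‖ * ρ₁ ^ j) := by ring
      _ ≤ (‖x‖ * max (ρ₁ ^ a) (ρ₂ ^ a)) * (κ * (‖f.coe N₁‖ * ρ₁ ^ N₁)) := by
          gcongr
          exact le_max_left _ _
      _ = _ := by ring
  · rw [← mul_div_assoc, div_le_iff₀ p2, zpow_add₀ hρ2.ne']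
    calc _ = (‖x‖ * ρ₂ ^ a) * (‖f.coe j‖ * ρ₂ ^ j) := by ring
      _ ≤ (‖x‖ * max (ρ₁ ^ a) (ρ₂ ^ a)) * (κ * (‖f.coe N₂‖ * ρ₂ ^ N₂)) := by
          gcongr
          exact le_max_right _ _
      _ = _ := by ring

/-- One reduction step for the monomial `T ^ (a + M)`, with `M = N₁` or `M = N₂`. -/
theorem reduces_single_step (D : DivData f N₁ N₂ θ) (a M : ℤ) (hM : f.coe M ≠ 0)
    (hMN : N₁ ≤ M ∧ M ≤ N₂)
    (hw : ‖(f.coe M)⁻¹‖ * max (ρ₁ ^ a) (ρ₂ ^ a) ≤ wt ρ₁ ρ₂ f.coe N₁ N₂ (a + M))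
    (ih : ∀ j ∈ (Finset.Icc N₁ N₂).erase M,
      Reduces f N₁ N₂ θ (wt ρ₁ ρ₂ f.coe N₁ N₂ (a + j)) (LaurRing.single _ (a + j) 1)) :
    Reduces f N₁ N₂ θ (wt ρ₁ ρ₂ f.coe N₁ N₂ (a + M)) (LaurRing.single _ (a + M) 1) := by
  set w := wt ρ₁ ρ₂ f.coe N₁ N₂ with hwdef
  set x := (f.coe M)⁻¹ with hx
  set sm : LaurRing F (icc h0 h12) := ∑ j ∈ (Finset.Icc N₁ N₂).erase M,
    LaurRing.single _ 0 (-(x * f.coe j)) * LaurRing.single _ (a + j) 1 with hsm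
  set e : LaurRing F (icc h0 h12) :=
    LaurRing.single _ (a + M) 1 - f * LaurRing.single _ a x - sm with he
  have hw0 : ∀ k, 0 < w k := wt_pos D
  have hsmc : ∀ i, sm.coe (a + i) = if i ∈ (Finset.Icc N₁ N₂).erase M then -(x * f.coe i) else 0 := by
    intro i
    rw [hsm, LaurRing.coe_sum]
    rw [← Finset.sum_ite_eq (a := i) (b := fun i => -(x * f.coe i))]
    refine Finset.sum_congr rfl fun j _ => ?_
    rw [LaurRing.single_mul_coe, LaurRing.coe_single, sub_zero]
    by_cases hij : i = j
    · subst hij; simp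
    · rw [Pi.single_eq_of_ne (by omega), mul_zero, if_neg hij]
  have hec : ∀ i, e.coe (a + i) = if i < N₁ ∨ N₂ < i then -(x * f.coe i) else 0 := by
    intro i
    rw [he, LaurRing.coe_sub, LaurRing.coe_sub, Pi.sub_apply, Pi.sub_apply, hsmc, mul_comm f,
      LaurRing.single_mul_coe, LaurRing.coe_single, add_sub_cancel_left]
    by_cases hi : i = M
    · subst hi
      rw [Pi.single_eq_same, hx, inv_mul_cancel₀ hM, if_neg (by simp), if_neg (by omega)]
      ring
    · rw [Pi.single_eq_of_ne (by omega)]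
      simp only [Finset.mem_erase, Finset.mem_Icc]
      by_cases h3 : N₁ ≤ i ∧ i ≤ N₂
      · rw [if_pos ⟨hi, h3⟩, if_neg (by omega)]
        ring
      · rw [if_neg (by tauto), if_pos (by omega)]
        ring
  have hx0 : 0 ≤ ‖x‖ * max (ρ₁ ^ a) (ρ₂ ^ a) :=
    mul_nonneg (norm_nonneg _) (le_max_of_le_left (by positivity))
  have hsum : LaurRing.single _ (a + M) 1 = f * LaurRing.single _ a x + (sm + e) := by
    rw [he]; ring
  rw [hsum]
  refine Reduces.add D ⟨LaurRing.single _ a x, 0, 0, by ring, fun j => ?_, fun _ _ => rfl, ?_, ?_⟩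
    (Reduces.add D ?_ ?_)
  · rw [LaurRing.coe_single]
    by_cases hj : j = a
    · subst hj
      rwa [Pi.single_eq_same]
    · rw [Pi.single_eq_of_ne hj, norm_zero, zero_mul]
      exact (hw0 _).le
  · intro j
    rw [LaurRing.coe_zero, Pi.zero_apply, norm_zero, zero_mul]
    exact (hw0 _).le
  · intro j
    rw [LaurRing.coe_zero, Pi.zero_apply, norm_zero, zero_mul]
    exact mul_nonneg D.pos.le (hw0 _).le
  · refine Reduces.sum D (hw0 _).le _ _ fun j hj => ?_
    refine Reduces.single_mul D (ih j hj) _ ?_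
    rw [norm_neg]
    refine (wt_shift_le D x a j (κ := 1) ?_ ?_).trans ?_
    · rw [one_mul]; exact D.dom.le₁ j
    · rw [one_mul]; exact D.dom.le₂ j
    · rw [one_mul]; exact hw
  · refine Reduces.of_small (hw0 _).le fun j => ?_
    obtain ⟨i, rfl⟩ : ∃ i, j = a + i := ⟨j - a, by ring⟩
    rw [hec]
    split_ifs with hi
    · rw [norm_neg]
      refine (wt_shift_le D x a i (D.ratio i hi).1 (D.ratio i hi).2).trans ?_
      exact mul_le_mul_of_nonneg_left hw D.pos.le
    · rw [norm_zero, zero_mul]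
      exact mul_nonneg D.pos.le (hw0 _).le

theorem reduces_single (D : DivData f N₁ N₂ θ) (k : ℤ) :
    Reduces f N₁ N₂ θ (wt ρ₁ ρ₂ f.coe N₁ N₂ k) (LaurRing.single _ k 1) := by
  have hρ2 : 0 < ρ₂ := h0.trans_le h12
  have hN := D.dom.le h0 h12
  have hmid : ∀ k, N₁ ≤ k → k < N₂ →
      Reduces f N₁ N₂ θ (wt ρ₁ ρ₂ f.coe N₁ N₂ k) (LaurRing.single _ k 1) := by
    intro k h1 h2
    have hw0 := fun j => (wt_pos D j).le
    refine ⟨0, LaurRing.single _ k 1, 0, by ring, fun j => ?_, fun j hj => ?_, fun j => ?_,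
      fun j => ?_⟩
    · simpa [LaurRing.coe_zero] using hw0 k
    · rw [LaurRing.coe_single, Pi.single_eq_of_ne (by omega)]
    · rw [LaurRing.coe_single]
      by_cases hj : j = k
      · subst hj; simp
      · rw [Pi.single_eq_of_ne hj, norm_zero, zero_mul]
        exact hw0 k
    · simpa [LaurRing.coe_zero] using mul_nonneg D.pos.le (hw0 k)
  rcases lt_or_ge k N₁ with hk | hk
  · obtain ⟨n, hn⟩ : ∃ n : ℕ, k = N₁ - 1 - n := ⟨(N₁ - 1 - k).toNat, by omega⟩
    induction n using Nat.strong_induction_on generalizing k with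
    | _ n ih =>
      have hk' : k = (k - N₁) + N₁ := by ring
      rw [hk']
      refine reduces_single_step D _ N₁ D.dom.ne₁ ⟨le_rfl, hN⟩ ?_ ?_
      · refine le_trans ?_ (le_max_left _ _)
        rw [max_eq_left (zpow_le_zpow_left_of_nonpos (by omega) h0 h12), norm_inv,
          zpow_add₀ h0.ne']
        have := (zpow_pos h0 N₁).ne'
        have := norm_ne_zero_iff.2 D.dom.ne₁
        apply le_of_eq
        field_simp
      · intro j hj
        rw [Finset.mem_erase, Finset.mem_Icc] at hj
        rcases lt_or_ge (k - N₁ + j) N₁ with h | h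
        · exact ih (N₁ - 1 - (k - N₁ + j)).toNat (by omega) _ h (by omega)
        · exact hmid _ h (by omega)
  · rcases lt_or_ge k N₂ with hk2 | hk2
    · exact hmid k hk hk2
    · obtain ⟨n, hn⟩ : ∃ n : ℕ, k = N₂ + n := ⟨(k - N₂).toNat, by omega⟩
      induction n using Nat.strong_induction_on generalizing k with
      | _ n ih =>
        have hk' : k = (k - N₂) + N₂ := by ring
        rw [hk']
        refine reduces_single_step D _ N₂ D.dom.ne₂ ⟨hN, le_rfl⟩ ?_ ?_
        · refine le_trans ?_ (le_max_right _ _)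
          rw [max_eq_right (zpow_le_zpow_left₀ (by omega) h0.le h12), norm_inv,
            zpow_add₀ hρ2.ne']
          have := (zpow_pos hρ2 N₂).ne'
          have := norm_ne_zero_iff.2 D.dom.ne₂
          apply le_of_eq
          field_simp
        · intro j hj
          rw [Finset.mem_erase, Finset.mem_Icc] at hj
          rcases lt_or_ge (k - N₂ + j) N₂ with h | h
          · exact hmid _ (by omega) h
          · exact ih (k - N₂ + j - N₂).toNat (by omega) _ (by omega) h (by omega)

theorem tendsto_wt (g : LaurRing F (icc h0 h12)) :
    Tendsto (fun j => ‖g.coe j‖ * wt ρ₁ ρ₂ f.coe N₁ N₂ j) cofinite (𝓝 0) := by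
  have hρ2 : 0 < ρ₂ := h0.trans_le h12
  have e1 := (g.conv (show ρ₁ ∈ Set.Icc ρ₁ ρ₂ from ⟨le_rfl, h12⟩)).div_const
    (‖f.coe N₁‖ * ρ₁ ^ N₁)
  have e2 := (g.conv (show ρ₂ ∈ Set.Icc ρ₁ ρ₂ from ⟨h12, le_rfl⟩)).div_const
    (‖f.coe N₂‖ * ρ₂ ^ N₂)
  have e3 := e1.max e2
  simp only [zero_div, max_self] at e3
  refine e3.congr fun j => ?_
  rw [wt, mul_max_of_nonneg _ _ (norm_nonneg _), mul_div_assoc, mul_div_assoc]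

theorem reduces_of_le (D : DivData f N₁ N₂ θ) {c : ℝ} (hc : 0 < c) (g : LaurRing F (icc h0 h12))
    (hg : ∀ j, ‖g.coe j‖ * wt ρ₁ ρ₂ f.coe N₁ N₂ j ≤ c) : Reduces f N₁ N₂ θ c g := by
  have hfin : {j | ¬ ‖g.coe j‖ * wt ρ₁ ρ₂ f.coe N₁ N₂ j < θ * c}.Finite :=
    (tendsto_wt g).eventually (eventually_lt_nhds (mul_pos D.pos hc))
  set t := hfin.toFinset with ht
  set sm : LaurRing F (icc h0 h12) :=
    ∑ j ∈ t, LaurRing.single _ 0 (g.coe j) * LaurRing.single _ j 1 with hsm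
  have hsmc : ∀ i, sm.coe i = if i ∈ t then g.coe i else 0 := by
    intro i
    rw [hsm, LaurRing.coe_sum, ← Finset.sum_ite_eq (a := i) (b := g.coe)]
    refine Finset.sum_congr rfl fun j _ => ?_
    rw [LaurRing.single_mul_coe, LaurRing.coe_single, sub_zero]
    by_cases hij : i = j
    · subst hij; simp
    · rw [Pi.single_eq_of_ne hij, mul_zero, if_neg hij]
  rw [show g = sm + (g - sm) by ring]
  refine Reduces.add D (Reduces.sum D hc.le _ _ fun j _ =>
    Reduces.single_mul D (reduces_single D j) _ (hg j)) (Reduces.of_small hc.le fun j => ?_)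
  rw [LaurRing.coe_sub, Pi.sub_apply, hsmc]
  split_ifs with hj
  · rw [sub_self, norm_zero, zero_mul]
    exact (mul_pos D.pos hc).le
  · rw [ht, Set.Finite.mem_toFinset, Set.mem_ofPred_eq, not_not] at hj
    rw [sub_zero]
    exact hj.le

/-- Weierstrass division. -/
theorem weierstrass_division (f : LaurRing F (icc h0 h12)) (dom : Dominant ρ₁ ρ₂ f.coe N₁ N₂)
    (g : LaurRing F (icc h0 h12)) :
    ∃ q s : LaurRing F (icc h0 h12), g = f * q + s ∧ ∀ j, (j < N₁ ∨ N₂ ≤ j) → s.coe j = 0 := by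
  have hρ2 : 0 < ρ₂ := h0.trans_le h12
  obtain ⟨θ, hθ0, hθ1, hθ⟩ := dom.exists_ratio
  have D : DivData f N₁ N₂ θ := ⟨dom, hθ0, hθ1, hθ⟩
  set w := wt ρ₁ ρ₂ f.coe N₁ N₂ with hw
  have hw0 : ∀ k, 0 < w k := wt_pos D
  obtain ⟨c, hc, hgc⟩ : ∃ c, 0 < c ∧ ∀ j, ‖g.coe j‖ * w j ≤ c := by
    obtain ⟨c, hc, h⟩ := tendsto_bdd (tendsto_wt (N₁ := N₁) (N₂ := N₂) (f := f) g)
    exact ⟨c + 1, by positivity, fun j => (le_abs_self _).trans ((h j).trans (by linarith))⟩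
  have hstep : ∀ (n : ℕ) (g : LaurRing F (icc h0 h12)), (∀ j, ‖g.coe j‖ * w j ≤ θ ^ n * c) →
      Reduces f N₁ N₂ θ (θ ^ n * c) g :=
    fun n g hg => reduces_of_le D (by positivity) g hg
  choose! Q S E hE using hstep
  let G : ℕ → LaurRing F (icc h0 h12) := fun n => Nat.rec g (fun n g => E n g) n
  have hG : ∀ n j, ‖(G n).coe j‖ * w j ≤ θ ^ n * c := by
    intro n
    induction n with
    | zero =>
      rw [pow_zero, one_mul]
      exact hgc
    | succ n ih =>
      intro j
      refine ((hE n (G n) ih).2.2.2.2 j).trans (le_of_eq ?_)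
      ring
  let q : ℕ → LaurRing F (icc h0 h12) := fun n => Q n (G n)
  let s : ℕ → LaurRing F (icc h0 h12) := fun n => S n (G n)
  have hrec : ∀ n, G n = f * q n + s n + G (n + 1) := fun n => (hE n (G n) (hG n)).1
  have hq : ∀ n j, ‖(q n).coe j‖ * max (ρ₁ ^ j) (ρ₂ ^ j) ≤ θ ^ n * c :=
    fun n => (hE n (G n) (hG n)).2.1
  have hs0 : ∀ n j, (j < N₁ ∨ N₂ ≤ j) → (s n).coe j = 0 := fun n => (hE n (G n) (hG n)).2.2.1
  have hs : ∀ n j, ‖(s n).coe j‖ * w j ≤ θ ^ n * c := fun n => (hE n (G n) (hG n)).2.2.2.1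
  have hθc : Tendsto (fun n => θ ^ n * c) cofinite (𝓝 0) := by
    rw [Nat.cofinite_eq_atTop]
    simpa using (tendsto_pow_atTop_nhds_zero_of_lt_one hθ0.le hθ1).mul_const c
  have hvρ : ∀ ρ ∈ Set.Icc ρ₁ ρ₂, ∀ j : ℤ, ρ ^ j ≤ max (ρ₁ ^ j) (ρ₂ ^ j) := by
    intro ρ hρ j
    rcases le_or_gt 0 j with hj | hj
    · exact le_max_of_le_right (zpow_le_zpow_left₀ hj (h0.trans_le hρ.1).le hρ.2)
    · exact le_max_of_le_left (zpow_le_zpow_left_of_nonpos hj.le h0 hρ.1)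
  have hQ := fun ρ (hρ : ρ ∈ Set.Icc ρ₁ ρ₂) => convAt_tsum (a := fun n j => (q n).coe j)
    (h0.trans_le hρ.1) (tendsto_cofinite_prod
      (fun x => by have := h0.trans_le hρ.1; positivity) (fun i => (q i).conv hρ)
      (Eventually.of_forall fun i j =>
        (mul_le_mul_of_nonneg_left (hvρ ρ hρ j) (norm_nonneg _)).trans (hq i j)) hθc)
  have hsums : ∀ j, Summable fun n => (s n).coe j := by
    intro j
    refine NonarchimedeanAddGroup.summable_of_tendsto_cofinite_zero
      (tendsto_of_mul_const (c := w j) (hw0 j) ?_)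
    exact squeeze_zero (fun i => mul_nonneg (norm_nonneg _) (hw0 j).le) (fun i => hs i j) hθc
  have hsumq : ∀ j, Summable fun n => (q n).coe j :=
    fun j => (hQ ρ₁ ⟨le_rfl, h12⟩).1 j
  have hS0 : ∀ j, (j < N₁ ∨ N₂ ≤ j) → ∑' n, (s n).coe j = 0 := by
    intro j hj
    simp [hs0 _ j hj]
  have hSfin : (Function.support fun j => ∑' n, (s n).coe j).Finite := by
    refine (Set.finite_Ico N₁ N₂).subset fun j hj => ?_
    by_contra hcon
    rw [Set.mem_Ico, not_and_or, not_le, not_lt] at hcon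
    exact hj (hS0 j hcon)
  set q' : LaurRing F (icc h0 h12) :=
    LaurRing.of (fun j => ∑' n, (q n).coe j) fun ρ hρ => (hQ ρ hρ).2 with hq'
  set s' : LaurRing F (icc h0 h12) :=
    LaurRing.of (fun j => ∑' n, (s n).coe j) (fun ρ _ => by
      refine tendsto_nhds_of_eventually_eq ?_
      filter_upwards [hSfin.compl_mem_cofinite] with j hj
      rw [Function.notMem_support.1 hj, norm_zero, zero_mul]) with hs'
  refine ⟨q', s', ?_, hS0⟩
  have htail : ∀ (a : ℕ → LaurRing F (icc h0 h12)) (A : LaurRing F (icc h0 h12)) (v : ℤ → ℝ),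
      (∀ j, 0 < v j) → (∀ n j, ‖(a n).coe j‖ * v j ≤ θ ^ n * c) →
      (∀ j, Summable fun n => (a n).coe j) → (∀ j, A.coe j = ∑' n, (a n).coe j) →
      ∀ m j, ‖(A - ∑ n ∈ Finset.range m, a n).coe j‖ * v j ≤ θ ^ m * c := by
    intro a A v hv ha hsum hA m j
    rw [LaurRing.coe_sub, Pi.sub_apply, LaurRing.coe_sum, hA,
      ← (hsum j).sum_add_tsum_nat_add m, add_sub_cancel_left, ← le_div_iff₀ (hv j)]
    refine IsUltrametricDist.norm_tsum_le_of_forall_le_of_nonneg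
      (div_nonneg (by positivity) (hv j).le) fun n => ?_
    rw [le_div_iff₀ (hv j)]
    refine (ha _ _).trans ?_
    gcongr ?_ * c
    exact pow_le_pow_of_le_one hθ0.le hθ1.le (by omega)
  have hv0 : ∀ j : ℤ, 0 < max (ρ₁ ^ j) (ρ₂ ^ j) := fun j => lt_max_of_lt_left (by positivity)
  have tq := htail q q' _ hv0 hq hsumq (fun _ => rfl)
  have ts := htail s s' _ hw0 hs hsums (fun _ => rfl)
  have hpart : ∀ m, g = f * ∑ n ∈ Finset.range m, q n + ∑ n ∈ Finset.range m, s n + G m := by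
    intro m
    induction m with
    | zero => simp [G]
    | succ m ih =>
      rw [Finset.sum_range_succ, Finset.sum_range_succ]
      conv_lhs => rw [ih, hrec m]
      ring
  have p1 : 0 < ‖f.coe N₁‖ * ρ₁ ^ N₁ := mul_pos (norm_pos_iff.2 D.dom.ne₁) (by positivity)
  have p2 : 0 < ‖f.coe N₂‖ * ρ₂ ^ N₂ := mul_pos (norm_pos_iff.2 D.dom.ne₂) (by positivity)
  have hfmul : ∀ (a : LaurRing F (icc h0 h12)) (B : ℝ), 0 ≤ B →
      (∀ j, ‖a.coe j‖ * max (ρ₁ ^ j) (ρ₂ ^ j) ≤ B) → ∀ j, ‖(f * a).coe j‖ * w j ≤ B := by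
    intro a B hB ha j
    rw [hw, wt, mul_max_of_nonneg _ _ (norm_nonneg _), ← mul_div_assoc, ← mul_div_assoc]
    refine max_le ((div_le_iff₀ p1).2 ?_) ((div_le_iff₀ p2).2 ?_)
    · rw [mul_comm B]
      exact norm_lmul_le h0 p1.le hB dom.le₁ (fun k =>
        (mul_le_mul_of_nonneg_left (le_max_left _ _) (norm_nonneg _)).trans (ha k)) j
    · rw [mul_comm B]
      exact norm_lmul_le hρ2 p2.le hB dom.le₂ (fun k =>
        (mul_le_mul_of_nonneg_left (le_max_right _ _) (norm_nonneg _)).trans (ha k)) j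
  ext j
  have hbound : ∀ m, ‖(g - (f * q' + s')).coe j‖ * w j ≤ θ ^ m * c := by
    intro m
    have e : g - (f * q' + s') = G m + (-(f * (q' - ∑ n ∈ Finset.range m, q n)) +
        -(s' - ∑ n ∈ Finset.range m, s n)) := by
      conv_lhs => rw [hpart m]
      ring
    rw [e]
    refine norm_add_mul_le (hw0 j).le (hG m j) (norm_add_mul_le (hw0 j).le ?_ ?_)
    · change ‖-((f * (q' - ∑ n ∈ Finset.range m, q n)).coe j)‖ * w j ≤ _
      rw [norm_neg]
      exact hfmul _ _ (by positivity) (tq m) j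
    · change ‖-((s' - ∑ n ∈ Finset.range m, s n).coe j)‖ * w j ≤ _
      rw [norm_neg]
      exact ts m j
  have hlim : Tendsto (fun n => θ ^ n * c) atTop (𝓝 0) := by rwa [← Nat.cofinite_eq_atTop]
  have h1 : ‖(g - (f * q' + s')).coe j‖ * w j ≤ 0 := ge_of_tendsto' hlim hbound
  have h2 : ‖(g - (f * q' + s')).coe j‖ ≤ 0 := by
    by_contra hcon
    exact absurd h1 (not_le.2 (mul_pos (not_le.1 hcon) (hw0 j)))
  rw [norm_le_zero_iff, LaurRing.coe_sub, Pi.sub_apply, sub_eq_zero] at h2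
  exact h2

/-- A series with a single dominant term is invertible. -/
theorem isUnit_of_dominant (f : LaurRing F (icc h0 h12)) {N : ℤ} (dom : Dominant ρ₁ ρ₂ f.coe N N) :
    IsUnit f := by
  obtain ⟨q, s, h, hs⟩ := weierstrass_division f dom 1
  have : s = 0 := LaurRing.ext (funext fun j => hs j (by omega))
  rw [this, add_zero] at h
  exact IsUnit.of_mul_eq_one _ h.symm

end Weierstrass

/-! ## The Robba ring: integrality, power series, descent along `φ` -/

section RobbaRing

variable {p : ℕ} [hp : Fact p.Prime]

theorem one_lt_p : (1 : ℝ) < p := by exact_mod_cast hp.1.one_lt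

theorem radius_lt_one {r : ℝ} (hr : 0 < r) : (p : ℝ) ^ (-1 / r) < 1 :=
  Real.rpow_lt_one_of_one_lt_of_neg one_lt_p (div_neg_of_neg_of_pos (by norm_num) hr)

instance : IsDomain (Robba p) := by
  have : Nontrivial (Robba p) := ⟨⟨0, 1, fun h => by
    have := congrFun (congrArg Robba.coe h) 0
    simp [Robba.coe_one, Robba.coe_zero] at this⟩⟩
  have : NoZeroDivisors (Robba p) := ⟨by
    intro f g h
    by_contra hcon
    push Not at hcon
    obtain ⟨ρ, hρ, hf, hg, -⟩ := f.conv₃ g 0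
    refine lmul_ne_zero hρ hf hg (fun h => hcon.1 (Robba.ext h))
      (fun h => hcon.2 (Robba.ext h)) ?_
    rw [← Robba.coe_mul, h, Robba.coe_zero]⟩
  exact NoZeroDivisors.to_isDomain _

theorem eventually_mem_RobbaR (f : Robba p) : ∀ᶠ r in atTop, f ∈ RobbaR p r := by
  obtain ⟨r, hr, hf⟩ := f.conv
  filter_upwards [eventually_ge_atTop r] with s hs using RobbaR_mono hr hs hf

/-- The restriction of an element of `R^r` to a set of radii. -/
def toLaur (r : ℝ) (S : Radii) (hS : ∀ ρ ∈ S.1, (p : ℝ) ^ (-1 / r) ≤ ρ ∧ ρ < 1) :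
    RobbaR p r →+* LaurRing ℚ_[p] S where
  toFun f := LaurRing.of (f : Robba p).coe fun ρ hρ => f.2 ρ (hS ρ hρ).1 (hS ρ hρ).2
  map_one' := rfl
  map_mul' _ _ := rfl
  map_zero' := rfl
  map_add' _ _ := rfl

theorem toLaur_coe (r : ℝ) (S : Radii) (hS : ∀ ρ ∈ S.1, (p : ℝ) ^ (-1 / r) ≤ ρ ∧ ρ < 1)
    (f : RobbaR p r) : (toLaur r S hS f).coe = (f : Robba p).coe := rfl

theorem toLaur_injective (r : ℝ) (S : Radii) (hS : ∀ ρ ∈ S.1, (p : ℝ) ^ (-1 / r) ≤ ρ ∧ ρ < 1) :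
    Function.Injective (toLaur (p := p) r S hS) := by
  intro f g h
  exact Subtype.ext (Robba.ext (congrArg LaurRing.coe h))

theorem icc_radius {r ρ₂ : ℝ} (h12 : (p : ℝ) ^ (-1 / r) ≤ ρ₂) (h2 : ρ₂ < 1) :
    ∀ ρ ∈ (icc (radius_pos p r) h12).1, (p : ℝ) ^ (-1 / r) ≤ ρ ∧ ρ < 1 :=
  fun _ hρ => ⟨hρ.1, hρ.2.trans_lt h2⟩

/-- Divisibility in `R^r` can be checked on closed annuli. -/
theorem dvd_of_dvd_laur {r : ℝ} (f g : RobbaR p r) (hg : g ≠ 0)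
    (H : ∀ ρ < 1, ∃ ρ₂, ρ ≤ ρ₂ ∧ ∃ (h12 : (p : ℝ) ^ (-1 / r) ≤ ρ₂) (h2 : ρ₂ < 1),
      toLaur r (icc (radius_pos p r) h12) (icc_radius h12 h2) g ∣
        toLaur r (icc (radius_pos p r) h12) (icc_radius h12 h2) f) : g ∣ f := by
  have key : ∀ ρ₂ ρ₂' (h12 : (p : ℝ) ^ (-1 / r) ≤ ρ₂) (h2 : ρ₂ < 1)
      (h12' : (p : ℝ) ^ (-1 / r) ≤ ρ₂') (h2' : ρ₂' < 1)
      (q : LaurRing ℚ_[p] (icc (radius_pos p r) h12))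
      (q' : LaurRing ℚ_[p] (icc (radius_pos p r) h12')),
      toLaur r _ (icc_radius h12 h2) f = toLaur r _ (icc_radius h12 h2) g * q →
      toLaur r _ (icc_radius h12' h2') f = toLaur r _ (icc_radius h12' h2') g * q' →
      q.coe = q'.coe := by
    intro ρ₂ ρ₂' h12 h2 h12' h2' q q' hq hq'
    set S := icc (radius_pos p r) (le_refl ((p : ℝ) ^ (-1 / r))) with hS
    have s1 : S.1 ⊆ (icc (radius_pos p r) h12).1 := fun ρ hρ => ⟨hρ.1, hρ.2.trans h12⟩
    have s2 : S.1 ⊆ (icc (radius_pos p r) h12').1 := fun ρ hρ => ⟨hρ.1, hρ.2.trans h12'⟩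
    have e1 := congrArg (LaurRing.res s1) hq
    have e2 := congrArg (LaurRing.res s2) hq'
    rw [map_mul] at e1 e2
    have e3 : LaurRing.res s1 (toLaur r _ (icc_radius h12 h2) g) * LaurRing.res s1 q =
        LaurRing.res s1 (toLaur r _ (icc_radius h12 h2) g) * LaurRing.res s2 q' := e1.symm.trans e2
    have hne : LaurRing.res s1 (toLaur r _ (icc_radius h12 h2) g) ≠ 0 := by
      intro h
      apply hg
      exact Subtype.ext (Robba.ext (congrArg LaurRing.coe h))
    exact congrArg LaurRing.coe (mul_left_cancel₀ hne e3)
  choose! R hR1 hR2 hR3 hR4 using H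
  choose q hq using hR4
  have h01 : (0 : ℝ) < 1 := one_pos
  have hmem : ∀ ρ, (p : ℝ) ^ (-1 / r) ≤ ρ → ρ < 1 → ConvAt ρ (q 0 h01).coe := by
    intro ρ h1 h2
    rw [key _ _ (hR2 0 h01) (hR3 0 h01) (hR2 ρ h2) (hR3 ρ h2) (q 0 h01) (q ρ h2) (hq 0 h01)
      (hq ρ h2)]
    exact (q ρ h2).conv ⟨h1, hR1 ρ h2⟩
  by_cases hr : 0 < r
  · refine ⟨⟨⟨(q 0 h01).coe, r, hr, hmem⟩, hmem⟩, Subtype.ext (Robba.ext ?_)⟩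
    exact congrArg LaurRing.coe (hq 0 h01)
  · exfalso
    have h1 := (hR2 0 h01).trans_lt (hR3 0 h01)
    rw [Real.rpow_lt_one_iff_of_pos (by linarith [one_lt_p (p := p)])] at h1
    rcases h1 with h1 | h1
    · have : 0 ≤ -1 / r := div_nonneg_of_nonpos (by norm_num) (not_lt.1 hr)
      linarith
    · linarith [one_lt_p (p := p)]

/-! ### Power series -/

/-- The element is a power series. -/
def IsPlus (f : Robba p) : Prop := ∀ j < 0, f.coe j = 0

theorem IsPlus.mem {f : Robba p} (hf : IsPlus f) (r : ℝ) : f ∈ RobbaR p r := by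
  intro ρ h1 h2
  have h0 : 0 < ρ := (radius_pos p r).trans_le h1
  obtain ⟨s, hs, hfs⟩ := f.conv
  have hc := hfs (max ρ ((p : ℝ) ^ (-1 / s))) (le_max_right _ _) (max_lt h2 (radius_lt_one hs))
  refine squeeze_zero (fun k => by positivity) (fun k => ?_) hc
  rcases lt_or_ge k 0 with hk | hk
  · simp [hf k hk]
  · exact mul_le_mul_of_nonneg_left (zpow_le_zpow_left₀ hk h0.le (le_max_left _ _)) (norm_nonneg _)

variable (p) in
/-- Constants. -/
def Robba.C : ℚ_[p] →+* Robba p where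
  toFun a := Robba.single 0 a
  map_one' := rfl
  map_mul' a b := by
    ext j
    rw [Robba.single_mul_coe, Robba.coe_single, Robba.coe_single]
    by_cases h : j = 0
    · subst h; simp
    · simp [Pi.single_eq_of_ne h]
  map_zero' := by ext j; simp [Robba.coe_single, Robba.coe_zero]
  map_add' a b := by
    ext j
    simp [Robba.coe_single, Robba.coe_add, Pi.single_add]

theorem Robba.single_mul_single (n m : ℤ) (a b : ℚ_[p]) :
    Robba.single n a * Robba.single m b = Robba.single (n + m) (a * b) := by
  ext k
  rw [Robba.coe_mul, Robba.coe_single, single_lmul, Robba.coe_single, Robba.coe_single]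
  by_cases h : k = n + m
  · subst h; simp
  · rw [Pi.single_eq_of_ne h, Pi.single_eq_of_ne (by omega), mul_zero]

theorem Robba.single_pow (k : ℕ) : (Robba.single 1 1 : Robba p) ^ k = Robba.single k 1 := by
  induction k with
  | zero => rfl
  | succ k ih => rw [pow_succ, ih, Robba.single_mul_single, mul_one, Nat.cast_succ]

variable (p) in
/-- Polynomials in `T`. -/
def polyR : Polynomial ℚ_[p] →+* Robba p :=
  Polynomial.eval₂RingHom (Robba.C p) (Robba.single 1 1)

theorem polyR_coe (P : Polynomial ℚ_[p]) : (polyR p P).coe = laur (P : ℚ_[p]⟦X⟧) 0 1 := by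
  induction P using Polynomial.induction_on' with
  | add P Q hP hQ =>
    rw [map_add, Robba.coe_add, hP, hQ]
    funext j
    simp only [Pi.add_apply, laur_zero_apply, Polynomial.coe_add, map_add]
    split_ifs <;> simp
  | monomial n a =>
    funext j
    rw [polyR, Polynomial.coe_eval₂RingHom, Polynomial.eval₂_monomial, Robba.single_pow]
    change (Robba.single 0 a * Robba.single n 1).coe j = _
    rw [Robba.single_mul_single, zero_add, mul_one, Robba.coe_single, laur_zero_apply,
      Polynomial.coeff_coe, Polynomial.coeff_monomial]
    by_cases hj : j = n
    · subst hj; simp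
    · rw [Pi.single_eq_of_ne hj]
      split_ifs with h1 h2
      · omega
      · rfl
      · rfl

theorem isPlus_of_laur {f : Robba p} {g : ℚ_[p]⟦X⟧} (h : f.coe = laur g 0 1) : IsPlus f := by
  intro j hj
  rw [h, laur_zero_apply, if_neg (by omega)]

theorem subCoeff_frob_one : subCoeff (frobUnit p) p (-1) 1 = laur ((1 + X) ^ p - 1) 0 1 := by
  funext j
  rw [laur_zero_apply]
  simp only [subCoeff, zpow_one, mul_one, laur, Units.val_neg, Units.val_one, frobUnit_coe,
    map_sub, coeff_one_add_X_pow', coeff_X_pow, coeff_one]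
  by_cases h0 : 0 ≤ j
  · obtain ⟨m, rfl⟩ := Int.eq_ofNat_of_zero_le h0
    by_cases hm : m ≤ p
    · have e1 : (-1 * ((m : ℤ) - p)) = ((p - m : ℕ) : ℤ) := by
        rw [Nat.cast_sub hm]; ring
      simp only [e1, Int.natCast_nonneg, if_true, Int.toNat_natCast, Nat.choose_symm hm]
      congr 1
      have := hp.1.pos
      by_cases hm0 : m = 0
      · simp [hm0]
      · rw [if_neg (by omega), if_neg hm0]
    · rw [if_neg (by omega), if_pos h0, Int.toNat_natCast, Nat.choose_eq_zero_of_lt (by omega),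
        if_neg (by omega)]
      simp
  · rw [if_neg h0, if_pos (by omega), Nat.choose_eq_zero_of_lt (by omega), if_neg (by omega)]
    simp

theorem frob_coe (f : Robba p) (j : ℤ) :
    (frob p f).coe j = ∑' k, f.coe k * subCoeff (frobUnit p) p (-1) k j := rfl

theorem IsPlus.frob {f : Robba p} (hf : IsPlus f) : IsPlus (frob p f) := by
  intro j hj
  rw [frob_coe]
  convert tsum_zero with k
  rcases lt_or_ge k 0 with hk | hk
  · rw [hf k hk, zero_mul]
  · obtain ⟨n, rfl⟩ := Int.eq_ofNat_of_zero_le hk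
    rw [subCoeff_natCast subCoeff_frob_one, laur_zero_apply, if_neg (by omega), mul_zero]

theorem frob_T : frob p (Robba.single 1 1) = polyR p ((1 + Polynomial.X) ^ p - 1) := by
  refine Robba.ext ?_
  rw [polyR_coe]
  funext j
  refine (lsub_single 1 1 j).trans ?_
  rw [one_mul, subCoeff_frob_one]
  simp

theorem polyR_C (a : ℚ_[p]) : polyR p (Polynomial.C a) = Robba.C p a := by
  rw [polyR, Polynomial.coe_eval₂RingHom, Polynomial.eval₂_C]

theorem polyR_X : polyR p Polynomial.X = Robba.single 1 1 := by
  rw [polyR, Polynomial.coe_eval₂RingHom, Polynomial.eval₂_X]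

theorem frob_one_add_T : frob p (1 + Robba.single 1 1) = (1 + Robba.single 1 1) ^ p := by
  rw [map_add, map_one, frob_T, map_sub, map_pow, map_add, map_one, polyR_X, add_sub_cancel]

/-! ### Descent along `φ` -/

/-- The part of a series with exponents in `s`. -/
def Robba.part (s : Set ℤ) (f : Robba p) : Robba p :=
  ⟨s.indicator f.coe, by
    obtain ⟨r, hr, hf⟩ := f.conv
    refine ⟨r, hr, fun ρ h1 h2 => ?_⟩
    have hρ : 0 < ρ := (radius_pos p r).trans_le h1
    refine squeeze_zero (fun k => by positivity) (fun k => ?_) (hf ρ h1 h2)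
    refine mul_le_mul_of_nonneg_right ?_ (by positivity)
    exact norm_indicator_le_norm_self _ _⟩

theorem Robba.part_coe (s : Set ℤ) (f : Robba p) : (f.part s).coe = s.indicator f.coe := rfl

theorem Robba.part_add_compl (s : Set ℤ) (f : Robba p) : f.part s + f.part sᶜ = f :=
  Robba.ext (Set.indicator_self_add_compl s f.coe)

theorem norm_subCoeff_frob_le (k : ℤ) (m : ℕ) :
    ‖subCoeff (frobUnit p) p (-1) k (p * k - m)‖ ≤ frobRadius p ^ m := by
  have h := subCoeff_apply (frobUnit p) p (-1) k m
  rw [show (p : ℤ) * k + ((-1 : ℤˣ) : ℤ) * m = p * k - m by push_cast; ring] at h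
  rw [h]
  have := Bd.zpow one_pos (radius_pos p _).le (frobUnit p) frobUnit_norm frobUnit_bd k m
  rwa [one_zpow, one_mul] at this

theorem subCoeff_frob_self (k : ℤ) : subCoeff (frobUnit p) p (-1) k (p * k) = 1 := by
  have h := subCoeff_apply (frobUnit p) p (-1) k 0
  rw [Nat.cast_zero, mul_zero, add_zero] at h
  rw [h, coeff_zero_eq_constantCoeff_apply]
  have h1 : constantCoeff (frobUnit p : ℚ_[p]⟦X⟧) = 1 := by
    simp [frobUnit_coe, zero_pow hp.1.ne_zero]
  have h2 : Units.map (constantCoeff (R := ℚ_[p])).toMonoidHom (frobUnit p ^ k) = 1 := by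
    rw [map_zpow, show Units.map (constantCoeff (R := ℚ_[p])).toMonoidHom (frobUnit p) = 1 from
      Units.ext h1, one_zpow]
  exact congrArg Units.val h2

theorem subCoeff_frob_eq_zero {k j : ℤ} (h : p * k < j) : subCoeff (frobUnit p) p (-1) k j = 0 := by
  simp only [subCoeff, laur]
  rw [if_neg]
  push_cast
  omega

/-- The terms of a series without positive exponents are bounded by those of its image by `φ`. -/
theorem tendsto_neg_of_frob {f : Robba p} (hf : ∀ j ≥ 0, f.coe j = 0) {ρ : ℝ} (hρ : 0 < ρ)
    (hM : frobRadius p < ρ) (hg : ConvAt ρ (frob p f).coe) : ConvAt (ρ ^ p) f.coe := by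
  set M := frobRadius p with hMdef
  have hM0 : 0 < M := radius_pos p _
  set θ := M / ρ with hθ
  have hθ0 : 0 < θ := by positivity
  have hθ1 : θ < 1 := (div_lt_one hρ).2 hM
  set g := (frob p f).coe with hgdef
  set a : ℕ → ℝ := fun K => ‖f.coe (-K)‖ * ρ ^ (-(p * K : ℤ)) with ha
  set b : ℕ → ℝ := fun K => ‖g (-(p * K : ℤ))‖ * ρ ^ (-(p * K : ℤ)) with hb
  have hp0 : (0 : ℤ) < p := by exact_mod_cast hp.1.pos
  have hbt : Tendsto b atTop (𝓝 0) := by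
    rw [← Nat.cofinite_eq_atTop]
    refine hg.comp (Function.Injective.tendsto_cofinite (f := fun K : ℕ => -(p * K : ℤ)) ?_)
    intro x y hxy
    have h1 : (p : ℤ) * x = p * y := by simpa using hxy
    exact_mod_cast mul_left_cancel₀ hp0.ne' h1
  have hrec : ∀ K : ℕ, f.coe (-K) = g (-(p * K : ℤ)) - ∑ i ∈ Finset.range K,
      f.coe (-i) * subCoeff (frobUnit p) p (-1) (-i) (-(p * K : ℤ)) := by
    intro K
    rw [eq_sub_iff_add_eq, hgdef, frob_coe, tsum_eq_sum (s := (Finset.range (K + 1)).image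
      fun i : ℕ => (-i : ℤ))]
    · rw [Finset.sum_image (fun x _ y _ hxy => by simpa using hxy), Finset.sum_range_succ, add_comm]
      congr 1
      rw [show (-(p * K : ℤ)) = p * (-K) by ring, subCoeff_frob_self, mul_one]
    · intro k hk
      rcases le_or_gt 0 k with hk0 | hk0
      · rw [hf k hk0, zero_mul]
      · rw [subCoeff_frob_eq_zero, mul_zero]
        have : k < -K := by
          by_contra hcon
          apply hk
          rw [Finset.mem_image]
          exact ⟨(-k).toNat, by rw [Finset.mem_range]; omega, by omega⟩
        rw [← mul_neg]
        exact mul_lt_mul_of_pos_left this hp0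
  have hterm : ∀ K i : ℕ, i < K →
      ‖f.coe (-i) * subCoeff (frobUnit p) p (-1) (-i) (-(p * K : ℤ))‖ * ρ ^ (-(p * K : ℤ)) ≤
        a i * θ ^ (K - i) := by
    intro K i hi
    have e1 : (-(p * K : ℤ)) = p * (-i) - ((p * (K - i) : ℕ) : ℤ) := by
      push_cast [Nat.cast_sub hi.le]; ring
    rw [norm_mul]
    calc _ ≤ ‖f.coe (-i)‖ * M ^ (p * (K - i)) * ρ ^ (-(p * K : ℤ)) := by
          gcongr
          rw [e1]
          exact norm_subCoeff_frob_le _ _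
      _ = a i * θ ^ (p * (K - i)) := by
          rw [ha, hθ, div_pow, e1, zpow_sub₀ hρ.ne', zpow_natCast]
          simp only [mul_neg]
          ring
      _ ≤ _ := by
          gcongr ?_ * ?_
          exact pow_le_pow_of_le_one hθ0.le hθ1.le (Nat.le_mul_of_pos_left _ hp.1.pos)
  obtain ⟨B, hB0, hB⟩ : ∃ B, 0 < B ∧ ∀ K, b K ≤ B := by
    obtain ⟨B, hB0, hB⟩ := tendsto_bdd (Nat.cofinite_eq_atTop ▸ hbt)
    exact ⟨B + 1, by positivity, fun K => (le_abs_self _).trans ((hB K).trans (by linarith))⟩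
  have hat : Tendsto a atTop (𝓝 0) := by
    rw [Metric.tendsto_atTop]
    intro ε hε
    obtain ⟨i0, hi0⟩ := (Metric.tendsto_atTop.1 hbt) (ε / 2) (by positivity)
    have key : ∀ K, a K ≤ max (ε / 2) (B * θ ^ ((K : ℤ) - i0)) := by
      intro K
      induction K using Nat.strong_induction_on with
      | _ K ih =>
        have h1 : b K ≤ max (ε / 2) (B * θ ^ ((K : ℤ) - i0)) := by
          rcases le_or_gt i0 K with h | h
          · have := hi0 K h
            rw [Real.dist_0_eq_abs] at this
            exact le_max_of_le_left ((le_abs_self _).trans this.le)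
          · refine le_max_of_le_right ((hB K).trans ?_)
            refine le_mul_of_one_le_right hB0.le ?_
            exact one_le_zpow_of_nonpos₀ hθ0 hθ1.le (by omega)
        rw [ha]
        simp only
        rw [hrec K, sub_eq_add_neg]
        refine norm_add_mul_le (by positivity) h1 ?_
        rw [norm_neg, ← le_div_iff₀ (by positivity)]
        refine IsUltrametricDist.norm_sum_le_of_forall_le_of_nonneg
          (div_nonneg (le_max_of_le_left (by positivity)) (by positivity)) fun i hi => ?_
        rw [Finset.mem_range] at hi
        rw [le_div_iff₀ (by positivity)]
        refine (hterm K i hi).trans ?_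
        refine (mul_le_mul_of_nonneg_right (ih i hi) (by positivity)).trans ?_
        rw [max_mul_of_nonneg _ _ (by positivity)]
        refine max_le_max ?_ (le_of_eq ?_)
        · exact mul_le_of_le_one_right (by positivity) (pow_le_one₀ hθ0.le hθ1.le)
        · rw [mul_assoc, ← zpow_natCast, ← zpow_add₀ hθ0.ne']
          congr 2
          push_cast [Nat.cast_sub hi.le]
          ring
    have h2 : Tendsto (fun K : ℕ => B * θ ^ ((K : ℤ) - i0)) atTop (𝓝 0) := by
      have := (tendsto_pow_atTop_nhds_zero_of_lt_one hθ0.le hθ1).const_mul (B * θ ^ (-(i0 : ℤ)))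
      rw [mul_zero] at this
      refine this.congr fun K => ?_
      rw [sub_eq_neg_add, zpow_add₀ hθ0.ne', zpow_natCast, mul_assoc]
    obtain ⟨K0, hK0⟩ := (Metric.tendsto_atTop.1 h2) ε hε
    refine ⟨K0, fun K hK => ?_⟩
    rw [Real.dist_0_eq_abs, abs_of_nonneg (by positivity)]
    refine (key K).trans_lt (max_lt (by linarith) ?_)
    have := hK0 K hK
    rw [Real.dist_0_eq_abs] at this
    exact (le_abs_self _).trans_lt this
  unfold ConvAt
  rw [Metric.tendsto_nhds]
  intro ε hε
  rw [← Nat.cofinite_eq_atTop] at hat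
  have h3 : {K : ℕ | ¬ dist (a K) 0 < ε}.Finite := (Metric.tendsto_nhds.1 hat) ε hε
  refine (h3.image fun K : ℕ => (-K : ℤ)).subset ?_
  intro j hj
  rcases lt_or_ge j 0 with h | h
  · obtain ⟨n, rfl⟩ : ∃ n : ℕ, j = -n := ⟨(-j).toNat, by omega⟩
    refine ⟨n, fun hcon => hj ?_, rfl⟩
    change dist _ _ < ε
    convert hcon using 2
    rw [ha, ← zpow_natCast, ← zpow_mul, mul_neg]
  · exfalso
    apply hj
    change dist _ _ < ε
    rw [hf j h]
    simpa using hε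

theorem frob_descent {r : ℝ} (hr : (p : ℝ) - 1 ≤ r) {f : Robba p}
    (hf : frob p f ∈ RobbaR p (p * r)) : f ∈ RobbaR p r := by
  have hp1 := one_lt_p (p := p)
  have hr0 : 0 < r := by linarith
  have hplus : IsPlus (f.part {j | j < 0}ᶜ) := fun j hj => by
    rw [Robba.part_coe, Set.indicator_of_notMem]
    simpa using hj
  rw [← Robba.part_add_compl {j | j < 0} f]
  refine add_mem ?_ (hplus.mem r)
  have hg : frob p (f.part {j | j < 0}) ∈ RobbaR p (p * r) := by
    have : frob p (f.part {j | j < 0}) = frob p f - frob p (f.part {j | j < 0}ᶜ) := by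
      rw [← map_sub]
      congr 1
      exact eq_sub_of_add_eq (Robba.part_add_compl _ f)
    rw [this]
    exact sub_mem hf (hplus.frob.mem _)
  intro σ h1 h2
  have hσ : 0 < σ := (radius_pos p r).trans_le h1
  have hpR : (0 : ℝ) < p := by linarith
  have e1 : (σ ^ (1 / (p : ℝ))) ^ p = σ := by
    rw [← Real.rpow_natCast, ← Real.rpow_mul hσ.le, one_div_mul_cancel hpR.ne', Real.rpow_one]
  have h3 : (p : ℝ) ^ (-1 / (p * r)) ≤ σ ^ (1 / (p : ℝ)) := by
    refine le_trans (le_of_eq ?_) (Real.rpow_le_rpow (radius_pos p r).le h1 (by positivity))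
    rw [← Real.rpow_mul hpR.le]
    congr 1
    field_simp
  have h4 : σ ^ (1 / (p : ℝ)) < 1 := Real.rpow_lt_one hσ.le h2 (by positivity)
  rw [← e1]
  refine tendsto_neg_of_frob (fun j hj => ?_) (by positivity) ?_ (hg _ h3 h4)
  · rw [Robba.part_coe, Set.indicator_of_notMem]
    simpa using hj
  · have := (frob_radius_aux hr0 le_rfl (by nlinarith) _ h3 h4).2
    rw [Units.val_neg, Units.val_one, zpow_neg_one, ← div_eq_mul_inv,
      div_lt_one (by positivity)] at this
    exact this

/-- Descent for matrices. -/
theorem matrix_descent {r : ℝ} (hr : (p : ℝ) - 1 ≤ r) {m n : Type*} [Fintype m] [Fintype n]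
    {U : Matrix m n (Robba p)} {P : Matrix m m (Robba p)} {Q : Matrix n n (Robba p)}
    (hP : ∀ i j, P i j ∈ RobbaR p (p * r)) (hQ : ∀ i j, Q i j ∈ RobbaR p (p * r))
    (hU : U.map (frob p) = P * U * Q) (i : m) (j : n) : U i j ∈ RobbaR p r := by
  have hp1 := one_lt_p (p := p)
  have hr0 : 0 < r := by linarith
  have h1 : ∀ᶠ s in atTop, ∀ i j, U i j ∈ RobbaR p s := by
    rw [eventually_all]
    intro i
    rw [eventually_all]
    exact fun j => eventually_mem_RobbaR _
  have h2 : Tendsto (fun k : ℕ => (p : ℝ) ^ k * r) atTop atTop :=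
    (tendsto_pow_atTop_atTop_of_one_lt hp1).atTop_mul_const hr0
  obtain ⟨k, hk⟩ := (h2.eventually h1).exists
  induction k with
  | zero => simpa using hk i j
  | succ k ih =>
    have hle : (p : ℝ) * r ≤ p * (p ^ k * r) := by
      refine mul_le_mul_of_nonneg_left ?_ (by linarith)
      exact le_mul_of_one_le_left hr0.le (one_le_pow₀ hp1.le)
    have hpr : 0 < p * r := by positivity
    refine ih fun a b => frob_descent ?_ ?_
    · exact hr.trans (le_mul_of_one_le_left hr0.le (one_le_pow₀ hp1.le))
    · have e := congrFun (congrFun hU a) b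
      rw [Matrix.map_apply] at e
      rw [e, Matrix.mul_apply]
      refine sum_mem fun c _ => mul_mem ?_ (RobbaR_mono hpr hle (hQ c b))
      rw [Matrix.mul_apply]
      refine sum_mem fun d _ => mul_mem (RobbaR_mono hpr hle (hP a d)) ?_
      have := hk d c
      rwa [pow_succ', mul_assoc] at this

/-! ### The element `t` and the iterates of `φ` -/

theorem tElt_isPlus : IsPlus (tElt p) := isPlus_of_laur (g := log ℚ_[p]) rfl

theorem tElt_ne_zero : tElt p ≠ 0 := by
  intro h
  have h1 := congrFun (congrArg Robba.coe h) 1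
  change laur (log ℚ_[p]) 0 1 1 = 0 at h1
  rw [laur_zero_apply] at h1
  simp [coeff_log] at h1

theorem tR_ne_zero (r : Radius p) : tR r ≠ 0 := fun h => tElt_ne_zero (congrArg Subtype.val h)

/-- `(1 + T) ^ (p ^ b) - 1` divides `t`, and the quotient is a power series. -/
theorem exists_tElt_eq (b : ℕ) : ∃ g : Robba p, IsPlus g ∧
    tElt p = ((1 + Robba.single 1 1) ^ p ^ b - 1) * g := by
  induction b with
  | zero =>
    refine ⟨Robba.single (-1) 1 * tElt p, fun j hj => ?_, ?_⟩
    · rw [Robba.coe_mul, Robba.coe_single, single_lmul, one_mul]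
      rcases lt_or_eq_of_le (show j - -1 ≤ 0 by omega) with h | h
      · exact tElt_isPlus _ h
      · rw [h]
        change laur (log ℚ_[p]) 0 1 0 = 0
        rw [laur_zero_apply]
        simp
    · rw [pow_zero, pow_one, add_sub_cancel_left, ← mul_assoc, Robba.single_mul_single,
        add_neg_cancel, mul_one]
      exact (one_mul _).symm
  | succ b ih =>
    obtain ⟨g, hg, h⟩ := ih
    have h1 := congrArg (frob p) h
    rw [frob_tElt, map_mul, map_sub, map_pow, frob_one_add_T, map_one, ← pow_mul, ← pow_succ'] at h1
    have hpp : (p : ℚ_[p]) ≠ 0 := by exact_mod_cast hp.1.ne_zero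
    refine ⟨Robba.C p (p : ℚ_[p])⁻¹ * frob p g, fun j hj => ?_, ?_⟩
    · change (Robba.single 0 _ * _).coe j = 0
      rw [Robba.single_mul_coe, hg.frob j hj, mul_zero]
    · rw [mul_left_comm, ← h1]
      change _ = Robba.C p (p : ℚ_[p])⁻¹ * (Robba.C p p * _)
      rw [← mul_assoc, ← map_mul, inv_mul_cancel₀ hpp, map_one, one_mul]

end RobbaRing

/-! ## Cyclotomic extensions of `ℚ_p` -/

section CyclotomicFields

open Polynomial in
theorem irreducible_cyclotomic (p : ℕ) [hp : Fact p.Prime] (n : ℕ) :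
    Irreducible (cyclotomic (p ^ (n + 1)) ℚ_[p]) := by
  set f := ((cyclotomic (p ^ (n + 1)) ℤ).comp (Polynomial.X + 1)) with hf
  have hE := cyclotomic_prime_pow_comp_X_add_one_isEisensteinAt p n
  rw [← hf] at hE
  have hmon : f.Monic := by
    rw [hf, show (Polynomial.X + 1 : ℤ[X]) = Polynomial.X + Polynomial.C 1 by simp]
    exact (cyclotomic.monic _ ℤ).comp_X_add_C 1
  set φ := Int.castRingHom ℤ_[p]
  have h0 : f.coeff 0 = p := by
    rw [hf, coeff_zero_eq_eval_zero, eval_comp]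
    simp [eval_one_cyclotomic_prime_pow]
  have hprime : (Ideal.span {(p : ℤ_[p])}).IsPrime :=
    (Ideal.span_singleton_prime (by exact_mod_cast hp.1.ne_zero)).2 PadicInt.prime_p
  have hmon' : (f.map φ).Monic := hmon.map φ
  have hE' : (f.map φ).IsEisensteinAt (Ideal.span {(p : ℤ_[p])}) := by
    refine hmon'.isEisensteinAt_of_mem_of_notMem hprime.ne_top ?_ ?_
    · intro i hi
      rw [hmon.natDegree_map] at hi
      have := hE.mem hi
      erw [Ideal.mem_span_singleton] at this
      rw [Polynomial.coeff_map, Ideal.mem_span_singleton]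
      obtain ⟨c, hc⟩ := this
      exact ⟨(c : ℤ_[p]), by rw [hc]; simp [φ]⟩
    · rw [Polynomial.coeff_map, h0, Ideal.span_singleton_pow, Ideal.mem_span_singleton]
      simp only [map_natCast]
      rintro ⟨c, hc⟩
      have hp0 : (p : ℤ_[p]) ≠ 0 := by exact_mod_cast hp.1.ne_zero
      have : (p : ℤ_[p]) * (p * c) = p * 1 := by rw [mul_one, ← mul_assoc, ← sq]; exact hc.symm
      exact PadicInt.prime_p.not_isUnit (IsUnit.of_mul_eq_one _ (mul_left_cancel₀ hp0 this))
  have hdeg : 0 < (f.map φ).natDegree := by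
    rw [hmon.natDegree_map, hf, natDegree_comp, natDegree_cyclotomic,
      show (Polynomial.X + 1 : ℤ[X]) = Polynomial.X + Polynomial.C 1 by simp, natDegree_X_add_C,
      mul_one]
    exact Nat.totient_pos.2 (pow_pos hp.1.pos _)
  have hirr := hE'.irreducible hprime hmon'.isPrimitive hdeg
  rw [hmon'.irreducible_iff_irreducible_map_fraction_map (K := ℚ_[p])] at hirr
  have hcomp : ((f.map φ).map (algebraMap ℤ_[p] ℚ_[p])) =
      (algEquivAevalXAddC (1 : ℚ_[p])) (cyclotomic (p ^ (n + 1)) ℚ_[p]) := by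
    rw [Polynomial.map_map, algEquivAevalXAddC_apply, hf, Polynomial.map_comp, map_cyclotomic,
      aeval_def, comp, Polynomial.algebraMap_eq]
    simp
  rw [hcomp] at hirr
  exact (MulEquiv.irreducible_iff (algEquivAevalXAddC (1 : ℚ_[p]))).1 hirr

variable {p : ℕ} [hp : Fact p.Prime] (ε : EpsSeq p)

theorem minpoly_eps (n : ℕ) {x : PadicAlgCl p} (hx : IsPrimitiveRoot x (p ^ (n + 1))) :
    minpoly ℚ_[p] x = Polynomial.cyclotomic (p ^ (n + 1)) ℚ_[p] :=
  (hx.minpoly_eq_cyclotomic_of_irreducible (irreducible_cyclotomic p n)).symm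

/-- Primitive roots of unity of order `p ^ n` are conjugate over `ℚ_p`. -/
theorem exists_algEquiv_eps (n : ℕ) {x y : PadicAlgCl p} (hx : IsPrimitiveRoot x (p ^ n))
    (hy : IsPrimitiveRoot y (p ^ n)) : ∃ σ : PadicAlgCl p ≃ₐ[ℚ_[p]] PadicAlgCl p, σ x = y := by
  cases n with
  | zero =>
    refine ⟨1, ?_⟩
    have h1 := hx.pow_eq_one
    have h2 := hy.pow_eq_one
    simp only [pow_zero, pow_one] at h1 h2
    rw [h1, h2]
    rfl
  | succ n =>
    have : IsConjRoot ℚ_[p] y x := by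
      rw [IsConjRoot, minpoly_eps n hx, minpoly_eps n hy]
    exact isConjRoot_iff_exists_algEquiv.1 this

theorem cyclotomic_degree_bound {n : ℕ} {x : PadicAlgCl p} (hx : IsPrimitiveRoot x (p ^ (n + 1)))
    {P : Polynomial ℚ_[p]} (hP : Polynomial.aeval x P = 0) :
    Polynomial.cyclotomic (p ^ (n + 1)) ℚ_[p] ∣ P := by
  rw [← minpoly_eps n hx]
  exact minpoly.dvd _ _ hP

theorem chi_eq_of_forall {σ : PadicAlgCl p ≃ₐ[ℚ_[p]] PadicAlgCl p} {a : ℕ}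
    (h : ∀ n, σ (ε.val n) = ε.val n ^ a) : ((chiG p σ : ℤ_[p]ˣ) : ℤ_[p]) = a := by
  refine PadicInt.ext_of_toZModPow.1 fun n => ?_
  have h1 := (chiG_spec ε σ n).symm.trans (h n)
  have : NeZero (p ^ n) := ⟨(pow_pos hp.1.pos n).ne'⟩
  have h2 := ((ε.prim n).isOfFinOrder (NeZero.ne _)).pow_eq_pow_iff_modEq.1 h1
  rw [← (ε.prim n).eq_orderOf] at h2
  have h3 : ((((chiG p σ : ℤ_[p]).toZModPow n).val : ℕ) : ZMod (p ^ n)) = (a : ZMod (p ^ n)) :=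
    (ZMod.natCast_eq_natCast_iff _ _ _).2 h2
  rw [ZMod.natCast_zmod_val] at h3
  rw [h3, map_natCast]

/-- The cyclotomic character takes every natural number prime to `p` as a value. -/
theorem exists_chi_eq {a : ℕ} (ha : a.Coprime p) :
    ∃ σ : PadicAlgCl p ≃ₐ[ℚ_[p]] PadicAlgCl p, (∀ n, σ (ε.val n) = ε.val n ^ a) ∧
      ((chiG p σ : ℤ_[p]ˣ) : ℤ_[p]) = a := by
  suffices h : ∃ σ : PadicAlgCl p ≃ₐ[ℚ_[p]] PadicAlgCl p, ∀ n, σ (ε.val n) = ε.val n ^ a by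
    obtain ⟨σ, hσ⟩ := h
    exact ⟨σ, hσ, chi_eq_of_forall ε hσ⟩
  let S : ℕ → Set Gal(PadicAlgCl p/ℚ_[p]) := fun n => {σ | σ (ε.val n) = ε.val n ^ a}
  have hne : ∀ n, (S n).Nonempty := fun n =>
    exists_algEquiv_eps n (ε.prim n) ((ε.prim n).pow_of_coprime a (Nat.Coprime.pow_right n ha))
  have hcl : ∀ n, IsClosed (S n) := by
    intro n
    obtain ⟨τ, hτ⟩ := hne n
    have h1 := (IntermediateField.fixingSubgroup_isClosed (Kn ε n)).leftCoset τ
    convert h1 using 1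
    ext σ
    rw [Set.mem_smul_set_iff_inv_smul_mem]
    have hτ' : τ (ε.val n) = ε.val n ^ a := hτ
    change σ (ε.val n) = ε.val n ^ a ↔ τ⁻¹ * σ ∈ (Kn ε n).fixingSubgroup
    rw [← hτ']
    constructor
    · intro h
      rw [IntermediateField.mem_fixingSubgroup_iff]
      intro x hx
      induction hx using IntermediateField.adjoin_induction with
      | mem y hy =>
        rw [Set.mem_singleton_iff.1 hy]
        change τ.symm (σ (ε.val n)) = _
        rw [h, AlgEquiv.symm_apply_apply]
      | algebraMap y => exact (τ⁻¹ * σ).commutes y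
      | add y z _ _ hy hz =>
        rw [map_add]; exact congrArg₂ _ hy hz
      | inv y _ hy =>
        rw [map_inv₀]; exact congrArg _ hy
      | mul y z _ _ hy hz =>
        rw [map_mul]; exact congrArg₂ _ hy hz
    · intro h
      rw [IntermediateField.mem_fixingSubgroup_iff] at h
      have h2 : τ.symm (σ (ε.val n)) = ε.val n :=
        h (ε.val n) (IntermediateField.mem_adjoin_simple_self ℚ_[p] _)
      rw [← h2, AlgEquiv.apply_symm_apply, h2]
  have hmono : ∀ n, S (n + 1) ⊆ S n := by
    intro n σ hσ
    have hσ' : σ (ε.val (n + 1)) = ε.val (n + 1) ^ a := hσ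
    change σ (ε.val n) = ε.val n ^ a
    rw [← ε.compat n, map_pow, hσ', ← pow_mul, ← pow_mul, mul_comm]
  obtain ⟨σ, hσ⟩ := IsCompact.nonempty_iInter_of_sequence_nonempty_isCompact_isClosed S hmono hne
    ((hcl 0).isCompact) hcl
  exact ⟨σ, fun n => Set.mem_iInter.1 hσ n⟩

theorem mem_Kn_iff {n : ℕ} {x : PadicAlgCl p} :
    x ∈ Kn ε n ↔ ∃ P : Polynomial ℚ_[p], Polynomial.aeval (ε.val n) P = x := by
  have hint : IsIntegral ℚ_[p] (ε.val n) :=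
    (Algebra.IsAlgebraic.isAlgebraic (R := ℚ_[p]) (ε.val n)).isIntegral
  rw [← IntermediateField.mem_toSubalgebra,
    IntermediateField.adjoin_simple_toSubalgebra_of_isAlgebraic hint.isAlgebraic,
    Algebra.adjoin_singleton_eq_range_aeval]
  rfl

theorem one_add_sq_pow (q j : ℕ) : ∃ u : ℕ, (1 + q ^ 2) ^ q ^ j = 1 + q ^ (2 + j) + q ^ (3 + j) * u := by
  suffices h : ∃ u v : ℕ, (1 + q ^ 2) ^ q ^ j = 1 + q ^ (2 + j) * u ∧ u = 1 + q * v by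
    obtain ⟨u, v, h1, rfl⟩ := h
    exact ⟨v, by rw [h1]; ring⟩
  induction j with
  | zero => exact ⟨1, 0, by simp, by simp⟩
  | succ j ih =>
    obtain ⟨u, v, h1, rfl⟩ := ih
    obtain ⟨k, hk⟩ := Polynomial.powAddExpansion 1 (q ^ (2 + j) * (1 + q * v)) q
    refine ⟨(1 + q * v) + k * q ^ (1 + j) * (1 + q * v) ^ 2,
      v + k * q ^ j * (1 + q * v) ^ 2, ?_, by ring⟩
    rw [pow_succ q j, pow_mul, h1, hk]
    simp only [one_pow, mul_one, Nat.cast_id]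
    ring

/-- The invariants of `1 + p ^ 2 ∈ ℤ_p ^ ×` in the cyclotomic extension lie in `ℚ_p(ε^(2))`. -/
theorem mem_Kn_two_of_fixed {σ : PadicAlgCl p ≃ₐ[ℚ_[p]] PadicAlgCl p}
    (hσ : ∀ n, σ (ε.val n) = ε.val n ^ (1 + p ^ 2)) (n : ℕ) {x : PadicAlgCl p} (hx : x ∈ Kn ε n)
    (hfix : σ x = x) : x ∈ Kn ε 2 := by
  induction n with
  | zero => exact Kn_mono ε (Nat.zero_le 2) hx
  | succ n ih =>
    rcases Nat.lt_or_ge n 2 with hn | hn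
    · exact Kn_mono ε (by omega) hx
    obtain ⟨j, rfl⟩ := Nat.exists_eq_add_of_le hn
    refine ih ?_
    obtain ⟨P, rfl⟩ := (mem_Kn_iff ε).1 hx
    set z := ε.val (2 + j + 1) with hz
    set w := ε.val 1 with hw
    have hpow : ∀ m i, (σ ^ m) (ε.val i) = ε.val i ^ ((1 + p ^ 2) ^ m) := by
      intro m i
      induction m with
      | zero => simp
      | succ m ihm => rw [pow_succ', AlgEquiv.mul_apply, ihm, map_pow, hσ, ← pow_mul, pow_succ' (1 + p ^ 2) m]
    set δ := σ ^ p ^ j with hδ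
    obtain ⟨u, hu⟩ := one_add_sq_pow p j
    have h1 : δ z = z * w := by
      rw [hδ, hpow, hu, pow_add, pow_add, pow_one, pow_mul, show 3 + j = 2 + j + 1 by ring,
        (ε.prim _).pow_eq_one, one_pow, mul_one, hz, hw, ← ε.pow_pow 1 (2 + j),
        show 1 + (2 + j) = 2 + j + 1 by ring]
    have h2 : δ w = w := by
      have hwp : w ^ p = 1 := by simpa using (ε.prim 1).pow_eq_one
      rw [hδ, hpow, hu, pow_add, pow_add, pow_one, pow_mul, show 2 + j = 1 + (1 + j) by ring,
        pow_add p 1, pow_one, pow_mul, hwp, one_pow, mul_one,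
        show 3 + j = 1 + (2 + j) by ring, pow_add p 1, pow_one, pow_mul, hwp, one_pow, one_pow, mul_one]
    have h3 : ∀ i, (δ ^ i) z = z * w ^ i := by
      intro i
      induction i with
      | zero => simp
      | succ i ihi => rw [pow_succ', AlgEquiv.mul_apply, ihi, map_mul, h1, map_pow, h2, pow_succ']; ring
    have h4 : ∀ m, (σ ^ m) (Polynomial.aeval z P) = Polynomial.aeval z P := by
      intro m
      induction m with
      | zero => simp
      | succ m ihm => rw [pow_succ', AlgEquiv.mul_apply, ihm, hfix]
    have h5 : (p : PadicAlgCl p) * Polynomial.aeval z P =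
        ∑ i ∈ Finset.range p, Polynomial.aeval (z * w ^ i) P := by
      rw [Finset.sum_congr rfl (g := fun _ => Polynomial.aeval z P), Finset.sum_const,
        Finset.card_range, nsmul_eq_mul]
      intro i _
      rw [← h3, Polynomial.aeval_algHom_apply (δ ^ i : PadicAlgCl p ≃ₐ[ℚ_[p]] PadicAlgCl p), hδ,
        ← pow_mul, h4]
    have h6 : (p : PadicAlgCl p) * Polynomial.aeval z P ∈ Kn ε (2 + j) := by
      rw [h5]
      simp only [Polynomial.aeval_eq_sum_range]
      rw [Finset.sum_comm]
      refine sum_mem fun m _ => ?_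
      rw [← Finset.smul_sum]
      refine (Kn ε (2 + j)).smul_mem ?_
      have e1 : ∑ i ∈ Finset.range p, (z * w ^ i) ^ m = z ^ m * ∑ i ∈ Finset.range p, (w ^ m) ^ i := by
        rw [Finset.mul_sum]
        exact Finset.sum_congr rfl fun i _ => by ring
      rw [e1]
      by_cases hm : p ∣ m
      · obtain ⟨l, rfl⟩ := hm
        rw [pow_mul, ε.compat]
        have hwp : w ^ p = 1 := by simpa using (ε.prim 1).pow_eq_one
        rw [pow_mul, hwp]
        simp only [one_pow, Finset.sum_const, Finset.card_range, nsmul_eq_mul, mul_one]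
        exact mul_mem (pow_mem (IntermediateField.mem_adjoin_simple_self ℚ_[p] _) _)
          (natCast_mem _ _)
      · have hprim : IsPrimitiveRoot (w ^ m) p := by
          have := (ε.prim 1).pow_of_coprime m
          rw [pow_one] at this
          exact this ((Nat.Prime.coprime_iff_not_dvd hp.1).2 hm).symm
        rw [hprim.geom_sum_eq_zero hp.1.one_lt, mul_zero]
        exact zero_mem _
    have hp0 : (p : PadicAlgCl p) ≠ 0 := by exact_mod_cast hp.1.ne_zero
    rw [← inv_mul_cancel_left₀ hp0 (Polynomial.aeval z P)]
    exact mul_mem (inv_mem (natCast_mem _ _)) h6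

theorem sum_totient_prime_pow (p : ℕ) [hp : Fact p.Prime] {a b : ℕ} (hab : a ≤ b) :
    ∑ i ∈ Finset.Ico a b, (p ^ (i + 1)).totient = p ^ b - p ^ a := by
  induction b, hab using Nat.le_induction with
  | base => simp
  | succ b hab ih =>
    have hle : p ^ a ≤ p ^ b := Nat.pow_le_pow_right hp.1.pos hab
    rw [Finset.sum_Ico_succ_top hab, ih, Nat.totient_prime_pow_succ hp.1]
    have := hp.1.one_le
    zify [hle, this, Nat.pow_le_pow_right hp.1.pos (Nat.le_succ_of_le hab)]
    ring

open Polynomial in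
/-- A polynomial of degree less than `p ^ b - p ^ a` vanishing at `ε^(n) - 1` for `a < n ≤ b`
is zero. -/
theorem eq_zero_of_roots {a b : ℕ} (hab : a ≤ b) {P : ℚ_[p][X]}
    (hP : ∀ n, a < n → n ≤ b → aeval (ε.val n - 1) P = 0) (hdeg : P.degree < (p ^ b - p ^ a : ℕ)) :
    P = 0 := by
  have hQ : ∏ i ∈ Finset.Ico a b, cyclotomic (p ^ (i + 1)) ℚ_[p] ∣ P.comp (Polynomial.X - Polynomial.C 1) := by
    refine Finset.prod_dvd_of_coprime ?_ ?_
    · intro i _ j _ hij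
      have h1 : IsCoprime (cyclotomic (p ^ (i + 1)) ℚ) (cyclotomic (p ^ (j + 1)) ℚ) :=
        cyclotomic.isCoprime_rat fun h => hij (by simpa using Nat.pow_right_injective hp.1.two_le h)
      have h2 := h1.map (mapRingHom (algebraMap ℚ ℚ_[p]))
      simpa [coe_mapRingHom, map_cyclotomic] using h2
    · intro i hi
      rw [Finset.mem_Ico] at hi
      refine cyclotomic_degree_bound (ε.prim (i + 1)) ?_
      rw [aeval_comp]
      simpa using hP (i + 1) (by omega) (by omega)
  have hcomp : P.comp (Polynomial.X - Polynomial.C 1) = 0 := by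
    refine eq_zero_of_dvd_of_degree_lt hQ ?_
    rw [degree_prod]
    simp only [degree_cyclotomic]
    have hsum := sum_totient_prime_pow p hab
    have hd : (P.comp (Polynomial.X - Polynomial.C 1)).degree = P.degree := by
      rw [show (Polynomial.X - Polynomial.C 1 : ℚ_[p][X]) = Polynomial.X + Polynomial.C (-1) by simp [sub_eq_add_neg], ← taylor_apply, degree_taylor]
    rw [hd]
    refine hdeg.trans_le ?_
    rw [← hsum]
    push_cast
    rfl
  have h2 := congrArg (fun Q => Q.comp (Polynomial.X + Polynomial.C 1)) hcomp
  simpa [comp_assoc] using h2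

end CyclotomicFields

/-! ## The localization maps -/

section Localization

variable {p : ℕ} [hp : Fact p.Prime] (ε : EpsSeq p)

/-- The element `T` of `R^r`. -/
def TR (r : ℝ) : RobbaR p r := ⟨Robba.single 1 1, single_mem r 1 1⟩

/-- The element `T` of `R^r`, as a unit. -/
def TUnit (r : ℝ) : (RobbaR p r)ˣ where
  val := TR r
  inv := ⟨Robba.single (-1) 1, single_mem r (-1) 1⟩
  val_inv := Subtype.ext ((Robba.single_mul_single 1 (-1) 1 1).trans (by rw [mul_one]; rfl))
  inv_val := Subtype.ext ((Robba.single_mul_single (-1) 1 1 1).trans (by rw [mul_one]; rfl))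

theorem TUnit_zpow (r : ℝ) (k : ℤ) :
    (((TUnit r ^ k : (RobbaR p r)ˣ) : RobbaR p r) : Robba p) = Robba.single k 1 := by
  induction k using Int.induction_on with
  | zero => simp only [zpow_zero, Units.val_one]; rfl
  | succ k ih =>
    rw [zpow_add_one, Units.val_mul, Subring.coe_mul, ih]
    exact (Robba.single_mul_single k 1 1 1).trans (by rw [mul_one])
  | pred k ih =>
    rw [zpow_sub_one, Units.val_mul, Subring.coe_mul, ih]
    exact (Robba.single_mul_single (-k) (-1) 1 1).trans (by rw [mul_one]; rfl)

/-- The monomial `a T ^ k` in `R^r`. -/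
def monR (r : ℝ) (k : ℤ) (a : ℚ_[p]) : RobbaR p r := ⟨Robba.single k a, single_mem r k a⟩

theorem TUnit_zpow' (r : ℝ) (k : ℤ) : ((TUnit r ^ k : (RobbaR p r)ˣ) : RobbaR p r) = monR r k 1 :=
  Subtype.ext (TUnit_zpow r k)

theorem hom_monR_eq {R : Type*} [CommRing R] {r : ℝ} (g h : RobbaR p r →+* R)
    (hT : g (TR r) = h (TR r)) (k : ℤ) : g (monR r k 1) = h (monR r k 1) := by
  have h1 : Units.map (g : RobbaR p r →* R) (TUnit r) = Units.map (h : RobbaR p r →* R) (TUnit r) :=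
    Units.ext hT
  have h2 := congrArg (fun u : Rˣ => ((u ^ k : Rˣ) : R)) h1
  simp only [← map_zpow, Units.coe_map] at h2
  rw [← TUnit_zpow']
  exact h2

section

variable {F : Type*} [NormedField F] [Algebra ℚ_[p] F] [IsUltrametricDist F] [CompleteSpace F]
  {V : (F⟦X⟧)ˣ} {c M : ℝ}

theorem tendsto_evalSer {κ : Type*} (hF : ∀ a : ℚ_[p], ‖algebraMap ℚ_[p] F a‖ = ‖a‖)
    (hV : ∀ (k : ℤ) (i : ℕ), ‖coeff i ((V ^ k : (F⟦X⟧)ˣ) : F⟦X⟧)‖ ≤ c ^ k * M ^ i)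
    (a : κ → ℤ → ℚ_[p]) (h : Tendsto (fun x : κ × ℤ => ‖a x.1 x.2‖ * c ^ x.2) cofinite (𝓝 0))
    (i : ℕ) :
    Tendsto (fun x : κ × ℤ => algebraMap ℚ_[p] F (a x.1 x.2) *
      coeff i ((V ^ x.2 : (F⟦X⟧)ˣ) : F⟦X⟧)) cofinite (𝓝 0) := by
  rw [tendsto_zero_iff_norm_tendsto_zero]
  refine squeeze_zero (fun _ => norm_nonneg _) (fun x => ?_) (by simpa using h.mul_const (M ^ i))
  rw [norm_mul, hF, mul_assoc]
  exact mul_le_mul_of_nonneg_left (hV x.2 i) (norm_nonneg _)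

theorem summable_evalSer (hF : ∀ a : ℚ_[p], ‖algebraMap ℚ_[p] F a‖ = ‖a‖)
    (hV : ∀ (k : ℤ) (i : ℕ), ‖coeff i ((V ^ k : (F⟦X⟧)ˣ) : F⟦X⟧)‖ ≤ c ^ k * M ^ i)
    {f : ℤ → ℚ_[p]} (hf : ConvAt c f) (i : ℕ) :
    Summable fun k : ℤ => algebraMap ℚ_[p] F (f k) * coeff i ((V ^ k : (F⟦X⟧)ˣ) : F⟦X⟧) := by
  refine NonarchimedeanAddGroup.summable_of_tendsto_cofinite_zero ?_
  have := tendsto_evalSer hF hV (κ := Unit) (fun _ => f)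
    (Tendsto.comp hf (Function.Injective.tendsto_cofinite (f := fun x : Unit × ℤ => x.2)
      (fun x y h => Prod.ext rfl h))) i
  exact this.comp (Function.Injective.tendsto_cofinite (f := fun k : ℤ => ((), k))
    (fun x y h => (Prod.mk.inj h).2))

theorem hasSum_evalSer {κ : Type*} (hc : 0 < c)
    (hF : ∀ a : ℚ_[p], ‖algebraMap ℚ_[p] F a‖ = ‖a‖)
    (hV : ∀ (k : ℤ) (i : ℕ), ‖coeff i ((V ^ k : (F⟦X⟧)ˣ) : F⟦X⟧)‖ ≤ c ^ k * M ^ i)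
    (a : κ → ℤ → ℚ_[p]) (h : Tendsto (fun x : κ × ℤ => ‖a x.1 x.2‖ * c ^ x.2) cofinite (𝓝 0))
    (i : ℕ) :
    HasSum (fun k => ∑' j, algebraMap ℚ_[p] F (a k j) * coeff i ((V ^ j : (F⟦X⟧)ˣ) : F⟦X⟧))
      (∑' j, algebraMap ℚ_[p] F (∑' k, a k j) * coeff i ((V ^ j : (F⟦X⟧)ˣ) : F⟦X⟧)) := by
  have hs := NonarchimedeanAddGroup.summable_of_tendsto_cofinite_zero (tendsto_evalSer hF hV a h i)
  have h2 := hs.hasSum.prod_fiberwise (fun k => (hs.prod_factor k).hasSum)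
  have hsymm : ∑' x : κ × ℤ, algebraMap ℚ_[p] F (a x.1 x.2) *
      coeff i ((V ^ x.2 : (F⟦X⟧)ˣ) : F⟦X⟧) =
      ∑' j : ℤ, ∑' k : κ, algebraMap ℚ_[p] F (a k j) * coeff i ((V ^ j : (F⟦X⟧)ˣ) : F⟦X⟧) := by
    rw [hs.tsum_prod]
    exact (Summable.tsum_comm (f := fun j k => algebraMap ℚ_[p] F (a k j) *
      coeff i ((V ^ j : (F⟦X⟧)ˣ) : F⟦X⟧)) (hs.prod_symm))
  rw [hsymm] at h2
  refine (congrArg (HasSum _) ?_).mp h2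
  refine tsum_congr fun j => ?_
  rw [tsum_mul_right]
  congr 1
  exact (((convAt_tsum hc h).1 j).hasSum.map (algebraMap ℚ_[p] F)
    (AddMonoidHomClass.isometry_of_norm (algebraMap ℚ_[p] F) hF).continuous).tsum_eq

end

section

variable {r : ℝ} (hr : (p : ℝ) - 1 ≤ r) {n : ℕ} (hn : nOf p r ≤ n)

theorem norm_eps_sub_one_pos {n : ℕ} (hn : 1 ≤ n) : 0 < ‖epsK ε n - 1‖ :=
  norm_pos_iff.2 (eps_sub_one_ne_zero ε hn)

theorem norm_algebraMap_Kn (n : ℕ) (a : ℚ_[p]) : ‖algebraMap ℚ_[p] (Kn ε n) a‖ = ‖a‖ := by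
  rw [norm_algebraMap']

theorem norm_coeff_iotaUnit_zpow (hn1 : 1 ≤ n) (k : ℤ) (i : ℕ) :
    ‖coeff i ((iotaUnit ε hn1 ^ k : ((Kn ε n)⟦X⟧)ˣ) : (Kn ε n)⟦X⟧)‖ ≤
      ‖epsK ε n - 1‖ ^ k * ((p : ℝ) ^ (n + 1) / ‖epsK ε n - 1‖) ^ i := by
  have hα := norm_eps_sub_one_pos ε hn1
  refine Bd.zpow hα (by positivity) _ ?_ ?_ k i
  · rw [iotaUnit_coe, constantCoeff_iotaSer]
  · rw [iotaUnit_coe]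
    exact iotaSer_bd ε hn1

theorem summable_iota (f : RobbaR p r) (i : ℕ) :
    Summable fun k : ℤ => algebraMap ℚ_[p] (Kn ε n) ((f : Robba p).coe k) *
      coeff i ((iotaUnit ε (one_le_of_nOf_le hr hn) ^ k : ((Kn ε n)⟦X⟧)ˣ) : (Kn ε n)⟦X⟧) :=
  summable_evalSer (norm_algebraMap_Kn ε n)
    (norm_coeff_iotaUnit_zpow ε _)
    (f.2 _ (radius_le_norm ε hr hn) (norm_eps_sub_one_lt ε n (one_le_of_nOf_le hr hn))) i

/-- The localization maps are compatible with convergent infinite sums. -/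
theorem iota_tsum {κ : Type*} (F : κ → RobbaR p r) (f : RobbaR p r)
    (hf : ∀ j, (f : Robba p).coe j = ∑' k, (F k : Robba p).coe j)
    (h : Tendsto (fun x : κ × ℤ => ‖(F x.1 : Robba p).coe x.2‖ * ‖epsK ε n - 1‖ ^ x.2)
      cofinite (𝓝 0)) (i : ℕ) :
    HasSum (fun k => coeff i (iota ε hr hn (F k))) (coeff i (iota ε hr hn f)) := by
  have := hasSum_evalSer (norm_eps_sub_one_pos ε (one_le_of_nOf_le hr hn))
    (norm_algebraMap_Kn ε n) (norm_coeff_iotaUnit_zpow ε (one_le_of_nOf_le hr hn)) (fun k => (F k : Robba p).coe) h i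
  simp only [← hf] at this
  rw [iota_apply]
  simp only [iota_apply]
  exact this

theorem iota_TR : iota ε hr hn (TR r) = iotaSer ε n := by
  refine PowerSeries.ext fun i => ?_
  rw [iota_apply, tsum_eq_single 1, zpow_one, iotaUnit_coe]
  · change algebraMap ℚ_[p] (Kn ε n) (Pi.single (M := fun _ => ℚ_[p]) (1 : ℤ) (1 : ℚ_[p]) 1) * _ = _
    simp
  · intro k hk
    change algebraMap ℚ_[p] (Kn ε n) (Pi.single (M := fun _ => ℚ_[p]) (1 : ℤ) (1 : ℚ_[p]) k) * _ = _
    simp [hk]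

theorem iota_C (a : ℚ_[p]) : iota ε hr hn (monR r 0 a) = C (algebraMap ℚ_[p] (Kn ε n) a) := by
  refine PowerSeries.ext fun i => ?_
  rw [iota_apply, tsum_eq_single 0]
  · change algebraMap ℚ_[p] (Kn ε n) (Pi.single (M := fun _ => ℚ_[p]) (0 : ℤ) a 0) * _ = _
    simp [coeff_one, coeff_C]
  · intro k hk
    change algebraMap ℚ_[p] (Kn ε n) (Pi.single (M := fun _ => ℚ_[p]) (0 : ℤ) a k) * _ = _
    simp [hk]

theorem monR_mul (k : ℤ) (a : ℚ_[p]) : monR r 0 a * monR r k 1 = monR r k a :=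
  Subtype.ext ((Robba.single_mul_single 0 k a 1).trans (by rw [zero_add, mul_one]; rfl))

theorem hasSum_iota (f : RobbaR p r) (i : ℕ) :
    HasSum (fun k : ℤ => algebraMap ℚ_[p] (Kn ε n) ((f : Robba p).coe k) *
      coeff i (iota ε hr hn (monR r k 1))) (coeff i (iota ε hr hn f)) := by
  have h1 := (summable_iota ε hr hn f i).hasSum
  rw [← iota_apply ε hr hn] at h1
  convert h1 using 3 with k
  rw [← TUnit_zpow']
  have : Units.map (iota ε hr hn : RobbaR p r →* (Kn ε n)⟦X⟧) (TUnit r) =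
      iotaUnit ε (one_le_of_nOf_le hr hn) := Units.ext ((iota_TR ε hr hn).trans (iotaUnit_coe _ _).symm)
  rw [← this, ← map_zpow]
  rfl

/-- A localization map composed with a substitution is determined by the image of `T`. -/
theorem hasSum_iota_subst {V : (ℚ_[p]⟦X⟧)ˣ} {e : ℤ} {s : ℤˣ} {M : ℝ} (hM : 0 ≤ M)
    (h0 : ‖constantCoeff (V : ℚ_[p]⟦X⟧)‖ = 1) (hB : Bd 1 M (V : ℚ_[p]⟦X⟧)) {r₁ : ℝ}
    (S : RobbaR p r₁ →+* RobbaR p r)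
    (hS : ∀ f, (S f : Robba p).coe = lsub (subCoeff V e s) (f : Robba p).coe)
    (hα : (p : ℝ) ^ (-1 / r₁) ≤ ‖epsK ε n - 1‖ ^ e ∧ ‖epsK ε n - 1‖ ^ e < 1)
    (hα' : M * ‖epsK ε n - 1‖ ^ (s : ℤ) < 1)
    (f : RobbaR p r₁) (i : ℕ) :
    HasSum (fun k : ℤ => algebraMap ℚ_[p] (Kn ε n) ((f : Robba p).coe k) *
      coeff i (iota ε hr hn (S (monR r₁ k 1)))) (coeff i (iota ε hr hn (S f))) := by
  have hα0 := norm_eps_sub_one_pos ε (one_le_of_nOf_le hr hn)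
  obtain ⟨H1, H2⟩ := subCoeff_bd one_pos hM hα0 V h0 hB e s hα'
  have hconv : ConvAt (1 * ‖epsK ε n - 1‖ ^ e) (f : Robba p).coe := by
    rw [one_mul]
    exact f.2 _ hα.1 hα.2
  have hC : ∀ k : ℤ, (S (monR r₁ k ((f : Robba p).coe k)) : Robba p).coe =
      fun j => (f : Robba p).coe k * subCoeff V e s k j := by
    intro k
    rw [hS]
    funext j
    exact lsub_single k _ j
  have h2 := iota_tsum ε hr hn (fun k : ℤ => S (monR r₁ k ((f : Robba p).coe k))) (S f) (fun j => by
      simp only [hC]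
      rw [hS]
      rfl) (by
      simp only [hC]
      exact sub_aux (by positivity) hα0 hconv H1 H2) i
  convert h2 using 2 with k
  have hSC : ∀ a, S (monR r₁ 0 a) = monR r 0 a := by
    intro a
    refine Subtype.ext (Robba.ext (funext fun j => ?_))
    rw [hS]
    refine (lsub_single 0 a j).trans ?_
    change _ = Pi.single (M := fun _ => ℚ_[p]) (0 : ℤ) a j
    simp only [subCoeff, zpow_zero, Units.val_one, mul_zero, laur_one]
    by_cases hj : j = 0
    · simp [hj]
    · simp [hj]
  rw [← monR_mul k ((f : Robba p).coe k), map_mul, map_mul, hSC, iota_C, coeff_C_mul]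

end

/-! ### Compatibility with `φ` -/

theorem inclK_coe {n m : ℕ} (h : n ≤ m) (x : Kn ε n) : (inclK ε h x : PadicAlgCl p) = x :=
  IntermediateField.coe_inclusion (Kn_mono ε h) x

theorem inclK_injective {n m : ℕ} (h : n ≤ m) : Function.Injective (inclK ε h) :=
  (inclK ε h).injective

theorem norm_inclK {n m : ℕ} (h : n ≤ m) (x : Kn ε n) : ‖inclK ε h x‖ = ‖x‖ := by
  change ‖(inclK ε h x : PadicAlgCl p)‖ = ‖(x : PadicAlgCl p)‖
  rw [inclK_coe]

theorem continuous_inclK {n m : ℕ} (h : n ≤ m) : Continuous (inclK ε h) :=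
  have : Isometry (inclK ε h) := AddMonoidHomClass.isometry_of_norm (inclK ε h) (norm_inclK ε h)
  this.continuous

theorem inclK_algebraMap {n m : ℕ} (h : n ≤ m) (a : ℚ_[p]) :
    inclK ε h (algebraMap ℚ_[p] (Kn ε n) a) = algebraMap ℚ_[p] (Kn ε m) a :=
  (IntermediateField.inclusion (Kn_mono ε h)).commutes a

theorem epsK_succ_pow (n : ℕ) : epsK ε (n + 1) ^ p = inclK ε (Nat.le_succ n) (epsK ε n) :=
  Subtype.ext ((ε.compat n).trans (inclK_coe ε (Nat.le_succ n) (epsK ε n)).symm)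

theorem map_exp {A B : Type*} [CommRing A] [CommRing B] [Algebra ℚ A] [Algebra ℚ B] (f : A →+* B) :
    PowerSeries.map f (exp A) = exp B := by
  ext i
  rw [coeff_map, coeff_exp, coeff_exp]
  exact RingHom.map_rat_algebraMap f _

theorem map_rescale_comm {A B : Type*} [CommRing A] [CommRing B] (f : A →+* B) (a : A) (g : A⟦X⟧) :
    PowerSeries.map f (rescale a g) = rescale (f a) (PowerSeries.map f g) := by
  ext i
  simp [coeff_rescale]

theorem inclPS_iotaSer (n : ℕ) :
    (1 + iotaSer ε (n + 1)) ^ p = inclPS ε (Nat.le_succ n) (1 + iotaSer ε n) := by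
  have hp0 : (p : Kn ε (n + 1)) ≠ 0 := by exact_mod_cast hp.1.ne_zero
  rw [iotaSer, iotaSer, add_sub_cancel, add_sub_cancel, inclPS, map_mul, map_C, map_rescale_comm,
    map_exp, mul_pow, ← map_pow, ← map_pow, exp_pow_eq_rescale_exp, epsK_succ_pow, rescale_rescale,
    map_inv₀, map_pow, map_natCast]
  congr 3
  rw [pow_succ]
  field_simp

theorem iota_frob (r : Radius p) {n : ℕ} (hn : nOf p r ≤ n) (hn' : nOf p r.frob ≤ (n + 1 : ℕ))
    (f : RobbaR p r) :
    iota ε r.frob.2 hn' (frobR r f) = inclPS ε (Nat.le_succ n) (iota ε r.2 hn f) := by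
  have hT : iota ε r.frob.2 hn' (frobR r (TR r)) = inclPS ε (Nat.le_succ n) (iota ε r.2 hn (TR r)) := by
    have e1 : frobR r (TR r) = (1 + TR _) ^ p - 1 := by
      refine Subtype.ext ?_
      have := frob_one_add_T (p := p)
      rw [map_add, map_one] at this
      exact eq_sub_of_add_eq' this
    rw [e1, map_sub, map_pow, map_add, map_one, iota_TR, iota_TR, inclPS_iotaSer, map_add, map_one,
      add_sub_cancel_left]
  have hrad := radius_le_norm ε r.frob.2 hn'
  have hlt := norm_eps_sub_one_lt ε (n + 1) (by omega)
  have hp1 := one_lt_p (p := p)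
  have h2 := frob_radius_aux (p := p) (r := r) (r' := r.frob) r.pos le_rfl (by
    change (p : ℝ) - 1 < p * r
    nlinarith [r.2, r.pos]) _ hrad hlt
  refine PowerSeries.ext fun i => ?_
  refine HasSum.unique (hasSum_iota_subst ε r.frob.2 hn' (radius_pos p _).le frobUnit_norm
    frobUnit_bd (frobR r) (fun _ => rfl) h2.1 h2.2 f i) ?_
  have h3 := (hasSum_iota ε r.2 hn f i).map (inclK ε (Nat.le_succ n)) (continuous_inclK ε _)
  have h4 : coeff i (inclPS ε (Nat.le_succ n) (iota ε r.2 hn f)) =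
    inclK ε (Nat.le_succ n) (coeff i (iota ε r.2 hn f)) := coeff_map _ _ _
  rw [h4]
  convert h3 using 2 with k
  have h5 := hom_monR_eq ((iota ε r.frob.2 hn').comp (frobR r))
    ((inclPS ε (Nat.le_succ n)).comp (iota ε r.2 hn)) hT k
  simp only [RingHom.comp_apply] at h5
  rw [h5, Function.comp_apply, map_mul, inclK_algebraMap]
  congr 1

/-! ### Compatibility with `Γ` -/

theorem gamK_epsK (n : ℕ) (γ : Gam p) :
    gamK ε n γ (epsK ε n) = epsK ε n ^ ((chi p γ : ℤ_[p]).toZModPow n).val := by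
  induction γ using QuotientGroup.induction_on with
  | H g => exact Subtype.ext (chiG_spec ε g n)

theorem norm_gamK (n : ℕ) (γ : Gam p) (x : Kn ε n) : ‖gamK ε n γ x‖ = ‖x‖ := by
  induction γ using QuotientGroup.induction_on with
  | H g =>
    change ‖g (x : PadicAlgCl p)‖ = ‖(x : PadicAlgCl p)‖
    rw [← PadicAlgCl.spectralNorm_eq, ← PadicAlgCl.spectralNorm_eq]
    exact (spectralNorm_eq_of_equiv g (x : PadicAlgCl p)).symm

theorem continuous_gamK (n : ℕ) (γ : Gam p) : Continuous (gamK ε n γ) :=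
  (AddMonoidHomClass.isometry_of_norm (gamK ε n γ) (norm_gamK ε n γ)).continuous

theorem summable_choose_iotaSer {n : ℕ} (hn : 1 ≤ n) (i : ℕ) :
    Summable fun m : ℕ => ‖epsK ε n - 1‖ ^ m * ((p : ℝ) ^ (n + 1) / ‖epsK ε n - 1‖) ^ i :=
  (summable_geometric_of_lt_one (norm_nonneg _) (norm_eps_sub_one_lt ε n hn)).mul_right _

theorem norm_coeff_iotaSer_pow {n : ℕ} (hn : 1 ≤ n) (m i : ℕ) :
    ‖coeff i (iotaSer ε n ^ m)‖ ≤ ‖epsK ε n - 1‖ ^ m * ((p : ℝ) ^ (n + 1) / ‖epsK ε n - 1‖) ^ i := by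
  have := norm_coeff_iotaUnit_zpow ε hn m i
  rwa [zpow_natCast, zpow_natCast, Units.val_pow_eq_pow_val, iotaUnit_coe] at this

theorem norm_choose_mul_le {n : ℕ} (hn : 1 ≤ n) (a : ℤ_[p]) (m i : ℕ) :
    ‖algebraMap ℚ_[p] (Kn ε n) ((Ring.choose a m : ℤ_[p]) : ℚ_[p]) * coeff i (iotaSer ε n ^ m)‖ ≤
      ‖epsK ε n - 1‖ ^ m * ((p : ℝ) ^ (n + 1) / ‖epsK ε n - 1‖) ^ i := by
  rw [norm_mul, norm_algebraMap_Kn]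
  exact (mul_le_of_le_one_left (norm_nonneg _) (PadicInt.norm_le_one _)).trans
    (norm_coeff_iotaSer_pow ε hn m i)

/-- The binomial expansion of `(1 + Z) ^ a` for `Z = ε^(n) exp(X / p ^ n) - 1` and `a ∈ ℤ_p`. -/
theorem tsum_choose_iotaSer {n : ℕ} (hn : 1 ≤ n) (a : ℤ_[p]) (i : ℕ) :
    ∑' m : ℕ, algebraMap ℚ_[p] (Kn ε n) ((Ring.choose a m : ℤ_[p]) : ℚ_[p]) *
      coeff i (iotaSer ε n ^ m) =
    epsK ε n ^ (a.toZModPow n).val * (algebraMap ℚ_[p] (Kn ε n) (a : ℚ_[p]) ^ i *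
      coeff i (rescale ((p : Kn ε n) ^ n)⁻¹ (exp (Kn ε n)))) := by
  have hcont := (AddMonoidHomClass.isometry_of_norm (algebraMap ℚ_[p] (Kn ε n))
    (norm_algebraMap_Kn ε n)).continuous
  have hlim : Tendsto (fun m : ℕ => ((a.appr m : ℕ) : ℤ_[p])) atTop (𝓝 a) := by
    rw [tendsto_iff_norm_sub_tendsto_zero]
    have h1 : Tendsto (fun m : ℕ => ((p : ℝ)⁻¹) ^ m) atTop (𝓝 0) :=
      tendsto_pow_atTop_nhds_zero_of_lt_one (by positivity) (inv_lt_one_of_one_lt₀ one_lt_p)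
    refine squeeze_zero (fun _ => norm_nonneg _) (fun m => ?_) h1
    rw [norm_sub_rev]
    have := (PadicInt.norm_le_pow_iff_mem_span_pow (a - (a.appr m : ℤ_[p])) m).2 (PadicInt.appr_spec m a)
    rwa [zpow_neg, zpow_natCast, ← inv_pow] at this
  have hL : Tendsto (fun N : ℕ => ∑' m : ℕ, algebraMap ℚ_[p] (Kn ε n)
      ((Ring.choose ((a.appr N : ℕ) : ℤ_[p]) m : ℤ_[p]) : ℚ_[p]) * coeff i (iotaSer ε n ^ m)) atTop
      (𝓝 (∑' m : ℕ, algebraMap ℚ_[p] (Kn ε n) ((Ring.choose a m : ℤ_[p]) : ℚ_[p]) *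
        coeff i (iotaSer ε n ^ m))) := by
    refine tendsto_tsum_of_dominated_convergence (summable_choose_iotaSer ε hn i) ?_ ?_
    · intro m
      refine Tendsto.mul_const _ ((hcont.tendsto _).comp ?_)
      exact (continuous_subtype_val.tendsto _).comp
        (((PadicInt.continuous_choose m).tendsto _).comp hlim)
    · exact Filter.Eventually.of_forall fun N m => norm_choose_mul_le ε hn _ m i
  have hR : Tendsto (fun N : ℕ => epsK ε n ^ (a.toZModPow n).val *
      (algebraMap ℚ_[p] (Kn ε n) (((a.appr N : ℕ) : ℤ_[p]) : ℚ_[p]) ^ i *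
        coeff i (rescale ((p : Kn ε n) ^ n)⁻¹ (exp (Kn ε n))))) atTop
      (𝓝 (epsK ε n ^ (a.toZModPow n).val * (algebraMap ℚ_[p] (Kn ε n) (a : ℚ_[p]) ^ i *
        coeff i (rescale ((p : Kn ε n) ^ n)⁻¹ (exp (Kn ε n)))))) := by
    refine Tendsto.const_mul _ (Tendsto.mul_const _ (Tendsto.pow ?_ i))
    exact (hcont.tendsto _).comp ((continuous_subtype_val.tendsto _).comp hlim)
  refine tendsto_nhds_unique hL (hR.congr' ?_)
  filter_upwards [eventually_ge_atTop n] with N hN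
  set A := a.appr N with hA
  have h1 : ∑' m : ℕ, algebraMap ℚ_[p] (Kn ε n)
      ((Ring.choose (A : ℤ_[p]) m : ℤ_[p]) : ℚ_[p]) * coeff i (iotaSer ε n ^ m) =
      coeff i ((1 + iotaSer ε n) ^ A) := by
    rw [tsum_eq_sum (s := Finset.range (A + 1)), add_comm 1 (iotaSer ε n), add_pow, map_sum]
    · refine Finset.sum_congr rfl fun m _ => ?_
      rw [one_pow, mul_one, Ring.choose_natCast, mul_comm (iotaSer ε n ^ m), ← map_natCast (C (R := Kn ε n)),
        coeff_C_mul]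
      push_cast
      rfl
    · intro m hm
      rw [Finset.mem_range] at hm
      rw [Ring.choose_natCast, Nat.choose_eq_zero_of_lt (by omega)]
      simp
  have h2 : epsK ε n ^ A = epsK ε n ^ (a.toZModPow n).val := by
    have e1 : a.toZModPow n = (A : ZMod (p ^ n)) := by
      have := PadicInt.appr_spec N a
      have h3 : a - a.appr N ∈ RingHom.ker (PadicInt.toZModPow (p := p) n) := by
        rw [PadicInt.ker_toZModPow]
        exact Ideal.span_singleton_le_span_singleton.2 (pow_dvd_pow _ hN) this
      rw [RingHom.mem_ker, map_sub, map_natCast, sub_eq_zero] at h3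
      exact h3
    rw [e1, ZMod.val_natCast]
    conv_lhs => rw [← Nat.mod_add_div A (p ^ n), pow_add, pow_mul, (epsK_prim ε n).pow_eq_one, one_pow,
      mul_one]
  rw [h1, iotaSer, add_sub_cancel, mul_pow, ← map_pow C, ← map_pow (rescale _),
    exp_pow_eq_rescale_exp, rescale_rescale, coeff_C_mul, ← h2, coeff_rescale, coeff_rescale, mul_pow]
  push_cast
  ring

theorem iota_gamR_TR (r : Radius p) {n : ℕ} (hn : nOf p r ≤ n) (γ : Gam p) :
    iota ε r.2 hn (gamR r (chi p γ) (TR r)) = gamPS ε n γ (iotaSer ε n) := by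
  have hn1 := one_le_of_nOf_le r.2 hn
  obtain ⟨a, ha⟩ : ∃ a, a = chi p γ := ⟨_, rfl⟩
  rw [← ha]
  have hcoe : ∀ m : ℕ, ((gamR r a (TR r) : RobbaR p r) : Robba p).coe m =
      if m = 0 then 0 else ((Ring.choose (a : ℤ_[p]) m : ℤ_[p]) : ℚ_[p]) := by
    intro m
    have e1 : ((gamR r a (TR r) : RobbaR p r) : Robba p).coe m = 1 * subCoeff (gamUnit a) 1 1 1 m :=
      lsub_single 1 1 m
    rw [e1, one_mul]
    cases m with
    | zero => simp [subCoeff, laur]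
    | succ m =>
      have := subCoeff_apply (gamUnit a) 1 1 1 m
      rw [zpow_one, gamUnit_coe, coeff_mk] at this
      rw [if_neg (Nat.succ_ne_zero m), ← this]
      congr 1
      simp [add_comm]
  have hneg : ∀ j : ℤ, ¬ 0 ≤ j → ((gamR r a (TR r) : RobbaR p r) : Robba p).coe j = 0 := by
    intro j hj
    have e1 : ((gamR r a (TR r) : RobbaR p r) : Robba p).coe j = 1 * subCoeff (gamUnit a) 1 1 1 j :=
      lsub_single 1 1 j
    rw [e1, one_mul, subCoeff, laur, if_neg]
    simp
    omega
  refine PowerSeries.ext fun i => ?_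
  have h1 : coeff i (iota ε r.2 hn (gamR r a (TR r))) = (∑' m : ℕ, algebraMap ℚ_[p] (Kn ε n)
      ((Ring.choose (a : ℤ_[p]) m : ℤ_[p]) : ℚ_[p]) * coeff i (iotaSer ε n ^ m)) - coeff i 1 := by
    have hs : Summable fun m : ℕ => algebraMap ℚ_[p] (Kn ε n)
        ((Ring.choose (a : ℤ_[p]) m : ℤ_[p]) : ℚ_[p]) * coeff i (iotaSer ε n ^ m) :=
      Summable.of_norm_bounded (summable_choose_iotaSer ε hn1 i)
        fun m => norm_choose_mul_le ε hn1 _ m i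
    rw [hs.tsum_eq_zero_add, iota_apply ε r.2 hn,
      ← Function.Injective.tsum_eq (g := fun m : ℕ => (m : ℤ)) Nat.cast_injective]
    · rw [Summable.tsum_eq_zero_add]
      · rw [hcoe, if_pos rfl, map_zero, zero_mul, zero_add]
        simp only [Ring.choose_zero_right, pow_zero]
        rw [PadicInt.coe_one, map_one, one_mul, add_sub_cancel_left]
        refine tsum_congr fun m => ?_
        rw [hcoe, if_neg (Nat.succ_ne_zero m), zpow_natCast, Units.val_pow_eq_pow_val, iotaUnit_coe]
      · exact (summable_iota ε r.2 hn (gamR r a (TR r)) i).comp_injective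
          (i := fun m : ℕ => (m : ℤ)) Nat.cast_injective
    · intro k hk
      by_contra hcon
      apply hk
      simp only [hneg k fun h => hcon ⟨k.toNat, by simp [h]⟩, map_zero, zero_mul]
  rw [h1, tsum_choose_iotaSer ε hn1, iotaSer, map_sub (gamPS ε n γ), map_one (gamPS ε n γ), map_sub,
    gamPS, RingHom.comp_apply, map_mul, map_mul, map_rescale_comm, map_exp, map_C, ← ha]
  congr 1
  have hres : rescale (algebraMap ℚ_[p] (Kn ε n) ((a : ℤ_[p]) : ℚ_[p])) (C ((gamK ε n γ : Kn ε n →+* Kn ε n) (epsK ε n))) = C ((gamK ε n γ : Kn ε n →+* Kn ε n) (epsK ε n)) := by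
    refine PowerSeries.ext fun j => ?_
    rw [coeff_rescale, coeff_C]
    split_ifs with hj <;> simp [hj]
  have e2 : (gamK ε n γ : Kn ε n →+* Kn ε n) (epsK ε n) = _ := gamK_epsK ε n γ
  rw [← ha] at e2
  have e3 : (gamK ε n γ : Kn ε n →+* Kn ε n) ((p : Kn ε n) ^ n)⁻¹ = ((p : Kn ε n) ^ n)⁻¹ := by
    rw [map_inv₀, map_pow, map_natCast]
  rw [hres, coeff_C_mul, coeff_rescale, e2, e3, coeff_rescale, coeff_rescale]

theorem iota_gamR (r : Radius p) {n : ℕ} (hn : nOf p r ≤ n) (γ : Gam p) (f : RobbaR p r) :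
    iota ε r.2 hn (gamR r (chi p γ) f) = gamPS ε n γ (iota ε r.2 hn f) := by
  have hT : iota ε r.2 hn (gamR r (chi p γ) (TR r)) = gamPS ε n γ (iota ε r.2 hn (TR r)) := by
    rw [iota_gamR_TR, iota_TR]
  have h2 := gam_radius_aux (p := p) (r := r) _ (radius_le_norm ε r.2 hn)
    (norm_eps_sub_one_lt ε n (one_le_of_nOf_le r.2 hn))
  refine PowerSeries.ext fun i => ?_
  refine HasSum.unique (hasSum_iota_subst ε r.2 hn zero_le_one (gamUnit_norm _)
    (gamUnit_bd _) (gamR r (chi p γ)) (fun _ => rfl) h2.1 h2.2 f i) ?_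
  set a := algebraMap ℚ_[p] (Kn ε n) (((chi p γ : ℤ_[p]ˣ) : ℤ_[p]) : ℚ_[p])
  have hgam : ∀ g : (Kn ε n)⟦X⟧, coeff i (gamPS ε n γ g) = a ^ i * gamK ε n γ (coeff i g) := by
    intro g
    rw [gamPS, RingHom.comp_apply, coeff_rescale, coeff_map]
    rfl
  have h3 := ((hasSum_iota ε r.2 hn f i).map (gamK ε n γ) (continuous_gamK ε n γ)).mul_left (a ^ i)
  rw [hgam]
  refine (congrArg (fun g => HasSum g _) (funext fun k => ?_)).mpr h3
  have h5 := hom_monR_eq ((iota ε r.2 hn).comp (gamR r (chi p γ)))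
    ((gamPS ε n γ).comp (iota ε r.2 hn)) hT k
  simp only [RingHom.comp_apply] at h5
  rw [h5, Function.comp_apply, map_mul, AlgHom.commutes, hgam]
  ring

/-! ### The image of `t` -/

theorem coeff_one_iota_t {r : ℝ} (hr : (p : ℝ) - 1 ≤ r) {n : ℕ} (hn : nOf p r ≤ n) :
    coeff 1 (iota ε hr hn ⟨tElt p, tElt_mem r⟩) = ((p : Kn ε n) ^ n)⁻¹ := by
  have hn1 := one_le_of_nOf_le hr hn
  have hlt := norm_eps_sub_one_lt ε n hn1
  have hc1 : coeff 1 (iotaSer ε n) = epsK ε n * ((p : Kn ε n) ^ n)⁻¹ := by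
    rw [iotaSer, map_sub, coeff_C_mul, coeff_rescale, coeff_exp, coeff_one]
    simp
  have hval : ∀ m : ℕ, algebraMap ℚ_[p] (Kn ε n) ((tElt p).coe (m + 1 : ℕ)) *
      coeff 1 (iotaSer ε n ^ (m + 1)) = (1 - epsK ε n) ^ m * (epsK ε n * ((p : Kn ε n) ^ n)⁻¹) := by
    intro m
    change algebraMap ℚ_[p] (Kn ε n) (laur (log ℚ_[p]) 0 1 (m + 1 : ℕ)) * _ = _
    rw [laur_zero_apply, if_pos (by omega), Int.toNat_natCast, coeff_log, if_neg (Nat.succ_ne_zero m),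
      coeff_one_pow, hc1, Nat.add_sub_cancel, constantCoeff_iotaSer]
    have hm : ((m + 1 : ℕ) : Kn ε n) ≠ 0 := by exact_mod_cast Nat.succ_ne_zero m
    have e1 : algebraMap ℚ_[p] (Kn ε n) (algebraMap ℚ ℚ_[p] ((-1) ^ (m + 1 + 1) / ((m + 1 : ℕ) : ℚ))) =
        (-1) ^ m / ((m + 1 : ℕ) : Kn ε n) := by
      rw [pow_succ, pow_succ]
      simp
    rw [e1, show (1 - epsK ε n) ^ m = (-1) ^ m * (epsK ε n - 1) ^ m by rw [← mul_pow]; ring]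
    field_simp
  rw [iota_apply ε hr hn, ← Function.Injective.tsum_eq (g := fun m : ℕ => (m : ℤ)) Nat.cast_injective]
  · rw [Summable.tsum_eq_zero_add]
    · simp only [zpow_natCast, Units.val_pow_eq_pow_val, iotaUnit_coe]
      have h0 : (tElt p).coe ((0 : ℕ) : ℤ) = 0 := by
        change laur (log ℚ_[p]) 0 1 ((0 : ℕ) : ℤ) = 0
        rw [laur_zero_apply]
        simp
      rw [h0, map_zero, zero_mul, zero_add, tsum_congr hval, tsum_mul_right, tsum_geometric_of_norm_lt_one
        (by rwa [norm_sub_rev]), sub_sub_cancel, inv_mul_cancel_left₀]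
      exact (epsK_prim ε n).ne_zero (pow_pos hp.1.pos n).ne'
    · exact (summable_iota ε hr hn ⟨tElt p, tElt_mem r⟩ 1).comp_injective
        (i := fun m : ℕ => (m : ℤ)) Nat.cast_injective
  · intro k hk
    by_contra hcon
    apply hk
    have h0 : ¬ 0 ≤ k := fun h => hcon ⟨k.toNat, by simp [h]⟩
    change algebraMap ℚ_[p] (Kn ε n) (laur (log ℚ_[p]) 0 1 k) * _ = _
    rw [laur_zero_apply, if_neg h0, map_zero, zero_mul]

/-- The image of `t` under a localization map is the variable, up to a unit. -/
theorem exists_iota_t (r : Radius p) {n : ℕ} (hn : nOf p r ≤ n) :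
    ∃ u : ((Kn ε n)⟦X⟧)ˣ, iota ε r.2 hn (tR r) = X * (u : (Kn ε n)⟦X⟧) := by
  obtain ⟨g, hg⟩ := iota_t_mem ε r.2 hn
  have h1 := coeff_one_iota_t ε r.2 hn
  rw [hg, ← zero_add 1, coeff_succ_X_mul] at h1
  have hu : IsUnit g := by
    rw [isUnit_iff_constantCoeff, ← coeff_zero_eq_constantCoeff_apply, h1]
    exact (inv_ne_zero (pow_ne_zero _ (by exact_mod_cast hp.1.ne_zero))).isUnit
  exact ⟨hu.unit, hg⟩

/-- The constant coefficient of the image of a polynomial is its value at `ε^(n) - 1`. -/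
theorem constantCoeff_iota_poly {r : ℝ} (hr : (p : ℝ) - 1 ≤ r) {n : ℕ} (hn : nOf p r ≤ n)
    (P : Polynomial ℚ_[p]) (hP : polyR p P ∈ RobbaR p r) :
    constantCoeff (iota ε hr hn ⟨polyR p P, hP⟩) = Polynomial.aeval (epsK ε n - 1) P := by
  have hmem : ∀ Q, polyR p Q ∈ RobbaR p r := fun Q => (isPlus_of_laur (polyR_coe Q)).mem r
  let f : Polynomial ℚ_[p] →+* RobbaR p r := (polyR p).codRestrict _ hmem
  have : ((constantCoeff (R := Kn ε n)).comp (iota ε hr hn)).comp f =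
      (Polynomial.aeval (epsK ε n - 1) : Polynomial ℚ_[p] →ₐ[ℚ_[p]] Kn ε n).toRingHom := by
    refine Polynomial.ringHom_ext (fun a => ?_) ?_
    · have e1 : f (Polynomial.C a) = monR r 0 a := Subtype.ext (polyR_C a)
      simp only [RingHom.comp_apply, e1]
      rw [iota_C, constantCoeff_C]
      exact (Polynomial.aeval_C _ _).symm
    · have e1 : f Polynomial.X = TR r := Subtype.ext polyR_X
      simp only [RingHom.comp_apply, e1]
      rw [iota_TR, constantCoeff_iotaSer]
      exact (Polynomial.aeval_X _).symm
  exact congrArg (fun g => g P) this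

end Localization

/-! ## The zeros of `t` -/

section ZerosOfT

variable {p : ℕ} [hp : Fact p.Prime]

theorem pow_sub_pow_le {x : ℝ} (hx : 1 < x) {m N : ℕ} (h : m ≤ N) :
    x * (x ^ N - x ^ m) ≤ (N - m : ℝ) * x ^ N * (x - 1) := by
  induction N, h using Nat.le_induction with
  | base => simp
  | succ N h ih =>
    have h1 : x ^ m ≤ x ^ N := pow_le_pow_right₀ hx.le h
    have h2 : (0 : ℝ) ≤ N - m := by
      rw [sub_nonneg]; exact_mod_cast h
    push_cast
    have e1 : x * (x ^ (N + 1) - x ^ m) = x * (x ^ N - x ^ m) + x ^ (N + 1) * (x - 1) := by ring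
    have e2 : ((N : ℝ) + 1 - m) * x ^ (N + 1) * (x - 1) =
      (N - m : ℝ) * x ^ N * (x - 1) + x ^ (N + 1) * (x - 1) + (N - m : ℝ) * x ^ N * (x - 1) * (x - 1) := by
      ring
    rw [e1, e2]
    have : 0 ≤ (N - m : ℝ) * x ^ N * (x - 1) * (x - 1) := by
      have : 0 ≤ x - 1 := by linarith
      positivity
    linarith

theorem le_pow_sub_pow {x : ℝ} (hx : 1 < x) {m N : ℕ} (h : N ≤ m) :
    (m - N : ℝ) * x ^ N * (x - 1) ≤ x ^ m - x ^ N := by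
  induction m, h using Nat.le_induction with
  | base => simp
  | succ m h ih =>
    have h1 : x ^ N ≤ x ^ m := pow_le_pow_right₀ hx.le h
    push_cast
    have : x ^ N * (x - 1) ≤ x ^ m * (x - 1) := mul_le_mul_of_nonneg_right h1 (by linarith)
    rw [pow_succ x m]
    nlinarith

theorem pow_padicValNat_le {i : ℕ} (hi : i ≠ 0) : (p : ℝ) ^ padicValNat p i ≤ i := by
  exact_mod_cast Nat.le_of_dvd (Nat.pos_of_ne_zero hi) pow_padicValNat_dvd

theorem valuation_bound {r : ℝ} {N : ℕ} (h1 : r ≤ (p : ℝ) ^ N * (p - 1))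
    (h2 : (p : ℝ) ^ N * (p - 1) ≤ p * r) {i : ℕ} (hi : i ≠ 0) :
    ((padicValNat p i : ℝ) - N) * r ≤ i - (p : ℝ) ^ N := by
  have hp1 := one_lt_p (p := p)
  have h3 := pow_padicValNat_le (p := p) hi
  set m := padicValNat p i
  rcases le_total m N with h | h
  · have h4 := pow_sub_pow_le hp1 h
    have h5 : (0 : ℝ) ≤ N - m := by rw [sub_nonneg]; exact_mod_cast h
    have h6 : p * ((p : ℝ) ^ N - p ^ m) ≤ p * ((N - m : ℝ) * r) := by
      refine h4.trans ?_
      rw [mul_assoc]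
      refine (mul_le_mul_of_nonneg_left h2 h5).trans (le_of_eq (by ring))
    have h7 := le_of_mul_le_mul_left h6 (by linarith)
    linarith
  · have h4 := le_pow_sub_pow hp1 h
    have h5 : (0 : ℝ) ≤ m - N := by rw [sub_nonneg]; exact_mod_cast h
    have := mul_le_mul_of_nonneg_left h1 h5
    linarith

theorem valuation_bound_lt {r : ℝ} {N : ℕ}
    (h2 : (p : ℝ) ^ N * (p - 1) < p * r) {i : ℕ} (hi : i ≠ 0) (hiN : i < p ^ N) :
    ((padicValNat p i : ℝ) - N) * r < i - (p : ℝ) ^ N := by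
  have hp1 := one_lt_p (p := p)
  have h3 := pow_padicValNat_le (p := p) hi
  set m := padicValNat p i
  have h : m < N := by
    by_contra hcon
    push Not at hcon
    have h4 : (p : ℝ) ^ N ≤ p ^ m := pow_le_pow_right₀ hp1.le hcon
    have h5 : (i : ℝ) < (p : ℝ) ^ N := by exact_mod_cast hiN
    linarith
  have h4 := pow_sub_pow_le hp1 h.le
  have h5 : (0 : ℝ) < N - m := by rw [sub_pos]; exact_mod_cast h
  have h6 : p * ((p : ℝ) ^ N - p ^ m) < p * ((N - m : ℝ) * r) := by
    refine h4.trans_lt ?_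
    rw [mul_assoc]
    refine (mul_lt_mul_of_pos_left h2 h5).trans_le (le_of_eq (by ring))
  have h7 := lt_of_mul_lt_mul_left h6 (by linarith)
  linarith

theorem valuation_bound_gt {r : ℝ} {N : ℕ} (hr : 0 < r) (h1 : r < (p : ℝ) ^ N * (p - 1))
    {i : ℕ} (hiN : p ^ N < i) : ((padicValNat p i : ℝ) - N) * r < i - (p : ℝ) ^ N := by
  have hp1 := one_lt_p (p := p)
  have h3 := pow_padicValNat_le (p := p) (show i ≠ 0 by omega)
  have h6 : (p : ℝ) ^ N < i := by exact_mod_cast hiN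
  set m := padicValNat p i
  rcases le_or_gt m N with h | h
  · have h5 : (m - N : ℝ) ≤ 0 := by rw [sub_nonpos]; exact_mod_cast h
    nlinarith
  · have h4 := le_pow_sub_pow hp1 h.le
    have h5 : (0 : ℝ) < m - N := by rw [sub_pos]; exact_mod_cast h
    have := mul_lt_mul_of_pos_left h1 h5
    linarith

theorem tElt_coe_of_nonpos {j : ℤ} (hj : j ≤ 0) : (tElt p).coe j = 0 := by
  change laur (log ℚ_[p]) 0 1 j = 0
  rw [laur_zero_apply]
  split_ifs with h
  · rw [show j = 0 by omega]
    simp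
  · rfl

theorem norm_tElt_coe {i : ℕ} (hi : i ≠ 0) : ‖(tElt p).coe i‖ = (p : ℝ) ^ padicValNat p i := by
  change ‖laur (log ℚ_[p]) 0 1 i‖ = _
  rw [laur_zero_apply, if_pos (by omega), Int.toNat_natCast, coeff_log, if_neg hi]
  simp only [eq_ratCast, Rat.cast_div, Rat.cast_pow, Rat.cast_neg, Rat.cast_one, Rat.cast_natCast,
    norm_div, norm_pow, norm_neg, norm_one, one_pow]
  have hn : (i : ℚ_[p]) ≠ 0 := by exact_mod_cast hi
  rw [Padic.norm_eq_zpow_neg_valuation hn, Padic.valuation_natCast, zpow_neg, one_div, inv_inv,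
    zpow_natCast]

theorem norm_tElt_term {r : ℝ} {i : ℕ} (hi : i ≠ 0) :
    ‖(tElt p).coe i‖ * ((p : ℝ) ^ (-1 / r)) ^ (i : ℤ) =
      (p : ℝ) ^ ((padicValNat p i : ℝ) - i / r) := by
  have hp0 : (0 : ℝ) < p := by linarith [one_lt_p (p := p)]
  rw [norm_tElt_coe hi, zpow_natCast, ← Real.rpow_natCast _ i, ← Real.rpow_mul hp0.le,
    ← Real.rpow_natCast, ← Real.rpow_add hp0]
  congr 1
  ring

theorem norm_tElt_term_nonpos (ρ : ℝ) {j : ℤ} (hj : j ≤ 0) : ‖(tElt p).coe j‖ * ρ ^ j = 0 := by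
  rw [tElt_coe_of_nonpos hj]; simp

theorem norm_tElt_term_pow {r : ℝ} (N : ℕ) :
    ‖(tElt p).coe ((p ^ N : ℕ) : ℤ)‖ * ((p : ℝ) ^ (-1 / r)) ^ ((p ^ N : ℕ) : ℤ) =
      (p : ℝ) ^ ((N : ℝ) - (p : ℝ) ^ N / r) := by
  rw [norm_tElt_term (pow_pos hp.1.pos N).ne', padicValNat.prime_pow]
  push_cast
  rfl

theorem tElt_dominant {r r' : ℝ} (hr : 0 < r) (hr' : 0 < r') {N b : ℕ}
    (h1 : r ≤ (p : ℝ) ^ N * (p - 1)) (h2 : (p : ℝ) ^ N * (p - 1) < p * r)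
    (h3 : r' < (p : ℝ) ^ b * (p - 1)) (h4 : (p : ℝ) ^ b * (p - 1) ≤ p * r') :
    Dominant ((p : ℝ) ^ (-1 / r)) ((p : ℝ) ^ (-1 / r')) (tElt p).coe (p ^ N : ℕ) (p ^ b : ℕ) := by
  have hp1 := one_lt_p (p := p)
  have hne : ∀ m : ℕ, (tElt p).coe ((p ^ m : ℕ) : ℤ) ≠ 0 := by
    intro m
    rw [← norm_pos_iff, norm_tElt_coe (pow_pos hp.1.pos m).ne']
    positivity
  have hexp : ∀ {s : ℝ} (hs : 0 < s) {v M : ℝ} {i q : ℝ}, (v - M) * s ≤ i - q →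
      v - i / s ≤ M - q / s := by
    intro s hs v M i q h
    rw [← le_div_iff₀ hs, sub_div] at h
    linarith
  have hexp' : ∀ {s : ℝ} (hs : 0 < s) {v M : ℝ} {i q : ℝ}, (v - M) * s < i - q →
      v - i / s < M - q / s := by
    intro s hs v M i q h
    rw [← lt_div_iff₀ hs, sub_div] at h
    linarith
  refine ⟨hne N, hne b, fun j => ?_, fun j => ?_, fun j hj => ?_, fun j hj => ?_⟩
  · rcases le_or_gt j 0 with h | h
    · rw [norm_tElt_term_nonpos _ h]; positivity
    · obtain ⟨i, rfl⟩ := Int.eq_ofNat_of_zero_le h.le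
      have hi : i ≠ 0 := by omega
      rw [norm_tElt_term hi, norm_tElt_term_pow]
      exact Real.rpow_le_rpow_of_exponent_le hp1.le (hexp hr (valuation_bound h1 h2.le hi))
  · rcases le_or_gt j 0 with h | h
    · rw [norm_tElt_term_nonpos _ h]; positivity
    · obtain ⟨i, rfl⟩ := Int.eq_ofNat_of_zero_le h.le
      have hi : i ≠ 0 := by omega
      rw [norm_tElt_term hi, norm_tElt_term_pow]
      exact Real.rpow_le_rpow_of_exponent_le hp1.le (hexp hr' (valuation_bound h3.le h4 hi))
  · rcases le_or_gt j 0 with h | h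
    · rw [norm_tElt_term_nonpos _ h, norm_tElt_term_pow]; positivity
    · obtain ⟨i, rfl⟩ := Int.eq_ofNat_of_zero_le h.le
      have hi : i ≠ 0 := by omega
      rw [norm_tElt_term hi, norm_tElt_term_pow]
      exact Real.rpow_lt_rpow_of_exponent_lt hp1
        (hexp' hr (valuation_bound_lt h2 hi (by exact_mod_cast hj)))
  · obtain ⟨i, rfl⟩ := Int.eq_ofNat_of_zero_le (show 0 ≤ j by omega)
    have hi : i ≠ 0 := by
      have := pow_pos hp.1.pos b
      omega
    rw [norm_tElt_term hi, norm_tElt_term_pow]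
    exact Real.rpow_lt_rpow_of_exponent_lt hp1
      (hexp' hr' (valuation_bound_gt hr' h3 (by exact_mod_cast hj)))

/-! ### The radii of the points `ε^(n) - 1` -/

theorem nOf_le_iff {r : ℝ} (hr : (p : ℝ) - 1 ≤ r) {n : ℕ} :
    nOf p r ≤ (n + 1 : ℕ) ↔ r ≤ (p : ℝ) ^ n * (p - 1) := by
  have hp1 := one_lt_p (p := p)
  have hr0 : 0 < r := by linarith
  unfold nOf
  push_cast
  rw [add_le_add_iff_right, div_le_iff₀ (Real.log_pos hp1), ← Real.log_pow,
    Real.log_le_log_iff (div_pos hr0 (by linarith)) (by positivity), div_le_iff₀ (by linarith)]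

theorem one_le_nMin (r : Radius p) : 1 ≤ nMin p r :=
  one_le_of_nOf_le r.2 (Nat.le_ceil (nOf p r))

theorem nOf_le_nMin (r : Radius p) : nOf p r ≤ nMin p r := Nat.le_ceil (nOf p r)

theorem nMin_radius (r : Radius p) : ∃ N : ℕ, nMin p r = N + 1 ∧ (r : ℝ) ≤ (p : ℝ) ^ N * (p - 1) ∧
    (p : ℝ) ^ N * (p - 1) < p * r := by
  have hp1 := one_lt_p (p := p)
  obtain ⟨N, hN⟩ := Nat.exists_eq_add_of_le' (one_le_nMin r)
  refine ⟨N, hN, (nOf_le_iff r.2).1 (by rw [← hN]; exact nOf_le_nMin r), ?_⟩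
  cases N with
  | zero =>
    have h1 := r.2
    rw [pow_zero, one_mul]
    nlinarith
  | succ N =>
    have h1 : ¬ nOf p r ≤ (N + 1 : ℕ) := by
      intro h
      have := nMin_le h
      omega
    rw [nOf_le_iff r.2, not_le] at h1
    rw [pow_succ']
    nlinarith

theorem norm_eps_sub_one_pow (ε : EpsSeq p) (n : ℕ) :
    ‖epsK ε (n + 1) - 1‖ ^ (p ^ n * (p - 1)) = (p : ℝ)⁻¹ := by
  refine le_antisymm ?_ (by simpa using inv_le_norm_pow ε (n + 1) (by omega))
  rw [← prod_norm ε (n + 1) (by omega), ← Nat.totient_prime_pow_succ hp.1,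
    ← (epsK_prim ε (n + 1)).card_primitiveRoots, ← Finset.prod_const]
  refine Finset.prod_le_prod (fun _ _ => norm_nonneg _) fun μ hμ => ?_
  have hpos := pow_pos hp.1.pos (n + 1)
  rw [mem_primitiveRoots hpos] at hμ
  have : NeZero (p ^ (n + 1)) := ⟨hpos.ne'⟩
  obtain ⟨i, -, hi⟩ := hμ.eq_pow_of_pow_eq_one (epsK_prim ε (n + 1)).pow_eq_one
  rw [← hi]
  refine norm_pow_sub_one_le ?_ i
  have h := congrArg norm hμ.pow_eq_one
  rw [norm_pow, norm_one] at h
  exact (pow_eq_one_iff_of_nonneg (norm_nonneg _) hpos.ne').1 h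

theorem norm_eps_sub_one (ε : EpsSeq p) (n : ℕ) :
    ‖epsK ε (n + 1) - 1‖ = (p : ℝ) ^ (-1 / ((p : ℝ) ^ n * (p - 1))) := by
  have hp1 := one_lt_p (p := p)
  have h1 := norm_eps_sub_one_pow ε n
  have hN : ((p ^ n * (p - 1) : ℕ) : ℝ) = (p : ℝ) ^ n * (p - 1) := by
    rw [Nat.cast_mul, Nat.cast_sub hp.1.one_le]; push_cast; ring
  have hN0 : (0 : ℝ) < (p : ℝ) ^ n * (p - 1) := mul_pos (by positivity) (by linarith)
  have hne : (p ^ n * (p - 1) : ℕ) ≠ 0 := by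
    intro h; rw [h] at hN; simp only [Nat.cast_zero] at hN; linarith
  refine (pow_left_inj₀ (norm_nonneg _) (by positivity) hne).1 ?_
  rw [h1, ← Real.rpow_natCast, ← Real.rpow_mul (by positivity), hN, div_mul_cancel₀ _ hN0.ne',
    Real.rpow_neg_one]

theorem rpow_neg_inv_le {r r' : ℝ} (h0 : 0 < r) (h : r ≤ r') :
    (p : ℝ) ^ (-1 / r) ≤ (p : ℝ) ^ (-1 / r') := by
  refine Real.rpow_le_rpow_of_exponent_le (one_lt_p (p := p)).le ?_
  rw [div_le_div_iff₀ h0 (h0.trans_le h)]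
  linarith

theorem tendsto_radius : Tendsto (fun r : ℝ => (p : ℝ) ^ (-1 / r)) atTop (𝓝 1) := by
  have h1 : Tendsto (fun r : ℝ => -1 / r) atTop (𝓝 0) := tendsto_const_nhds.div_atTop tendsto_id
  have h2 := (Real.continuous_const_rpow (a := (p : ℝ)) (by
    have := one_lt_p (p := p); positivity)).tendsto 0
  rw [Real.rpow_zero] at h2
  exact h2.comp h1

theorem tendsto_pow_mul_sub_one : Tendsto (fun b : ℕ => (p : ℝ) ^ b * (p - 1)) atTop atTop :=
  (tendsto_pow_atTop_atTop_of_one_lt one_lt_p).atTop_mul_const (by linarith [one_lt_p (p := p)])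

/-! ### Divisibility by `t` -/

theorem coeff_zero_evalSer {F : Type*} [NormedField F] (V : (F⟦X⟧)ˣ) (f : ℤ → F) :
    constantCoeff (evalSer V f) = ∑' k : ℤ, f k * constantCoeff (V : F⟦X⟧) ^ k := by
  rw [← coeff_zero_eq_constantCoeff_apply, evalSer, coeff_mk]
  refine tsum_congr fun k => ?_
  congr 1
  have : Units.map (constantCoeff (R := F) : F⟦X⟧ →* F) V ^ k =
    Units.map (constantCoeff (R := F) : F⟦X⟧ →* F) (V ^ k) := (map_zpow _ _ _).symm
  have h2 := congrArg (Units.val) this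
  rw [Units.val_zpow_eq_zpow_val] at h2
  rw [coeff_zero_eq_constantCoeff_apply]
  exact h2.symm

theorem lmul_algebraMap {F : Type*} [NormedField F] [Algebra ℚ_[p] F]
    (hF : ∀ a : ℚ_[p], ‖algebraMap ℚ_[p] F a‖ = ‖a‖) {ρ : ℝ} (hρ : 0 < ρ) {f g : ℤ → ℚ_[p]}
    (hf : ConvAt ρ f) (hg : ConvAt ρ g) :
    (fun k => algebraMap ℚ_[p] F (lmul f g k)) =
      lmul (fun k => algebraMap ℚ_[p] F (f k)) (fun k => algebraMap ℚ_[p] F (g k)) := by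
  funext k
  have := (summable_lmul hρ hf hg k).hasSum.map (algebraMap ℚ_[p] F)
    (AddMonoidHomClass.isometry_of_norm (algebraMap ℚ_[p] F) hF).continuous
  refine Eq.trans this.tsum_eq.symm ?_
  unfold lmul
  exact tsum_congr fun i => by simp

/-- An element of `R^r` vanishing at all the points `ε^(n) - 1` with `n ≥ n(r)` is a multiple
of `t`. -/
theorem tR_dvd_of_constantCoeff (ε : EpsSeq p) (r : Radius p) (f : RobbaR p r)
    (h : ∀ (n : ℕ) (hn : nOf p r ≤ n), constantCoeff (iota ε r.2 hn f) = 0) : tR r ∣ f := by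
  have hp1 := one_lt_p (p := p)
  obtain ⟨N, hN, hN1, hN2⟩ := nMin_radius r
  refine dvd_of_dvd_laur f (tR r) (tR_ne_zero r) fun ρ hρ => ?_
  obtain ⟨b, hb, hbN⟩ : ∃ b : ℕ, ρ ≤ (p : ℝ) ^ (-1 / ((p : ℝ) ^ b * (p - 1))) ∧ N ≤ b := by
    have h1 := (tendsto_radius (p := p)).comp (tendsto_pow_mul_sub_one (p := p))
    obtain ⟨b, hb⟩ := ((h1.eventually (eventually_ge_nhds hρ)).and (eventually_ge_atTop N)).exists
    exact ⟨b, hb⟩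
  have hb0 : ∀ b : ℕ, (0 : ℝ) < (p : ℝ) ^ b * (p - 1) := fun b =>
    mul_pos (by positivity) (by linarith)
  have hmono : ∀ {a b : ℕ}, a ≤ b → (p : ℝ) ^ a * (p - 1) ≤ (p : ℝ) ^ b * (p - 1) := by
    intro a b hab
    exact mul_le_mul_of_nonneg_right (pow_le_pow_right₀ hp1.le hab) (by linarith)
  have h12 : (p : ℝ) ^ (-1 / (r : ℝ)) ≤ (p : ℝ) ^ (-1 / ((p : ℝ) ^ b * (p - 1))) :=
    rpow_neg_inv_le r.pos (hN1.trans (hmono hbN))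
  have h2 := radius_lt_one (p := p) (hb0 b)
  refine ⟨_, hb, h12, h2, ?_⟩
  set S := icc (radius_pos p r) h12 with hS
  have hdom : Dominant ((p : ℝ) ^ (-1 / (r : ℝ))) ((p : ℝ) ^ (-1 / ((p : ℝ) ^ b * (p - 1))))
      (toLaur r S (icc_radius h12 h2) (tR r)).coe (p ^ N : ℕ) (p ^ (b + 1) : ℕ) := by
    refine tElt_dominant r.pos (hb0 b) hN1 hN2 ?_ ?_
    · rw [pow_succ]; nlinarith [hb0 b]
    · rw [pow_succ]; nlinarith [hb0 b]
  obtain ⟨q, s, hqs, hs⟩ := weierstrass_division _ hdom (toLaur r S (icc_radius h12 h2) f)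
  suffices hs0 : s = 0 by
    rw [hs0, add_zero] at hqs
    exact ⟨q, hqs⟩
  set M := p ^ (b + 1) - p ^ N with hM
  have hle : p ^ N ≤ p ^ (b + 1) := Nat.pow_le_pow_right hp.1.pos (by omega)
  let P : Polynomial ℚ_[p] := ∑ i ∈ Finset.range M, Polynomial.monomial i (s.coe ((p ^ N : ℕ) + i))
  have hPc : ∀ i < M, P.coeff i = s.coe ((p ^ N : ℕ) + i) := by
    intro i hi
    simp only [P, Polynomial.finsetSum_coeff, Polynomial.coeff_monomial]
    rw [Finset.sum_ite_eq' , if_pos (Finset.mem_range.2 hi)]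
  have hP0 : P = 0 := by
    refine eq_zero_of_roots ε (a := N) (b := b + 1) (by omega) (fun n hn1 hn2 => ?_) ?_
    · have hn : nOf p r ≤ n := (nOf_le_nMin r).trans (by rw [hN]; exact_mod_cast hn1)
      have hn1' := one_le_of_nOf_le r.2 hn
      obtain ⟨m, rfl⟩ := Nat.exists_eq_add_of_le' hn1'
      set α := ‖epsK ε (m + 1) - 1‖ with hα
      have hαpos : 0 < α := norm_eps_sub_one_pos ε hn1'
      have hαS : α ∈ S.1 := by
        refine ⟨radius_le_norm ε r.2 hn, ?_⟩
        rw [hα, norm_eps_sub_one]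
        exact rpow_neg_inv_le (hb0 m) (hmono (by omega))
      let V := iotaUnit ε hn1'
      let a : ℚ_[p] → Kn ε (m + 1) := algebraMap ℚ_[p] (Kn ε (m + 1))
      have hF := norm_algebraMap_Kn ε (m + 1)
      have hV0 : ‖constantCoeff (V : (Kn ε (m + 1))⟦X⟧)‖ = α := by
        rw [iotaUnit_coe, constantCoeff_iotaSer]
      have hVb : Bd α ((p : ℝ) ^ (m + 1 + 1) / α) (V : (Kn ε (m + 1))⟦X⟧) := by
        rw [iotaUnit_coe]; exact iotaSer_bd ε hn1'
      have hconv : ∀ g : LaurRing ℚ_[p] S, ConvAt α fun k => a (g.coe k) := by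
        intro g
        refine (g.conv hαS).congr fun k => ?_
        rw [hF]
      have e1 : (fun k => a ((f : Robba p).coe k)) =
          lmul (fun k => a ((tElt p).coe k)) (fun k => a (q.coe k)) + fun k => a (s.coe k) := by
        have h5 := lmul_algebraMap hF hαpos ((tR r).2 _ (radius_le_norm ε r.2 hn)
          (norm_eps_sub_one_lt ε _ hn1')) (q.conv hαS)
        refine Eq.trans (funext fun k => ?_) (congrArg (· + fun k => a (s.coe k)) h5)
        have := congrArg (fun g : LaurRing ℚ_[p] S => a (g.coe k)) hqs
        exact this.trans (map_add (algebraMap ℚ_[p] (Kn ε (m + 1))) _ _)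
      have hαM : (0 : ℝ) ≤ (p : ℝ) ^ (m + 1 + 1) / α := by positivity
      have ht : ConvAt α fun k => a ((tElt p).coe k) := hconv (toLaur r S (icc_radius h12 h2) (tR r))
      have e2 : constantCoeff (evalSer V _) = constantCoeff (evalSer V _) :=
        congrArg (fun g => constantCoeff (evalSer V g)) e1
      rw [evalSer_add hαpos hαM V hV0 hVb (ConvAt.lmul hαpos ht (hconv q)) (hconv s),
        evalSer_lmul hαpos hαM V hV0 hVb ht (hconv q), map_add, map_mul] at e2
      have e3 : constantCoeff (evalSer V fun k => a ((f : Robba p).coe k)) = 0 := h _ hn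
      have e4 : constantCoeff (evalSer V fun k => a ((tElt p).coe k)) = 0 :=
        constantCoeff_iota_t ε r.2 hn
      rw [e3, e4, zero_mul, zero_add, coeff_zero_evalSer] at e2
      have hV0' : constantCoeff (V : (Kn ε (m + 1))⟦X⟧) = epsK ε (m + 1) - 1 := by
        rw [iotaUnit_coe, constantCoeff_iotaSer]
      rw [hV0'] at e2
      have hne := eps_sub_one_ne_zero ε hn1'
      have e5 : ∑' k : ℤ, a (s.coe k) * (epsK ε (m + 1) - 1) ^ k =
          (epsK ε (m + 1) - 1) ^ (p ^ N) * Polynomial.aeval (epsK ε (m + 1) - 1) P := by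
        rw [tsum_eq_sum (s := (Finset.range M).image fun i : ℕ => ((p ^ N : ℕ) : ℤ) + i)]
        · rw [Finset.sum_image (fun x _ y _ hxy => by simpa using hxy)]
          simp only [P, map_sum, Polynomial.aeval_monomial, Finset.mul_sum]
          refine Finset.sum_congr rfl fun i _ => ?_
          rw [zpow_add₀ hne, zpow_natCast, zpow_natCast]
          ring
        · intro k hk
          suffices hk0 : k < (p ^ N : ℕ) ∨ ((p ^ (b + 1) : ℕ) : ℤ) ≤ k by
            change algebraMap ℚ_[p] (Kn ε (m + 1)) (s.coe k) * _ = 0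
            rw [hs k hk0, map_zero, zero_mul]
          by_contra hcon
          push Not at hcon
          refine hk (Finset.mem_image.2 ⟨(k - (p ^ N : ℕ)).toNat, ?_, ?_⟩)
          · rw [Finset.mem_range]; omega
          · omega
      rw [e5] at e2
      have e6 : Polynomial.aeval (epsK ε (m + 1) - 1) P = 0 := by
        rcases mul_eq_zero.1 e2.symm with h | h
        · exact absurd h (pow_ne_zero _ hne)
        · exact h
      have e7 := congrArg (fun x : Kn ε (m + 1) => (x : PadicAlgCl p)) e6
      have e8 := Polynomial.aeval_algHom_apply (Kn ε (m + 1)).val (epsK ε (m + 1) - 1) P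
      exact e8.trans e7
    · refine (Polynomial.degree_sum_le _ _).trans_lt ?_
      rw [Finset.sup_lt_iff (by exact WithBot.bot_lt_coe _)]
      intro i hi
      exact (Polynomial.degree_monomial_le _ _).trans_lt (by exact_mod_cast Finset.mem_range.1 hi)
  refine LaurRing.ext (funext fun j => ?_)
  by_cases hj : j < (p ^ N : ℕ) ∨ ((p ^ (b + 1) : ℕ) : ℤ) ≤ j
  · exact hs j hj
  · push Not at hj
    have h3 := hPc (j - (p ^ N : ℕ)).toNat (by omega)
    rw [hP0, Polynomial.coeff_zero, show (((p ^ N : ℕ) : ℤ) + ((j - (p ^ N : ℕ)).toNat : ℤ)) = j by omega]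
      at h3
    exact h3.symm

end ZerosOfT

/-! ## Interpolation at the zeros of `t` -/

section Interpolation

variable {p : ℕ} [hp : Fact p.Prime]

theorem norm_coeff_cyclotomic_comp (n : ℕ) :
    ((Polynomial.cyclotomic (p ^ (n + 1)) ℚ_[p]).comp (Polynomial.X + 1)).coeff 0 = p ∧
    (∀ i < p ^ n * (p - 1), ‖((Polynomial.cyclotomic (p ^ (n + 1)) ℚ_[p]).comp
      (Polynomial.X + 1)).coeff i‖ ≤ (p : ℝ)⁻¹) ∧
    ((Polynomial.cyclotomic (p ^ (n + 1)) ℚ_[p]).comp (Polynomial.X + 1)).coeff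
      (p ^ n * (p - 1)) = 1 ∧
    ∀ i > p ^ n * (p - 1), ((Polynomial.cyclotomic (p ^ (n + 1)) ℚ_[p]).comp
      (Polynomial.X + 1)).coeff i = 0 := by
  set f := ((Polynomial.cyclotomic (p ^ (n + 1)) ℤ).comp (Polynomial.X + 1)) with hf
  have hE := cyclotomic_prime_pow_comp_X_add_one_isEisensteinAt p n
  rw [← hf] at hE
  have hX : (Polynomial.X + 1 : Polynomial ℤ) = Polynomial.X + Polynomial.C 1 := by simp
  have hmon : f.Monic := by
    rw [hf, hX]
    exact (Polynomial.cyclotomic.monic _ ℤ).comp_X_add_C 1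
  have hdeg : f.natDegree = p ^ n * (p - 1) := by
    rw [hf, Polynomial.natDegree_comp, Polynomial.natDegree_cyclotomic, hX,
      Polynomial.natDegree_X_add_C, mul_one, Nat.totient_prime_pow_succ hp.1]
  have h0 : f.coeff 0 = p := by
    rw [hf, Polynomial.coeff_zero_eq_eval_zero, Polynomial.eval_comp]
    simp [Polynomial.eval_one_cyclotomic_prime_pow]
  have hmap : (Polynomial.cyclotomic (p ^ (n + 1)) ℚ_[p]).comp (Polynomial.X + 1) =
      f.map (Int.castRingHom ℚ_[p]) := by
    rw [hf, Polynomial.map_comp, Polynomial.map_cyclotomic]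
    simp
  rw [hmap]
  simp only [Polynomial.coeff_map]
  refine ⟨by rw [h0]; simp, fun i hi => ?_, ?_, fun i hi => ?_⟩
  · rw [← hdeg] at hi
    have := hE.mem hi
    erw [Ideal.mem_span_singleton] at this
    obtain ⟨c, hc⟩ := this
    rw [hc]
    simp only [map_mul, map_natCast, norm_mul, eq_intCast, Padic.norm_p]
    exact mul_le_of_le_one_right (by positivity) (Padic.norm_int_le_one c)
  · rw [← hdeg, hmon.coeff_natDegree, map_one]
  · rw [Polynomial.coeff_eq_zero_of_natDegree_lt (by rw [hdeg]; exact hi), map_zero]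

/-- The radius of a disc that contains `ε^(n+1) - 1`, and that tends to `1`. -/
def discRadius (p : ℕ) (n : ℕ) : ℝ := (p : ℝ) ^ (-1 / ((p : ℝ) ^ n * (p - 1) / 2))

theorem discRadius_pos (n : ℕ) : 0 < discRadius p n :=
  Real.rpow_pos_of_pos (by exact_mod_cast hp.1.pos) _

theorem discRadius_lt_one (n : ℕ) : discRadius p n < 1 := by
  have hp1 := one_lt_p (p := p)
  exact radius_lt_one (p := p) (half_pos (mul_pos (by positivity) (by linarith)))

theorem discRadius_pow (n : ℕ) : discRadius p n ^ (p ^ n * (p - 1)) = ((p : ℝ)⁻¹) ^ 2 := by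
  have hp1 := one_lt_p (p := p)
  have hN : ((p ^ n * (p - 1) : ℕ) : ℝ) = (p : ℝ) ^ n * (p - 1) := by
    rw [Nat.cast_mul, Nat.cast_sub hp.1.one_le]; push_cast; ring
  have hN0 : (0 : ℝ) < (p : ℝ) ^ n * (p - 1) := mul_pos (by positivity) (by linarith)
  rw [discRadius, ← Real.rpow_natCast, ← Real.rpow_mul (by positivity), hN, inv_pow,
    ← Real.rpow_natCast _ 2, ← Real.rpow_neg (by positivity)]
  congr 1
  rw [div_div_eq_mul_div, div_mul_cancel₀ _ hN0.ne']
  push_cast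
  ring

theorem tendsto_discRadius : Tendsto (discRadius p) atTop (𝓝 1) :=
  (tendsto_radius (p := p)).comp ((tendsto_pow_mul_sub_one (p := p)).atTop_div_const two_pos)

theorem Bd.pow {F : Type*} [NormedField F] [IsUltrametricDist F] {c M : ℝ} (hc : 0 ≤ c)
    (hM : 0 ≤ M) {g : F⟦X⟧} (h : Bd c M g) (m : ℕ) : Bd (c ^ m) M (g ^ m) := by
  induction m with
  | zero => simpa using Bd.one hM
  | succ m ih => rw [pow_succ, pow_succ]; exact Bd.mul (by positivity) hc hM ih h

theorem exists_bd_polynomial {M : ℝ} (hM : 0 < M) (P : Polynomial ℚ_[p]) :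
    ∃ c, 0 ≤ c ∧ Bd c M (P : ℚ_[p]⟦X⟧) := by
  refine ⟨∑ i ∈ P.support, ‖P.coeff i‖ / M ^ i, by positivity, fun i => ?_⟩
  rw [Polynomial.coeff_coe]
  by_cases hi : i ∈ P.support
  · rw [← div_le_iff₀ (by positivity)]
    exact Finset.single_le_sum (f := fun i => ‖P.coeff i‖ / M ^ i) (fun _ _ => by positivity) hi
  · rw [Polynomial.notMem_support_iff.1 hi, norm_zero]
    positivity

variable (ε : EpsSeq p)

/-- There is a polynomial that takes a given value at `ε^(n+1) - 1`, vanishes at the points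
`ε^(l) - 1` with `l ≤ n`, and is small on a disc. -/
theorem exists_small_polynomial (n : ℕ) (y : Kn ε (n + 1)) {δ : ℝ} (hδ : 0 < δ) :
    ∃ P : Polynomial ℚ_[p], Polynomial.aeval (epsK ε (n + 1) - 1) P = y ∧
      (∀ l ≤ n, Polynomial.aeval (epsK ε l - 1) P = 0) ∧
      ∀ i, ‖P.coeff i‖ * discRadius p n ^ i ≤ δ := by
  have hp1 := one_lt_p (p := p)
  set ρ := discRadius p n with hρ
  have hρ0 : 0 < ρ := discRadius_pos n
  have hρ1 : ρ < 1 := discRadius_lt_one n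
  obtain ⟨hc0, hc1, hc2, hc3⟩ := norm_coeff_cyclotomic_comp (p := p) n
  set Φ := (Polynomial.cyclotomic (p ^ (n + 1)) ℚ_[p]).comp (Polynomial.X + 1) with hΦ
  set N := p ^ n * (p - 1) with hN
  have hN0 : 0 < N := Nat.mul_pos (pow_pos hp.1.pos _) (by have := hp.1.two_le; omega)
  set G : Polynomial ℚ_[p] := 1 - Polynomial.C (p : ℚ_[p])⁻¹ * Φ with hG
  have hpn : (p : ℚ_[p]) ≠ 0 := by exact_mod_cast hp.1.ne_zero
  set θ := max ρ (p : ℝ)⁻¹ with hθ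
  have hθ0 : 0 < θ := lt_max_of_lt_left hρ0
  have hθ1 : θ < 1 := max_lt hρ1 (inv_lt_one_of_one_lt₀ hp1)
  have hGb : Bd θ ρ⁻¹ (G : ℚ_[p]⟦X⟧) := by
    intro i
    rw [Polynomial.coeff_coe, inv_pow, ← div_eq_mul_inv, le_div_iff₀ (by positivity)]
    rcases Nat.eq_zero_or_pos i with rfl | hi
    · rw [hG, Polynomial.coeff_sub, Polynomial.coeff_C_mul, hc0, inv_mul_cancel₀ hpn]
      simpa using hθ0.le
    · rw [hG, Polynomial.coeff_sub, Polynomial.coeff_C_mul, Polynomial.coeff_one,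
        if_neg (by omega), zero_sub, norm_neg, norm_mul, norm_inv, Padic.norm_p, inv_inv]
      rcases lt_trichotomy i N with h | h | h
      · refine le_trans ?_ (le_max_left _ _)
        have h2 : (p : ℝ) * ‖Φ.coeff i‖ ≤ 1 := by
          refine (mul_le_mul_of_nonneg_left (hc1 i h) (by positivity)).trans (le_of_eq ?_)
          exact mul_inv_cancel₀ (by positivity)
        refine (mul_le_mul_of_nonneg_right h2 (by positivity)).trans ?_
        rw [one_mul]
        exact pow_le_of_le_one hρ0.le hρ1.le (by omega)
      · refine le_trans (le_of_eq ?_) (le_max_right _ _)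
        rw [h, hc2, norm_one, mul_one, hρ, hN, discRadius_pow, sq, ← mul_assoc,
          mul_inv_cancel₀ (by positivity), one_mul]
      · rw [hc3 i h]
        simpa using hθ0.le
  have hGe : Polynomial.aeval (epsK ε (n + 1) - 1) G = 1 := by
    have h1 : Polynomial.aeval (epsK ε (n + 1) - 1) Φ = 0 := by
      rw [hΦ, Polynomial.aeval_comp, map_add, map_one, Polynomial.aeval_X, sub_add_cancel,
        Polynomial.aeval_def, ← Polynomial.eval_map, Polynomial.map_cyclotomic]
      exact (epsK_prim ε (n + 1)).isRoot_cyclotomic (pow_pos hp.1.pos _)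
    rw [hG, map_sub, map_mul, h1, mul_zero, sub_zero, map_one]
  set E : Polynomial ℚ_[p] := (1 + Polynomial.X) ^ p ^ n - 1 with hE
  have hEe : ∀ l, Polynomial.aeval (epsK ε l - 1) E = epsK ε l ^ p ^ n - 1 := by
    intro l
    rw [hE, map_sub, map_pow, map_add, map_one, Polynomial.aeval_X, add_sub_cancel]
  have hE1 : Polynomial.aeval (epsK ε (n + 1) - 1) E ≠ 0 := by
    rw [hEe, sub_ne_zero]
    intro h
    have := (epsK_prim ε (n + 1)).dvd_of_pow_eq_one _ h
    exact absurd (Nat.le_of_dvd (pow_pos hp.1.pos _) this)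
      (not_le.2 (Nat.pow_lt_pow_right hp.1.one_lt (Nat.lt_succ_self n)))
  obtain ⟨Q, hQ⟩ := (mem_Kn_iff ε).1 (y * (Polynomial.aeval (epsK ε (n + 1) - 1) E)⁻¹).2
  set Q' := Q.comp (Polynomial.X + 1) with hQ'
  have hQe : Polynomial.aeval (epsK ε (n + 1) - 1) Q' =
      y * (Polynomial.aeval (epsK ε (n + 1) - 1) E)⁻¹ := by
    rw [hQ', Polynomial.aeval_comp, map_add, map_one, Polynomial.aeval_X, sub_add_cancel]
    refine Subtype.ext (Eq.trans ?_ hQ)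
    exact (Polynomial.aeval_algHom_apply (Kn ε (n + 1)).val (epsK ε (n + 1)) Q).symm
  obtain ⟨c, hc, hcb⟩ := exists_bd_polynomial (inv_pos.2 hρ0) (Q' * E)
  obtain ⟨m, hm⟩ : ∃ m : ℕ, c * θ ^ m ≤ δ := by
    have := (tendsto_pow_atTop_nhds_zero_of_lt_one hθ0.le hθ1).const_mul c
    rw [mul_zero] at this
    exact (this.eventually (eventually_le_nhds hδ)).exists
  refine ⟨Q' * E * G ^ m, ?_, fun l hl => ?_, fun i => ?_⟩
  · rw [map_mul, map_mul, map_pow, hGe, one_pow, mul_one, hQe, inv_mul_cancel_right₀ hE1]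
  · obtain ⟨a, rfl⟩ := Nat.exists_eq_add_of_le hl
    rw [map_mul, map_mul, hEe, pow_add, pow_mul, (epsK_prim ε l).pow_eq_one, one_pow, sub_self,
      mul_zero, zero_mul]
  · have h1 := (hcb.mul hc (by positivity) (by positivity)
      (hGb.pow hθ0.le (by positivity) m)) i
    rw [← Polynomial.coe_pow, ← Polynomial.coe_mul, Polynomial.coeff_coe, inv_pow,
      ← div_eq_mul_inv, le_div_iff₀ (by positivity)] at h1
    exact h1.trans hm

theorem exists_polynomial_seq (y : ∀ n, Kn ε n) : ∃ Q : ℕ → Polynomial ℚ_[p],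
    (∀ n, Polynomial.aeval (epsK ε (n + 1) - 1) (∑ i ∈ Finset.range (n + 1), Q i) = y (n + 1)) ∧
    (∀ n, ∀ l ≤ n, Polynomial.aeval (epsK ε l - 1) (Q n) = 0) ∧
    ∀ n i, ‖(Q n).coeff i‖ * discRadius p n ^ i ≤ (1 / 2) ^ n := by
  choose P hP1 hP2 hP3 using fun (n : ℕ) (z : Kn ε (n + 1)) =>
    exists_small_polynomial ε n z (δ := (1 / 2) ^ n) (by positivity)
  let S : ℕ → Polynomial ℚ_[p] := fun n => Nat.rec 0
    (fun n s => s + P n (y (n + 1) - Polynomial.aeval (epsK ε (n + 1) - 1) s)) n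
  have hSum : ∀ n, S n = ∑ i ∈ Finset.range n,
      P i (y (i + 1) - Polynomial.aeval (epsK ε (i + 1) - 1) (S i)) := by
    intro n
    induction n with
    | zero => rfl
    | succ n ih => rw [Finset.sum_range_succ, ← ih]
  refine ⟨fun n => P n (y (n + 1) - Polynomial.aeval (epsK ε (n + 1) - 1) (S n)),
    fun n => ?_, fun n l hl => hP2 n _ l hl, fun n i => hP3 n _ i⟩
  rw [Finset.sum_range_succ, ← hSum, map_add, hP1, add_sub_cancel]

theorem polyR_mem (r : ℝ) (P : Polynomial ℚ_[p]) : polyR p P ∈ RobbaR p r :=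
  (isPlus_of_laur (polyR_coe _)).mem r

theorem tendsto_norm_polyR_coe {Q : ℕ → Polynomial ℚ_[p]}
    (hQ : ∀ n i, ‖(Q n).coeff i‖ * discRadius p n ^ i ≤ (1 / 2) ^ n) {r ρ : ℝ}
    (hr : (p : ℝ) ^ (-1 / r) ≤ ρ) (hρ1 : ρ < 1) :
    Tendsto (fun x : ℕ × ℤ => ‖(polyR p (Q x.1)).coe x.2‖ * ρ ^ x.2) cofinite (𝓝 0) := by
  have hρ0 : 0 < ρ := (radius_pos p r).trans_le hr
  refine tendsto_cofinite_prod (b := fun n => (1 / 2 : ℝ) ^ n) (fun x => by positivity)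
    (fun n => ?_) ?_ ?_
  · exact polyR_mem r (Q n) ρ hr hρ1
  · rw [Nat.cofinite_eq_atTop]
    filter_upwards [(tendsto_discRadius (p := p)).eventually (eventually_ge_nhds hρ1)]
      with n hn j
    rw [polyR_coe, laur_zero_apply]
    split_ifs with hj
    · obtain ⟨i, rfl⟩ := Int.eq_ofNat_of_zero_le hj
      rw [Int.toNat_natCast, Polynomial.coeff_coe, zpow_natCast]
      refine le_trans ?_ (hQ n i)
      exact mul_le_mul_of_nonneg_left (pow_le_pow_left₀ hρ0.le hn i) (norm_nonneg _)
    · rw [norm_zero, zero_mul]; positivity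
  · rw [Nat.cofinite_eq_atTop]
    exact tendsto_pow_atTop_nhds_zero_of_lt_one (by norm_num) (by norm_num)

theorem exists_eq_tsum_polyR (r : Radius p) {Q : ℕ → Polynomial ℚ_[p]}
    (hQ : ∀ n i, ‖(Q n).coeff i‖ * discRadius p n ^ i ≤ (1 / 2) ^ n) :
    ∃ F : RobbaR p r, ∀ j, (F : Robba p).coe j = ∑' n, (polyR p (Q n)).coe j := by
  have hconv : ConvOn p r fun j => ∑' n, (polyR p (Q n)).coe j := fun ρ h1 h2 =>
    (convAt_tsum (a := fun n j => (polyR p (Q n)).coe j) ((radius_pos p _).trans_le h1)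
      (tendsto_norm_polyR_coe hQ h1 h2)).2
  exact ⟨⟨⟨_, r, r.pos, hconv⟩, hconv⟩, fun j => rfl⟩

theorem hasSum_aeval_polyR {r : Radius p} {Q : ℕ → Polynomial ℚ_[p]}
    (hQ : ∀ n i, ‖(Q n).coeff i‖ * discRadius p n ^ i ≤ (1 / 2) ^ n) {F : RobbaR p r}
    (hF : ∀ j, (F : Robba p).coe j = ∑' n, (polyR p (Q n)).coe j) {n : ℕ} (hn : nOf p r ≤ n) :
    HasSum (fun i => Polynomial.aeval (epsK ε n - 1) (Q i)) (constantCoeff (iota ε r.2 hn F)) := by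
  have hn1 := one_le_of_nOf_le r.2 hn
  have h1 := tendsto_norm_polyR_coe hQ (radius_le_norm ε r.2 hn) (norm_eps_sub_one_lt ε n hn1)
  have h2 := iota_tsum ε r.2 hn (fun n => (⟨polyR p (Q n), polyR_mem r _⟩ : RobbaR p r)) F hF h1 0
  rw [coeff_zero_eq_constantCoeff_apply] at h2
  have e : (fun i => Polynomial.aeval (epsK ε n - 1) (Q i)) =
      fun i => coeff 0 (iota ε r.2 hn ⟨polyR p (Q i), polyR_mem r _⟩) := funext fun i =>
    ((coeff_zero_eq_constantCoeff_apply _).trans (constantCoeff_iota_poly ε r.2 hn (Q i) _)).symm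
  rw [e]
  exact h2

/-- The elements of `R^r` take arbitrary values at the points `ε^(n) - 1` with `n ≥ n(r)`. -/
theorem exists_constantCoeff_iota (r : Radius p) (y : ∀ n, Kn ε n) :
    ∃ f : RobbaR p r, ∀ (n : ℕ) (hn : nOf p r ≤ n), constantCoeff (iota ε r.2 hn f) = y n := by
  obtain ⟨Q, hQ1, hQ2, hQ3⟩ := exists_polynomial_seq ε y
  obtain ⟨F, hF⟩ := exists_eq_tsum_polyR r hQ3
  refine ⟨F, fun n hn => (hasSum_aeval_polyR ε hQ3 hF hn).unique ?_⟩
  have hn1 := one_le_of_nOf_le r.2 hn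
  clear hF hn
  obtain ⟨m, rfl⟩ := Nat.exists_eq_add_of_le' hn1
  rw [← hQ1 m, map_sum]
  refine hasSum_sum_of_ne_finset_zero fun i hi => ?_
  exact hQ2 i _ (by simpa using hi)

/-! ### Reduction modulo `t ^ k` -/

theorem tR_pow_dvd_iff (r : Radius p) (k : ℕ) (f : RobbaR p r) :
    tR r ^ k ∣ f ↔ ∀ (n : ℕ) (hn : nOf p r ≤ n), X ^ k ∣ iota ε r.2 hn f := by
  constructor
  · rintro ⟨g, rfl⟩ n hn
    rw [map_mul, map_pow]
    exact Dvd.dvd.mul_right (pow_dvd_pow_of_dvd (iota_t_mem ε r.2 hn) k) _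
  · intro h
    induction k with
    | zero => simp
    | succ k ih =>
      obtain ⟨g, rfl⟩ := ih fun n hn => (pow_dvd_pow _ (Nat.le_succ k)).trans (h n hn)
      rw [pow_succ]
      refine mul_dvd_mul_left _ (tR_dvd_of_constantCoeff ε r g fun n hn => ?_)
      obtain ⟨u, hu⟩ := exists_iota_t ε r hn
      have h1 := h n hn
      rw [map_mul, map_pow, hu, mul_pow, mul_assoc, pow_succ] at h1
      have h2 := (mul_dvd_mul_iff_left (pow_ne_zero k (X_ne_zero))).1 h1
      rw [← Units.val_pow_eq_pow_val, Units.dvd_mul_left] at h2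
      exact X_dvd_iff.1 h2

/-- The localization maps are jointly surjective modulo powers of `t`. -/
theorem exists_iota_approx (r : Radius p) (k : ℕ) (a : ∀ n : ℕ, (Kn ε n)⟦X⟧) :
    ∃ f : RobbaR p r, ∀ (n : ℕ) (hn : nOf p r ≤ n), X ^ k ∣ iota ε r.2 hn f - a n := by
  induction k with
  | zero => exact ⟨0, fun n hn => by simp⟩
  | succ k ih =>
    obtain ⟨f, hf⟩ := ih
    have h1 : ∀ n : ℕ, ∃ y : Kn ε n, ∀ hn : nOf p r ≤ n, ∀ g : RobbaR p r,
        constantCoeff (iota ε r.2 hn g) = y → X ^ (k + 1) ∣ iota ε r.2 hn (f + tR r ^ k * g) - a n := by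
      intro n
      by_cases hn : nOf p r ≤ n
      · obtain ⟨c, hc⟩ := hf n hn
        obtain ⟨u, hu⟩ := exists_iota_t ε r hn
        refine ⟨- constantCoeff c * (constantCoeff (u : (Kn ε n)⟦X⟧) ^ k)⁻¹, fun _ g hg => ?_⟩
        rw [map_add, add_sub_right_comm, hc, map_mul, map_pow, hu, mul_pow, mul_assoc, ← mul_add,
          pow_succ]
        refine mul_dvd_mul_left _ (X_dvd_iff.2 ?_)
        have hu0 : constantCoeff (u : (Kn ε n)⟦X⟧) ≠ 0 :=
          (u.isUnit.map (constantCoeff (R := Kn ε n))).ne_zero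
        rw [map_add, map_mul, map_pow, hg, mul_comm (-constantCoeff c),
          mul_inv_cancel_left₀ (pow_ne_zero k hu0), add_neg_cancel]
      · exact ⟨0, fun h => absurd h hn⟩
    choose y hy using h1
    obtain ⟨g, hg⟩ := exists_constantCoeff_iota ε r y
    exact ⟨f + tR r ^ k * g, fun n hn => hy n hn g (hg n hn)⟩

theorem iotaQ_mk (k : ℕ) (r : Radius p) {n : ℕ} (hn : nOf p r ≤ n) (f : RobbaR p r) :
    iotaQ ε k r hn (Ideal.Quotient.mk _ f) = Ideal.Quotient.mk _ (iota ε r.2 hn f) := rfl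

/-- `R^r / (t ^ k)` is the product of the rings `ℚ_p(ε^(n))[t] / (t ^ k)` with `n ≥ n(r)`. -/
theorem iotaQ_bijective (k : ℕ) (r : Radius p) :
    Function.Bijective fun (x : RQ k r) (n : Idx p r) => iotaQ ε k r n.2 x := by
  constructor
  · intro x y h
    obtain ⟨f, rfl⟩ := Ideal.Quotient.mk_surjective x
    obtain ⟨g, rfl⟩ := Ideal.Quotient.mk_surjective y
    rw [Ideal.Quotient.eq, Ideal.mem_span_singleton, tR_pow_dvd_iff ε]
    intro n hn
    have := congrFun h ⟨n, hn⟩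
    simp only [iotaQ_mk] at this
    rwa [Ideal.Quotient.eq, Ideal.mem_span_singleton, ← map_sub] at this
  · intro z
    have h1 : ∀ n : ℕ, ∃ a : (Kn ε n)⟦X⟧, ∀ hn : nOf p r ≤ n, Ideal.Quotient.mk _ a = z ⟨n, hn⟩ := by
      intro n
      by_cases hn : nOf p r ≤ n
      · obtain ⟨a, ha⟩ := Ideal.Quotient.mk_surjective (z ⟨n, hn⟩)
        exact ⟨a, fun _ => ha⟩
      · exact ⟨0, fun h => absurd h hn⟩
    choose a ha using h1
    obtain ⟨f, hf⟩ := exists_iota_approx ε r k a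
    refine ⟨Ideal.Quotient.mk _ f, funext fun n => ?_⟩
    change Ideal.Quotient.mk _ (iota ε r.2 n.2 f) = _
    rw [← ha n n.2, Ideal.Quotient.eq, Ideal.mem_span_singleton]
    exact hf n n.2

end Interpolation

/-! ## Semilinear maps and extension of scalars -/

section ExtendScalars

variable {A B A' B' : Type*} [CommRing A] [CommRing B] [CommRing A'] [CommRing B']
  {σ : A →+* B} {σ' : A' →+* B'} {α : A →+* A'} {β : B →+* B'}
  {M M' N : Type*} [AddCommGroup M] [Module A M] [AddCommGroup M'] [Module A' M']
  [AddCommGroup N] [Module B N] {ι : Type*}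

theorem Ext.induction {P : Ext σ M → Prop} (h0 : P 0) (hadd : ∀ x y, P x → P y → P (x + y))
    (hof : ∀ (b : B) (x : M), P (b • Ext.of σ x)) (x : Ext σ M) : P x := by
  refine TensorProduct.induction_on (motive := P) x h0 (fun (b : B) x => ?_) hadd
  have : (b • Ext.of σ x : Ext σ M) = TensorProduct.tmul A (show Via σ from b) x := by
    change (show Via σ from b) • TensorProduct.tmul A (1 : Via σ) x = _
    rw [TensorProduct.smul_tmul', smul_eq_mul, mul_one]
  rw [← this]
  exact hof b x

theorem Ext.addMonoidHom_ext {G : Type*} [AddCommGroup G] {f g : Ext σ M →+ G}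
    (h : ∀ (b : B) (x : M), f (b • Ext.of σ x) = g (b • Ext.of σ x)) (x : Ext σ M) : f x = g x := by
  refine Ext.induction (P := fun x => f x = g x) ?_ (fun x y hx hy => ?_) h x
  · rw [map_zero, map_zero]
  · rw [map_add, map_add, hx, hy]

theorem Ext.lift_of (f : M →ₛₗ[σ] N) (x : M) : Ext.lift f (Ext.of σ x) = f x := by
  have := Ext.lift_smul_of σ f 1 x
  rwa [one_smul, one_smul] at this

variable (σ) in
/-- The basis of the extension of scalars given by a basis. -/
def Ext.basis (b : Module.Basis ι A M) : Module.Basis ι B (Ext σ M) :=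
  (Algebra.TensorProduct.basis (Via σ) b :
    Module.Basis ι (Via σ) (TensorProduct A (Via σ) M))

theorem Ext.basis_apply (b : Module.Basis ι A M) (i : ι) : Ext.basis σ b i = Ext.of σ (b i) :=
  Algebra.TensorProduct.basis_apply (A := Via σ) b i

theorem Ext.basis_repr_of (b : Module.Basis ι A M) (x : M) (i : ι) :
    (Ext.basis σ b).repr (Ext.of σ x) i = σ (b.repr x i) := by
  have := Algebra.TensorProduct.basis_repr_tmul (A := Via σ) b 1 x
  have h2 := DFunLike.congr_fun this i
  refine h2.trans ?_
  exact one_mul (σ (b.repr x i))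

theorem Ext.of_injective (b : Module.Basis ι A M) (hσ : Function.Injective σ) :
    Function.Injective (Ext.of σ : M →ₛₗ[σ] Ext σ M) := by
  intro x y h
  refine b.repr.injective (Finsupp.ext fun i => hσ ?_)
  rw [← Ext.basis_repr_of, ← Ext.basis_repr_of, h]

theorem Ext.lift_bijective {f : M →ₛₗ[σ] N} (b : Module.Basis ι A M) (c : Module.Basis ι B N)
    (h : ∀ i, f (b i) = c i) : Function.Bijective (Ext.lift f) := by
  have : Ext.lift f = ((Ext.basis σ b).equiv c (Equiv.refl ι) : Ext σ M →ₗ[B] N) := by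
    refine (Ext.basis σ b).ext fun i => ?_
    rw [LinearEquiv.coe_coe, Module.Basis.equiv_apply, Ext.basis_apply, Ext.lift_of, h]
    rfl
  rw [this]
  exact LinearEquiv.bijective _

theorem exists_basis_of_matrix [Fintype ι] [DecidableEq ι] (c : Module.Basis ι B N)
    {P Q : Matrix ι ι B} (h : P * Q = 1) (h' : Q * P = 1) :
    ∃ c' : Module.Basis ι B N, ∀ j, c' j = ∑ i, P i j • c i := by
  refine ⟨c.map (LinearEquiv.ofLinearMap (Matrix.toLin c c P) (Matrix.toLin c c Q) ?_ ?_), fun j => ?_⟩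
  · rw [← Matrix.toLin_mul, h, Matrix.toLin_one]
  · rw [← Matrix.toLin_mul, h', Matrix.toLin_one]
  · rw [Module.Basis.map_apply, LinearEquiv.coe_ofLinearMap, Matrix.toLin_self]

theorem Ext.lift_bijective_of_matrix [Fintype ι] [DecidableEq ι] {f : M →ₛₗ[σ] N}
    (b : Module.Basis ι A M) (c : Module.Basis ι B N) {P Q : Matrix ι ι B} (h : P * Q = 1)
    (h' : Q * P = 1) (hf : ∀ j, f (b j) = ∑ i, P i j • c i) :
    Function.Bijective (Ext.lift f) := by
  obtain ⟨c', hc'⟩ := exists_basis_of_matrix c h h'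
  exact Ext.lift_bijective b c' fun i => (hf i).trans (hc' i).symm

theorem injective_of_bijective_lift {f : M →ₛₗ[σ] N} (b : Module.Basis ι A M)
    (hσ : Function.Injective σ) (hf : Function.Injective (Ext.lift f)) : Function.Injective f := by
  intro x y h
  rw [← Ext.lift_of f x, ← Ext.lift_of f y] at h
  exact Ext.of_injective b hσ (hf h)

/-- The semilinear map between extensions of scalars induced by a semilinear map. -/
def Ext.mapₛ (h : ∀ a, β (σ a) = σ' (α a)) (f : M →ₛₗ[α] M') : Ext σ M →ₛₗ[β] Ext σ' M' :=
  let g : M →ₛₗ[σ] Res (Ext σ' M') β :=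
    { toFun := fun x => (Ext.of σ' (f x) : Ext σ' M')
      map_add' := fun x y => by rw [map_add, map_add]; rfl
      map_smul' := fun a x => by
        rw [map_smulₛₗ, map_smulₛₗ, ← h]
        rfl }
  let l := Ext.lift (N := Res (Ext σ' M') β) g
  { toFun := fun x => l x
    map_add' := fun x y => by
      have := l.map_add x y
      exact this
    map_smul' := fun b x => by
      have := l.map_smul b x
      exact this }

theorem Ext.mapₛ_of (h : ∀ a, β (σ a) = σ' (α a)) (f : M →ₛₗ[α] M') (x : M) :
    Ext.mapₛ h f (Ext.of σ x) = Ext.of σ' (f x) :=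
  Ext.lift_of (N := Res (Ext σ' M') β) _ x

theorem Ext.mapₛ_smul_of (h : ∀ a, β (σ a) = σ' (α a)) (f : M →ₛₗ[α] M') (b : B) (x : M) :
    Ext.mapₛ h f (b • Ext.of σ x) = β b • Ext.of σ' (f x) := by
  rw [map_smulₛₗ, Ext.mapₛ_of]

/-- If the semilinear maps `f : M → M'` has an invertible matrix, then so does the map that it
induces between extensions of scalars. -/
theorem Ext.lift_mapₛ_bijective [Fintype ι] [DecidableEq ι] (h : ∀ a, β (σ a) = σ' (α a))
    {f : M →ₛₗ[α] M'} (b : Module.Basis ι A M) (c : Module.Basis ι A' M') {P Q : Matrix ι ι A'}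
    (hPQ : P * Q = 1) (hQP : Q * P = 1) (hf : ∀ j, f (b j) = ∑ i, P i j • c i) :
    Function.Bijective (Ext.lift (Ext.mapₛ h f)) := by
  refine Ext.lift_bijective_of_matrix (Ext.basis σ b) (Ext.basis σ' c) (P := P.map σ')
    (Q := Q.map σ') ?_ ?_ fun j => ?_
  · rw [← Matrix.map_mul, hPQ, Matrix.map_one _ (map_zero _) (map_one _)]
  · rw [← Matrix.map_mul, hQP, Matrix.map_one _ (map_zero _) (map_one _)]
  · rw [Ext.basis_apply, Ext.mapₛ_of, hf, map_sum]
    refine Finset.sum_congr rfl fun i _ => ?_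
    rw [map_smulₛₗ, Ext.basis_apply, Matrix.map_apply]

theorem lift_mapQ_bijective {f : M →ₛₗ[σ] N} (hf : Function.Bijective (Ext.lift f))
    (Y : Submodule A M) (Y' : Submodule B N) (h : Y ≤ Y'.comap f)
    (h' : Y' ≤ Submodule.span B (f '' Y)) : Function.Bijective (Ext.lift (Y.mapQ Y' f h)) := by
  let e : Ext σ M ≃ₗ[B] N := LinearEquiv.ofBijective (Ext.lift f) hf
  have he : ∀ x, e.symm (f x) = Ext.of σ x := fun x => by
    rw [LinearEquiv.symm_apply_eq]
    exact (Ext.lift_of f x).symm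
  let g₀ : N →ₗ[B] Ext σ (M ⧸ Y) := (Ext.map σ Y.mkQ).comp (e.symm : N →ₗ[B] Ext σ M)
  have hg₀ : ∀ x, g₀ (f x) = Ext.of σ (Y.mkQ x) := fun x => by
    change Ext.map σ Y.mkQ (e.symm (f x)) = _
    rw [he, Ext.map_of]
  have hY' : Y' ≤ LinearMap.ker g₀ := by
    refine h'.trans (Submodule.span_le.2 ?_)
    rintro _ ⟨y, hy, rfl⟩
    rw [SetLike.mem_coe, LinearMap.mem_ker, hg₀, Submodule.mkQ_apply,
      (Submodule.Quotient.mk_eq_zero Y).2 hy, map_zero]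
  let g := Y'.liftQ g₀ hY'
  refine Function.bijective_iff_has_inverse.2 ⟨g, fun x => ?_, fun y => ?_⟩
  · refine Ext.induction (P := fun x => g (Ext.lift (Y.mapQ Y' f h) x) = x) ?_ ?_ ?_ x
    · rw [map_zero, map_zero]
    · intro x y hx hy
      rw [map_add, map_add, hx, hy]
    · intro b x
      obtain ⟨x, rfl⟩ := Submodule.mkQ_surjective Y x
      rw [map_smul, map_smul, Ext.lift_of, Submodule.mkQ_apply, Submodule.mapQ_apply]
      congr 1
      exact hg₀ x
  · obtain ⟨y, rfl⟩ := Submodule.mkQ_surjective Y' y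
    obtain ⟨z, rfl⟩ := e.surjective y
    refine Ext.induction (P := fun z => Ext.lift (Y.mapQ Y' f h) (g (Y'.mkQ (e z))) = Y'.mkQ (e z))
      ?_ ?_ ?_ z
    · simp only [map_zero]
    · intro x y hx hy
      rw [map_add, map_add, map_add, map_add, hx, hy]
    · intro b x
      rw [map_smul, map_smul, map_smul, map_smul]
      congr 1
      have h1 : e (Ext.of σ x) = f x := Ext.lift_of f x
      rw [h1]
      have h2 : g (Y'.mkQ (f x)) = Ext.of σ (Y.mkQ x) := hg₀ x
      rw [h2, Ext.lift_of]
      rfl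

end ExtendScalars

/-! ## The rings `R^r / (t ^ k)` and their localizations -/

section Localizations

variable {p : ℕ} [hp : Fact p.Prime] (ε : EpsSeq p)

theorem inclK_gamK {n m : ℕ} (h : n ≤ m) (γ : Gam p) (x : Kn ε n) :
    inclK ε h (gamK ε n γ x) = gamK ε m γ (inclK ε h x) := by
  induction γ using QuotientGroup.induction_on with
  | H g =>
    refine Subtype.ext ((inclK_coe ε h _).trans ?_)
    change g (x : PadicAlgCl p) = g (inclK ε h x : PadicAlgCl p)
    rw [inclK_coe]

theorem coeff_inclPS {n m : ℕ} (h : n ≤ m) (f : (Kn ε n)⟦X⟧) (i : ℕ) :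
    coeff i (inclPS ε h f) = inclK ε h (coeff i f) := coeff_map _ _ _

theorem coeff_gamPS (n : ℕ) (γ : Gam p) (f : (Kn ε n)⟦X⟧) (i : ℕ) :
    coeff i (gamPS ε n γ f) =
      algebraMap ℚ_[p] (Kn ε n) ((chi p γ : ℤ_[p]) : ℚ_[p]) ^ i * gamK ε n γ (coeff i f) := by
  rw [gamPS, RingHom.comp_apply, coeff_rescale, coeff_map]
  rfl

theorem inclPS_gamPS {n m : ℕ} (h : n ≤ m) (γ : Gam p) (f : (Kn ε n)⟦X⟧) :
    inclPS ε h (gamPS ε n γ f) = gamPS ε m γ (inclPS ε h f) := by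
  refine PowerSeries.ext fun i => ?_
  rw [coeff_inclPS, coeff_gamPS, coeff_gamPS, coeff_inclPS, map_mul, map_pow, inclK_algebraMap,
    inclK_gamK]

theorem gamPS_one (n : ℕ) (f : (Kn ε n)⟦X⟧) : gamPS ε n 1 f = f := by
  refine PowerSeries.ext fun i => ?_
  rw [coeff_gamPS, map_one, map_one]
  simp

theorem gamPS_mul (n : ℕ) (γ γ' : Gam p) (f : (Kn ε n)⟦X⟧) :
    gamPS ε n (γ * γ') f = gamPS ε n γ (gamPS ε n γ' f) := by
  refine PowerSeries.ext fun i => ?_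
  rw [coeff_gamPS, coeff_gamPS, coeff_gamPS, map_mul, map_mul, AlgHom.mul_apply, map_mul, map_pow,
    AlgHom.commutes, Units.val_mul, PadicInt.coe_mul, map_mul, mul_pow, mul_assoc]

theorem X_pow_dvd_inclPS {n m : ℕ} (h : n ≤ m) {k : ℕ} {f : (Kn ε n)⟦X⟧}
    (hf : X ^ k ∣ inclPS ε h f) : X ^ k ∣ f := by
  rw [X_pow_dvd_iff] at hf ⊢
  intro i hi
  have := hf i hi
  rw [coeff_inclPS] at this
  exact inclK_injective ε h (this.trans (map_zero _).symm)

theorem iota_resR {r r' : Radius p} (h : r ≤ r') {n : ℕ} (hn : nOf p r ≤ n)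
    (hn' : nOf p r' ≤ n) (f : RobbaR p r) :
    iota ε r'.2 hn' (resR h f) = iota ε r.2 hn f := rfl

variable (k : ℕ)

theorem iotaQ_resQ {r r' : Radius p} (h : r ≤ r') {n : ℕ} (hn : nOf p r ≤ n)
    (hn' : nOf p r' ≤ n) (x : RQ k r) : iotaQ ε k r' hn' (resQ k h x) = iotaQ ε k r hn x := by
  obtain ⟨f, rfl⟩ := Ideal.Quotient.mk_surjective x
  rfl

theorem iotaQ_frobQ (r : Radius p) {n : ℕ} (hn : nOf p r ≤ n) (hn' : nOf p r.frob ≤ (n + 1 : ℕ))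
    (x : RQ k r) :
    iotaQ ε k r.frob hn' (frobQ k r x) = inclKT ε k (Nat.le_succ n) (iotaQ ε k r hn x) := by
  obtain ⟨f, rfl⟩ := Ideal.Quotient.mk_surjective x
  exact congrArg (Ideal.Quotient.mk _) (iota_frob ε r hn hn' f)

theorem iotaQ_gamQ (r : Radius p) {n : ℕ} (hn : nOf p r ≤ n) (γ : Gam p) (x : RQ k r) :
    iotaQ ε k r hn (gamQ k r γ x) = gamKT ε k n γ (iotaQ ε k r hn x) := by
  obtain ⟨f, rfl⟩ := Ideal.Quotient.mk_surjective x
  exact congrArg (Ideal.Quotient.mk _) (iota_gamR ε r hn γ f)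

theorem inclKT_gamKT {n m : ℕ} (h : n ≤ m) (γ : Gam p) (x : KT ε k n) :
    inclKT ε k h (gamKT ε k n γ x) = gamKT ε k m γ (inclKT ε k h x) := by
  obtain ⟨f, rfl⟩ := Ideal.Quotient.mk_surjective x
  exact congrArg (Ideal.Quotient.mk _) (inclPS_gamPS ε h γ f)

theorem gamKT_one (n : ℕ) (x : KT ε k n) : gamKT ε k n 1 x = x := by
  obtain ⟨f, rfl⟩ := Ideal.Quotient.mk_surjective x
  exact congrArg (Ideal.Quotient.mk _) (gamPS_one ε n f)

theorem gamKT_mul (n : ℕ) (γ γ' : Gam p) (x : KT ε k n) :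
    gamKT ε k n (γ * γ') x = gamKT ε k n γ (gamKT ε k n γ' x) := by
  obtain ⟨f, rfl⟩ := Ideal.Quotient.mk_surjective x
  exact congrArg (Ideal.Quotient.mk _) (gamPS_mul ε n γ γ' f)

theorem inclKT_injective {n m : ℕ} (h : n ≤ m) : Function.Injective (inclKT ε k h) := by
  rw [injective_iff_map_eq_zero]
  intro x hx
  obtain ⟨f, rfl⟩ := Ideal.Quotient.mk_surjective x
  have h1 : Ideal.Quotient.mk (Ideal.span {(X : (Kn ε m)⟦X⟧) ^ k}) (inclPS ε h f) = 0 := hx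
  rw [Ideal.Quotient.eq_zero_iff_mem, Ideal.mem_span_singleton] at h1 ⊢
  exact X_pow_dvd_inclPS ε h h1

variable {k} in
theorem RQ_ext {r : Radius p} {x y : RQ k r}
    (h : ∀ (n : ℕ) (hn : nOf p r ≤ n), iotaQ ε k r hn x = iotaQ ε k r hn y) : x = y :=
  (iotaQ_bijective ε k r).1 (funext fun n => h n n.2)

theorem exists_forall_iotaQ_eq (r : Radius p) (z : ∀ n : Idx p r, KT ε k n) :
    ∃ x : RQ k r, ∀ (n : ℕ) (hn : nOf p r ≤ n), iotaQ ε k r hn x = z ⟨n, hn⟩ := by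
  obtain ⟨x, hx⟩ := (iotaQ_bijective ε k r).2 z
  exact ⟨x, fun n hn => congrFun hx ⟨n, hn⟩⟩

/-- The isomorphism of `R^r / (t ^ k)` with the product of its localizations. -/
def iotaEquiv (r : Radius p) : RQ k r ≃+* ∀ n : Idx p r, KT ε k n :=
  RingEquiv.ofBijective (RingHom.pi fun n : Idx p r => iotaQ ε k r n.2) (iotaQ_bijective ε k r)

/-- The embedding `ℚ_p(ε^(n(r)))[t] / (t ^ k) → R^r / (t ^ k)`. -/
def delta (r : Radius p) : KT ε k (nMin p r) →+* RQ k r :=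
  (iotaEquiv ε k r).symm.toRingHom.comp (RingHom.pi fun n : Idx p r => inclKT ε k (nMin_le n.2))

theorem iotaQ_delta (r : Radius p) {n : ℕ} (hn : nOf p r ≤ n) (a : KT ε k (nMin p r)) :
    iotaQ ε k r hn (delta ε k r a) = inclKT ε k (nMin_le hn) a := by
  have h1 : iotaEquiv ε k r (delta ε k r a) = fun n : Idx p r => inclKT ε k (nMin_le n.2) a :=
    (iotaEquiv ε k r).apply_symm_apply _
  exact congrFun h1 ⟨n, hn⟩

theorem delta_unique (r : Radius p) (δ : KT ε k (nMin p r) →+* RQ k r)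
    (h : ∀ (n : ℕ) (hn : nOf p r ≤ n) (a : KT ε k (nMin p r)),
      iotaQ ε k r hn (δ a) = inclKT ε k (nMin_le hn) a) : δ = delta ε k r :=
  RingHom.ext fun a => RQ_ext ε fun n hn => by rw [h, iotaQ_delta]

theorem delta_gamKT (r : Radius p) (γ : Gam p) (a : KT ε k (nMin p r)) :
    delta ε k r (gamKT ε k (nMin p r) γ a) = gamQ k r γ (delta ε k r a) :=
  RQ_ext ε fun n hn => by rw [iotaQ_delta, iotaQ_gamQ, iotaQ_delta, inclKT_gamKT]

end Localizations

section GammaMul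

variable {p : ℕ} [hp : Fact p.Prime]

theorem gamQ_one (ε : EpsSeq p) (k : ℕ) (r : Radius p) (x : RQ k r) : gamQ k r 1 x = x :=
  RQ_ext ε fun n hn => by rw [iotaQ_gamQ, gamKT_one]

theorem gamQ_mul (ε : EpsSeq p) (k : ℕ) (r : Radius p) (γ γ' : Gam p) (x : RQ k r) :
    gamQ k r (γ * γ') x = gamQ k r γ (gamQ k r γ' x) :=
  RQ_ext ε fun n hn => by rw [iotaQ_gamQ, iotaQ_gamQ, iotaQ_gamQ, gamKT_mul]

theorem resQ_gamQ (k : ℕ) {r r' : Radius p} (h : r ≤ r') (γ : Gam p) (x : RQ k r) :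
    resQ k h (gamQ k r γ x) = gamQ k r' γ (resQ k h x) := by
  obtain ⟨f, rfl⟩ := Ideal.Quotient.mk_surjective x
  rfl

theorem resQ_resQ (k : ℕ) {r r' r'' : Radius p} (h : r ≤ r') (h' : r' ≤ r'') (x : RQ k r) :
    resQ k h' (resQ k h x) = resQ k (h.trans h') x := by
  obtain ⟨f, rfl⟩ := Ideal.Quotient.mk_surjective x
  rfl

theorem Radius.frob_mono {r r' : Radius p} (h : r ≤ r') : r.frob ≤ r'.frob :=
  mul_le_mul_of_nonneg_left (show (r : ℝ) ≤ r' from h) (Nat.cast_nonneg p)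

end GammaMul

/-! ## The localizations of pure `t ^ k`-torsion modules -/

section TorsionLocalization

theorem matMap_apply {A B : Type*} [CommRing A] [CommRing B] (σ : A →+* B) {d : ℕ}
    (P : Matrix (Fin d) (Fin d) B) (x : Fin d → A) (i : Fin d) :
    matMap σ P x i = ∑ j, P i j * σ (x j) := rfl

theorem matMap_basisFun {A B : Type*} [CommRing A] [CommRing B] (σ : A →+* B) {d : ℕ}
    (P : Matrix (Fin d) (Fin d) B) (j : Fin d) :
    matMap σ P (Pi.basisFun A (Fin d) j) = ∑ i, P i j • Pi.basisFun B (Fin d) i := by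
  funext l
  rw [matMap_apply, Finset.sum_apply]
  simp [Pi.single_apply, apply_ite]

theorem matMap_matMap {A B C : Type*} [CommRing A] [CommRing B] [CommRing C] (σ : A →+* B)
    (τ : B →+* C) {d : ℕ} (P : Matrix (Fin d) (Fin d) C) (Q : Matrix (Fin d) (Fin d) B)
    (x : Fin d → A) : matMap τ P (matMap σ Q x) = matMap (τ.comp σ) (P * Q.map τ) x := by
  change P.mulVec (fun i => τ (Q.mulVec (fun j => σ (x j)) i)) = (P * Q.map τ).mulVec _
  rw [← Matrix.mulVec_mulVec]
  congr 1
  funext i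
  exact RingHom.map_mulVec τ Q _ i

variable {p : ℕ} [hp : Fact p.Prime] {k d : ℕ} {S : Type*} [AddCommGroup S] [Module (Robba p) S]
  [Module (RQuot p k) S] {hS : GenPhiGamma p S} {e : Module.Basis (Fin d) (RQuot p k) S}
  {r₀ r : Radius p} (M : TorsionModel hS e r₀) (hr : r₀ ≤ r) (ε : EpsSeq p)

theorem map_mul_eq_one {A B ι : Type*} [Fintype ι] [DecidableEq ι] [CommRing A] [CommRing B]
    (f : A →+* B) {P Q : Matrix ι ι A} (h : P * Q = 1) : P.map f * Q.map f = 1 := by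
  rw [← Matrix.map_mul, h, Matrix.map_one _ (map_zero _) (map_one _)]

theorem TorsionModel.lift_phi_bijective : Function.Bijective (Ext.lift (M.phi hr)) :=
  Ext.lift_bijective_of_matrix (Pi.basisFun _ _) (Pi.basisFun _ _)
    (map_mul_eq_one _ M.mul_eq_one) (map_mul_eq_one _ M.mul_eq_one') (matMap_basisFun _ _)

theorem TorsionModel.act_one (x : TMod k d r) (ε : EpsSeq p) : M.act hr 1 x = x := by
  funext i
  change ∑ j, ((M.C 1).map (resQ k hr)) i j * gamQ k r 1 (x j) = _
  rw [M.C_one, Matrix.map_one _ (map_zero _) (map_one _)]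
  simp only [gamQ_one ε, Matrix.one_apply, ite_mul, one_mul, zero_mul, Finset.sum_ite_eq,
    Finset.mem_univ, if_true]

theorem TorsionModel.act_mul (γ γ' : Gam p) (x : TMod k d r) (ε : EpsSeq p) :
    M.act hr (γ * γ') x = M.act hr γ (M.act hr γ' x) := by
  refine Eq.trans ?_ (matMap_matMap (gamQ k r γ') (gamQ k r γ) _ _ x).symm
  funext i
  rw [matMap_apply, TorsionModel.act, matMap_apply]
  refine Finset.sum_congr rfl fun j _ => ?_
  rw [RingHom.comp_apply, ← gamQ_mul ε]
  congr 1
  rw [M.C_mul, Matrix.map_mul]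
  refine congrArg (fun N : Matrix (Fin d) (Fin d) (RQ k r) => (((M.C γ).map (resQ k hr)) * N) i j) ?_
  ext a b
  exact resQ_gamQ k hr γ _

/-- The basis of `S^n`. -/
def TLoc.basis (k d : ℕ) (r : Radius p) {n : ℕ} (hn : nOf p r ≤ n) :
    Module.Basis (Fin d) (KT ε k n) (TLoc ε k d r hn) :=
  Ext.basis (iotaQ ε k r hn) (Pi.basisFun (RQ k r) (Fin d))

theorem TLoc.repr_of {n : ℕ} (hn : nOf p r ≤ n) (x : TMod k d r) (i : Fin d) :
    (TLoc.basis ε k d r hn).repr (TLoc.of ε k d r hn x) i = iotaQ ε k r hn (x i) :=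
  Ext.basis_repr_of _ _ _

theorem TLoc.of_bijective (k d : ℕ) (r : Radius p) :
    Function.Bijective (fun (x : TMod k d r) (n : Idx p r) => TLoc.of ε k d r n.2 x) := by
  constructor
  · intro x y h
    funext i
    refine RQ_ext ε fun n hn => ?_
    rw [← TLoc.repr_of, ← TLoc.repr_of]
    exact congrArg (fun z => (TLoc.basis ε k d r hn).repr z i) (congrFun h ⟨n, hn⟩)
  · intro z
    choose x hx using fun i => exists_forall_iotaQ_eq ε k r
      (fun n : Idx p r => (TLoc.basis ε k d r n.2).repr (z n) i)
    refine ⟨x, funext fun n => (TLoc.basis ε k d r n.2).repr.injective (Finsupp.ext fun i => ?_)⟩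
    rw [TLoc.repr_of, hx i n n.2]

theorem TLoc.of_delta_smul {n : ℕ} (hn : nOf p r ≤ n) (a : KT ε k (nMin p r))
    (x : TMod k d r) : TLoc.of ε k d r hn (delta ε k r a • x) =
      inclKT ε k (nMin_le hn) a • TLoc.of ε k d r hn x := by
  rw [map_smulₛₗ, iotaQ_delta]

theorem TorsionModel.exists_act {n : ℕ} (hn : nOf p r ≤ n) :
    ∃ act : Gam p →* AddMonoid.End (TLoc ε k d r hn), ∀ γ : Gam p,
      (∀ (a : KT ε k n) (y : TLoc ε k d r hn), act γ (a • y) = gamKT ε k n γ a • act γ y) ∧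
      ∀ x : TMod k d r, TLoc.of ε k d r hn (M.act hr γ x) = act γ (TLoc.of ε k d r hn x) := by
  have hc : ∀ (γ : Gam p) (a : RQ k r), gamKT ε k n γ (iotaQ ε k r hn a) =
      iotaQ ε k r hn (gamQ k r γ a) := fun γ a => (iotaQ_gamQ ε k r hn γ a).symm
  let f : ∀ γ : Gam p, TLoc ε k d r hn →ₛₗ[gamKT ε k n γ] TLoc ε k d r hn := fun γ =>
    Ext.mapₛ (hc γ) (M.act hr γ)
  have hf : ∀ (γ : Gam p) (b : KT ε k n) (x : TMod k d r), f γ (b • TLoc.of ε k d r hn x) =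
      gamKT ε k n γ b • TLoc.of ε k d r hn (M.act hr γ x) := fun γ b x =>
    Ext.mapₛ_smul_of (hc γ) (M.act hr γ) b x
  refine ⟨⟨⟨fun γ => (f γ).toAddMonoidHom, ?_⟩, ?_⟩, fun γ => ⟨fun a y => (f γ).map_smulₛₗ a y,
    fun x => (Ext.mapₛ_of (hc γ) (M.act hr γ) x).symm⟩⟩
  · refine AddMonoidHom.ext fun y => ?_
    refine Ext.addMonoidHom_ext (f := (f 1).toAddMonoidHom) (g := AddMonoidHom.id _)
      (fun b x => ?_) y
    refine (hf 1 b x).trans ?_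
    rw [gamKT_one, M.act_one hr x ε]
    rfl
  · intro γ γ'
    refine AddMonoidHom.ext fun y => ?_
    refine Ext.addMonoidHom_ext (f := (f (γ * γ')).toAddMonoidHom)
      (g := (f γ).toAddMonoidHom.comp (f γ').toAddMonoidHom) (fun b x => ?_) y
    refine (hf (γ * γ') b x).trans ?_
    rw [gamKT_mul, M.act_mul hr γ γ' x ε]
    refine Eq.trans ?_ (congrArg (f γ) (hf γ' b x)).symm
    exact (hf γ _ _).symm

theorem TLoc.exists_cmp {r' : Radius p} (h : r ≤ r') {n : ℕ} (hn : nOf p r ≤ n)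
    (hn' : nOf p r' ≤ n) : ∃ cmp : TLoc ε k d r hn ≃ₗ[KT ε k n] TLoc ε k d r' hn',
      ∀ x : TMod k d r,
        TLoc.of ε k d r' hn' (TMod.res k d h x) = cmp (TLoc.of ε k d r hn x) := by
  let f : TMod k d r →ₛₗ[iotaQ ε k r hn] TLoc ε k d r' hn' :=
    { toFun := fun x => TLoc.of ε k d r' hn' (TMod.res k d h x)
      map_add' := fun x y => by rw [map_add, map_add]
      map_smul' := fun a x => by rw [map_smulₛₗ, map_smulₛₗ, iotaQ_resQ ε k h hn hn'] }
  have hf : Function.Bijective (Ext.lift f) := by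
    refine Ext.lift_bijective (Pi.basisFun _ _) (TLoc.basis ε k d r' hn') fun i => ?_
    refine Eq.trans ?_ (Ext.basis_apply _ i).symm
    refine congrArg (TLoc.of ε k d r' hn') (funext fun j => ?_)
    change resQ k h (Pi.basisFun (RQ k r) (Fin d) i j) = _
    rw [Pi.basisFun_apply, Pi.basisFun_apply, Pi.single_apply, Pi.single_apply, apply_ite (resQ k h),
      map_one, map_zero]
  exact ⟨LinearEquiv.ofBijective _ hf, fun x => (Ext.lift_of f x).symm⟩

theorem TorsionModel.exists_phi {n : ℕ} (hn : nOf p r ≤ n) (hn' : nOf p r.frob ≤ (n + 1 : ℕ)) :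
    ∃ φ : TLoc ε k d r hn →ₛₗ[inclKT ε k (Nat.le_succ n)] TLoc ε k d r.frob hn',
      Function.Injective φ ∧ Function.Bijective (Ext.lift φ) ∧
      ∀ x : TMod k d r,
        TLoc.of ε k d r.frob hn' (M.phi hr x) = φ (TLoc.of ε k d r hn x) := by
  have hc : ∀ a : RQ k r, inclKT ε k (Nat.le_succ n) (iotaQ ε k r hn a) =
      iotaQ ε k r.frob hn' (frobQ k r a) := fun a => (iotaQ_frobQ ε k r hn hn' a).symm
  have h1 : Function.Bijective (Ext.lift (Ext.mapₛ hc (M.phi hr))) :=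
    Ext.lift_mapₛ_bijective hc (Pi.basisFun _ _) (Pi.basisFun _ _)
      (map_mul_eq_one _ M.mul_eq_one) (map_mul_eq_one _ M.mul_eq_one') (matMap_basisFun _ _)
  exact ⟨Ext.mapₛ hc (M.phi hr), injective_of_bijective_lift (TLoc.basis ε k d r hn)
    (inclKT_injective ε k _) h1.1, h1, fun x => (Ext.mapₛ_of hc (M.phi hr) x).symm⟩

end TorsionLocalization

/-! ## Cocycles with values in an increasing union of rings -/

section Cocycles

variable {k₀ F O G : Type*} [Field k₀] [Field F] [Algebra k₀ F] [CommRing O] [Algebra F O]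
  [Algebra k₀ O] [IsScalarTower k₀ F O] [Group G] {d : ℕ}

/-- The semilinear map attached to a matrix and to an automorphism of the ring. -/
def twist (act : G →* (O →ₐ[k₀] O)) (U : G → Matrix (Fin d) (Fin d) O) (γ : G) :
    (Fin d → O) →ₗ[k₀] (Fin d → O) where
  toFun v := (U γ).mulVec fun i => act γ (v i)
  map_add' x y := by
    rw [← Matrix.mulVec_add]
    congr 1
    exact funext fun _ => map_add _ _ _
  map_smul' a x := by
    rw [RingHom.id_apply, ← Matrix.mulVec_smul]
    congr 1
    exact funext fun _ => map_smul _ _ _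

variable {act : G →* (O →ₐ[k₀] O)} {U : G → Matrix (Fin d) (Fin d) O}

theorem twist_apply (γ : G) (v : Fin d → O) (i : Fin d) :
    twist act U γ v i = ∑ j, U γ i j * act γ (v j) := rfl

theorem twist_mul (hU : ∀ γ γ', U (γ * γ') = U γ * (U γ').map (act γ)) (γ γ' : G)
    (v : Fin d → O) : twist act U (γ * γ') v = twist act U γ (twist act U γ' v) := by
  change (U (γ * γ')).mulVec _ = (U γ).mulVec (fun i => act γ ((U γ').mulVec _ i))
  rw [hU, ← Matrix.mulVec_mulVec]
  congr 1
  funext i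
  rw [map_mul]
  exact (RingHom.map_mulVec (act γ : O →+* O) (U γ') _ i).symm

theorem twist_one (hU : U 1 = 1) (v : Fin d → O) : twist act U 1 v = v := by
  change (U 1).mulVec (fun i => act 1 (v i)) = v
  rw [hU, Matrix.one_mulVec, map_one]
  rfl

theorem twist_smul {γ : G} {s : F → F} (hs : ∀ x, act γ (algebraMap F O x) = algebraMap F O (s x))
    (x : F) (v : Fin d → O) : twist act U γ (x • v) = s x • twist act U γ v := by
  funext i
  rw [Pi.smul_apply, twist_apply, twist_apply, Finset.smul_sum]
  refine Finset.sum_congr rfl fun j _ => ?_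
  rw [Pi.smul_apply, Algebra.smul_def, map_mul, hs, Algebra.smul_def]
  ring

theorem exists_nat_of_finite {ι : Type*} [Finite ι] {P : ι → ℕ → Prop}
    (hP : ∀ i, ∀ {n m : ℕ}, n ≤ m → P i n → P i m) (h : ∀ i, ∃ n, P i n) : ∃ n, ∀ i, P i n := by
  choose f hf using h
  obtain ⟨N, hN⟩ := (Set.finite_range f).bddAbove
  exact ⟨N, fun i => hP i (hN ⟨i, rfl⟩) (hf i)⟩

theorem matrix_mul_mem {S : Subalgebra k₀ O} {X Z : Matrix (Fin d) (Fin d) O}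
    (hX : ∀ i j, X i j ∈ S) (hZ : ∀ i j, Z i j ∈ S) (i j : Fin d) : (X * Z) i j ∈ S :=
  (Matrix.mul_apply (M := X) (N := Z)).symm ▸ sum_mem fun l _ => mul_mem (hX i l) (hZ l j)

/-- Under a finiteness condition, all the values of a cocycle for a commutative group lie in one
of the rings of the union. -/
theorem exists_cocycle_level [Module.Finite F O] {L : ℕ → Subalgebra k₀ O} (hL : Monotone L)
    (hfin : ∀ n, Module.Finite k₀ (L n)) (hunion : ∀ x, ∃ n, x ∈ L n)
    (hact : ∀ γ n, ∀ x ∈ L n, act γ x ∈ L n) (hcomm : ∀ γ γ' : G, γ * γ' = γ' * γ) {γ₀ : G}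
    {s : F → F} (hs : ∀ x, act γ₀ (algebraMap F O x) = algebraMap F O (s x)) {n₀ : ℕ}
    (hfix : ∀ x, s x = x → algebraMap F O x ∈ L n₀) (hU1 : U 1 = 1)
    (hU : ∀ γ γ', U (γ * γ') = U γ * (U γ').map (act γ)) :
    ∃ N, ∀ γ i j, U γ i j ∈ L N := by
  have hmat : ∀ γ, ∃ n, ∀ x : Fin d × Fin d, U γ x.1 x.2 ∈ L n := fun γ =>
    exists_nat_of_finite (fun x {n m} h hx => hL h hx) fun x => hunion _
  obtain ⟨m₁, hm₁⟩ := hmat γ₀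
  obtain ⟨m₂, hm₂⟩ := hmat γ₀⁻¹
  set N := max m₁ m₂ with hN
  let Y : Submodule k₀ (Fin d → O) := Submodule.pi Set.univ fun _ => Subalgebra.toSubmodule (L N)
  have hYmem : ∀ v, v ∈ Y ↔ ∀ i, v i ∈ L N := fun v => by
    simp only [Y, Submodule.mem_pi, Set.mem_univ, true_imp_iff, Subalgebra.mem_toSubmodule]
  have hYfin : Module.Finite k₀ Y := by
    have h1 := hfin N
    let l : (Fin d → L N) →ₗ[k₀] Y :=
      { toFun := fun v => ⟨fun i => v i, (hYmem _).2 fun i => (v i).2⟩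
        map_add' := fun _ _ => rfl
        map_smul' := fun _ _ => rfl }
    exact Module.Finite.of_surjective l fun v =>
      ⟨fun i => ⟨v.1 i, (hYmem _).1 v.2 i⟩, rfl⟩
  have hstab : ∀ γ, (∀ i j, U γ i j ∈ L N) → ∀ v ∈ Y, twist act U γ v ∈ Y := by
    intro γ hγ v hv
    rw [hYmem] at hv ⊢
    intro i
    rw [twist_apply]
    exact sum_mem fun j _ => mul_mem (hγ i j) (hact γ N _ (hv j))
  have h₁ := hstab γ₀ fun i j => hL (le_max_left _ _) (hm₁ (i, j))
  have h₂ := hstab γ₀⁻¹ fun i j => hL (le_max_right _ _) (hm₂ (i, j))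
  let E : Set (Y →ₗ[k₀] (Fin d → O)) :=
    {f | ∀ y : Y, twist act U γ₀ (f y) = f ⟨twist act U γ₀ y, h₁ y y.2⟩}
  have hE : ∀ γ, (twist act U γ).comp Y.subtype ∈ E := by
    intro γ y
    change twist act U γ₀ (twist act U γ y) = twist act U γ (twist act U γ₀ y)
    rw [← twist_mul hU, ← twist_mul hU, hcomm]
  obtain ⟨b, hbE, hbspan, hb⟩ := exists_linearIndependent F E
  have : Module.Finite F (Y →ₗ[k₀] (Fin d → O)) := inferInstance
  have hbfin : Finite b := hb.finite
  have hlev : ∀ f : Y →ₗ[k₀] (Fin d → O), ∃ n, ∀ y i, f y i ∈ L n := by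
    intro f
    obtain ⟨t, ht⟩ := hYfin.fg_top
    obtain ⟨n, hn⟩ : ∃ n, ∀ x : t × Fin d, f x.1 x.2 ∈ L n :=
      exists_nat_of_finite (fun x {n m} h hx => hL h hx) fun x => hunion _
    refine ⟨n, fun y => ?_⟩
    have hy : y ∈ Submodule.span k₀ (t : Set Y) := by rw [ht]; trivial
    induction hy using Submodule.span_induction with
    | mem x hx => exact fun i => hn (⟨x, hx⟩, i)
    | zero => intro i; rw [map_zero]; exact zero_mem _
    | add x y _ _ hx hy => intro i; rw [map_add]; exact add_mem (hx i) (hy i)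
    | smul a x _ hx => intro i; rw [map_smul]; exact (L n).smul_mem (hx i) a
  obtain ⟨n, hn⟩ : ∃ n, ∀ f : b, ∀ y i, f.1 y i ∈ L n :=
    exists_nat_of_finite (fun f {n m} h hx y i => hL h (hx y i)) fun f => hlev f
  refine ⟨max n n₀, fun γ i j => ?_⟩
  have hmem : (twist act U γ).comp Y.subtype ∈ Submodule.span F b := by
    rw [hbspan]
    exact Submodule.subset_span (hE γ)
  rw [Finsupp.mem_span_iff_linearCombination] at hmem
  obtain ⟨c, hc⟩ := hmem
  have hcy : ∀ y : Y, twist act U γ y = c.sum fun f a => a • f.1 y := by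
    intro y
    have := congrArg (fun f : Y →ₗ[k₀] (Fin d → O) => f y) hc
    refine this.symm.trans ?_
    rw [Finsupp.linearCombination_apply, Finsupp.sum, Finsupp.sum, LinearMap.sum_apply]
    rfl
  have hcs : ∀ f, s (c f) = c f := by
    have hs0 : s 0 = 0 ∨ ∀ x : O, x = 0 := by
      by_cases h : Nontrivial O
      · left
        have := hs 0
        rw [map_zero, map_zero] at this
        exact ((algebraMap F O).injective (this.symm.trans (map_zero _).symm))
      · right
        rw [not_nontrivial_iff_subsingleton] at h
        exact fun x => Subsingleton.elim _ _
    rcases hs0 with hs0 | hs0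
    swap
    · intro f
      exfalso
      refine hb.ne_zero f (LinearMap.ext fun y => funext fun i => ?_)
      exact hs0 _
    have h3 : Finsupp.linearCombination F (Subtype.val : b → _) (c.mapRange s hs0 - c) = 0 := by
      refine LinearMap.ext fun y => ?_
      let y' : Y := ⟨twist act U γ₀⁻¹ y, h₂ y y.2⟩
      have hy' : (⟨twist act U γ₀ y', h₁ y' y'.2⟩ : Y) = y := by
        refine Subtype.ext ?_
        change twist act U γ₀ (twist act U γ₀⁻¹ y) = y
        rw [← twist_mul hU, mul_inv_cancel, twist_one hU1]
      have h4 : twist act U γ₀ (twist act U γ y') = twist act U γ y := by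
        have := hE γ y'
        rw [hy'] at this
        exact this
      rw [hcy y', hcy y, Finsupp.sum, Finsupp.sum, map_sum] at h4
      have e1 : (c.mapRange s hs0).sum (fun f a => a • (f : Y →ₗ[k₀] (Fin d → O))) =
          c.sum fun f a => s a • (f : Y →ₗ[k₀] (Fin d → O)) :=
        Finsupp.sum_mapRange_index fun f => zero_smul F _
      rw [map_sub, LinearMap.sub_apply, Finsupp.linearCombination_apply,
        Finsupp.linearCombination_apply, e1, Finsupp.sum, Finsupp.sum, LinearMap.sum_apply, LinearMap.sum_apply, LinearMap.zero_apply,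
        sub_eq_zero]
      refine Eq.trans (Finset.sum_congr rfl fun f _ => ?_) h4
      rw [twist_smul hs]
      have := hbE f.2 y'
      rw [hy'] at this
      rw [this]
      rfl
    have h5 := (linearIndependent_iff.1 hb) _ h3
    intro f
    have := DFunLike.congr_fun h5 f
    rw [Finsupp.sub_apply, Finsupp.mapRange_apply, Finsupp.zero_apply, sub_eq_zero] at this
    exact this
  have hej : (Pi.single j 1 : Fin d → O) ∈ Y := by
    rw [hYmem]
    intro l
    by_cases h : l = j
    · subst h; rw [Pi.single_eq_same]; exact one_mem _
    · rw [Pi.single_eq_of_ne h]; exact zero_mem _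
  have h6 := congrFun (hcy ⟨_, hej⟩) i
  have h7 : twist act U γ (Pi.single j 1) i = U γ i j := by
    rw [twist_apply, Finset.sum_eq_single j]
    · rw [Pi.single_eq_same, map_one, mul_one]
    · intro l _ hl
      rw [Pi.single_eq_of_ne hl, map_zero, mul_zero]
    · exact fun h => absurd (Finset.mem_univ _) h
  rw [← h7, h6, Finsupp.sum, Finset.sum_apply]
  refine sum_mem fun f _ => ?_
  rw [Pi.smul_apply, Algebra.smul_def]
  exact mul_mem (hL (le_max_right _ _) (hfix _ (hcs f))) (hL (le_max_left _ _) (hn f _ i))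

/-- A family of cocycles `c γ n`, each defined and with values in the `n`-th ring for all large
`n`, that are related by the matrices `a n`, is defined for all `n ≥ N`, for some `N` independent
of `γ`. -/
theorem exists_uniform_cocycle [Module.Finite F O] {L : ℕ → Subalgebra k₀ O} (hL : Monotone L)
    (hfin : ∀ n, Module.Finite k₀ (L n)) (hunion : ∀ x, ∃ n, x ∈ L n)
    (hact : ∀ γ n, ∀ x ∈ L n, act γ x ∈ L n) (hcomm : ∀ γ γ' : G, γ * γ' = γ' * γ) {γ₀ : G}
    {s : F → F} (hs : ∀ x, act γ₀ (algebraMap F O x) = algebraMap F O (s x)) {n₀ : ℕ}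
    (hfix : ∀ x, s x = x → algebraMap F O x ∈ L n₀)
    {a b : ℕ → Matrix (Fin d) (Fin d) O} (ha : ∀ n i j, a n i j ∈ L n)
    (hb : ∀ n i j, b n i j ∈ L n) (hab : ∀ n, a n * b n = 1) {c : G → ℕ → Matrix (Fin d) (Fin d) O}
    (hc1 : ∀ᶠ n in atTop, c 1 n = 1)
    (hcmul : ∀ γ γ', ∀ᶠ n in atTop, c (γ * γ') n = c γ n * (c γ' n).map (act γ))
    (hca : ∀ γ, ∀ᶠ n in atTop, a (n + 1) * c γ n = c γ (n + 1) * (a (n + 1)).map (act γ)) :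
    ∃ N, ∃ D : G → ℕ → Matrix (Fin d) (Fin d) O,
      (∀ γ, ∀ n ≥ N, ∀ i j, D γ n i j ∈ L n) ∧ (∀ n, D 1 n = 1) ∧
      (∀ γ γ' n, D (γ * γ') n = D γ n * (D γ' n).map (act γ)) ∧
      (∀ γ n, a (n + 1) * D γ n = D γ (n + 1) * (a (n + 1)).map (act γ)) ∧
      ∀ γ, ∀ᶠ n in atTop, D γ n = c γ n := by
  have hba : ∀ n, b n * a n = 1 := fun n => mul_eq_one_comm.1 (hab n)
  let P : ℕ → Matrix (Fin d) (Fin d) O := fun n => Nat.rec 1 (fun n X => a (n + 1) * X) n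
  let Q : ℕ → Matrix (Fin d) (Fin d) O := fun n => Nat.rec 1 (fun n X => X * b (n + 1)) n
  have hPs : ∀ n, P (n + 1) = a (n + 1) * P n := fun n => rfl
  have hQs : ∀ n, Q (n + 1) = Q n * b (n + 1) := fun n => rfl
  have hPQ : ∀ n, P n * Q n = 1 := by
    intro n
    induction n with
    | zero => exact one_mul 1
    | succ n ih =>
      rw [hPs, hQs, mul_assoc, ← mul_assoc (P n), ih, one_mul, hab]
  have hQP : ∀ n, Q n * P n = 1 := fun n => mul_eq_one_comm.1 (hPQ n)
  have hmap : ∀ (γ : G) (X Z : Matrix (Fin d) (Fin d) O),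
      (X * Z).map (act γ) = X.map (act γ) * Z.map (act γ) := fun γ X Z => Matrix.map_mul
  have hmap1 : ∀ (γ : G), (1 : Matrix (Fin d) (Fin d) O).map (act γ) = 1 := fun γ =>
    Matrix.map_one _ (map_zero _) (map_one _)
  have hmm : ∀ (γ γ' : G) (X : Matrix (Fin d) (Fin d) O),
      X.map (act (γ * γ')) = (X.map (act γ')).map (act γ) := fun γ γ' X => by
    rw [map_mul, Matrix.map_map]; rfl
  have hmone : ∀ X : Matrix (Fin d) (Fin d) O, X.map (act 1) = X := fun X => by
    rw [map_one]; rfl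
  have h1L : ∀ i j, (1 : Matrix (Fin d) (Fin d) O) i j ∈ L 0 := fun i j => by
    rw [Matrix.one_apply]
    split_ifs
    · exact one_mem _
    · exact zero_mem _
  have hPL : ∀ n i j, P n i j ∈ L n := by
    intro n
    induction n with
    | zero => exact h1L
    | succ n ih => exact matrix_mul_mem (ha _) fun i j => hL (Nat.le_succ n) (ih i j)
  have hQL : ∀ n i j, Q n i j ∈ L n := by
    intro n
    induction n with
    | zero => exact h1L
    | succ n ih => exact matrix_mul_mem (fun i j => hL (Nat.le_succ n) (ih i j)) (hb _)
  have hstep : ∀ γ, ∃ X : Matrix (Fin d) (Fin d) O, ∀ᶠ n in atTop,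
      c γ n = P n * X * (Q n).map (act γ) := by
    intro γ
    obtain ⟨m, hm⟩ := eventually_atTop.1 (hca γ)
    refine ⟨Q m * c γ m * (P m).map (act γ), eventually_atTop.2 ⟨m, fun n hn => ?_⟩⟩
    induction n, hn using Nat.le_induction with
    | base =>
      have h1 : (P m).map (act γ) * (Q m).map (act γ) = 1 := by rw [← hmap, hPQ, hmap1]
      calc c γ m = (P m * Q m) * c γ m * ((P m).map (act γ) * (Q m).map (act γ)) := by
            rw [hPQ, h1, one_mul, mul_one]
        _ = _ := by simp only [mul_assoc]
    | succ n hn ih =>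
      have h1 : (a (n + 1)).map (act γ) * (b (n + 1)).map (act γ) = 1 := by
        rw [← hmap, hab, hmap1]
      calc c γ (n + 1) = c γ (n + 1) * (a (n + 1)).map (act γ) * (b (n + 1)).map (act γ) := by
            rw [mul_assoc, h1, mul_one]
        _ = a (n + 1) * c γ n * (b (n + 1)).map (act γ) := by rw [hm n hn]
        _ = _ := by
            rw [ih, hPs, hQs, hmap]
            simp only [mul_assoc]
  choose U hUc using hstep
  have hQPg : ∀ γ n, (Q n).map (act γ) * (P n).map (act γ) = 1 := fun γ n => by
    rw [← hmap, hQP, hmap1]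
  have hcan : ∀ (γ : G) (n : ℕ) (X Z : Matrix (Fin d) (Fin d) O),
      P n * X * (Q n).map (act γ) = P n * Z * (Q n).map (act γ) → X = Z := by
    intro γ n X Z h
    have h1 := congrArg (fun W => Q n * W * (P n).map (act γ)) h
    have h2 : ∀ W, Q n * (P n * W * (Q n).map (act γ)) * (P n).map (act γ) = W := fun W => by
      calc _ = (Q n * P n) * W * ((Q n).map (act γ) * (P n).map (act γ)) := by
            simp only [mul_assoc]
        _ = W := by rw [hQP, hQPg, one_mul, mul_one]
    exact (h2 X).symm.trans (h1.trans (h2 Z))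
  have hmulD : ∀ (γ γ' : G) (n : ℕ) (X Z : Matrix (Fin d) (Fin d) O),
      P n * X * (Q n).map (act γ) * (P n * Z * (Q n).map (act γ')).map (act γ) =
        P n * (X * Z.map (act γ)) * (Q n).map (act (γ * γ')) := by
    intro γ γ' n X Z
    rw [hmap, hmap, ← hmm]
    calc _ = P n * X * ((Q n).map (act γ) * (P n).map (act γ)) * Z.map (act γ) *
          (Q n).map (act (γ * γ')) := by simp only [mul_assoc]
      _ = _ := by rw [hQPg, mul_one]; simp only [mul_assoc]
  have hU1 : U 1 = 1 := by
    obtain ⟨n, h1, h2⟩ := ((hUc 1).and hc1).exists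
    refine hcan 1 n _ _ ?_
    rw [← h1, h2, mul_one, hmone, hPQ]
  have hUmul : ∀ γ γ', U (γ * γ') = U γ * (U γ').map (act γ) := by
    intro γ γ'
    obtain ⟨n, ⟨h1, h2⟩, h3, h4⟩ :=
      (((hUc γ).and (hUc γ')).and ((hUc (γ * γ')).and (hcmul γ γ'))).exists
    refine hcan (γ * γ') n _ _ ?_
    rw [← h3, h4, h1, h2, hmulD]
  obtain ⟨N, hN⟩ := exists_cocycle_level hL hfin hunion hact hcomm hs hfix hU1 hUmul
  refine ⟨N, fun γ n => P n * U γ * (Q n).map (act γ), fun γ n hn i j => ?_, fun n => ?_,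
    fun γ γ' n => ?_, fun γ n => ?_, fun γ => ?_⟩
  · exact matrix_mul_mem (matrix_mul_mem (hPL n) fun i j => hL hn (hN γ i j))
      (fun i j => hact γ n _ (hQL n i j)) i j
  · beta_reduce
    rw [hU1, mul_one, hmone, hPQ]
  · beta_reduce
    rw [hmulD, hUmul]
  · beta_reduce
    have h1 : (b (n + 1)).map (act γ) * (a (n + 1)).map (act γ) = 1 := by
      rw [← hmap, hba, hmap1]
    rw [hPs, hQs, hmap]
    calc _ = a (n + 1) * P n * U γ * (Q n).map (act γ) * 1 := by simp only [mul_assoc, mul_one]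
      _ = _ := by rw [← h1]; simp only [mul_assoc]
  · filter_upwards [hUc γ] with n hn
    exact hn.symm

end Cocycles

/-! ## The union of the cyclotomic fields -/

section Union

/-- Truncated power series form a finite module. -/
theorem finite_truncated (F : Type*) [Field F] (k : ℕ) :
    Module.Finite F (F⟦X⟧ ⧸ Ideal.span {(X : F⟦X⟧) ^ k}) := by
  let l : (Fin k → F) →ₗ[F] (F⟦X⟧ ⧸ Ideal.span {(X : F⟦X⟧) ^ k}) :=
    ∑ i : Fin k, ((LinearMap.toSpanSingleton F _
      (Ideal.Quotient.mk (Ideal.span {(X : F⟦X⟧) ^ k}) (X ^ (i : ℕ)))).comp (LinearMap.proj i))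
  refine Module.Finite.of_surjective l fun x => ?_
  obtain ⟨f, rfl⟩ := Ideal.Quotient.mk_surjective x
  refine ⟨fun i => coeff i f, ?_⟩
  have h1 : l (fun i => coeff i f) = Ideal.Quotient.mk (Ideal.span {(X : F⟦X⟧) ^ k})
      (∑ i : Fin k, coeff (i : ℕ) f • (X : F⟦X⟧) ^ (i : ℕ)) := by
    rw [LinearMap.sum_apply, map_sum]
    rfl
  rw [h1, Ideal.Quotient.eq, Ideal.mem_span_singleton, X_pow_dvd_iff]
  intro m hm
  rw [map_sub, map_sum, Finset.sum_eq_single (⟨m, hm⟩ : Fin k)]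
  · simp [coeff_X_pow]
  · intro i _ hi
    have : m ≠ (i : ℕ) := fun h => hi (Fin.ext h.symm)
    simp [coeff_X_pow, this]
  · exact fun h => absurd (Finset.mem_univ _) h

variable {p : ℕ} [hp : Fact p.Prime] (ε : EpsSeq p)

/-- The union of the fields `ℚ_p(ε^(n))`. -/
def Kinf : IntermediateField ℚ_[p] (PadicAlgCl p) := ⨆ n, Kn ε n

theorem Kn_le_Kinf (n : ℕ) : Kn ε n ≤ Kinf ε := le_iSup (Kn ε) n

theorem mem_Kinf {x : PadicAlgCl p} : x ∈ Kinf ε ↔ ∃ n, x ∈ Kn ε n := by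
  have hdir : Directed (· ≤ ·) (Kn ε) := directed_of_isDirected_le fun _ _ h => Kn_mono ε h
  rw [← SetLike.mem_coe, Kinf, IntermediateField.coe_iSup_of_directed hdir, Set.mem_iUnion]
  rfl

/-- The inclusion `ℚ_p(ε^(n)) → ℚ_p(ε^(∞))`. -/
def inclInf (n : ℕ) : Kn ε n →ₐ[ℚ_[p]] Kinf ε := IntermediateField.inclusion (Kn_le_Kinf ε n)

theorem inclInf_coe (n : ℕ) (x : Kn ε n) : (inclInf ε n x : PadicAlgCl p) = x :=
  IntermediateField.coe_inclusion (Kn_le_Kinf ε n) x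

theorem inclInf_inclK {n m : ℕ} (h : n ≤ m) (x : Kn ε n) :
    inclInf ε m (inclK ε h x) = inclInf ε n x :=
  Subtype.ext (by rw [inclInf_coe, inclInf_coe, inclK_coe])

theorem exists_inclInf (x : Kinf ε) : ∃ n, ∃ y : Kn ε n, inclInf ε n y = x := by
  obtain ⟨n, hn⟩ := (mem_Kinf ε).1 x.2
  exact ⟨n, ⟨x, hn⟩, Subtype.ext (inclInf_coe ε n _)⟩

theorem coe_gamK_mk (n : ℕ) (g : PadicAlgCl p ≃ₐ[ℚ_[p]] PadicAlgCl p) (x : Kn ε n) :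
    (gamK ε n (QuotientGroup.mk g) x : PadicAlgCl p) = g x := rfl

/-- The action of `Γ` on `ℚ_p(ε^(∞))`. -/
def gamInf (γ : Gam p) : Kinf ε →ₐ[ℚ_[p]] Kinf ε :=
  ((Quotient.out γ : PadicAlgCl p ≃ₐ[ℚ_[p]] PadicAlgCl p).toAlgHom.comp (Kinf ε).val).codRestrict
    (Kinf ε).toSubalgebra fun x => by
      obtain ⟨n, hn⟩ := (mem_Kinf ε).1 x.2
      exact (mem_Kinf ε).2 ⟨n, map_mem_Kn ε _ n ⟨x, hn⟩⟩

theorem gamInf_inclInf (γ : Gam p) (n : ℕ) (x : Kn ε n) :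
    gamInf ε γ (inclInf ε n x) = inclInf ε n (gamK ε n γ x) := by
  refine Subtype.ext ?_
  rw [inclInf_coe]
  have h1 : QuotientGroup.mk (Quotient.out γ) = γ := Quotient.out_eq γ
  conv_rhs => rw [← h1]
  rw [coe_gamK_mk]
  change Quotient.out γ (inclInf ε n x : PadicAlgCl p) = _
  rw [inclInf_coe]

variable (k : ℕ)

/-- The ring `ℚ_p(ε^(∞))[t] / (t ^ k)`. -/
abbrev KTinf : Type := (Kinf ε)⟦X⟧ ⧸ Ideal.span {(X : (Kinf ε)⟦X⟧) ^ k}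

instance : Module.Finite (Kinf ε) (KTinf ε k) := finite_truncated _ k

instance (n : ℕ) : Module.Finite ℚ_[p] (KT ε k n) :=
  have : Module.Finite (Kn ε n) (KT ε k n) := finite_truncated _ k
  Module.Finite.trans (Kn ε n) (KT ε k n)

/-- The inclusion of `ℚ_p(ε^(n))[t] / (t ^ k)`. -/
def inclKTinf (n : ℕ) : KT ε k n →ₐ[ℚ_[p]] KTinf ε k :=
  { quotMap (PowerSeries.map (inclInf ε n : Kn ε n →+* Kinf ε)) _ _ (by rw [map_pow, map_X]) with
    commutes' := fun a => by
      change Ideal.Quotient.mk _ (PowerSeries.map (inclInf ε n : Kn ε n →+* Kinf ε)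
        (algebraMap ℚ_[p] (Kn ε n)⟦X⟧ a)) =
        Ideal.Quotient.mk _ (algebraMap ℚ_[p] (Kinf ε)⟦X⟧ a)
      rw [PowerSeries.algebraMap_apply, PowerSeries.algebraMap_apply, map_C]
      exact congrArg (fun z => Ideal.Quotient.mk _ (C z)) ((inclInf ε n).commutes a) }

theorem inclKTinf_mk (n : ℕ) (f : (Kn ε n)⟦X⟧) : inclKTinf ε k n (Ideal.Quotient.mk _ f) =
    Ideal.Quotient.mk _ (PowerSeries.map (inclInf ε n : Kn ε n →+* Kinf ε) f) := rfl

theorem rescale_C_eq {A : Type*} [CommRing A] (a c : A) : rescale a (C c) = C c := by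
  ext i
  rw [coeff_rescale, coeff_C]
  split_ifs with h
  · rw [h, pow_zero, one_mul]
  · rw [mul_zero]

/-- The action of `Γ` on `ℚ_p(ε^(∞))[t] / (t ^ k)`. -/
def gamKTinf (γ : Gam p) : KTinf ε k →ₐ[ℚ_[p]] KTinf ε k :=
  { quotMap ((rescale (algebraMap ℚ_[p] (Kinf ε) ((chi p γ : ℤ_[p]) : ℚ_[p]))).comp
      (PowerSeries.map (gamInf ε γ : Kinf ε →+* Kinf ε))) _ _ (by
        rw [map_pow]
        refine pow_dvd_pow_of_dvd ?_ k
        rw [RingHom.comp_apply, map_X, rescale_X]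
        exact dvd_mul_left _ _) with
    commutes' := fun a => by
      change Ideal.Quotient.mk _ (rescale _ (PowerSeries.map (gamInf ε γ : Kinf ε →+* Kinf ε)
        (algebraMap ℚ_[p] (Kinf ε)⟦X⟧ a))) =
        Ideal.Quotient.mk _ (algebraMap ℚ_[p] (Kinf ε)⟦X⟧ a)
      rw [PowerSeries.algebraMap_apply, map_C, rescale_C_eq]
      exact congrArg (fun z => Ideal.Quotient.mk _ (C z)) ((gamInf ε γ).commutes a) }

theorem gamKTinf_mk (γ : Gam p) (f : (Kinf ε)⟦X⟧) : gamKTinf ε k γ (Ideal.Quotient.mk _ f) =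
    Ideal.Quotient.mk _ (rescale (algebraMap ℚ_[p] (Kinf ε) ((chi p γ : ℤ_[p]) : ℚ_[p]))
      (PowerSeries.map (gamInf ε γ : Kinf ε →+* Kinf ε) f)) := rfl

theorem exists_inclKTinf (x : KTinf ε k) : ∃ n, ∃ y : KT ε k n, inclKTinf ε k n y = x := by
  obtain ⟨f, rfl⟩ := Ideal.Quotient.mk_surjective x
  obtain ⟨n, hn⟩ : ∃ n, ∀ i : Fin k, ((coeff (i : ℕ) f : Kinf ε) : PadicAlgCl p) ∈ Kn ε n :=
    exists_nat_of_finite (fun i {n m} h hx => Kn_mono ε h hx) fun i =>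
      (mem_Kinf ε).1 (coeff (i : ℕ) f).2
  refine ⟨n, Ideal.Quotient.mk _ (PowerSeries.mk fun i =>
    if h : i < k then ⟨((coeff i f : Kinf ε) : PadicAlgCl p), hn ⟨i, h⟩⟩ else 0), ?_⟩
  rw [inclKTinf_mk, Ideal.Quotient.eq, Ideal.mem_span_singleton, X_pow_dvd_iff]
  intro m hm
  rw [map_sub, coeff_map, coeff_mk, dif_pos hm, sub_eq_zero]
  exact Subtype.ext (inclInf_coe ε n _)

theorem inclKTinf_injective (n : ℕ) : Function.Injective (inclKTinf ε k n) := by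
  rw [injective_iff_map_eq_zero]
  intro x hx
  obtain ⟨f, rfl⟩ := Ideal.Quotient.mk_surjective x
  rw [inclKTinf_mk] at hx
  rw [Ideal.Quotient.eq_zero_iff_mem, Ideal.mem_span_singleton, X_pow_dvd_iff] at hx ⊢
  intro m hm
  have := hx m hm
  rw [coeff_map] at this
  exact (inclInf ε n).injective (this.trans (map_zero _).symm)

theorem inclKTinf_inclKT {n m : ℕ} (h : n ≤ m) (x : KT ε k n) :
    inclKTinf ε k m (inclKT ε k h x) = inclKTinf ε k n x := by
  obtain ⟨f, rfl⟩ := Ideal.Quotient.mk_surjective x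
  refine congrArg (Ideal.Quotient.mk _) (PowerSeries.ext fun i => ?_)
  rw [coeff_map, coeff_map, coeff_inclPS]
  exact inclInf_inclK ε h _

theorem inclKTinf_gamKT (n : ℕ) (γ : Gam p) (x : KT ε k n) :
    inclKTinf ε k n (gamKT ε k n γ x) = gamKTinf ε k γ (inclKTinf ε k n x) := by
  obtain ⟨f, rfl⟩ := Ideal.Quotient.mk_surjective x
  refine congrArg (Ideal.Quotient.mk _) (PowerSeries.ext fun i => ?_)
  rw [RingHom.comp_apply, coeff_map, coeff_rescale, coeff_map, coeff_map, coeff_gamPS, map_mul,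
    map_pow]
  refine congrArg₂ _ (congrArg (· ^ i) ((inclInf ε n).commutes _)) ?_
  exact (gamInf_inclInf ε γ n _).symm

/-- The action of `Γ` on `ℚ_p(ε^(∞))[t] / (t ^ k)`. -/
def actKTinf : Gam p →* (KTinf ε k →ₐ[ℚ_[p]] KTinf ε k) where
  toFun := gamKTinf ε k
  map_one' := by
    refine AlgHom.ext fun x => ?_
    obtain ⟨n, y, rfl⟩ := exists_inclKTinf ε k x
    rw [← inclKTinf_gamKT, gamKT_one]
    rfl
  map_mul' γ γ' := by
    refine AlgHom.ext fun x => ?_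
    obtain ⟨n, y, rfl⟩ := exists_inclKTinf ε k x
    rw [← inclKTinf_gamKT, gamKT_mul, inclKTinf_gamKT, inclKTinf_gamKT]
    rfl

/-- The subring `ℚ_p(ε^(n))[t] / (t ^ k)` of `ℚ_p(ε^(∞))[t] / (t ^ k)`. -/
def levelKT (n : ℕ) : Subalgebra ℚ_[p] (KTinf ε k) := (inclKTinf ε k n).range

theorem levelKT_mono : Monotone (levelKT ε k) := by
  rintro n m h _ ⟨x, rfl⟩
  exact ⟨inclKT ε k h x, inclKTinf_inclKT ε k h x⟩

theorem levelKT_finite (n : ℕ) : Module.Finite ℚ_[p] (levelKT ε k n) :=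
  Module.Finite.of_surjective (inclKTinf ε k n).rangeRestrict.toLinearMap
    (inclKTinf ε k n).rangeRestrict_surjective

theorem Gam_mul_comm (γ γ' : Gam p) : γ * γ' = γ' * γ :=
  QuotientGroup.kerLift_injective (chiG p) (by
    change chi p (γ * γ') = chi p (γ' * γ)
    rw [map_mul, map_mul, mul_comm])

theorem exists_gam_fixed : ∃ γ : Gam p, ((chi p γ : ℤ_[p]ˣ) : ℤ_[p]) = (1 + p ^ 2 : ℕ) ∧
    ∀ x : Kinf ε, gamInf ε γ x = x → (x : PadicAlgCl p) ∈ Kn ε 2 := by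
  have hcop : (1 + p ^ 2).Coprime p := by
    rw [Nat.coprime_comm, hp.1.coprime_iff_not_dvd]
    intro h
    have h1 := (Nat.dvd_add_right (dvd_pow_self p two_ne_zero)).1 (by rwa [add_comm] at h)
    exact hp.1.one_lt.ne' (Nat.dvd_one.1 h1)
  obtain ⟨σ, hσ, hσ'⟩ := exists_chi_eq ε hcop
  refine ⟨QuotientGroup.mk σ, hσ', fun x hx => ?_⟩
  obtain ⟨n, y, rfl⟩ := exists_inclInf ε x
  rw [gamInf_inclInf] at hx
  have h1 := congrArg (fun z : Kinf ε => (z : PadicAlgCl p)) hx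
  simp only [inclInf_coe, coe_gamK_mk] at h1
  rw [inclInf_coe]
  exact mem_Kn_two_of_fixed ε hσ n y.2 h1

end Union

/-! ## Models of pure `t ^ k`-torsion modules -/

section RadiusLimit

variable {p : ℕ} [hp : Fact p.Prime]

instance : Nonempty (Radius p) := ⟨⟨_, le_rfl⟩⟩

theorem exists_radius_ge {ι : Type*} [Finite ι] (f : ι → Radius p) : ∃ r, ∀ i, f i ≤ r := by
  obtain ⟨r, hr⟩ := (Set.finite_range f).bddAbove
  exact ⟨r, fun i => hr ⟨i, rfl⟩⟩

theorem exists_mem_RobbaR (f : Robba p) : ∃ r : Radius p, f ∈ RobbaR p r := by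
  obtain ⟨r, h1, h2⟩ := ((eventually_mem_RobbaR f).and (eventually_ge_atTop ((p : ℝ) - 1))).exists
  exact ⟨⟨r, h2⟩, h1⟩

theorem RobbaR_le {r r' : Radius p} (h : r ≤ r') : RobbaR p r ≤ RobbaR p r' := RobbaR_mono r.pos h

theorem tendsto_nOf_radius (n : ℕ) : ∃ r : Radius p, ∀ r', r ≤ r' → (n : ℝ) ≤ nOf p r' := by
  obtain ⟨r, hr⟩ : ∃ r : ℝ, (p : ℝ) ^ n * (p - 1) + (p : ℝ) ≤ r := ⟨_, le_rfl⟩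
  have hp1 := one_lt_p (p := p)
  have h0 : (0 : ℝ) ≤ (p : ℝ) ^ n * (p - 1) := mul_nonneg (by positivity) (by linarith)
  refine ⟨⟨r, by linarith⟩, fun r' h => ?_⟩
  have h2 : r ≤ (r' : ℝ) := h
  by_contra hcon
  push Not at hcon
  have h3 : nOf p r' ≤ (n + 1 : ℕ) := by push_cast; linarith
  rw [nOf_le_iff r'.2] at h3
  linarith

variable (k : ℕ)

theorem toRQuot_resQ {r r' : Radius p} (h : r ≤ r') (x : RQ k r) :
    toRQuot k r' (resQ k h x) = toRQuot k r x := by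
  obtain ⟨f, rfl⟩ := Ideal.Quotient.mk_surjective x
  rfl

theorem exists_toRQuot (x : RQuot p k) : ∃ r, ∃ y : RQ k r, toRQuot k r y = x := by
  obtain ⟨f, rfl⟩ := Ideal.Quotient.mk_surjective x
  obtain ⟨r, hr⟩ := exists_mem_RobbaR f
  exact ⟨r, Ideal.Quotient.mk _ ⟨f, hr⟩, rfl⟩

theorem exists_toRQuot_matrix {ι : Type*} [Finite ι] (X : Matrix ι ι (RQuot p k)) (r₁ : Radius p) :
    ∃ r, r₁ ≤ r ∧ ∃ Y : Matrix ι ι (RQ k r), Y.map (toRQuot k r) = X := by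
  choose r y hy using fun x : ι × ι => exists_toRQuot k (X x.1 x.2)
  obtain ⟨R, hR⟩ := exists_radius_ge r
  refine ⟨max R r₁, le_max_right _ _, Matrix.of fun i j =>
    resQ k ((hR (i, j)).trans (le_max_left _ _)) (y (i, j)), ?_⟩
  ext i j
  rw [Matrix.map_apply, Matrix.of_apply, toRQuot_resQ, hy]

theorem exists_resQ_eq {r r' : Radius p} {x : RQ k r} {x' : RQ k r'}
    (h : toRQuot k r x = toRQuot k r' x') :
    ∃ r'', ∃ (h₁ : r ≤ r'') (h₂ : r' ≤ r''), resQ k h₁ x = resQ k h₂ x' := by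
  obtain ⟨f, rfl⟩ := Ideal.Quotient.mk_surjective x
  obtain ⟨f', rfl⟩ := Ideal.Quotient.mk_surjective x'
  have h1 : (Ideal.Quotient.mk (Ideal.span {tElt p ^ k}) (f : Robba p)) =
    Ideal.Quotient.mk _ (f' : Robba p) := h
  rw [Ideal.Quotient.eq, Ideal.mem_span_singleton] at h1
  obtain ⟨g, hg⟩ := h1
  obtain ⟨s, hs⟩ := exists_mem_RobbaR g
  refine ⟨max s (max r r'), (le_max_left _ _).trans (le_max_right _ _),
    (le_max_right _ _).trans (le_max_right _ _), ?_⟩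
  change Ideal.Quotient.mk (Ideal.span {tR (max s (max r r')) ^ k}) (resR _ f) =
    Ideal.Quotient.mk _ (resR _ f')
  rw [Ideal.Quotient.eq, Ideal.mem_span_singleton]
  exact ⟨⟨g, RobbaR_le (le_max_left _ _) hs⟩, Subtype.ext hg⟩

theorem exists_resQ_matrix_eq {ι : Type*} [Finite ι] {r : Radius p} {X Y : Matrix ι ι (RQ k r)}
    (h : X.map (toRQuot k r) = Y.map (toRQuot k r)) :
    ∃ r', ∃ h' : r ≤ r', X.map (resQ k h') = Y.map (resQ k h') := by
  have h1 : ∀ x : ι × ι, toRQuot k r (X x.1 x.2) = toRQuot k r (Y x.1 x.2) := fun x =>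
    congrFun (congrFun h x.1) x.2
  choose s h₁ h₂ hs using fun x => exists_resQ_eq k (h1 x)
  obtain ⟨R, hR⟩ := exists_radius_ge s
  refine ⟨max R r, le_max_right _ _, ?_⟩
  ext i j
  have := congrArg (resQ k ((hR (i, j)).trans (le_max_left R r))) (hs (i, j))
  rwa [resQ_resQ, resQ_resQ] at this

/-- The Frobenius of `R / (t ^ k)`. -/
def frobQuot : RQuot p k →+* RQuot p k :=
  quotMap (frob p) _ _ (by
    rw [map_pow]
    exact pow_dvd_pow_of_dvd (by rw [frob_tElt]; exact dvd_mul_left _ _) k)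

/-- The action of `Γ` on `R / (t ^ k)`. -/
def gamQuot (γ : Gam p) : RQuot p k →+* RQuot p k :=
  quotMap (gam (chi p γ)) _ _ (by
    rw [map_pow]
    exact pow_dvd_pow_of_dvd (by rw [gam_tElt]; exact dvd_mul_left _ _) k)

theorem toRQuot_frobQ {r : Radius p} (x : RQ k r) :
    toRQuot k r.frob (frobQ k r x) = frobQuot k (toRQuot k r x) := by
  obtain ⟨f, rfl⟩ := Ideal.Quotient.mk_surjective x
  rfl

theorem toRQuot_gamQ {r : Radius p} (γ : Gam p) (x : RQ k r) :
    toRQuot k r (gamQ k r γ x) = gamQuot k γ (toRQuot k r x) := by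
  obtain ⟨f, rfl⟩ := Ideal.Quotient.mk_surjective x
  rfl

/-! ### Localization for large `n` -/

variable (ε : EpsSeq p)

/-- The localization map `R^r / (t ^ k) → ℚ_p(ε^(∞))[t] / (t ^ k)`. -/
def locHom {r : Radius p} {n : ℕ} (hn : nOf p r ≤ n) : RQ k r →+* KTinf ε k :=
  (inclKTinf ε k n : KT ε k n →+* KTinf ε k).comp (iotaQ ε k r hn)

theorem locHom_resQ {r r' : Radius p} (h : r ≤ r') {n : ℕ} (hn : nOf p r ≤ n) (hn' : nOf p r' ≤ n)
    (x : RQ k r) : locHom k ε hn' (resQ k h x) = locHom k ε hn x :=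
  congrArg (inclKTinf ε k n) (iotaQ_resQ ε k h hn hn' x)

theorem locHom_frobQ {r : Radius p} {n : ℕ} (hn : nOf p r ≤ n) (hn' : nOf p r.frob ≤ (n + 1 : ℕ))
    (x : RQ k r) : locHom k ε hn' (frobQ k r x) = locHom k ε hn x := by
  refine (congrArg (inclKTinf ε k (n + 1)) (iotaQ_frobQ ε k r hn hn' x)).trans ?_
  exact inclKTinf_inclKT ε k _ _

theorem locHom_gamQ {r : Radius p} {n : ℕ} (hn : nOf p r ≤ n) (γ : Gam p) (x : RQ k r) :
    locHom k ε hn (gamQ k r γ x) = actKTinf ε k γ (locHom k ε hn x) :=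
  (congrArg (inclKTinf ε k n) (iotaQ_gamQ ε k r hn γ x)).trans (inclKTinf_gamKT ε k n γ _)

theorem locHom_mem {r : Radius p} {n : ℕ} (hn : nOf p r ≤ n) (x : RQ k r) :
    locHom k ε hn x ∈ levelKT ε k n := ⟨_, rfl⟩

theorem locHom_ext {r : Radius p} {x y : RQ k r}
    (h : ∀ (n : ℕ) (hn : nOf p r ≤ n), locHom k ε hn x = locHom k ε hn y) : x = y :=
  RQ_ext ε fun n hn => inclKTinf_injective ε k n (h n hn)

open Classical in
/-- The localizations of an element of `R / (t ^ k)`, for all large `n`. -/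
def loc (n : ℕ) (x : RQuot p k) : KTinf ε k :=
  if hn : nOf p (exists_toRQuot k x).choose ≤ n then
    locHom k ε hn (exists_toRQuot k x).choose_spec.choose else 0

theorem eventually_nOf_le (r : ℝ) : ∀ᶠ n : ℕ in atTop, nOf p r ≤ n :=
  tendsto_natCast_atTop_atTop.eventually (eventually_ge_atTop _)

theorem eventually_loc {r : Radius p} (y : RQ k r) :
    ∀ᶠ n : ℕ in atTop, ∀ hn : nOf p r ≤ n, loc k ε n (toRQuot k r y) = locHom k ε hn y := by
  set x := toRQuot k r y with hx
  obtain ⟨r', h₁, h₂, h⟩ := exists_resQ_eq k ((exists_toRQuot k x).choose_spec.choose_spec.trans hx)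
  filter_upwards [eventually_nOf_le (p := p) r'] with n hn' hn
  have hn₁ := (Radius.nOf_mono h₁).trans hn'
  rw [loc, dif_pos hn₁, ← locHom_resQ k ε h₁ hn₁ hn', h, locHom_resQ]

theorem eventually_loc_matrix {ι : Type*} [Finite ι] {r : Radius p} (Y : Matrix ι ι (RQ k r)) :
    ∀ᶠ n : ℕ in atTop, ∀ hn : nOf p r ≤ n,
      (Y.map (toRQuot k r)).map (loc k ε n) = Y.map (locHom k ε hn) := by
  have h : ∀ᶠ n : ℕ in atTop, ∀ x : ι × ι, ∀ hn : nOf p r ≤ n,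
      loc k ε n (toRQuot k r (Y x.1 x.2)) = locHom k ε hn (Y x.1 x.2) :=
    eventually_all.2 fun x => eventually_loc k ε (Y x.1 x.2)
  filter_upwards [h] with n h hn
  ext i j
  exact h (i, j) hn

theorem toRQuot_eq_of_eventually {r r' : Radius p} {x : RQ k r} {x' : RQ k r'}
    (h : ∀ᶠ n : ℕ in atTop, ∀ (hn : nOf p r ≤ n) (hn' : nOf p r' ≤ n),
      locHom k ε hn x = locHom k ε hn' x') : toRQuot k r x = toRQuot k r' x' := by
  obtain ⟨N, hN⟩ := eventually_atTop.1 h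
  obtain ⟨R, hR⟩ := tendsto_nOf_radius (p := p) N
  have h₁ : r ≤ max R (max r r') := (le_max_left _ _).trans (le_max_right _ _)
  have h₂ : r' ≤ max R (max r r') := (le_max_right _ _).trans (le_max_right _ _)
  rw [← toRQuot_resQ k h₁, ← toRQuot_resQ k h₂]
  congr 1
  refine locHom_ext k ε fun n hn => ?_
  have h1 : N ≤ n := by exact_mod_cast (hR _ (le_max_left _ _)).trans hn
  have hn₁ := (Radius.nOf_mono h₁).trans hn
  have hn₂ := (Radius.nOf_mono h₂).trans hn
  rw [locHom_resQ k ε h₁ hn₁ hn, locHom_resQ k ε h₂ hn₂ hn]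
  exact hN n h1 hn₁ hn₂

end RadiusLimit

section TorsionMatrices

variable {p : ℕ} [hp : Fact p.Prime] {k d : ℕ} {S : Type*} [AddCommGroup S] [Module (Robba p) S]
  [Module (RQuot p k) S] [IsScalarTower (Robba p) (RQuot p k) S] (hS : GenPhiGamma p S)
  (e : Module.Basis (Fin d) (RQuot p k) S)

theorem mk_smul (f : Robba p) (x : S) : (Ideal.Quotient.mk _ f : RQuot p k) • x = f • x :=
  algebraMap_smul (RQuot p k) f x

/-- The matrix of a map. -/
def matOf (F : S → S) : Matrix (Fin d) (Fin d) (RQuot p k) := fun i j => e.repr (F (e j)) i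

theorem matOf_sum (F : S → S) (j : Fin d) : F (e j) = ∑ i, matOf e F i j • e i :=
  (e.sum_repr _).symm

theorem matOf_comp {σ : RQuot p k →+* RQuot p k} {F : S →+ S}
    (hF : ∀ (a : RQuot p k) x, F (a • x) = σ a • F x) (G : S → S) :
    matOf e (F ∘ G) = matOf e F * (matOf e G).map σ := by
  ext i j
  rw [Matrix.mul_apply]
  change e.repr (F (G (e j))) i = _
  rw [matOf_sum e G j, map_sum, map_sum, Finsupp.finsetSum_apply]
  refine Finset.sum_congr rfl fun l _ => ?_
  rw [hF, map_smul, Finsupp.smul_apply, smul_eq_mul, mul_comm, Matrix.map_apply]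
  rfl

theorem phi_smul_quot (a : RQuot p k) (x : S) : hS.phi (a • x) = frobQuot k a • hS.phi x := by
  obtain ⟨f, rfl⟩ := Ideal.Quotient.mk_surjective a
  rw [mk_smul, map_smulₛₗ]
  exact (mk_smul _ _).symm

theorem act_smul_quot (γ : Gam p) (a : RQuot p k) (x : S) :
    hS.act γ (a • x) = gamQuot k γ a • hS.act γ x := by
  obtain ⟨f, rfl⟩ := Ideal.Quotient.mk_surjective a
  rw [mk_smul, hS.act_smul]
  exact (mk_smul _ _).symm

theorem exists_phi_inverse : ∃ B, matOf e hS.phi * B = 1 := by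
  have h1 : ∀ z, ∃ b : Fin d → RQuot p k, Ext.lift hS.phi z = ∑ j, b j • hS.phi (e j) := by
    intro z
    refine Ext.induction (P := fun z => ∃ b : Fin d → RQuot p k,
      Ext.lift hS.phi z = ∑ j, b j • hS.phi (e j)) ⟨0, by simp⟩ ?_ (fun f x => ?_) z
    · rintro x y ⟨b, hb⟩ ⟨c, hc⟩
      exact ⟨b + c, by simp only [map_add, hb, hc, Pi.add_apply, add_smul, Finset.sum_add_distrib]⟩
    · refine ⟨fun j => Ideal.Quotient.mk _ f * frobQuot k (e.repr x j), ?_⟩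
      rw [Ext.lift_smul_of]
      conv_lhs => rw [← e.sum_repr x, map_sum, Finset.smul_sum]
      refine Finset.sum_congr rfl fun j _ => ?_
      rw [phi_smul_quot, mul_smul, mk_smul]
  choose z hz using hS.bijective.2
  choose b hb using h1
  refine ⟨Matrix.of fun j i => b (z (e i)) j, ?_⟩
  ext l i
  have h2 := hb (z (e i))
  rw [hz] at h2
  have h3 := congrArg (fun x => e.repr x l) h2
  simp only [map_sum, map_smul, Finsupp.finsetSum_apply, Finsupp.smul_apply, smul_eq_mul,
    Module.Basis.repr_self] at h3
  rw [Matrix.mul_apply, Matrix.one_apply]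
  rw [Finsupp.single_apply] at h3
  simp only [eq_comm (a := l)]
  rw [h3]
  exact Finset.sum_congr rfl fun j _ => mul_comm _ _

theorem matOf_act_one : matOf e (hS.act 1) = 1 := by
  ext i j
  change e.repr (hS.act 1 (e j)) i = _
  rw [map_one, Matrix.one_apply]
  change e.repr (e j) i = _
  rw [Module.Basis.repr_self, Finsupp.single_apply]
  simp only [eq_comm]

theorem matOf_act_mul (γ γ' : Gam p) : matOf e (hS.act (γ * γ')) =
    matOf e (hS.act γ) * (matOf e (hS.act γ')).map (gamQuot k γ) := by
  refine Eq.trans ?_ (matOf_comp e (F := (hS.act γ : S →+ S)) (act_smul_quot hS γ) (hS.act γ'))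
  rw [map_mul]
  rfl

theorem matOf_comm (γ : Gam p) :
    matOf e hS.phi * (matOf e (hS.act γ)).map (frobQuot k) =
      matOf e (hS.act γ) * (matOf e hS.phi).map (gamQuot k γ) := by
  refine (matOf_comp e (F := hS.phi.toAddMonoidHom) (phi_smul_quot hS) _).symm.trans
    (Eq.trans ?_ (matOf_comp e (F := (hS.act γ : S →+ S)) (act_smul_quot hS γ) hS.phi))
  congr 1
  exact funext fun x => (hS.act_phi γ x).symm

end TorsionMatrices

section TorsionModels

variable {p : ℕ} [hp : Fact p.Prime] {k d : ℕ}

theorem map_map_one {A B ι : Type*} [DecidableEq ι] [CommRing A] [CommRing B] (f : A →+* B) :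
    (1 : Matrix ι ι A).map f = 1 := Matrix.map_one _ (map_zero _) (map_one _)

theorem exists_inverse_radius (Abar : Matrix (Fin d) (Fin d) (RQuot p k))
    (h : ∃ B, Abar * B = 1) : ∃ r : Radius p, ∃ A B : Matrix (Fin d) (Fin d) (RQ k r),
      A.map (toRQuot k r) = Abar ∧ A * B = 1 ∧ B * A = 1 := by
  obtain ⟨Bbar, hB⟩ := h
  obtain ⟨r₁, -, A, hA⟩ := exists_toRQuot_matrix k Abar (Classical.arbitrary _)
  obtain ⟨r, hr, B, hB'⟩ := exists_toRQuot_matrix k Bbar r₁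
  have h1 : (A.map (resQ k hr) * B).map (toRQuot k r) = (1 : Matrix _ _ _).map (toRQuot k r) := by
    rw [Matrix.map_mul, hB', map_map_one, ← hB, ← hA]
    congr 1
    ext i j
    exact toRQuot_resQ k hr _
  obtain ⟨r', hr', h2⟩ := exists_resQ_matrix_eq k h1
  rw [Matrix.map_mul, map_map_one] at h2
  refine ⟨r', (A.map (resQ k hr)).map (resQ k hr'), B.map (resQ k hr'), ?_, h2,
    mul_eq_one_comm.1 h2⟩
  rw [← hA]
  ext i j
  exact (toRQuot_resQ k hr' _).trans (toRQuot_resQ k hr _)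



/-- Matrices over `R / (t ^ k)` satisfying the relations of a `(φ, Γ)`-module come from matrices
over `R^r / (t ^ k)` for some `r`. -/
theorem exists_gam_matrices (ε : EpsSeq p) {r₁ : Radius p} {A B : Matrix (Fin d) (Fin d) (RQ k r₁)}
    (hAB : A * B = 1) {Cbar : Gam p → Matrix (Fin d) (Fin d) (RQuot p k)} (hC1 : Cbar 1 = 1)
    (hCmul : ∀ γ γ', Cbar (γ * γ') = Cbar γ * (Cbar γ').map (gamQuot k γ))
    (hCA : ∀ γ, A.map (toRQuot k r₁) * (Cbar γ).map (frobQuot k) =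
      Cbar γ * (A.map (toRQuot k r₁)).map (gamQuot k γ)) :
    ∃ r₀, ∃ h : r₁ ≤ r₀, ∃ C : Gam p → Matrix (Fin d) (Fin d) (RQ k r₀),
      (∀ γ, (C γ).map (toRQuot k r₀) = Cbar γ) ∧ C 1 = 1 ∧
      (∀ γ γ', C (γ * γ') = C γ * (C γ').map (gamQ k r₀ γ)) ∧
      ∀ γ, (A.map (resQ k h)).map (resQ k r₀.le_frob) * (C γ).map (frobQ k r₀) =
        (C γ).map (resQ k r₀.le_frob) *
          ((A.map (resQ k h)).map (resQ k r₀.le_frob)).map (gamQ k r₀.frob γ) := by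
  classical
  have hBA : B * A = 1 := mul_eq_one_comm.1 hAB
  let a : ℕ → Matrix (Fin d) (Fin d) (KTinf ε k) := fun n =>
    if hn : nOf p r₁ ≤ n then A.map (locHom k ε hn) else 1
  let b : ℕ → Matrix (Fin d) (Fin d) (KTinf ε k) := fun n =>
    if hn : nOf p r₁ ≤ n then B.map (locHom k ε hn) else 1
  have ha' : ∀ {n : ℕ} (hn : nOf p r₁ ≤ n), a n = A.map (locHom k ε hn) := fun hn => dif_pos hn
  have hb' : ∀ {n : ℕ} (hn : nOf p r₁ ≤ n), b n = B.map (locHom k ε hn) := fun hn => dif_pos hn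
  have h1L : ∀ n i j, (1 : Matrix (Fin d) (Fin d) (KTinf ε k)) i j ∈ levelKT ε k n := by
    intro n i j
    rw [Matrix.one_apply]
    split_ifs
    · exact one_mem _
    · exact zero_mem _
  have ha : ∀ n i j, a n i j ∈ levelKT ε k n := by
    intro n i j
    by_cases hn : nOf p r₁ ≤ n
    · rw [ha' hn]; exact locHom_mem k ε hn _
    · simp only [a, dif_neg hn]; exact h1L n i j
  have hb : ∀ n i j, b n i j ∈ levelKT ε k n := by
    intro n i j
    by_cases hn : nOf p r₁ ≤ n
    · rw [hb' hn]; exact locHom_mem k ε hn _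
    · simp only [b, dif_neg hn]; exact h1L n i j
  have hab : ∀ n, a n * b n = 1 := by
    intro n
    by_cases hn : nOf p r₁ ≤ n
    · rw [ha' hn, hb' hn]; exact map_mul_eq_one _ hAB
    · simp only [a, b, dif_neg hn, mul_one]
  let c : Gam p → ℕ → Matrix (Fin d) (Fin d) (KTinf ε k) := fun γ n => (Cbar γ).map (loc k ε n)
  have hgam : ∀ {r : Radius p} {n : ℕ} (hn : nOf p r ≤ n) (γ : Gam p)
      (Y : Matrix (Fin d) (Fin d) (RQ k r)), (Y.map (gamQ k r γ)).map (locHom k ε hn) =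
        (Y.map (locHom k ε hn)).map (actKTinf ε k γ) := by
    intro r n hn γ Y
    ext i j
    exact locHom_gamQ k ε hn γ _
  have hres : ∀ {r r' : Radius p} (h : r ≤ r') {n : ℕ} (hn : nOf p r ≤ n) (hn' : nOf p r' ≤ n)
      (Y : Matrix (Fin d) (Fin d) (RQ k r)),
      (Y.map (resQ k h)).map (locHom k ε hn') = Y.map (locHom k ε hn) := by
    intro r r' h n hn hn' Y
    ext i j
    exact locHom_resQ k ε h hn hn' _
  have hfrob : ∀ {r : Radius p} {n : ℕ} (hn : nOf p r ≤ n) (hn' : nOf p r.frob ≤ (n + 1 : ℕ))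
      (Y : Matrix (Fin d) (Fin d) (RQ k r)),
      (Y.map (frobQ k r)).map (locHom k ε hn') = Y.map (locHom k ε hn) := by
    intro r n hn hn' Y
    ext i j
    exact locHom_frobQ k ε hn hn' _
  have hc1 : ∀ᶠ n in atTop, c 1 n = 1 := by
    filter_upwards [eventually_loc_matrix k ε (1 : Matrix (Fin d) (Fin d) (RQ k r₁)),
      eventually_nOf_le (p := p) r₁] with n h1 h2
    have := h1 h2
    rw [map_map_one, map_map_one] at this
    simp only [c, hC1]
    exact this
  have hcmul : ∀ γ γ', ∀ᶠ n in atTop, c (γ * γ') n = c γ n * (c γ' n).map (actKTinf ε k γ) := by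
    intro γ γ'
    obtain ⟨s, -, Y, hY⟩ := exists_toRQuot_matrix k (Cbar γ) r₁
    obtain ⟨r, hr, Z, hZ⟩ := exists_toRQuot_matrix k (Cbar γ') s
    have hY' : (Y.map (resQ k hr)).map (toRQuot k r) = Cbar γ := by
      rw [← hY]; ext i j; exact toRQuot_resQ k hr _
    have hYZ : (Y.map (resQ k hr) * Z.map (gamQ k r γ)).map (toRQuot k r) = Cbar (γ * γ') := by
      rw [Matrix.map_mul, hY', hCmul, ← hZ]
      congr 1
      ext i j
      exact toRQuot_gamQ k γ _
    filter_upwards [eventually_loc_matrix k ε (Y.map (resQ k hr)), eventually_loc_matrix k ε Z,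
      eventually_loc_matrix k ε (Y.map (resQ k hr) * Z.map (gamQ k r γ)),
      eventually_nOf_le (p := p) r] with n h1 h2 h3 hn
    specialize h1 hn
    specialize h2 hn
    specialize h3 hn
    rw [hY'] at h1
    rw [hZ] at h2
    rw [hYZ, Matrix.map_mul, hgam] at h3
    simp only [c, h1, h2, h3]
  have hca : ∀ γ, ∀ᶠ n in atTop,
      a (n + 1) * c γ n = c γ (n + 1) * (a (n + 1)).map (actKTinf ε k γ) := by
    intro γ
    obtain ⟨r, hr, Y, hY⟩ := exists_toRQuot_matrix k (Cbar γ) r₁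
    have hr' := hr.trans r.le_frob
    have e1 : (A.map (resQ k hr')).map (toRQuot k r.frob) = A.map (toRQuot k r₁) := by
      ext i j; exact toRQuot_resQ k hr' _
    have e2 : (Y.map (resQ k r.le_frob)).map (toRQuot k r.frob) = Cbar γ := by
      rw [← hY]; ext i j; exact toRQuot_resQ k _ _
    have e3 : (Y.map (frobQ k r)).map (toRQuot k r.frob) = (Cbar γ).map (frobQuot k) := by
      rw [← hY]; ext i j; exact toRQuot_frobQ k _
    have e4 : ((A.map (resQ k hr')).map (gamQ k r.frob γ)).map (toRQuot k r.frob) =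
        (A.map (toRQuot k r₁)).map (gamQuot k γ) := by
      rw [← e1]; ext i j; exact toRQuot_gamQ k _ _
    have e5 : (A.map (resQ k hr') * Y.map (frobQ k r)).map (toRQuot k r.frob) =
        (Y.map (resQ k r.le_frob) * (A.map (resQ k hr')).map (gamQ k r.frob γ)).map
          (toRQuot k r.frob) := by
      rw [Matrix.map_mul, Matrix.map_mul, e1, e2, e3, e4, hCA]
    filter_upwards [(tendsto_add_atTop_nat 1).eventually (eventually_loc_matrix k ε
        (A.map (resQ k hr') * Y.map (frobQ k r))),
      (tendsto_add_atTop_nat 1).eventually (eventually_loc_matrix k ε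
        (Y.map (resQ k r.le_frob) * (A.map (resQ k hr')).map (gamQ k r.frob γ))),
      eventually_loc_matrix k ε Y, (tendsto_add_atTop_nat 1).eventually
        (eventually_loc_matrix k ε (Y.map (resQ k r.le_frob))),
      eventually_nOf_le (p := p) r] with n h1 h2 h3 h4 hn
    have hn' := Radius.nOf_frob_le hn
    have hn₁ := (Radius.nOf_mono hr').trans hn'
    have hn₂ := (Radius.nOf_mono r.le_frob).trans hn'
    specialize h1 hn'
    specialize h2 hn'
    specialize h3 hn
    specialize h4 hn'
    rw [e5, h2, Matrix.map_mul, Matrix.map_mul, hgam, hres hr' hn₁ hn', hfrob hn hn'] at h1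
    rw [hY] at h3
    rw [e2] at h4
    rw [h4.symm] at h1
    rw [ha' hn₁]
    simp only [c]
    rw [h3]
    exact h1.symm
  obtain ⟨γ₀, -, hγ₀⟩ := exists_gam_fixed ε
  have hs : ∀ x, actKTinf ε k γ₀ (algebraMap (Kinf ε) (KTinf ε k) x) =
      algebraMap (Kinf ε) (KTinf ε k) (gamInf ε γ₀ x) := by
    intro x
    refine (gamKTinf_mk ε k γ₀ (algebraMap (Kinf ε) (Kinf ε)⟦X⟧ x)).trans ?_
    rw [PowerSeries.algebraMap_apply, map_C, rescale_C_eq]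
    rfl
  have hfix : ∀ x, gamInf ε γ₀ x = x → algebraMap (Kinf ε) (KTinf ε k) x ∈ levelKT ε k 2 := by
    intro x hx
    refine ⟨Ideal.Quotient.mk _ (C ⟨x, hγ₀ x hx⟩), ?_⟩
    refine (inclKTinf_mk ε k 2 _).trans ?_
    rw [map_C]
    rfl
  obtain ⟨N, D, hDL, hD1, hDmul, hDa, hDc⟩ := exists_uniform_cocycle (levelKT_mono ε k)
    (levelKT_finite ε k) (exists_inclKTinf ε k) (act := actKTinf ε k) (by
      rintro γ n _ ⟨x, rfl⟩
      exact ⟨gamKT ε k n γ x, inclKTinf_gamKT ε k n γ x⟩) Gam_mul_comm hs hfix ha hb hab hc1 hcmul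
    hca
  obtain ⟨R, hR⟩ := tendsto_nOf_radius (p := p) N
  set r₀ := max R r₁ with hr₀
  have hN : ∀ n : ℕ, nOf p r₀ ≤ n → N ≤ n := fun n hn => by
    exact_mod_cast (hR r₀ (le_max_left _ _)).trans hn
  have hpre : ∀ (γ : Gam p) (i j : Fin d), ∃ x : RQ k r₀, ∀ (n : ℕ) (hn : nOf p r₀ ≤ n),
      locHom k ε hn x = D γ n i j := by
    intro γ i j
    choose z hz using fun n : Idx p r₀ => hDL γ n (hN n n.2) i j
    obtain ⟨x, hx⟩ := exists_forall_iotaQ_eq ε k r₀ z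
    refine ⟨x, fun n hn => ?_⟩
    rw [← hz ⟨n, hn⟩, ← hx n hn]
    rfl
  choose C' hC' using hpre
  let C : Gam p → Matrix (Fin d) (Fin d) (RQ k r₀) := fun γ => Matrix.of (C' γ)
  have hC : ∀ (γ : Gam p) (n : ℕ) (hn : nOf p r₀ ≤ n), (C γ).map (locHom k ε hn) = D γ n := by
    intro γ n hn
    ext i j
    exact hC' γ i j n hn
  have hext : ∀ {r : Radius p} {Y Z : Matrix (Fin d) (Fin d) (RQ k r)},
      (∀ (n : ℕ) (hn : nOf p r ≤ n), Y.map (locHom k ε hn) = Z.map (locHom k ε hn)) → Y = Z := by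
    intro r Y Z h
    ext i j
    exact locHom_ext k ε fun n hn => congrFun (congrFun (h n hn) i) j
  refine ⟨r₀, le_max_right _ _, C, fun γ => ?_, ?_, fun γ γ' => ?_, fun γ => ?_⟩
  · obtain ⟨r, hr, Y, hY⟩ := exists_toRQuot_matrix k (Cbar γ) r₁
    rw [← hY]
    ext i j
    refine toRQuot_eq_of_eventually k ε ?_
    filter_upwards [hDc γ, eventually_loc_matrix k ε Y] with n h1 h2 hn hn'
    have h3 := h2 hn'
    rw [hY] at h3
    have h4 : (C γ).map (locHom k ε hn) = Y.map (locHom k ε hn') := by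
      rw [hC, h1, ← h3]
    exact congrFun (congrFun h4 i) j
  · refine hext fun n hn => ?_
    rw [hC, hD1, map_map_one]
  · refine hext fun n hn => ?_
    rw [Matrix.map_mul, hgam, hC, hC, hC, hDmul]
  · refine hext fun m hm => ?_
    obtain ⟨n, rfl⟩ := Nat.exists_eq_add_of_le' (one_le_of_nOf_le r₀.frob.2 hm)
    have hn : nOf p r₀ ≤ n := by
      rw [Radius.nOf_frob] at hm
      push_cast at hm
      linarith
    have hn₀ := (Radius.nOf_mono r₀.le_frob).trans hm
    have hn₁ : nOf p r₁ ≤ (n + 1 : ℕ) := (Radius.nOf_mono (le_max_right R r₁)).trans hn₀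
    rw [Matrix.map_mul, Matrix.map_mul, hgam, hfrob hn hm, hres r₀.le_frob hn₀ hm,
      hres r₀.le_frob hn₀ hm, hres _ hn₁ hn₀, hC, hC, ← ha' hn₁, hDa]

variable {S : Type*} [AddCommGroup S] [Module (Robba p) S]
  [Module (RQuot p k) S] [IsScalarTower (Robba p) (RQuot p k) S]

/-- A pure `t ^ k`-torsion `(φ, Γ)`-module has a model over `R^r / (t ^ k)` for some `r`. -/
theorem exists_torsionModel (ε : EpsSeq p) (hS : GenPhiGamma p S)
    (e : Module.Basis (Fin d) (RQuot p k) S) : ∃ r₀ : Radius p, Nonempty (TorsionModel hS e r₀) := by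
  obtain ⟨r₁, A, B, hA, hAB, hBA⟩ := exists_inverse_radius _ (exists_phi_inverse hS e)
  obtain ⟨r₀, h, C, hC, hC1, hCmul, hCA⟩ := exists_gam_matrices ε hAB
    (Cbar := fun γ => matOf e (hS.act γ)) (matOf_act_one hS e) (matOf_act_mul hS e)
    (fun γ => by rw [hA]; exact matOf_comm hS e γ)
  refine ⟨r₀, ⟨{
    A := A.map (resQ k h)
    B := B.map (resQ k h)
    C := C
    phi_basis := fun j => ?_
    act_basis := fun γ j => ?_
    mul_eq_one := map_mul_eq_one _ hAB
    mul_eq_one' := map_mul_eq_one _ hBA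
    C_one := hC1
    C_mul := hCmul
    comm := hCA }⟩⟩
  · rw [matOf_sum e hS.phi j, ← hA]
    exact Finset.sum_congr rfl fun i _ => congrArg (· • e i) (toRQuot_resQ k h _).symm
  · rw [matOf_sum e (hS.act γ) j, ← hC]
    rfl

end TorsionModels

/-! ## Elements of the Robba ring that generate an ideal stable under `φ` and `Γ` -/

section StableIdeals

theorem exists_pow_dvd_of_roots {K : Type*} [Field K] (s : Multiset K) (q : Polynomial K)
    (h : ∀ x ∈ s, q.IsRoot x) :
    (s.map fun x => Polynomial.X - Polynomial.C x).prod ∣ q ^ Multiset.card s := by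
  induction s using Multiset.induction_on with
  | empty => simp
  | cons x s ih =>
    rw [Multiset.map_cons, Multiset.prod_cons, Multiset.card_cons, pow_succ']
    exact mul_dvd_mul (Polynomial.dvd_iff_isRoot.2 (h x (Multiset.mem_cons_self x s)))
      (ih fun y hy => h y (Multiset.mem_cons_of_mem hy))

theorem exists_dvd_of_roots_pow {K : Type*} [Field K] [IsAlgClosed K] {M : Polynomial K}
    (hM0 : M ≠ 0) {n : ℕ} (hn : 2 ≤ n) (hroot : ∀ x ∈ M.roots, x ^ n ∈ M.roots) :
    ∃ L k : ℕ, 0 < L ∧ M ∣ (Polynomial.X * (Polynomial.X ^ L - 1)) ^ k := by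
  classical
  have hpow : ∀ x ∈ M.roots, ∀ i : ℕ, x ^ n ^ i ∈ M.roots := by
    intro x hx i
    induction i with
    | zero => simpa using hx
    | succ i ih => rw [pow_succ, pow_mul]; exact hroot _ ih
  have hL : ∀ x ∈ M.roots, ∃ L : ℕ, 0 < L ∧ x * (x ^ L - 1) = 0 := by
    intro x hx
    have hni : ¬ Function.Injective fun i : ℕ => (⟨x ^ n ^ i, Multiset.mem_toFinset.2 (hpow x hx i)⟩ :
        M.roots.toFinset) := not_injective_infinite_finite _
    simp only [Function.Injective, not_forall, Subtype.mk.injEq] at hni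
    obtain ⟨i, j, hij, hne⟩ := hni
    wlog hlt : i < j generalizing i j
    · exact this j i hij.symm (Ne.symm hne) (by omega)
    have hlt' : n ^ i < n ^ j := Nat.pow_lt_pow_right hn hlt
    refine ⟨n ^ j - n ^ i, by omega, ?_⟩
    by_cases hx0 : x = 0
    · rw [hx0, zero_mul]
    · have h3 : x ^ n ^ i * x ^ (n ^ j - n ^ i) = x ^ n ^ i * 1 := by
        rw [← pow_add, Nat.add_sub_cancel' hlt'.le, mul_one, hij]
      rw [mul_left_cancel₀ (pow_ne_zero _ hx0) h3, sub_self, mul_zero]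
  choose! L hL0 hL1 using hL
  refine ⟨∏ x ∈ M.roots.toFinset, L x, Multiset.card M.roots,
    Finset.prod_pos fun x hx => hL0 x (Multiset.mem_toFinset.1 hx), ?_⟩
  have hunit : IsUnit (Polynomial.C M.leadingCoeff) :=
    Polynomial.isUnit_C.2 (IsUnit.mk0 _ (Polynomial.leadingCoeff_ne_zero.2 hM0))
  rw [(IsAlgClosed.splits M).eq_prod_roots, hunit.mul_left_dvd, ← (IsAlgClosed.splits M).eq_prod_roots]
  refine exists_pow_dvd_of_roots _ _ fun x hx => ?_
  obtain ⟨N, hN⟩ := Finset.dvd_prod_of_mem L (Multiset.mem_toFinset.2 hx)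
  rw [Polynomial.IsRoot.def, Polynomial.eval_mul, Polynomial.eval_sub, Polynomial.eval_pow,
    Polynomial.eval_X, Polynomial.eval_one, hN]
  rcases mul_eq_zero.1 (hL1 x hx) with h | h
  · rw [h, zero_mul]
  · rw [pow_mul, sub_eq_zero.1 h, one_pow, sub_self, mul_zero]

/-- A polynomial `m` dividing `m(X ^ n)` has no roots other than `0` and roots of unity. -/
theorem exists_dvd_of_dvd_expand {F : Type*} [Field F] {m : Polynomial F} (hm : m ≠ 0) {n : ℕ}
    (hn : 2 ≤ n) (h : m ∣ Polynomial.expand F n m) :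
    ∃ L k : ℕ, 0 < L ∧ m ∣ (Polynomial.X * (Polynomial.X ^ L - 1)) ^ k := by
  have hM0 : m.map (algebraMap F (AlgebraicClosure F)) ≠ 0 := Polynomial.map_ne_zero hm
  obtain ⟨L, k, hL, h1⟩ := exists_dvd_of_roots_pow hM0 hn (fun x hx => by
    rw [Polynomial.mem_roots hM0] at hx ⊢
    have h1 := Polynomial.map_dvd (algebraMap F (AlgebraicClosure F)) h
    rw [Polynomial.map_expand] at h1
    have h2 := hx.dvd h1
    rwa [Polynomial.IsRoot.def, Polynomial.expand_eval] at h2)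
  refine ⟨L, k, hL, ?_⟩
  rw [← Polynomial.map_dvd_map' (algebraMap F (AlgebraicClosure F))]
  simpa using h1

variable {p : ℕ} [hp : Fact p.Prime]

theorem gam_C (a : ℤ_[p]ˣ) (c : ℚ_[p]) : gam a (Robba.C p c) = Robba.C p c := by
  ext j
  refine (lsub_single 0 c j).trans ?_
  change _ = (Pi.single 0 c : ℤ → ℚ_[p]) j
  simp only [subCoeff, zpow_zero, Units.val_one, mul_zero, laur_one]
  by_cases hj : j = 0
  · subst hj; simp
  · simp [Pi.single_eq_of_ne hj]

theorem gam_one_add_T {a : ℤ_[p]ˣ} {n : ℕ} (ha : (a : ℤ_[p]) = n) :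
    gam a (1 + Robba.single 1 1) = (1 + Robba.single 1 1) ^ n := by
  have h : gam a (Robba.single 1 1) = polyR p ((1 + Polynomial.X) ^ n - 1) := by
    refine Robba.ext ?_
    rw [polyR_coe]
    funext j
    refine (lsub_single 1 1 j).trans ?_
    rw [one_mul, laur_zero_apply]
    simp only [subCoeff, zpow_one, mul_one, laur, Units.val_one, one_mul]
    by_cases h0 : 0 < j
    · obtain ⟨m, rfl⟩ := Int.eq_succ_of_zero_lt h0
      rw [if_pos (by omega), if_pos (by omega), Polynomial.coeff_coe, Polynomial.coeff_sub,
        show ((m : ℤ) + 1 - 1).toNat = m by omega, gamUnit_coe, coeff_mk, ha,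
        show ((m : ℤ) + 1).toNat = m + 1 by omega, Polynomial.coeff_one_add_X_pow,
        Polynomial.coeff_one, if_neg (Nat.succ_ne_zero m), sub_zero, Ring.choose_natCast]
      simp
    · rw [if_neg (by omega)]
      split_ifs with h1
      · have : j = 0 := by omega
        simp [this]
      · rfl
  rw [map_add, map_one, h, map_sub, map_pow, map_add, map_one, polyR_X, add_sub_cancel]

variable (p) in
/-- The ring homomorphism `m ↦ m(1 + T)`. -/
def polyOneAdd (r : ℝ) : Polynomial ℚ_[p] →+* RobbaR p r :=
  ((polyR p).codRestrict (RobbaR p r) (polyR_mem r)).comp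
    (Polynomial.compRingHom (1 + Polynomial.X))

theorem polyOneAdd_coe (r : ℝ) (m : Polynomial ℚ_[p]) :
    (polyOneAdd p r m : Robba p) = polyR p (m.comp (1 + Polynomial.X)) := rfl

theorem polyOneAdd_X (r : ℝ) : (polyOneAdd p r Polynomial.X : Robba p) = 1 + Robba.single 1 1 := by
  rw [polyOneAdd_coe, Polynomial.X_comp, map_add, map_one, polyR_X]

theorem gam_polyOneAdd {a : ℤ_[p]ˣ} {n : ℕ} (ha : (a : ℤ_[p]) = n) (r : ℝ)
    (m : Polynomial ℚ_[p]) :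
    gam a (polyOneAdd p r m : Robba p) = (polyOneAdd p r (Polynomial.expand ℚ_[p] n m)) := by
  have : (gam a).comp ((RobbaR p r).subtype.comp (polyOneAdd p r)) =
      ((RobbaR p r).subtype.comp (polyOneAdd p r)).comp
        (Polynomial.expand ℚ_[p] n : Polynomial ℚ_[p] →+* Polynomial ℚ_[p]) := by
    refine Polynomial.ringHom_ext (fun c => ?_) ?_
    · change gam a (polyOneAdd p r (Polynomial.C c) : Robba p) =
        (polyOneAdd p r (Polynomial.expand ℚ_[p] n (Polynomial.C c)))
      rw [Polynomial.expand_C, polyOneAdd_coe, Polynomial.C_comp, polyR_C, gam_C]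
    · change gam a (polyOneAdd p r Polynomial.X : Robba p) =
        (polyOneAdd p r (Polynomial.expand ℚ_[p] n Polynomial.X))
      rw [Polynomial.expand_X, map_pow, polyOneAdd_X, gam_one_add_T ha, SubmonoidClass.coe_pow,
        polyOneAdd_X]
  exact RingHom.congr_fun this m

variable {r ρ₂ : ℝ} (h12 : (p : ℝ) ^ (-1 / r) ≤ ρ₂) (h2 : ρ₂ < 1)

/-- The restriction of an element of `R^r` to the annulus `p ^ (-1 / r) ≤ |T| ≤ ρ₂`. -/
abbrev resAnn : RobbaR p r →+* LaurRing ℚ_[p] (icc (radius_pos p r) h12) :=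
  toLaur r (icc (radius_pos p r) h12) (icc_radius h12 h2)

theorem isUnit_resAnn_polyR {P : Polynomial ℚ_[p]} (h0 : ‖P.coeff 0‖ = 1)
    (h : ∀ i, ‖P.coeff i‖ ≤ 1) : IsUnit (resAnn h12 h2 ⟨polyR p P, polyR_mem r P⟩) := by
  have hρ1 := radius_pos p r
  have hρ2 := hρ1.trans_le h12
  have hcoe : (resAnn h12 h2 ⟨polyR p P, polyR_mem r P⟩).coe = laur (P : ℚ_[p]⟦X⟧) 0 1 := polyR_coe P
  have hz : laur (P : ℚ_[p]⟦X⟧) 0 1 0 = P.coeff 0 := by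
    rw [laur_zero_apply, if_pos le_rfl]; simp
  have hle : ∀ ρ : ℝ, 0 < ρ → ρ < 1 → ∀ j : ℤ, j ≠ 0 →
      ‖laur (P : ℚ_[p]⟦X⟧) 0 1 j‖ * ρ ^ j < 1 := by
    intro ρ hρ hρ' j hj
    rw [laur_zero_apply]
    split_ifs with hj0
    · rw [Polynomial.coeff_coe]
      refine (mul_le_of_le_one_left (by positivity) (h _)).trans_lt ?_
      obtain ⟨i, rfl⟩ := Int.eq_ofNat_of_zero_le hj0
      rw [zpow_natCast]
      exact pow_lt_one₀ hρ.le hρ' (by exact_mod_cast hj)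
    · simp
  have hne : P.coeff 0 ≠ 0 := norm_pos_iff.1 (by rw [h0]; exact one_pos)
  refine isUnit_of_dominant (N := 0) _ ?_
  rw [hcoe]
  have e : ∀ ρ : ℝ, ‖laur (P : ℚ_[p]⟦X⟧) 0 1 0‖ * ρ ^ (0 : ℤ) = 1 := by
    intro ρ; rw [hz, h0, zpow_zero, one_mul]
  have hle' : ∀ ρ : ℝ, 0 < ρ → ρ < 1 → ∀ j : ℤ, ‖laur (P : ℚ_[p]⟦X⟧) 0 1 j‖ * ρ ^ j ≤ 1 := by
    intro ρ hρ hρ' j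
    by_cases hj : j = 0
    · rw [hj, e]
    · exact (hle ρ hρ hρ' j hj).le
  constructor
  · rwa [hz]
  · rwa [hz]
  · intro j; rw [e]; exact hle' _ hρ1 (h12.trans_lt h2) j
  · intro j; rw [e]; exact hle' _ hρ2 h2 j
  · intro j hj; rw [e]; exact hle _ hρ1 (h12.trans_lt h2) j hj.ne
  · intro j hj; rw [e]; exact hle _ hρ2 h2 j hj.ne'

/-- The polynomials in `1 + T` divisible by `f` on a closed annulus form a nonzero ideal. -/
theorem exists_polyOneAdd_dvd {f : LaurRing ℚ_[p] (icc (radius_pos p r) h12)} (hf : f ≠ 0) :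
    ∃ m : Polynomial ℚ_[p], m ≠ 0 ∧ f ∣ resAnn h12 h2 (polyOneAdd p r m) := by
  obtain ⟨N₁, N₂, dom⟩ := exists_dominant_icc f hf
  choose q s hqs hs using weierstrass_division f dom
  let g : ℕ → LaurRing ℚ_[p] (icc (radius_pos p r) h12) := fun i =>
    resAnn h12 h2 (polyOneAdd p r (Polynomial.X ^ i))
  let w : Fin ((N₂ - N₁).toNat + 1) → Fin (N₂ - N₁).toNat → ℚ_[p] := fun i l =>
    (s (g i)).coe (N₁ + l)
  have hdep : ¬ LinearIndependent ℚ_[p] w := by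
    intro h
    have := h.fintype_card_le_finrank
    simp at this
  obtain ⟨c, hc, i₀, hi₀⟩ := Fintype.not_linearIndependent_iff.1 hdep
  refine ⟨∑ i, Polynomial.C (c i) * Polynomial.X ^ (i : ℕ), fun h0 => ?_, ?_⟩
  · have h1 := congrArg (fun P => Polynomial.coeff P i₀) h0
    simp only [Polynomial.finsetSum_coeff, Polynomial.coeff_C_mul, Polynomial.coeff_X_pow,
      Polynomial.coeff_zero] at h1
    rw [Finset.sum_eq_single i₀] at h1
    · exact hi₀ (by simpa using h1)
    · intro i _ hi
      rw [if_neg (fun h => hi (Fin.ext h.symm)), mul_zero]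
    · simp
  · refine ⟨∑ i, LaurRing.single _ 0 (c i) * q (g i), ?_⟩
    have hC : ∀ a : ℚ_[p], resAnn h12 h2 (polyOneAdd p r (Polynomial.C a)) =
        LaurRing.single _ 0 a := by
      intro a
      refine LaurRing.ext ?_
      rw [toLaur_coe, polyOneAdd_coe, Polynomial.C_comp, polyR_C]
      rfl
    have hzero : ∑ i, LaurRing.single (icc (radius_pos p r) h12) 0 (c i) * s (g i) = 0 := by
      refine LaurRing.ext (funext fun j => ?_)
      rw [LaurRing.coe_sum, LaurRing.coe_zero, Pi.zero_apply]
      simp only [LaurRing.single_mul_coe, sub_zero]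
      by_cases hj : j < N₁ ∨ N₂ ≤ j
      · exact Finset.sum_eq_zero fun i _ => by rw [hs _ j hj, mul_zero]
      · push Not at hj
        have h1 := congrFun hc ⟨(j - N₁).toNat, by omega⟩
        simp only [Finset.sum_apply, Pi.smul_apply, smul_eq_mul, w, Pi.zero_apply] at h1
        rw [show N₁ + (((j - N₁).toNat : ℕ) : ℤ) = j by omega] at h1
        exact h1
    rw [map_sum, map_sum, Finset.mul_sum]
    rw [← sub_eq_zero, ← Finset.sum_sub_distrib, ← hzero]
    refine Finset.sum_congr rfl fun i _ => ?_
    rw [map_mul, map_mul, hC]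
    change LaurRing.single _ 0 (c i) * g i - _ = _
    linear_combination LaurRing.single (icc (radius_pos p r) h12) 0 (c i) * hqs (g i)

end StableIdeals

section StableElements

variable {p : ℕ} [hp : Fact p.Prime]

section

variable {r ρ₂ : ℝ} (h12 : (p : ℝ) ^ (-1 / r) ≤ ρ₂) (h2 : ρ₂ < 1)

theorem gam_coe_lmul (a : ℤ_[p]ˣ) {f g : Robba p} {h : ℤ → ℚ_[p]} {ρ : ℝ} (hρ : 0 < ρ) (hρ1 : ρ < 1)
    (hf : ConvAt ρ f.coe) (hh : ConvAt ρ h) (hg : g.coe = lmul f.coe h) :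
    (gam a g).coe = lmul (gam a f).coe (lsub (subCoeff (gamUnit a) 1 1) h) := by
  obtain ⟨H1, H2⟩ := subCoeff_bd one_pos zero_le_one hρ (gamUnit a) (gamUnit_norm a) (gamUnit_bd a)
    1 1 (by simpa using hρ1)
  change lsub (subCoeff (gamUnit a) 1 1) g.coe = _
  rw [hg]
  exact lsub_lmul (by positivity) hρ (by simpa using hf) (by simpa using hh) H1 H2
    (subCoeff_mul _ _ _)

/-- If `γ(f)` is a multiple of `f`, the ideal of the polynomials in `1 + T` divisible by `f` on a
closed annulus is stable under `γ`. -/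
theorem dvd_polyOneAdd_expand {a : ℤ_[p]ˣ} {n : ℕ} (ha : (a : ℤ_[p]) = n) {f v : RobbaR p r}
    (hv : gam a (f : Robba p) = v * f) {m : Polynomial ℚ_[p]}
    (h : resAnn h12 h2 f ∣ resAnn h12 h2 (polyOneAdd p r m)) :
    resAnn h12 h2 f ∣ resAnn h12 h2 (polyOneAdd p r (Polynomial.expand ℚ_[p] n m)) := by
  obtain ⟨q, hq⟩ := h
  have hq' : (polyOneAdd p r m : Robba p).coe = lmul (f : Robba p).coe q.coe :=
    congrArg LaurRing.coe hq
  have hconv : ∀ ρ ∈ (icc (radius_pos p r) h12).1,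
      ConvAt ρ (lsub (subCoeff (gamUnit a) 1 1) q.coe) := by
    intro ρ hρ
    have hρ0 := (radius_pos p r).trans_le hρ.1
    obtain ⟨H1, H2⟩ := subCoeff_bd one_pos zero_le_one hρ0 (gamUnit a) (gamUnit_norm a)
      (gamUnit_bd a) 1 1 (by simpa using (icc_radius h12 h2 ρ hρ).2)
    exact ConvAt.lsub (by positivity) hρ0 (by simpa using q.conv hρ) H1 H2
  refine ⟨resAnn h12 h2 v * LaurRing.of _ hconv, ?_⟩
  have hρ : (p : ℝ) ^ (-1 / r) ∈ (icc (radius_pos p r) h12).1 := ⟨le_rfl, h12⟩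
  have h3 := gam_coe_lmul a (radius_pos p r) (h12.trans_lt h2) (f.2 _ le_rfl (h12.trans_lt h2))
    (q.conv hρ) hq'
  rw [gam_polyOneAdd ha, hv] at h3
  rw [← mul_assoc, mul_comm (resAnn h12 h2 f), ← map_mul]
  exact LaurRing.ext h3

theorem isUnit_resAnn_one_add_T :
    IsUnit (resAnn h12 h2 (polyOneAdd p r Polynomial.X)) := by
  refine (congrArg IsUnit (congrArg (resAnn h12 h2) (Subtype.ext ?_))).mp
    (isUnit_resAnn_polyR h12 h2 (P := 1 + Polynomial.X) (by simp) fun i => ?_)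
  · rw [polyOneAdd_coe, Polynomial.X_comp]
  · rw [Polynomial.coeff_add, Polynomial.coeff_one, Polynomial.coeff_X]
    split_ifs <;> simp_all

theorem isUnit_resAnn_geom (b : ℕ) {L : ℕ} (hL : ¬ p ∣ L) :
    IsUnit (resAnn h12 h2 (polyOneAdd p r (∑ i ∈ Finset.range L, (Polynomial.X ^ p ^ b) ^ i))) := by
  let Q : Polynomial ℤ := ∑ i ∈ Finset.range L, ((1 + Polynomial.X) ^ p ^ b) ^ i
  have hQ : Q.map (Int.castRingHom ℚ_[p]) = (∑ i ∈ Finset.range L, (Polynomial.X ^ p ^ b) ^ i :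
      Polynomial ℚ_[p]).comp (1 + Polynomial.X) := by
    simp [Q, Polynomial.map_sum]
  refine (congrArg IsUnit (congrArg (resAnn h12 h2) (Subtype.ext ?_))).mp
    (isUnit_resAnn_polyR h12 h2 (P := Q.map (Int.castRingHom ℚ_[p])) ?_ fun i => ?_)
  · rw [polyOneAdd_coe, ← hQ]
  · have : Q.coeff 0 = L := by
      rw [Polynomial.coeff_zero_eq_eval_zero]
      simp [Q, Polynomial.eval_finsetSum]
    rw [Polynomial.coeff_map, this, eq_intCast, Int.cast_natCast, Padic.norm_natCast_eq_one_iff]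
    exact (hp.1.coprime_iff_not_dvd.2 hL)
  · rw [Polynomial.coeff_map, eq_intCast]
    exact Padic.norm_int_le_one _

theorem exists_dvd_tR_pow_resAnn {r : Radius p} {ρ₂ : ℝ} (h12 : (p : ℝ) ^ (-1 / (r : ℝ)) ≤ ρ₂)
    (h2 : ρ₂ < 1) {a : ℤ_[p]ˣ} {n : ℕ} (hn : 2 ≤ n)
    (ha : (a : ℤ_[p]) = n) {f v : RobbaR p r} (hf : f ≠ 0)
    (hv : gam a (f : Robba p) = v * f) :
    ∃ k : ℕ, resAnn h12 h2 f ∣ resAnn h12 h2 (tR r ^ k) := by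
  have hf0 : resAnn h12 h2 f ≠ 0 := fun h => hf (toLaur_injective _ _ _ (by rw [h, map_zero]))
  let β := (resAnn h12 h2).comp (polyOneAdd p r)
  let I : Ideal (Polynomial ℚ_[p]) := (Ideal.span {resAnn h12 h2 f}).comap β
  have hI : ∀ m, m ∈ I ↔ resAnn h12 h2 f ∣ resAnn h12 h2 (polyOneAdd p r m) := fun m => by
    rw [Ideal.mem_comap, Ideal.mem_span_singleton]; rfl
  obtain ⟨m₀, hm₀⟩ := (IsPrincipalIdealRing.principal I).principal
  have hdvd : ∀ m, m ∈ I ↔ m₀ ∣ m := fun m => by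
    rw [hm₀]; exact Ideal.mem_span_singleton
  obtain ⟨m, hm, hfm⟩ := exists_polyOneAdd_dvd h12 h2 hf0
  have hm₀0 : m₀ ≠ 0 := fun h => hm (zero_dvd_iff.1 (h ▸ (hdvd m).1 ((hI m).2 hfm)))
  obtain ⟨L, k, hL, h3⟩ := exists_dvd_of_dvd_expand hm₀0 hn ((hdvd _).1 ((hI _).2
    (dvd_polyOneAdd_expand h12 h2 ha hv ((hI _).1 ((hdvd _).2 dvd_rfl)))))
  refine ⟨k, ((hI _).1 ((hdvd _).2 h3)).trans ?_⟩
  rw [map_pow, map_pow, map_pow]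
  refine pow_dvd_pow_of_dvd ?_ k
  obtain ⟨b, L', hL', rfl⟩ := Nat.exists_eq_pow_mul_and_not_dvd hL.ne' p hp.1.ne_one
  rw [map_mul, map_mul, (isUnit_resAnn_one_add_T h12 h2).mul_left_dvd, pow_mul, ← mul_geom_sum,
    map_mul, map_mul, (isUnit_resAnn_geom h12 h2 b hL').mul_right_dvd]
  obtain ⟨g, hg, h4⟩ := exists_tElt_eq (p := p) b
  refine ⟨resAnn h12 h2 ⟨g, hg.mem r⟩, ?_⟩
  rw [← map_mul]
  refine congrArg _ (Subtype.ext ?_)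
  change tElt p = (polyOneAdd p r (Polynomial.X ^ p ^ b - 1) : Robba p) * g
  rw [map_sub, map_pow, map_one, AddSubgroupClass.coe_sub, SubmonoidClass.coe_pow, polyOneAdd_X, h4]
  rfl

end

theorem frob_coe_lmul {f g : Robba p} {h : ℤ → ℚ_[p]} {ρ : ℝ} (hρ : 0 < ρ)
    (hρ1 : frobRadius p * ρ ^ ((-1 : ℤˣ) : ℤ) < 1) (hf : ConvAt (ρ ^ p) f.coe)
    (hh : ConvAt (ρ ^ p) h) (hg : g.coe = lmul f.coe h) :
    (frob p g).coe = lmul (frob p f).coe (lsub (subCoeff (frobUnit p) p (-1)) h) := by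
  obtain ⟨H1, H2⟩ := subCoeff_bd one_pos (radius_pos p _).le hρ (frobUnit p) frobUnit_norm
    frobUnit_bd p (-1) hρ1
  change lsub (subCoeff (frobUnit p) p (-1)) g.coe = _
  rw [hg]
  refine lsub_lmul (by positivity) hρ ?_ ?_ H1 H2 (subCoeff_mul _ _ _)
  · simpa using hf
  · simpa using hh

theorem radius_pow (s : ℝ) (hs : 0 < s) : ((p : ℝ) ^ (-1 / (p * s))) ^ p = (p : ℝ) ^ (-1 / s) := by
  have hp0 : (0 : ℝ) < p := by exact_mod_cast hp.1.pos
  rw [← Real.rpow_natCast, ← Real.rpow_mul hp0.le]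
  congr 1
  field_simp

/-- If `φ(f)` is a multiple of `f` and `f` divides `t ^ k` for `p ^ (-1 / r) ≤ |T| ≤ p ^ (-1 / s)`,
where `s ≥ p r`, then it does so for `p ^ (-1 / r) ≤ |T| ≤ p ^ (-1 / (p s))`. -/
theorem dvd_tElt_pow_step {r : Radius p} {f u : Robba p} (hf : f ∈ RobbaR p r) (hf0 : f ≠ 0)
    (hu : u ∈ RobbaR p (p * r)) (hφ : frob p f = u * f) {k : ℕ} {s : ℝ} (hs : p * (r : ℝ) ≤ s)
    {h : ℤ → ℚ_[p]} (hh : ∀ ρ, (p : ℝ) ^ (-1 / (r : ℝ)) ≤ ρ → ρ ≤ (p : ℝ) ^ (-1 / s) → ConvAt ρ h)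
    (hq : (tElt p ^ k).coe = lmul f.coe h) :
    ∀ ρ, (p : ℝ) ^ (-1 / (r : ℝ)) ≤ ρ → ρ ≤ (p : ℝ) ^ (-1 / (p * s)) → ConvAt ρ h := by
  have hp1 := one_lt_p (p := p)
  have hr := r.pos
  have hs0 : 0 < s := by nlinarith
  have hps : s ≤ p * s := by nlinarith
  have hrs : (r : ℝ) ≤ p * r := r.le_frob
  have h12 : (p : ℝ) ^ (-1 / (p * (r : ℝ))) ≤ (p : ℝ) ^ (-1 / (p * s)) :=
    rpow_neg_inv_le (by positivity) (hs.trans hps)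
  have hmem : ∀ ρ ∈ (icc (radius_pos p (p * (r : ℝ))) h12).1,
      frobRadius p * ρ ^ ((-1 : ℤˣ) : ℤ) < 1 ∧ (p : ℝ) ^ (-1 / (r : ℝ)) ≤ ρ ^ p ∧
        ρ ^ p ≤ (p : ℝ) ^ (-1 / s) ∧ ρ < 1 ∧ 0 < ρ := by
    intro ρ hρ
    have hρ0 := (radius_pos p _).trans_le hρ.1
    have hρ1 : ρ < 1 := hρ.2.trans_lt (radius_lt_one (by positivity))
    have h1 := frob_radius_aux hr le_rfl (by nlinarith [r.2]) ρ hρ.1 hρ1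
    rw [zpow_natCast] at h1
    exact ⟨h1.2, h1.1.1, (pow_le_pow_left₀ hρ0.le hρ.2 p).trans_eq (radius_pow s hs0), hρ1, hρ0⟩
  have hconv : ∀ ρ ∈ (icc (radius_pos p (p * (r : ℝ))) h12).1,
      ConvAt ρ (lsub (subCoeff (frobUnit p) p (-1)) h) := by
    intro ρ hρ
    obtain ⟨h1, h2, h3, h4, h5⟩ := hmem ρ hρ
    obtain ⟨H1, H2⟩ := subCoeff_bd one_pos (radius_pos p _).le h5 (frobUnit p) frobUnit_norm
      frobUnit_bd p (-1) h1
    exact ConvAt.lsub (by positivity) h5 (by simpa using hh _ h2 h3) H1 H2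
  have hrad : ∀ ρ ∈ (icc (radius_pos p (p * (r : ℝ))) h12).1,
      (p : ℝ) ^ (-1 / (p * (r : ℝ))) ≤ ρ ∧ ρ < 1 := fun ρ hρ => ⟨hρ.1, (hmem ρ hρ).2.2.2.1⟩
  have hf' : f ∈ RobbaR p (p * (r : ℝ)) := RobbaR_mono hr hrs hf
  let F := toLaur (p * (r : ℝ)) _ hrad ⟨f, hf'⟩
  let U := toLaur (p * (r : ℝ)) _ hrad ⟨u, hu⟩
  let T := toLaur (p * (r : ℝ)) _ hrad ⟨tElt p ^ k, pow_mem (tElt_mem _) k⟩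
  let c := toLaur (p * (r : ℝ)) _ hrad ⟨Robba.C p (p : ℚ_[p])⁻¹, single_mem _ 0 _⟩
  let c' := toLaur (p * (r : ℝ)) _ hrad ⟨Robba.C p p, single_mem _ 0 _⟩
  let H := LaurRing.of (S := icc (radius_pos p (p * (r : ℝ))) h12) _ hconv
  have hcc : c * c' = 1 := by
    rw [← map_mul, ← map_one (toLaur (p * (r : ℝ)) _ hrad)]
    refine congrArg _ (Subtype.ext ?_)
    change Robba.C p (p : ℚ_[p])⁻¹ * Robba.C p p = 1
    rw [← map_mul, inv_mul_cancel₀ (by exact_mod_cast hp.1.ne_zero), map_one]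
  have hend : (p : ℝ) ^ (-1 / (p * (r : ℝ))) ∈ (icc (radius_pos p (p * (r : ℝ))) h12).1 :=
    ⟨le_rfl, h12⟩
  obtain ⟨e1, e2, e3, e4, e5⟩ := hmem _ hend
  have h1 : c' ^ k * T = U * F * H := by
    have := frob_coe_lmul e5 e1 (hf _ e2 (e3.trans_lt (radius_lt_one hs0))) (hh _ e2 e3) hq
    rw [map_pow, frob_tElt, mul_pow, hφ] at this
    rw [← map_pow, ← map_mul, ← map_mul]
    exact LaurRing.ext this
  have h2 : T = F * (c ^ k * U * H) := by
    calc T = (c * c') ^ k * T := by rw [hcc, one_pow, one_mul]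
      _ = c ^ k * (c' ^ k * T) := by ring
      _ = _ := by rw [h1]; ring
  have h3 : h = (c ^ k * U * H).coe := by
    have hS : (icc (radius_pos p (p * (r : ℝ))) le_rfl).1 ⊆
        (icc (radius_pos p (p * (r : ℝ))) h12).1 := fun ρ hρ => ⟨hρ.1, hρ.2.trans h12⟩
    have hh' : ∀ ρ ∈ (icc (radius_pos p (p * (r : ℝ))) le_rfl).1, ConvAt ρ h := fun ρ hρ =>
      hh ρ ((rpow_neg_inv_le hr hrs).trans hρ.1) (hρ.2.trans (rpow_neg_inv_le (by positivity) hs))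
    have h4 : LaurRing.res hS F * LaurRing.of h hh' =
        LaurRing.res hS F * LaurRing.res hS (c ^ k * U * H) := by
      rw [← map_mul, ← h2]
      exact LaurRing.ext hq.symm
    have hne : LaurRing.res hS F ≠ 0 := fun h0 => hf0 (Robba.ext (congrArg LaurRing.coe h0))
    exact congrArg LaurRing.coe (mul_left_cancel₀ hne h4)
  intro ρ hρ1 hρ2
  rcases le_total ρ ((p : ℝ) ^ (-1 / s)) with h4 | h4
  · exact hh ρ hρ1 h4
  · rw [h3]
    exact (c ^ k * U * H).conv ⟨(rpow_neg_inv_le (by positivity) hs).trans h4, hρ2⟩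

/-- A nonzero element of `R^r` such that `φ(f)` and `γ(f)` are multiples of `f` divides a power of
`t`. -/
theorem exists_dvd_tR_pow {r : Radius p} {a : ℤ_[p]ˣ} {n : ℕ} (hn : 2 ≤ n) (ha : (a : ℤ_[p]) = n)
    {f v : RobbaR p r} (hf : f ≠ 0) (hv : gam a (f : Robba p) = v * f) {u : Robba p}
    (hu : u ∈ RobbaR p (p * r)) (hφ : frob p (f : Robba p) = u * f) :
    ∃ k : ℕ, f ∣ tR r ^ k := by
  have hp1 := one_lt_p (p := p)
  have hr := r.pos
  have h12 : ∀ i : ℕ, (p : ℝ) ^ (-1 / (r : ℝ)) ≤ (p : ℝ) ^ (-1 / ((p : ℝ) ^ (i + 1) * r)) := fun i =>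
    rpow_neg_inv_le hr (le_mul_of_one_le_left hr.le (one_le_pow₀ hp1.le))
  have h2 : ∀ i : ℕ, (p : ℝ) ^ (-1 / ((p : ℝ) ^ (i + 1) * r)) < 1 := fun i =>
    radius_lt_one (by positivity)
  obtain ⟨k, q, hq⟩ := exists_dvd_tR_pow_resAnn (h12 0) (h2 0) hn ha hf hv
  have hq' : (tElt p ^ k).coe = lmul (f : Robba p).coe q.coe := congrArg LaurRing.coe hq
  have key : ∀ i : ℕ, ∀ ρ, (p : ℝ) ^ (-1 / (r : ℝ)) ≤ ρ →
      ρ ≤ (p : ℝ) ^ (-1 / ((p : ℝ) ^ (i + 1) * r)) → ConvAt ρ q.coe := by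
    intro i
    induction i with
    | zero => exact fun ρ h1 h2 => q.conv ⟨h1, h2⟩
    | succ i ih =>
      rw [pow_succ' (p : ℝ) (i + 1), mul_assoc]
      refine dvd_tElt_pow_step f.2 (fun h => hf (Subtype.ext h)) hu hφ ?_ ih hq'
      rw [pow_succ' (p : ℝ) i, mul_assoc]
      exact mul_le_mul_of_nonneg_left (le_mul_of_one_le_left hr.le (one_le_pow₀ hp1.le)) (by linarith)
  refine ⟨k, dvd_of_dvd_laur _ _ hf fun ρ hρ => ?_⟩
  have hlim : Tendsto (fun i : ℕ => (p : ℝ) ^ (-1 / ((p : ℝ) ^ (i + 1) * r))) atTop (𝓝 1) := by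
    refine tendsto_radius.comp (Tendsto.atTop_mul_const hr ?_)
    exact (tendsto_pow_atTop_atTop_of_one_lt hp1).comp (tendsto_add_atTop_nat 1)
  obtain ⟨i, hi⟩ := (hlim.eventually (lt_mem_nhds hρ)).exists
  refine ⟨_, hi.le, h12 i, h2 i, ?_⟩
  exact ⟨LaurRing.of q.coe fun ρ' h => key i ρ' h.1 h.2, LaurRing.ext hq'⟩

end StableElements

/-! ## Models of `(φ, Γ)`-modules over `R^r` -/

section SemilinearMatrices

variable {A : Type*} [CommRing A] {d : ℕ} {D E E' : Type*} [AddCommGroup D] [Module A D]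
  [AddCommGroup E] [Module A E] [AddCommGroup E'] [Module A E']

/-- The matrix of a map with respect to bases of the source and of the target. -/
def semiMat (b : Module.Basis (Fin d) A D) (c : Module.Basis (Fin d) A E) (F : E → D) :
    Matrix (Fin d) (Fin d) A :=
  Matrix.of fun i j => b.repr (F (c j)) i

theorem semiMat_sum (b : Module.Basis (Fin d) A D) (c : Module.Basis (Fin d) A E) (F : E → D)
    (j : Fin d) : F (c j) = ∑ i, semiMat b c F i j • b i :=
  (b.sum_repr _).symm

theorem semiMat_comp (b : Module.Basis (Fin d) A D) (c : Module.Basis (Fin d) A E)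
    (c' : Module.Basis (Fin d) A E') {σ : A →+* A} {F : E →+ D} (hF : ∀ a x, F (a • x) = σ a • F x)
    (G : E' → E) : semiMat b c' (F ∘ G) = semiMat b c F * (semiMat c c' G).map σ := by
  ext i j
  change b.repr (F (G (c' j))) i = _
  rw [semiMat_sum c c' G j, map_sum, map_sum, Matrix.mul_apply, Finsupp.finsetSum_apply]
  refine Finset.sum_congr rfl fun l _ => ?_
  rw [hF, map_smul, Finsupp.smul_apply, smul_eq_mul, mul_comm]
  rfl

theorem semiMat_id (b : Module.Basis (Fin d) A D) : semiMat b b id = 1 := by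
  ext i j
  change b.repr (b j) i = _
  rw [Module.Basis.repr_self, Finsupp.single_apply, Matrix.one_apply]
  simp only [eq_comm]

theorem semiMat_smul (b : Module.Basis (Fin d) A D) (c : Module.Basis (Fin d) A E) (F : E → D)
    (a : A) : semiMat b c (fun x => a • F x) = a • semiMat b c F := by
  ext i j
  change b.repr (a • F (c j)) i = a * b.repr (F (c j)) i
  rw [map_smul]
  rfl

theorem det_semiMat_ne_zero [IsDomain A] (b : Module.Basis (Fin d) A D)
    (c : Module.Basis (Fin d) A E) {F : E →ₗ[A] D} (hF : Function.Injective F) :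
    (semiMat b c F).det ≠ 0 := by
  have : semiMat b c F = LinearMap.toMatrix c b F := by
    ext i j
    rw [LinearMap.toMatrix_apply]
    rfl
  intro h
  rw [this] at h
  obtain ⟨v, hv, hv0⟩ := Matrix.exists_mulVec_eq_zero_iff.2 h
  apply hv
  have h1 := LinearMap.toMatrix_mulVec_repr c b F (c.equivFun.symm v)
  rw [← Module.Basis.equivFun_apply, LinearEquiv.apply_symm_apply, hv0] at h1
  have h2 : F (c.equivFun.symm v) = 0 := b.repr.injective (by
    rw [map_zero]; exact DFunLike.coe_injective h1.symm)
  exact (LinearEquiv.map_eq_zero_iff _).1 (hF (h2.trans (map_zero F).symm))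

end SemilinearMatrices

section Models

variable {p : ℕ} [hp : Fact p.Prime] {d : ℕ} {D E : Type*} [AddCommGroup D] [Module (Robba p) D]
  [AddCommGroup E] [Module (Robba p) E]

/-- The matrix of `φ` in the basis `b` is invertible over `R^(pr)`. -/
def IsModelBasis (hD : GenPhiGamma p D) (r : Radius p) (b : Module.Basis (Fin d) (Robba p) D) :
    Prop :=
  ∃ P P' : Matrix (Fin d) (Fin d) (RobbaR p r.frob), P * P' = 1 ∧ P' * P = 1 ∧
    semiMat b b hD.phi = P.map (RobbaR p r.frob).subtype

variable {hD : GenPhiGamma p D} {hE : GenPhiGamma p E} {b : Module.Basis (Fin d) (Robba p) D}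
  {c : Module.Basis (Fin d) (Robba p) E} {r : Radius p}

theorem exists_semiMat_phi_inverse (hD : GenPhiGamma p D) (b : Module.Basis (Fin d) (Robba p) D) :
    ∃ P' : Matrix (Fin d) (Fin d) (Robba p),
      semiMat b b hD.phi * P' = 1 ∧ P' * semiMat b b hD.phi = 1 := by
  let b' := (Ext.basis (frob p) b).map (LinearEquiv.ofBijective _ hD.bijective)
  have hb' : ∀ j, b' j = hD.phi (b j) := fun j => by
    rw [Module.Basis.map_apply, Ext.basis_apply]
    exact Ext.lift_of _ _
  have h1 : semiMat b b hD.phi = b.toMatrix b' := by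
    ext i j
    rw [Module.Basis.toMatrix_apply, hb']
    rfl
  rw [h1]
  exact ⟨b'.toMatrix b, b.toMatrix_mul_toMatrix_flip b', b'.toMatrix_mul_toMatrix_flip b⟩

theorem exists_matrix_mem_RobbaR (P : Matrix (Fin d) (Fin d) (Robba p)) :
    ∃ r₀ : Radius p, ∀ r, r₀ ≤ r → ∃ Q : Matrix (Fin d) (Fin d) (RobbaR p r),
      P = Q.map (RobbaR p r).subtype := by
  choose R hR using fun x : Fin d × Fin d => exists_mem_RobbaR (P x.1 x.2)
  obtain ⟨r₀, hr₀⟩ := exists_radius_ge R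
  exact ⟨r₀, fun r hr => ⟨Matrix.of fun i j =>
    ⟨P i j, RobbaR_le ((hr₀ (i, j)).trans hr) (hR (i, j))⟩, rfl⟩⟩

theorem map_subtype_injective {r : ℝ} : Function.Injective
    fun P : Matrix (Fin d) (Fin d) (RobbaR p r) => P.map (RobbaR p r).subtype :=
  Matrix.map_injective Subtype.val_injective

theorem mul_eq_one_of_map {r : ℝ} {P Q : Matrix (Fin d) (Fin d) (RobbaR p r)}
    (h : P.map (RobbaR p r).subtype * Q.map (RobbaR p r).subtype = 1) : P * Q = 1 :=
  map_subtype_injective (by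
    change (P * Q).map (RobbaR p r).subtype = (1 : Matrix _ _ _).map (RobbaR p r).subtype
    rw [Matrix.map_mul, h, map_map_one])

theorem exists_isModelBasis (hD : GenPhiGamma p D) (b : Module.Basis (Fin d) (Robba p) D) :
    ∃ r₀ : Radius p, ∀ r, r₀ ≤ r → IsModelBasis hD r b := by
  obtain ⟨P', h1, h2⟩ := exists_semiMat_phi_inverse hD b
  obtain ⟨r₁, hr₁⟩ := exists_matrix_mem_RobbaR (semiMat b b hD.phi)
  obtain ⟨r₂, hr₂⟩ := exists_matrix_mem_RobbaR P'
  refine ⟨max r₁ r₂, fun r hr => ?_⟩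
  obtain ⟨Q, hQ⟩ := hr₁ r.frob (((le_max_left _ _).trans hr).trans r.le_frob)
  obtain ⟨Q', hQ'⟩ := hr₂ r.frob (((le_max_right _ _).trans hr).trans r.le_frob)
  rw [hQ, hQ'] at h1 h2
  exact ⟨Q, Q', mul_eq_one_of_map h1, mul_eq_one_of_map h2, hQ⟩

theorem IsModelBasis.mono {r' : Radius p} (h : IsModelBasis hD r b) (hr : r ≤ r') :
    IsModelBasis hD r' b := by
  obtain ⟨P, P', h1, h2, h3⟩ := h
  exact ⟨P.map (resR (Radius.frob_mono hr)), P'.map (resR (Radius.frob_mono hr)),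
    map_mul_eq_one _ h1, map_mul_eq_one _ h2, h3⟩

/-- A semilinear map between `(φ, Γ)`-modules that commutes with `φ` up to a scalar has a matrix
with entries in `R^r` with respect to bases in which `φ` is invertible over `R^(pr)`. -/
theorem semiMat_mem (hb : IsModelBasis hD r b) (hc : IsModelBasis hE r c) {σ : Robba p →+* Robba p}
    (hσ : ∀ f ∈ RobbaR p r.frob, σ f ∈ RobbaR p r.frob) {F : E →+ D}
    (hF : ∀ a x, F (a • x) = σ a • F x) {κ : Robba p} (hκ : κ ∈ RobbaR p r.frob)
    (h : ∀ x, hD.phi (F x) = κ • F (hE.phi x)) (i j : Fin d) :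
    semiMat b c F i j ∈ RobbaR p r := by
  obtain ⟨P, P', -, h2, h3⟩ := hb
  obtain ⟨Q, -, -, -, hQ⟩ := hc
  have e1 := semiMat_comp b b c (F := hD.phi.toAddMonoidHom) (σ := frob p)
    (fun a x => map_smulₛₗ hD.phi a x) F
  have e2 := semiMat_comp b c c hF hE.phi
  have e3 : semiMat b c (hD.phi.toAddMonoidHom ∘ F) = κ • semiMat b c (F ∘ hE.phi) := by
    rw [← semiMat_smul]
    exact congrArg _ (funext h)
  rw [e1, e2] at e3
  change semiMat b b hD.phi * _ = _ at e3
  rw [h3] at e3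
  refine matrix_descent r.2 (U := semiMat b c F) (P := P'.map (RobbaR p r.frob).subtype)
    (Q := κ • (semiMat c c hE.phi).map σ) (fun i j => (P' i j).2) (fun i j => ?_) ?_ i j
  · rw [hQ]
    exact mul_mem hκ (hσ _ (Q i j).2)
  · rw [mul_assoc, Matrix.mul_smul, ← e3, ← mul_assoc, map_mul_eq_one _ h2, one_mul]

theorem mem_span_iff_repr (x : D) :
    x ∈ Submodule.span (RobbaR p r) (Set.range b) ↔ ∀ i, b.repr x i ∈ RobbaR p r := by
  rw [Module.Basis.mem_span_iff_repr_mem]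
  refine forall_congr' fun i => ⟨?_, fun h => ⟨⟨_, h⟩, rfl⟩⟩
  rintro ⟨y, hy⟩
  rw [← hy]
  exact y.2

theorem map_mem_span (hb : IsModelBasis hD r b) (hc : IsModelBasis hE r c)
    {σ : Robba p →+* Robba p} (hσ : ∀ s : ℝ, ∀ f ∈ RobbaR p s, σ f ∈ RobbaR p s) {F : E →+ D}
    (hF : ∀ a x, F (a • x) = σ a • F x) {κ : Robba p} (hκ : κ ∈ RobbaR p r.frob)
    (h : ∀ x, hD.phi (F x) = κ • F (hE.phi x)) {x : E}
    (hx : x ∈ Submodule.span (RobbaR p r) (Set.range c)) :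
    F x ∈ Submodule.span (RobbaR p r) (Set.range b) := by
  induction hx using Submodule.span_induction with
  | mem x hx =>
    obtain ⟨j, rfl⟩ := hx
    exact (mem_span_iff_repr _).2 fun i => semiMat_mem hb hc (hσ _) hF hκ h i j
  | zero => rw [map_zero]; exact zero_mem _
  | add x y _ _ hx hy => rw [map_add]; exact add_mem hx hy
  | smul a x _ hx =>
    have : F (a • x) = (⟨σ a, hσ _ _ a.2⟩ : RobbaR p r) • F x := hF a x
    rw [this]
    exact Submodule.smul_mem _ _ hx

theorem IsModelBasis.span_le {b' : Module.Basis (Fin d) (Robba p) D} (hb : IsModelBasis hD r b)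
    (hb' : IsModelBasis hD r b') : Submodule.span (RobbaR p r) (Set.range b) ≤
      Submodule.span (RobbaR p r) (Set.range b') := fun _ hx =>
  map_mem_span hb' hb (σ := RingHom.id _) (fun _ _ hf => hf) (F := AddMonoidHom.id D)
    (fun _ _ => rfl) (one_mem _) (fun _ => (one_smul _ _).symm) hx

theorem IsModelBasis.act_mem (hb : IsModelBasis hD r b) (γ : Gam p) {x : D}
    (hx : x ∈ Submodule.span (RobbaR p r) (Set.range b)) :
    hD.act γ x ∈ Submodule.span (RobbaR p r) (Set.range b) :=
  map_mem_span hb hb (σ := gam (chi p γ)) (fun _ _ hf => gam_mem _ hf) (F := hD.act γ)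
    (hD.act_smul γ) (one_mem _)
    (fun _ => ((one_smul (Robba p) _).trans (hD.act_phi γ _)).symm) hx

theorem span_span_eq {r' : Radius p} (h : r ≤ r') (b : Fin d → D) :
    Submodule.span (RobbaR p r') (Submodule.span (RobbaR p r) (Set.range b) : Set D) =
      Submodule.span (RobbaR p r') (Set.range b) := by
  refine le_antisymm (Submodule.span_le.2 fun x hx => ?_)
    (Submodule.span_mono Submodule.subset_span)
  induction hx using Submodule.span_induction with
  | mem x hx => exact Submodule.subset_span hx
  | zero => exact zero_mem _
  | add x y _ _ hx hy => exact add_mem hx hy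
  | smul a x _ hx =>
    exact Submodule.smul_mem (Submodule.span (RobbaR p r') (Set.range b)) (resR h a) hx

theorem isModelBasis_iff : IsModelBasis hD r b ↔
    Submodule.span (RobbaR p r.frob) (Set.range fun i => hD.phi (b i)) =
      Submodule.span (RobbaR p r.frob)
        (Submodule.span (RobbaR p r) (Set.range b) : Set D) := by
  rw [span_span_eq r.le_frob]
  constructor
  · rintro ⟨P, P', h1, h2, h3⟩
    have hP : ∀ j, hD.phi (b j) = ∑ i, P i j • b i := fun j => by
      rw [semiMat_sum b b hD.phi j, h3]
      rfl
    refine le_antisymm (Submodule.span_le.2 ?_) (Submodule.span_le.2 ?_)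
    · rintro _ ⟨j, rfl⟩
      have h4 : ∑ i, P i j • b i ∈ Submodule.span (RobbaR p r.frob) (Set.range b) :=
        Submodule.sum_mem _ fun i _ => Submodule.smul_mem _ _ (Submodule.subset_span ⟨i, rfl⟩)
      rwa [← hP j] at h4
    · rintro _ ⟨j, rfl⟩
      have h4 : b j = ∑ l, P' l j • hD.phi (b l) := by
        simp only [hP, Finset.smul_sum, smul_smul]
        rw [Finset.sum_comm]
        simp only [← Finset.sum_smul]
        have h5 : ∀ i, ∑ l, P' l j * P i l = (1 : Matrix (Fin d) (Fin d) (RobbaR p r.frob)) i j :=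
          fun i => by
            rw [← h1, Matrix.mul_apply]
            exact Finset.sum_congr rfl fun l _ => mul_comm _ _
        simp [h5, Matrix.one_apply]
      exact h4.symm ▸ Submodule.sum_mem _ fun i _ => Submodule.smul_mem _ _
        (Submodule.subset_span ⟨i, rfl⟩)
  · intro h
    obtain ⟨Q, hQ1, hQ2⟩ := exists_semiMat_phi_inverse hD b
    have hP : ∀ i j, semiMat b b hD.phi i j ∈ RobbaR p r.frob := fun i j =>
      (mem_span_iff_repr (b := b) (r := r.frob) _).1 (h ▸ Submodule.subset_span ⟨j, rfl⟩) i
    have hQ : ∀ j, ∃ q : Fin d → RobbaR p r.frob, b j = ∑ i, q i • hD.phi (b i) := by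
      intro j
      have h4 : b j ∈ Submodule.span (RobbaR p r.frob) (Set.range fun i => hD.phi (b i)) :=
        h ▸ Submodule.subset_span ⟨j, rfl⟩
      obtain ⟨q, hq⟩ := (Submodule.mem_span_range_iff_exists_fun _).1 h4
      exact ⟨q, hq.symm⟩
    choose q hq using hQ
    let P : Matrix (Fin d) (Fin d) (RobbaR p r.frob) := Matrix.of fun i j => ⟨_, hP i j⟩
    let P' : Matrix (Fin d) (Fin d) (RobbaR p r.frob) := Matrix.of fun i j => q j i
    have h5 : P * P' = 1 := by
      refine mul_eq_one_of_map ?_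
      rw [← semiMat_id b]
      refine Matrix.ext fun i j => ?_
      rw [Matrix.mul_apply]
      change _ = b.repr (b j) i
      conv_rhs => rw [hq j]
      rw [map_sum, Finsupp.finsetSum_apply]
      refine Finset.sum_congr rfl fun l _ => ?_
      have : b.repr (q j l • hD.phi (b l)) i = (q j l : Robba p) * b.repr (hD.phi (b l)) i := by
        rw [Subring.smul_def, map_smul]
        rfl
      rw [this, mul_comm]
      rfl
    exact ⟨P, P', h5, mul_eq_one_comm.1 h5, rfl⟩

theorem IsModel.exists_isModelBasis {M : Submodule (RobbaR p r) D} (h : IsModel hD d r M) :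
    ∃ b : Module.Basis (Fin d) (Robba p) D, IsModelBasis hD r b ∧
      Submodule.span (RobbaR p r) (Set.range b) = M := by
  obtain ⟨b, rfl, hb⟩ := h.exists_basis
  exact ⟨b, isModelBasis_iff.2 hb, rfl⟩

theorem IsModelBasis.isModel (h : IsModelBasis hD r b) :
    IsModel hD d r (Submodule.span (RobbaR p r) (Set.range b)) :=
  ⟨⟨b, rfl, isModelBasis_iff.1 h⟩, fun γ _ hx => h.act_mem γ hx⟩

theorem IsModelBasis.existsUnique (h : IsModelBasis hD r b) : ∃! M, IsModel hD d r M := by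
  refine ⟨_, h.isModel, fun M hM => ?_⟩
  obtain ⟨b', hb', rfl⟩ := hM.exists_isModelBasis
  exact le_antisymm (hb'.span_le h) (h.span_le hb')

variable {j : E →ₗ[Robba p] D}

theorem IsModelBasis.map_mem (hb : IsModelBasis hD r b) (hc : IsModelBasis hE r c)
    (hj : ∀ x, j (hE.phi x) = hD.phi (j x)) {x : E}
    (hx : x ∈ Submodule.span (RobbaR p r) (Set.range c)) :
    j x ∈ Submodule.span (RobbaR p r) (Set.range b) :=
  map_mem_span hb hc (σ := RingHom.id _) (fun _ _ hf => hf) (F := j.toAddMonoidHom)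
    (fun a x => map_smul j a x) (one_mem _)
    (fun x => ((one_smul (Robba p) _).trans (hj x)).symm) hx

theorem IsModelBasis.nonempty_quotModel (hb : IsModelBasis hD r b) (hc : IsModelBasis hE r c)
    (hj : ∀ x, j (hE.phi x) = hD.phi (j x)) : Nonempty (QuotModel hD hE j d r) :=
  ⟨⟨_, _, hb.isModel, hc.isModel, fun _ hx => hb.map_mem hc hj hx⟩⟩

theorem IsModelBasis.semiMat_map_mem (hb : IsModelBasis hD r b) (hc : IsModelBasis hE r c)
    (hj : ∀ x, j (hE.phi x) = hD.phi (j x)) (i l : Fin d) : semiMat b c j i l ∈ RobbaR p r :=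
  semiMat_mem hb hc (σ := RingHom.id _) (fun _ hf => hf) (F := j.toAddMonoidHom)
    (fun a x => map_smul j a x) (one_mem _)
    (fun x => ((one_smul (Robba p) _).trans (hj x)).symm) i l

theorem IsModelBasis.semiMat_act_mem (hb : IsModelBasis hD r b) (γ : Gam p) (i l : Fin d) :
    semiMat b b (hD.act γ) i l ∈ RobbaR p r :=
  semiMat_mem hb hb (σ := gam (chi p γ)) (fun _ hf => gam_mem _ hf) (F := hD.act γ)
    (hD.act_smul γ) (one_mem _)
    (fun x => ((one_smul (Robba p) _).trans (hD.act_phi γ x)).symm) i l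

theorem det_mem_RobbaR {r : ℝ} {P : Matrix (Fin d) (Fin d) (Robba p)}
    (h : ∀ i l, P i l ∈ RobbaR p r) : P.det ∈ RobbaR p r := by
  rw [Matrix.det_apply]
  exact sum_mem fun σ _ => zsmul_mem (prod_mem fun i _ => h _ _) _

theorem exists_frob_det (hb : IsModelBasis hD r b) (hc : IsModelBasis hE r c)
    (hj : ∀ x, j (hE.phi x) = hD.phi (j x)) :
    ∃ u ∈ RobbaR p r.frob, frob p (semiMat b c j).det = u * (semiMat b c j).det := by
  have e1 := semiMat_comp b b c (F := hD.phi.toAddMonoidHom) (σ := frob p)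
    (fun a x => map_smulₛₗ hD.phi a x) j
  have e2 := semiMat_comp b c c (F := j.toAddMonoidHom) (σ := RingHom.id _)
    (fun a x => map_smul j a x) hE.phi
  have e3 : hD.phi.toAddMonoidHom ∘ j = j.toAddMonoidHom ∘ hE.phi := funext fun x => (hj x).symm
  rw [e3, e2] at e1
  obtain ⟨P, P', h1, h2, h3⟩ := hb
  obtain ⟨Q, -, -, -, hQ⟩ := hc
  have h4 := congrArg Matrix.det e1
  rw [Matrix.det_mul, Matrix.det_mul] at h4
  change _ * ((semiMat c c hE.phi).map id).det =
    (semiMat b b hD.phi).det * ((frob p).mapMatrix (semiMat b c j)).det at h4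
  rw [Matrix.map_id, ← RingHom.map_det] at h4
  have h5 : (P'.map (RobbaR p r.frob).subtype).det * (semiMat b b hD.phi).det = 1 := by
    rw [h3, ← Matrix.det_mul, map_mul_eq_one _ h2, Matrix.det_one]
  refine ⟨(P'.map (RobbaR p r.frob).subtype).det * (semiMat c c hE.phi).det,
    mul_mem (det_mem_RobbaR fun i l => (P' i l).2) (det_mem_RobbaR fun i l => ?_), ?_⟩
  · rw [hQ]; exact (Q i l).2
  · change (semiMat b c j).det * _ = _ at h4
    linear_combination (-(frob p (semiMat b c j).det)) * h5 -
      (P'.map (RobbaR p r.frob).subtype).det * h4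

theorem exists_gam_det (hb : IsModelBasis hD r b) (hc : IsModelBasis hE r c)
    (hjγ : ∀ γ x, j (hE.act γ x) = hD.act γ (j x)) (γ : Gam p) :
    ∃ v ∈ RobbaR p r, gam (chi p γ) (semiMat b c j).det = v * (semiMat b c j).det := by
  have e1 := semiMat_comp b b c (hD.act_smul γ) j
  have e2 := semiMat_comp b c c (F := j.toAddMonoidHom) (σ := RingHom.id _)
    (fun a x => map_smul j a x) (hE.act γ)
  have e3 : hD.act γ ∘ j = j.toAddMonoidHom ∘ hE.act γ := funext fun x => (hjγ γ x).symm
  have e4 := semiMat_comp b b b (hD.act_smul γ) (hD.act γ⁻¹ : D → D)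
  have e5 : hD.act γ ∘ hD.act γ⁻¹ = id := by
    funext x
    change (hD.act γ * hD.act γ⁻¹) x = x
    rw [← map_mul, mul_inv_cancel, map_one]
    rfl
  have e6 : semiMat b b (hD.act γ) * (semiMat b b (hD.act γ⁻¹)).map (gam (chi p γ)) = 1 :=
    e4.symm.trans ((congrArg (semiMat b b) e5).trans (semiMat_id b))
  have h4 := congrArg Matrix.det (e2.symm.trans ((congrArg (semiMat b c) e3).symm.trans e1))
  rw [Matrix.det_mul, Matrix.det_mul] at h4
  change _ * ((semiMat c c (hE.act γ)).map id).det =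
    (semiMat b b (hD.act γ)).det * ((gam (chi p γ)).mapMatrix (semiMat b c j)).det at h4
  rw [Matrix.map_id, ← RingHom.map_det] at h4
  have h5 := congrArg Matrix.det e6
  rw [Matrix.det_mul, Matrix.det_one] at h5
  refine ⟨((semiMat b b (hD.act γ⁻¹)).map (gam (chi p γ))).det * (semiMat c c (hE.act γ)).det,
    mul_mem (det_mem_RobbaR fun i l => gam_mem _ (hb.semiMat_act_mem _ i l))
      (det_mem_RobbaR fun i l => hc.semiMat_act_mem _ i l), ?_⟩
  change (semiMat b c j).det * _ = _ at h4
  linear_combination (-(gam (chi p γ) (semiMat b c j).det)) * h5 -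
    ((semiMat b b (hD.act γ⁻¹)).map (gam (chi p γ))).det * h4

/-- If `E ⊆ D` are `(φ, Γ)`-modules of the same rank, then `t ^ k D ⊆ E` for some `k`. -/
theorem exists_tElt_pow_smul_mem_range (ε : EpsSeq p) (hb : IsModelBasis hD r b)
    (hc : IsModelBasis hE r c) (hinj : Function.Injective j)
    (hj : ∀ x, j (hE.phi x) = hD.phi (j x)) (hjγ : ∀ γ x, j (hE.act γ x) = hD.act γ (j x)) :
    ∃ k : ℕ, ∀ x : D, tElt p ^ k • x ∈ LinearMap.range j := by
  obtain ⟨γ, hγ, -⟩ := exists_gam_fixed ε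
  obtain ⟨u, hu, h1⟩ := exists_frob_det hb hc hj
  obtain ⟨v, hv, h2⟩ := exists_gam_det hb hc hjγ γ
  have hn : 2 ≤ 1 + p ^ 2 := by
    have := pow_pos hp.1.pos 2
    omega
  obtain ⟨k, g, hg⟩ := exists_dvd_tR_pow (r := r) (f := ⟨_, det_mem_RobbaR
    (hb.semiMat_map_mem hc hj)⟩) (v := ⟨v, hv⟩) hn hγ
    (fun h => det_semiMat_ne_zero b c hinj (congrArg Subtype.val h)) h2 hu h1
  have hg' : tElt p ^ k = (semiMat b c j).det * g := congrArg Subtype.val hg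
  refine ⟨k, fun x => ?_⟩
  rw [← b.sum_repr x, Finset.smul_sum]
  refine Submodule.sum_mem _ fun i _ => ?_
  rw [smul_comm]
  refine Submodule.smul_mem _ _ ⟨∑ l, ((semiMat b c j).adjugate l i * g) • c l, ?_⟩
  rw [map_sum]
  simp only [map_smul, semiMat_sum b c j, Finset.smul_sum, smul_smul]
  rw [Finset.sum_comm]
  simp only [← Finset.sum_smul]
  have h3 : ∀ m, ∑ l, (semiMat b c j).adjugate l i * g * semiMat b c j m l =
      (tElt p ^ k • (1 : Matrix (Fin d) (Fin d) (Robba p))) m i := fun m => by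
    rw [hg', mul_comm, mul_smul, ← Matrix.mul_adjugate, Matrix.smul_apply, Matrix.mul_apply,
      Finset.smul_sum]
    exact Finset.sum_congr rfl fun l _ => by rw [smul_eq_mul]; ring
  simp [h3, Matrix.one_apply]

end Models

section ExtendScalarsMaps

variable {A B A' B' : Type*} [CommRing A] [CommRing B] [CommRing A'] [CommRing B']
  {σ : A →+* B} {σ' : A' →+* B'} {α : A →+* A'} {β : B →+* B'}
  {M N M' N' : Type*} [AddCommGroup M] [Module A M] [AddCommGroup N] [Module A N]
  [AddCommGroup M'] [Module A' M'] [AddCommGroup N'] [Module A' N']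

theorem Ext.map_map_eq_smul {u : N →ₗ[A] M} {v : M →ₗ[A] N} {s : A} (h : ∀ y, v (u y) = s • y)
    (y : Ext σ N) : Ext.map σ v (Ext.map σ u y) = σ s • y := by
  refine Ext.addMonoidHom_ext (f := ((Ext.map σ v).comp (Ext.map σ u)).toAddMonoidHom)
    (g := (LinearMap.lsmul B (Ext σ N) (σ s)).toAddMonoidHom) (fun b y => ?_) y
  change Ext.map σ v (Ext.map σ u (b • Ext.of σ y)) = σ s • b • Ext.of σ y
  rw [map_smul, map_smul, Ext.map_of, Ext.map_of, h, map_smulₛₗ, smul_comm]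

theorem Ext.map_injective [IsDomain B] {ι : Type*} (b : Module.Basis ι A N) {u : N →ₗ[A] M}
    {v : M →ₗ[A] N} {s : A} (h : ∀ y, v (u y) = s • y) (hs : σ s ≠ 0) :
    Function.Injective (Ext.map σ u) := by
  rw [injective_iff_map_eq_zero]
  intro y hy
  have h1 := Ext.map_map_eq_smul (σ := σ) h y
  rw [hy, map_zero] at h1
  refine (Ext.basis σ b).repr.injective (Finsupp.ext fun i => ?_)
  have h2 := congrArg (fun z => (Ext.basis σ b).repr z i) h1
  simp only [map_zero, map_smul, Finsupp.smul_apply, Finsupp.zero_apply, smul_eq_mul] at h2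
  rw [map_zero, Finsupp.zero_apply]
  exact (mul_eq_zero.1 h2.symm).resolve_left hs

theorem Ext.mapₛ_map (h : ∀ a, β (σ a) = σ' (α a)) {f : M →ₛₗ[α] M'} {g : N →ₛₗ[α] N'}
    {u : N →ₗ[A] M} {u' : N' →ₗ[A'] M'} (hu : ∀ y, f (u y) = u' (g y)) (y : Ext σ N) :
    Ext.mapₛ h f (Ext.map σ u y) = Ext.map σ' u' (Ext.mapₛ h g y) := by
  refine Ext.addMonoidHom_ext (f := (Ext.mapₛ h f).toAddMonoidHom.comp (Ext.map σ u).toAddMonoidHom)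
    (g := (Ext.map σ' u').toAddMonoidHom.comp (Ext.mapₛ h g).toAddMonoidHom) (fun b y => ?_) y
  change Ext.mapₛ h f (Ext.map σ u (b • Ext.of σ y)) = Ext.map σ' u' (Ext.mapₛ h g (b • Ext.of σ y))
  rw [map_smul, Ext.map_of, Ext.mapₛ_smul_of, Ext.mapₛ_smul_of, map_smul, Ext.map_of, hu]

theorem Ext.range_map_le_comap (h : ∀ a, β (σ a) = σ' (α a)) {f : M →ₛₗ[α] M'} {g : N →ₛₗ[α] N'}
    {u : N →ₗ[A] M} {u' : N' →ₗ[A'] M'} (hu : ∀ y, f (u y) = u' (g y)) :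
    LinearMap.range (Ext.map σ u) ≤ (LinearMap.range (Ext.map σ' u')).comap (Ext.mapₛ h f) := by
  rintro _ ⟨y, rfl⟩
  exact ⟨Ext.mapₛ h g y, (Ext.mapₛ_map h hu y).symm⟩

theorem Ext.range_map_le_span (h : ∀ a, β (σ a) = σ' (α a)) {f : M →ₛₗ[α] M'} {g : N →ₛₗ[α] N'}
    {u : N →ₗ[A] M} {u' : N' →ₗ[A'] M'} (hu : ∀ y, f (u y) = u' (g y))
    (hg : Function.Surjective (Ext.lift (Ext.mapₛ h g))) :
    LinearMap.range (Ext.map σ' u') ≤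
      Submodule.span B' (Ext.mapₛ h f '' (LinearMap.range (Ext.map σ u) : Set (Ext σ M))) := by
  rintro _ ⟨y', rfl⟩
  obtain ⟨z, rfl⟩ := hg y'
  refine Ext.induction (P := fun z => Ext.map σ' u' (Ext.lift (Ext.mapₛ h g) z) ∈ Submodule.span B'
    (Ext.mapₛ h f '' (LinearMap.range (Ext.map σ u) : Set (Ext σ M)))) ?_ (fun x y hx hy => ?_)
    (fun b y => ?_) z
  · rw [map_zero, map_zero]
    exact zero_mem _
  · rw [map_add, map_add]
    exact add_mem hx hy
  · rw [Ext.lift_smul_of, map_smul, ← Ext.mapₛ_map h hu]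
    exact Submodule.smul_mem _ _ (Submodule.subset_span ⟨_, ⟨y, rfl⟩, rfl⟩)

theorem Ext.of_injective_of_retraction (ρ : B →+ A) (h : ∀ a b, ρ (σ a * b) = a * ρ b)
    (h1 : ρ 1 = 1) : Function.Injective (Ext.of σ : M →ₛₗ[σ] Ext σ M) := by
  let ρ' : Via σ →ₗ[A] A :=
    { toFun := ρ
      map_add' := ρ.map_add
      map_smul' := fun a b => by
        rw [Algebra.smul_def]
        exact h a b }
  let g : TensorProduct A (Via σ) M →ₗ[A] M := TensorProduct.lift ((LinearMap.lsmul A M).comp ρ')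
  refine Function.LeftInverse.injective (g := g) fun x => ?_
  change TensorProduct.lift ((LinearMap.lsmul A M).comp ρ') (TensorProduct.tmul A (1 : Via σ) x) = x
  rw [TensorProduct.lift.tmul]
  change ρ 1 • x = x
  rw [h1, one_smul]

theorem injective_of_lift_injective {P : Type*} [AddCommGroup P] [Module B P] (ρ : B →+ A)
    (h : ∀ a b, ρ (σ a * b) = a * ρ b) (h1 : ρ 1 = 1) {f : M →ₛₗ[σ] P}
    (hf : Function.Injective (Ext.lift f)) : Function.Injective f := by
  intro x y hxy
  rw [← Ext.lift_of f x, ← Ext.lift_of f y] at hxy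
  exact Ext.of_injective_of_retraction ρ h h1 (hf hxy)

end ExtendScalarsMaps

section Retraction

theorem exists_retraction {K L : Type*} [Field K] [Field L] (σ : K →+* L) :
    ∃ π : L →+ K, (∀ a b, π (σ a * b) = a * π b) ∧ π 1 = 1 := by
  let := σ.toAlgebra
  obtain ⟨g, hg⟩ := (Algebra.linearMap K L).exists_leftInverse_of_injective
    (LinearMap.ker_eq_bot.2 σ.injective)
  refine ⟨g.toAddMonoidHom, fun a b => ?_, ?_⟩
  · exact (congrArg g (Algebra.smul_def a b).symm).trans (g.map_smul a b)
  · have := LinearMap.congr_fun hg 1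
    simpa using this

theorem exists_retraction_map {K L : Type*} [Field K] [Field L] (σ : K →+* L) :
    ∃ ρ : L⟦X⟧ →+ K⟦X⟧, (∀ a b, ρ (PowerSeries.map σ a * b) = a * ρ b) ∧ ρ 1 = 1 := by
  obtain ⟨π, h, h1⟩ := exists_retraction σ
  refine ⟨⟨⟨fun f => PowerSeries.mk fun i => π (coeff i f), ?_⟩, fun f g => ?_⟩, fun a b => ?_, ?_⟩
  · ext i; simp
  · ext i; simp
  · ext i
    change coeff i (PowerSeries.mk fun i => π (coeff i (PowerSeries.map σ a * b))) =
      coeff i (a * PowerSeries.mk fun i => π (coeff i b))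
    rw [coeff_mk, coeff_mul, coeff_mul, map_sum]
    exact Finset.sum_congr rfl fun x _ => by rw [coeff_map, h, coeff_mk]
  · ext i
    change coeff i (PowerSeries.mk fun i => π (coeff i (1 : L⟦X⟧))) = _
    rw [coeff_mk, coeff_one, coeff_one]
    split_ifs
    · exact h1
    · exact map_zero π

end Retraction

section ModelMaps

variable {p : ℕ} [hp : Fact p.Prime] {d : ℕ} {D : Type*} [AddCommGroup D] [Module (Robba p) D]
  {hD : GenPhiGamma p D} {r r' : Radius p}

theorem IsModel.exists_basis_restrict {M : Submodule (RobbaR p r) D} (hM : IsModel hD d r M)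
    {M' : Submodule (RobbaR p r') D} (hM' : IsModel hD d r' M') (h : r ≤ r') :
    ∃ (b : Module.Basis (Fin d) (Robba p) D) (c : Module.Basis (Fin d) (RobbaR p r) M)
      (c' : Module.Basis (Fin d) (RobbaR p r') M'), IsModelBasis hD r b ∧
      (∀ i, (c i : D) = b i) ∧ ∀ i, (c' i : D) = b i := by
  obtain ⟨b, hb, rfl⟩ := hM.exists_isModelBasis
  obtain rfl := (hb.mono h).existsUnique.unique hM' (hb.mono h).isModel
  exact ⟨b, b.restrictScalars _, b.restrictScalars _, hb, b.restrictScalars_apply _,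
    b.restrictScalars_apply _⟩

theorem IsModel.exists_basis' {M : Submodule (RobbaR p r) D} (hM : IsModel hD d r M) :
    ∃ (b : Module.Basis (Fin d) (Robba p) D) (c : Module.Basis (Fin d) (RobbaR p r) M),
      IsModelBasis hD r b ∧ ∀ i, (c i : D) = b i := by
  obtain ⟨b, c, -, h1, h2, -⟩ := hM.exists_basis_restrict hM le_rfl
  exact ⟨b, c, h1, h2⟩

theorem IsModel.res_mem {M : Submodule (RobbaR p r) D} (hM : IsModel hD d r M)
    {M' : Submodule (RobbaR p r') D} (hM' : IsModel hD d r' M') (h : r ≤ r') {x : D} (hx : x ∈ M) :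
    x ∈ M' := by
  obtain ⟨b, hb, rfl⟩ := hM.exists_isModelBasis
  obtain rfl := (hb.mono h).existsUnique.unique hM' (hb.mono h).isModel
  exact (mem_span_iff_repr x).2 fun i => RobbaR_le h ((mem_span_iff_repr x).1 hx i)

/-- The inclusion `D_r → D_r'`. -/
def IsModel.res {M : Submodule (RobbaR p r) D} (hM : IsModel hD d r M)
    {M' : Submodule (RobbaR p r') D} (hM' : IsModel hD d r' M') (h : r ≤ r') : M →ₛₗ[resR h] M' where
  toFun x := ⟨x, hM.res_mem hM' h x.2⟩
  map_add' _ _ := rfl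
  map_smul' _ _ := rfl

/-- The action of `γ` on `D_r`. -/
def IsModel.actHom {M : Submodule (RobbaR p r) D} (hM : IsModel hD d r M) (γ : Gam p) :
    M →ₛₗ[gamR r (chi p γ)] M where
  toFun x := ⟨hD.act γ x, hM.act_mem γ x x.2⟩
  map_add' _ _ := Subtype.ext (map_add _ _ _)
  map_smul' a x := Subtype.ext (hD.act_smul γ a x)

theorem IsModel.phi_mem {M : Submodule (RobbaR p r) D} (hM : IsModel hD d r M)
    {M' : Submodule (RobbaR p r.frob) D} (hM' : IsModel hD d r.frob M') {x : D} (hx : x ∈ M) :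
    hD.phi x ∈ M' := by
  obtain ⟨b, hb, rfl⟩ := hM.exists_isModelBasis
  obtain rfl := (hb.mono r.le_frob).existsUnique.unique hM' (hb.mono r.le_frob).isModel
  obtain ⟨P, P', -, -, h3⟩ := hb
  induction hx using Submodule.span_induction with
  | mem x hx =>
    obtain ⟨j, rfl⟩ := hx
    refine (mem_span_iff_repr _).2 fun i => ?_
    change semiMat b b hD.phi i j ∈ _
    rw [h3]
    exact (P i j).2
  | zero => rw [map_zero]; exact zero_mem _
  | add x y _ _ hx hy => rw [map_add]; exact add_mem hx hy
  | smul a x _ hx =>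
    have : hD.phi (a • x) = frobR r a • hD.phi x := map_smulₛₗ hD.phi (a : Robba p) x
    rw [this]
    exact Submodule.smul_mem _ _ hx

/-- The Frobenius `D_r → D_(pr)`. -/
def IsModel.phiHom {M : Submodule (RobbaR p r) D} (hM : IsModel hD d r M)
    {M' : Submodule (RobbaR p r.frob) D} (hM' : IsModel hD d r.frob M') : M →ₛₗ[frobR r] M' where
  toFun x := ⟨hD.phi x, hM.phi_mem hM' x.2⟩
  map_add' _ _ := Subtype.ext (map_add _ _ _)
  map_smul' a x := Subtype.ext (map_smulₛₗ hD.phi (a : Robba p) (x : D))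

theorem IsModel.exists_phi_matrix {M : Submodule (RobbaR p r) D} (hM : IsModel hD d r M)
    {M' : Submodule (RobbaR p r.frob) D} (hM' : IsModel hD d r.frob M') :
    ∃ (c : Module.Basis (Fin d) (RobbaR p r) M) (c' : Module.Basis (Fin d) (RobbaR p r.frob) M')
      (P P' : Matrix (Fin d) (Fin d) (RobbaR p r.frob)), P * P' = 1 ∧ P' * P = 1 ∧
      ∀ j, hM.phiHom hM' (c j) = ∑ i, P i j • c' i := by
  obtain ⟨b, c, c', ⟨P, P', h1, h2, h3⟩, hc, hc'⟩ := hM.exists_basis_restrict hM' r.le_frob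
  refine ⟨c, c', P, P', h1, h2, fun j => Subtype.ext ?_⟩
  rw [AddSubmonoidClass.coe_finsetSum]
  change hD.phi (c j) = ∑ i, (P i j : Robba p) • (c' i : D)
  rw [hc, semiMat_sum b b hD.phi j, h3]
  exact Finset.sum_congr rfl fun i _ => by rw [hc']; rfl

variable (ε : EpsSeq p)

theorem IsModel.lift_phi_bijective {M : Submodule (RobbaR p r) D} (hM : IsModel hD d r M)
    {M' : Submodule (RobbaR p r.frob) D} (hM' : IsModel hD d r.frob M') {n : ℕ}
    (hn : nOf p r ≤ n) (hn' : nOf p r.frob ≤ (n + 1 : ℕ))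
    (h : ∀ a, inclPS ε (Nat.le_succ n) (iota ε r.2 hn a) = iota ε r.frob.2 hn' (frobR r a)) :
    Function.Bijective (Ext.lift (Ext.mapₛ h (hM.phiHom hM'))) := by
  obtain ⟨c, c', P, P', h1, h2, h3⟩ := hM.exists_phi_matrix hM'
  exact Ext.lift_mapₛ_bijective h c c' h1 h2 h3

/-- The comparison of the extensions of scalars of `D_r` and of `D_r'`. -/
theorem IsModel.exists_cmp {M : Submodule (RobbaR p r) D} (hM : IsModel hD d r M)
    {M' : Submodule (RobbaR p r') D} (hM' : IsModel hD d r' M') (h : r ≤ r') {n : ℕ}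
    (hn : nOf p r ≤ n) (hn' : nOf p r' ≤ n) :
    ∃ e : Ext (iota ε r.2 hn) M ≃ₗ[(Kn ε n)⟦X⟧] Ext (iota ε r'.2 hn') M',
      ∀ x, e (Ext.of _ x) = Ext.of _ (hM.res hM' h x) := by
  obtain ⟨b, c, c', hb, hc, hc'⟩ := hM.exists_basis_restrict hM' h
  let f : M →ₛₗ[iota ε r.2 hn] Ext (iota ε r'.2 hn') M' :=
    { toFun := fun x => Ext.of _ (hM.res hM' h x)
      map_add' := fun x y => by rw [map_add, map_add]
      map_smul' := fun a x => by rw [map_smulₛₗ, map_smulₛₗ, iota_resR ε h hn hn'] }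
  have hf : Function.Bijective (Ext.lift f) :=
    Ext.lift_bijective c (Ext.basis _ c') fun i => by
      rw [Ext.basis_apply]
      exact congrArg (Ext.of _) (Subtype.ext ((hc i).trans (hc' i).symm))
  exact ⟨LinearEquiv.ofBijective _ hf, fun x => Ext.lift_of f x⟩

end ModelMaps

/-! ## Quotients of `(φ, Γ)`-modules of the same rank -/

section Quotients

variable {p : ℕ} [hp : Fact p.Prime] {d : ℕ} {D E : Type*} [AddCommGroup D] [Module (Robba p) D]
  [AddCommGroup E] [Module (Robba p) E] {hD : GenPhiGamma p D} {hE : GenPhiGamma p E}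
  {j : E →ₗ[Robba p] D} {r : Radius p}

/-- If `t ^ k D ⊆ E`, then multiplication by `t ^ k` factors through a map `D_r → E_r`. -/
theorem QuotModel.exists_quasi_inverse (Q : QuotModel hD hE j d r) (hinj : Function.Injective j)
    (hj : ∀ x, j (hE.phi x) = hD.phi (j x)) {k : ℕ}
    (hk : ∀ x : D, tElt p ^ k • x ∈ LinearMap.range j) :
    ∃ v : Q.MD →ₗ[RobbaR p r] Q.ME, (∀ x, Q.incl (v x) = tR r ^ k • x) ∧
      ∀ y, v (Q.incl y) = tR r ^ k • y := by
  choose w hw using hk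
  have hadd : ∀ x y, w (x + y) = w x + w y := fun x y => hinj (by
    rw [map_add, hw, hw, hw, smul_add])
  have hsmul : ∀ (a : Robba p) x, w (a • x) = a • w x := fun a x => hinj (by
    rw [map_smul, hw, hw, smul_comm])
  have hphi : ∀ x, hE.phi (w x) = Robba.C p p ^ k • w (hD.phi x) := fun x => hinj (by
    rw [hj, hw, map_smulₛₗ hD.phi, map_smul j, hw, map_pow, frob_tElt, mul_pow, mul_smul]
    rfl)
  obtain ⟨b, hb, hb'⟩ := Q.isModelD.exists_isModelBasis
  obtain ⟨c, hc, hc'⟩ := Q.isModelE.exists_isModelBasis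
  have hmem : ∀ x ∈ Q.MD, w x ∈ Q.ME := fun x hx => by
    rw [← hc']
    rw [← hb'] at hx
    exact map_mem_span hc hb (σ := RingHom.id _) (fun _ _ hf => hf)
      (F := ⟨⟨w, by simpa using hsmul 0 0⟩, hadd⟩) hsmul (pow_mem (single_mem _ _ _) k) hphi hx
  refine ⟨⟨⟨fun x => ⟨w x, hmem x x.2⟩, fun x y => Subtype.ext (hadd _ _)⟩,
    fun a x => Subtype.ext (hsmul a x)⟩, fun x => Subtype.ext (hw x), fun y => Subtype.ext ?_⟩
  exact hinj ((hw _).trans (map_smul j (tElt p ^ k) (y : E)).symm)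

variable {Q : QuotModel hD hE j d r} {k : ℕ} {v : Q.MD →ₗ[RobbaR p r] Q.ME} (ε : EpsSeq p)

theorem iota_tR_pow_ne_zero {n : ℕ} (hn : nOf p r ≤ n) : iota ε r.2 hn (tR r ^ k) ≠ 0 := by
  obtain ⟨u, hu⟩ := exists_iota_t ε r hn
  rw [map_pow, hu]
  exact pow_ne_zero _ (mul_ne_zero X_ne_zero u.ne_zero)

theorem exists_X_pow_eq (k : ℕ) {n : ℕ} (hn : nOf p r ≤ n) :
    ∃ g : (Kn ε n)⟦X⟧, X ^ k = g * iota ε r.2 hn (tR r ^ k) := by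
  obtain ⟨u, hu⟩ := exists_iota_t ε r hn
  refine ⟨((u⁻¹ : ((Kn ε n)⟦X⟧)ˣ) : (Kn ε n)⟦X⟧) ^ k, ?_⟩
  rw [map_pow, hu, ← mul_pow, mul_left_comm, Units.inv_mul, mul_one]

theorem QuotModel.dif_injective (hvu : ∀ y, v (Q.incl y) = tR r ^ k • y)
    {n : ℕ} (hn : nOf p r ≤ n) : Function.Injective (Q.dif ε hn) := by
  obtain ⟨-, c, -, -⟩ := Q.isModelE.exists_basis'
  exact Ext.map_injective c hvu (iota_tR_pow_ne_zero ε hn)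

theorem QuotModel.of_mk {n : ℕ} (hn : nOf p r ≤ n) (x : Q.MD) :
    Q.of ε hn (Submodule.Quotient.mk x) = Submodule.Quotient.mk (Ext.of (iota ε r.2 hn) x) := rfl

theorem QuotModel.X_pow_smul_mem (huv : ∀ x, Q.incl (v x) = tR r ^ k • x)
    {n : ℕ} (hn : nOf p r ≤ n) (x : Ext (iota ε r.2 hn) Q.MD) :
    (X : (Kn ε n)⟦X⟧) ^ k • x ∈ LinearMap.range (Q.dif ε hn) := by
  obtain ⟨g, hg⟩ := exists_X_pow_eq ε k hn
  rw [hg, mul_smul, ← Ext.map_map_eq_smul huv x]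
  exact Submodule.smul_mem _ _ ⟨_, rfl⟩

theorem QuotModel.X_pow_smul_eq_zero (huv : ∀ x, Q.incl (v x) = tR r ^ k • x)
    {n : ℕ} (hn : nOf p r ≤ n) (y : Q.Loc ε hn) :
    (X : (Kn ε n)⟦X⟧) ^ k • y = 0 := by
  obtain ⟨x, rfl⟩ := Submodule.mkQ_surjective _ y
  rw [← map_smul, Submodule.mkQ_apply, Submodule.Quotient.mk_eq_zero]
  exact QuotModel.X_pow_smul_mem ε huv hn x

theorem QuotModel.tR_pow_smul_eq_zero (huv : ∀ x, Q.incl (v x) = tR r ^ k • x)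
    (y : Q.Quo) : tR r ^ k • y = 0 := by
  obtain ⟨x, rfl⟩ := Submodule.mkQ_surjective _ y
  rw [← map_smul, Submodule.mkQ_apply, Submodule.Quotient.mk_eq_zero, ← huv]
  exact ⟨_, rfl⟩

theorem QuotModel.of_smul_of_delta (huv : ∀ x, Q.incl (v x) = tR r ^ k • x)
    {n : ℕ} (hn : nOf p r ≤ n) {a : (Kn ε (nMin p r))⟦X⟧}
    {f : RobbaR p r}
    (h : (Ideal.Quotient.mk _ f : RQ k r) = delta ε k r (Ideal.Quotient.mk _ a)) (y : Q.Quo) :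
    Q.of ε hn (f • y) = inclPS ε (nMin_le hn) a • Q.of ε hn y := by
  have h1 := congrArg (iotaQ ε k r hn) h
  rw [iotaQ_delta, iotaQ_mk] at h1
  have h2 : X ^ k ∣ iota ε r.2 hn f - inclPS ε (nMin_le hn) a :=
    Ideal.mem_span_singleton.1 (Ideal.Quotient.eq.1 h1)
  obtain ⟨g, hg⟩ := h2
  rw [map_smulₛₗ, ← sub_eq_zero, ← sub_smul, hg, mul_comm, mul_smul,
    QuotModel.X_pow_smul_eq_zero ε huv, smul_zero]

theorem QuotModel.mem_range_of_forall (huv : ∀ x, Q.incl (v x) = tR r ^ k • x)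
    (hvu : ∀ y, v (Q.incl y) = tR r ^ k • y) {x : Q.MD}
    (h : ∀ (n : ℕ) (hn : nOf p r ≤ n), Ext.of (iota ε r.2 hn) x ∈ LinearMap.range (Q.dif ε hn)) :
    x ∈ LinearMap.range Q.incl := by
  obtain ⟨-, c, -, -⟩ := Q.isModelE.exists_basis'
  obtain ⟨-, b, -, -⟩ := Q.isModelD.exists_basis'
  have hdvd : ∀ i, tR r ^ k ∣ c.repr (v x) i := by
    intro i
    rw [tR_pow_dvd_iff ε]
    intro n hn
    obtain ⟨w, hw⟩ := h n hn
    have h1 : Ext.of (iota ε r.2 hn) (v x) = iota ε r.2 hn (tR r ^ k) • w := by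
      rw [← Ext.map_of, ← hw]
      exact Ext.map_map_eq_smul hvu w
    rw [← Ext.basis_repr_of, h1, map_smul, Finsupp.smul_apply, smul_eq_mul, map_pow]
    exact (pow_dvd_pow_of_dvd (iota_t_mem ε r.2 hn) k).mul_right _
  choose z hz using hdvd
  have h2 : v x = tR r ^ k • ∑ i, z i • c i := by
    rw [← c.sum_repr (v x), Finset.smul_sum]
    exact Finset.sum_congr rfl fun i _ => by rw [hz, mul_smul]
  refine ⟨∑ i, z i • c i, b.repr.injective (Finsupp.ext fun i => ?_)⟩
  have h3 : tR r ^ k • Q.incl (∑ i, z i • c i) = tR r ^ k • x := by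
    rw [← map_smul, ← h2, huv]
  have h4 := congrArg (fun y => b.repr y i) h3
  simp only [map_smul, Finsupp.smul_apply, smul_eq_mul] at h4
  exact mul_left_cancel₀ (pow_ne_zero _ (tR_ne_zero r)) h4

/-- `D_r / E_r` is the product of its localizations. -/
theorem QuotModel.of_bijective (huv : ∀ x, Q.incl (v x) = tR r ^ k • x)
    (hvu : ∀ y, v (Q.incl y) = tR r ^ k • y) :
    Function.Bijective (fun (y : Q.Quo) (n : Idx p r) => Q.of ε n.2 y) := by
  constructor
  · intro y y' h
    obtain ⟨x, hx⟩ := Submodule.mkQ_surjective _ (y - y')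
    rw [← sub_eq_zero, ← hx, Submodule.mkQ_apply, Submodule.Quotient.mk_eq_zero]
    refine QuotModel.mem_range_of_forall ε huv hvu fun n hn => ?_
    rw [← Submodule.Quotient.mk_eq_zero, ← QuotModel.of_mk]
    rw [Submodule.mkQ_apply] at hx
    rw [hx, map_sub, sub_eq_zero]
    exact congrFun h ⟨n, hn⟩
  · intro z
    obtain ⟨-, b, -, -⟩ := Q.isModelD.exists_basis'
    choose w hw using fun n : Idx p r => Submodule.mkQ_surjective _ (z n)
    choose f hf using fun i => exists_iota_approx ε r k (fun n => if hn : nOf p r ≤ n then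
      (Ext.basis (iota ε r.2 hn) b).repr (w ⟨n, hn⟩) i else 0)
    refine ⟨Submodule.Quotient.mk (∑ i, f i • b i), funext fun n => ?_⟩
    change Q.of ε n.2 _ = z n
    rw [QuotModel.of_mk, ← hw, Submodule.mkQ_apply, Submodule.Quotient.eq]
    have h1 : ∀ i, ∃ g, iota ε r.2 n.2 (f i) - (Ext.basis (iota ε r.2 n.2) b).repr (w n) i =
        X ^ k * g := fun i => by
      have := hf i n n.2
      rw [dif_pos n.2] at this
      exact this
    choose g hg using h1
    have h2 : Ext.of (iota ε r.2 n.2) (∑ i, f i • b i) - w n =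
        (X : (Kn ε n)⟦X⟧) ^ k • ∑ i, g i • Ext.basis (iota ε r.2 n.2) b i := by
      rw [← (Ext.basis (iota ε r.2 n.2) b).sum_repr (w n), map_sum, ← Finset.sum_sub_distrib,
        Finset.smul_sum]
      refine Finset.sum_congr rfl fun i _ => ?_
      rw [map_smulₛₗ, Ext.basis_apply, ← sub_smul, hg, mul_smul]
    rw [h2]
    exact QuotModel.X_pow_smul_mem ε huv n.2 _

theorem QuotModel.exists_act (hjγ : ∀ γ x, j (hE.act γ x) = hD.act γ (j x)) {n : ℕ}
    (hn : nOf p r ≤ n) : ∃ act : Gam p →* AddMonoid.End (Q.Loc ε hn), ∀ γ : Gam p,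
      (∀ (a : (Kn ε n)⟦X⟧) (y : Q.Loc ε hn), act γ (a • y) = gamPS ε n γ a • act γ y) ∧
      ∀ (x : D) (hx : x ∈ Q.MD), Q.of ε hn (Q.cls (Q.isModelD.act_mem γ x hx)) =
        act γ (Q.of ε hn (Q.cls hx)) := by
  have hc : ∀ (γ : Gam p) (a : RobbaR p r), gamPS ε n γ (iota ε r.2 hn a) =
      iota ε r.2 hn (gamR r (chi p γ) a) := fun γ a => (iota_gamR ε r hn γ a).symm
  let g : ∀ γ : Gam p, Ext (iota ε r.2 hn) Q.MD →ₛₗ[gamPS ε n γ] Ext (iota ε r.2 hn) Q.MD :=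
    fun γ => Ext.mapₛ (hc γ) (Q.isModelD.actHom γ)
  have hg : ∀ (γ : Gam p) b x, g γ (b • Ext.of _ x) =
      gamPS ε n γ b • Ext.of _ (Q.isModelD.actHom γ x) := fun γ b x =>
    Ext.mapₛ_smul_of (hc γ) (Q.isModelD.actHom γ) b x
  have hu : ∀ (γ : Gam p) (y : Q.ME), Q.isModelD.actHom γ (Q.incl y) =
      Q.incl (Q.isModelE.actHom γ y) := fun γ y => Subtype.ext (hjγ γ y).symm
  have g_one : ∀ x, g 1 x = x := by
    refine Ext.addMonoidHom_ext (f := (g 1).toAddMonoidHom) (g := AddMonoidHom.id _)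
      (fun b x => (hg 1 b x).trans ?_)
    rw [gamPS_one, show Q.isModelD.actHom 1 x = x from Subtype.ext (by
      change hD.act 1 x = x
      rw [map_one]; rfl)]
    rfl
  have g_mul : ∀ γ γ' x, g (γ * γ') x = g γ (g γ' x) := by
    intro γ γ'
    refine Ext.addMonoidHom_ext (f := (g (γ * γ')).toAddMonoidHom)
      (g := (g γ).toAddMonoidHom.comp (g γ').toAddMonoidHom) (fun b x => (hg _ b x).trans ?_)
    rw [gamPS_mul, show Q.isModelD.actHom (γ * γ') x = Q.isModelD.actHom γ (Q.isModelD.actHom γ' x)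
      from Subtype.ext (by
        change hD.act (γ * γ') x = hD.act γ (hD.act γ' x)
        rw [map_mul]; rfl)]
    exact ((congrArg (g γ) (hg γ' b x)).trans (hg γ _ _)).symm
  let f : ∀ γ : Gam p, Q.Loc ε hn →ₛₗ[gamPS ε n γ] Q.Loc ε hn := fun γ =>
    Submodule.mapQ _ _ (g γ) (Ext.range_map_le_comap (hc γ) (hu γ))
  have hf : ∀ γ x, f γ (Submodule.Quotient.mk x) = Submodule.Quotient.mk (g γ x) := fun _ _ => rfl
  refine ⟨⟨⟨fun γ => (f γ).toAddMonoidHom, ?_⟩, ?_⟩, fun γ => ⟨fun a y => (f γ).map_smulₛₗ a y,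
    fun x hx => ?_⟩⟩
  · refine AddMonoidHom.ext fun y => ?_
    obtain ⟨x, rfl⟩ := Submodule.mkQ_surjective _ y
    exact (hf 1 x).trans (congrArg _ (g_one x))
  · intro γ γ'
    refine AddMonoidHom.ext fun y => ?_
    obtain ⟨x, rfl⟩ := Submodule.mkQ_surjective _ y
    exact (hf _ x).trans (congrArg _ (g_mul γ γ' x))
  · exact congrArg Submodule.Quotient.mk (Ext.mapₛ_of (hc γ) (Q.isModelD.actHom γ) ⟨x, hx⟩).symm

theorem QuotModel.exists_res {r' : Radius p} (h : r ≤ r') (Q' : QuotModel hD hE j d r') :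
    ∃ res : Q.Quo →ₛₗ[resR h] Q'.Quo,
      (∀ (x : D) (hx : x ∈ Q.MD), ∃ hx' : x ∈ Q'.MD, res (Q.cls hx) = Q'.cls hx') ∧
      ∀ (n : ℕ) (hn : nOf p r ≤ n) (hn' : nOf p r' ≤ n),
        ∃ cmp : Q.Loc ε hn ≃ₗ[(Kn ε n)⟦X⟧] Q'.Loc ε hn',
          ∀ y : Q.Quo, Q'.of ε hn' (res y) = cmp (Q.of ε hn y) := by
  have hle : LinearMap.range Q.incl ≤
      (LinearMap.range Q'.incl).comap (Q.isModelD.res Q'.isModelD h) := by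
    rintro _ ⟨y, rfl⟩
    exact ⟨Q.isModelE.res Q'.isModelE h y, rfl⟩
  refine ⟨Submodule.mapQ _ _ (Q.isModelD.res Q'.isModelD h) hle, fun x hx =>
    ⟨Q.isModelD.res_mem Q'.isModelD h hx, rfl⟩, fun n hn hn' => ?_⟩
  obtain ⟨e, he⟩ := Q.isModelD.exists_cmp ε Q'.isModelD h hn hn'
  obtain ⟨e', he'⟩ := Q.isModelE.exists_cmp ε Q'.isModelE h hn hn'
  have hcomm : ∀ y, e (Q.dif ε hn y) = Q'.dif ε hn' (e' y) := by
    refine Ext.addMonoidHom_ext (f := (e.toLinearMap.comp (Q.dif ε hn)).toAddMonoidHom)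
      (g := ((Q'.dif ε hn').comp e'.toLinearMap).toAddMonoidHom) fun b y => ?_
    change e (Q.dif ε hn (b • Ext.of _ y)) = Q'.dif ε hn' (e' (b • Ext.of _ y))
    rw [map_smul, map_smul, map_smul, map_smul, he']
    congr 1
    exact he _
  have hmap : (LinearMap.range (Q.dif ε hn)).map (e : _ →ₗ[(Kn ε n)⟦X⟧] _) =
      LinearMap.range (Q'.dif ε hn') := by
    refine le_antisymm ?_ ?_
    · rintro _ ⟨_, ⟨y, rfl⟩, rfl⟩
      exact ⟨e' y, (hcomm y).symm⟩
    · rintro _ ⟨y, rfl⟩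
      exact ⟨_, ⟨e'.symm y, rfl⟩, (hcomm _).trans (by rw [LinearEquiv.apply_symm_apply])⟩
  refine ⟨Submodule.Quotient.equiv _ _ e hmap, fun y => ?_⟩
  obtain ⟨x, rfl⟩ := Submodule.mkQ_surjective _ y
  exact congrArg Submodule.Quotient.mk (he x).symm

theorem QuotModel.exists_phi (hj : ∀ x, j (hE.phi x) = hD.phi (j x))
    (Q' : QuotModel hD hE j d r.frob) :
    ∃ φ : Q.Quo →ₛₗ[frobR r] Q'.Quo,
      (∀ (x : D) (hx : x ∈ Q.MD), ∃ hx' : hD.phi x ∈ Q'.MD, φ (Q.cls hx) = Q'.cls hx') ∧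
      ∀ (n : ℕ) (hn : nOf p r ≤ n) (hn' : nOf p r.frob ≤ (n + 1 : ℕ)),
        ∃ φn : Q.Loc ε hn →ₛₗ[inclPS ε (Nat.le_succ n)] Q'.Loc ε hn',
          Function.Injective φn ∧ Function.Bijective (Ext.lift φn) ∧
          ∀ y : Q.Quo, Q'.of ε hn' (φ y) = φn (Q.of ε hn y) := by
  have hu : ∀ y : Q.ME, Q.isModelD.phiHom Q'.isModelD (Q.incl y) =
      Q'.incl (Q.isModelE.phiHom Q'.isModelE y) := fun y => Subtype.ext (hj y).symm
  have hle : LinearMap.range Q.incl ≤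
      (LinearMap.range Q'.incl).comap (Q.isModelD.phiHom Q'.isModelD) := by
    rintro _ ⟨y, rfl⟩
    exact ⟨Q.isModelE.phiHom Q'.isModelE y, (hu y).symm⟩
  refine ⟨Submodule.mapQ _ _ (Q.isModelD.phiHom Q'.isModelD) hle, fun x hx =>
    ⟨Q.isModelD.phi_mem Q'.isModelD hx, rfl⟩, fun n hn hn' => ?_⟩
  have hc : ∀ a : RobbaR p r, inclPS ε (Nat.le_succ n) (iota ε r.2 hn a) =
      iota ε r.frob.2 hn' (frobR r a) := fun a => (iota_frob ε r hn hn' a).symm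
  have hbij : Function.Bijective (Ext.lift (Submodule.mapQ _ _
      (Ext.mapₛ hc (Q.isModelD.phiHom Q'.isModelD)) (Ext.range_map_le_comap hc hu))) :=
    lift_mapQ_bijective (Q.isModelD.lift_phi_bijective ε Q'.isModelD hn hn' hc) _ _ _
      (Ext.range_map_le_span hc hu (Q.isModelE.lift_phi_bijective ε Q'.isModelE hn hn' hc).2)
  obtain ⟨ρ, hρ, hρ1⟩ := exists_retraction_map (inclK ε (Nat.le_succ n))
  refine ⟨_, injective_of_lift_injective ρ hρ hρ1 hbij.1, hbij, fun y => ?_⟩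
  obtain ⟨x, rfl⟩ := Submodule.mkQ_surjective _ y
  exact congrArg Submodule.Quotient.mk
    (Ext.mapₛ_of hc (Q.isModelD.phiHom Q'.isModelD) x).symm

end Quotients

end PhiGamma

end


theorem theorem3p3 (p : ℕ) [Fact p.Prime] (ε : EpsSeq p) :
    ∃ δ : ∀ (k : ℕ) (r : Radius p), KT ε k (nMin p r) →+* RQ k r,
      -- the `ℚ_p(ε^(n(r)))[t] / (t ^ k)`-algebra structure of `R^r / (t ^ k)`
      (∀ (k : ℕ) (r : Radius p),
        (∀ (n : ℕ) (hn : nOf p r ≤ n) (a : KT ε k (nMin p r)),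
          iotaQ ε k r hn (δ k r a) = inclKT ε k (nMin_le hn) a) ∧
        (∀ δ' : KT ε k (nMin p r) →+* RQ k r,
          (∀ (n : ℕ) (hn : nOf p r ≤ n) (a : KT ε k (nMin p r)),
            iotaQ ε k r hn (δ' a) = inclKT ε k (nMin_le hn) a) → δ' = δ k r) ∧
        (∀ (γ : Gam p) (a : KT ε k (nMin p r)),
          δ k r (gamKT ε k (nMin p r) γ a) = gamQ k r γ (δ k r a))) ∧
      -- pure `t ^ k`-torsion `(φ, Γ)`-modules
      (∀ (k d : ℕ) (S : Type*) [AddCommGroup S] [Module (Robba p) S] [Module (RQuot p k) S]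
        [IsScalarTower (Robba p) (RQuot p k) S] (hS : GenPhiGamma p S)
        (e : Module.Basis (Fin d) (RQuot p k) S),
        (∃ r₀ : Radius p, Nonempty (TorsionModel hS e r₀)) ∧
        ∀ (r₀ : Radius p) (M : TorsionModel hS e r₀) (r : Radius p) (hr : r₀ ≤ r),
          Function.Bijective (Ext.lift (M.phi hr)) ∧
          (∀ (n : ℕ) (hn : nOf p r ≤ n),
            Nonempty (Module.Basis (Fin d) (KT ε k n) (TLoc ε k d r hn))) ∧
          -- (1)
          Function.Bijective (fun (x : TMod k d r) (n : Idx p r) => TLoc.of ε k d r n.2 x) ∧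
          (∀ (n : ℕ) (hn : nOf p r ≤ n) (a : KT ε k (nMin p r)) (x : TMod k d r),
            TLoc.of ε k d r hn (δ k r a • x) = inclKT ε k (nMin_le hn) a • TLoc.of ε k d r hn x) ∧
          (∀ (n : ℕ) (hn : nOf p r ≤ n), ∃ act : Gam p →* AddMonoid.End (TLoc ε k d r hn),
            ∀ γ : Gam p,
              (∀ (a : KT ε k n) (y : TLoc ε k d r hn),
                act γ (a • y) = gamKT ε k n γ a • act γ y) ∧
              ∀ x : TMod k d r, TLoc.of ε k d r hn (M.act hr γ x) = act γ (TLoc.of ε k d r hn x)) ∧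
          -- (2)
          (∀ (r' : Radius p) (h : r ≤ r') (n : ℕ) (hn : nOf p r ≤ n) (hn' : nOf p r' ≤ n),
            ∃ cmp : TLoc ε k d r hn ≃ₗ[KT ε k n] TLoc ε k d r' hn',
              ∀ x : TMod k d r,
                TLoc.of ε k d r' hn' (TMod.res k d h x) = cmp (TLoc.of ε k d r hn x)) ∧
          -- (3)
          (∀ (n : ℕ) (hn : nOf p r ≤ n) (hn' : nOf p r.frob ≤ (n + 1 : ℕ)),
            ∃ φ : TLoc ε k d r hn →ₛₗ[inclKT ε k (Nat.le_succ n)] TLoc ε k d r.frob hn',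
              Function.Injective φ ∧ Function.Bijective (Ext.lift φ) ∧
              ∀ x : TMod k d r,
                TLoc.of ε k d r.frob hn' (M.phi hr x) = φ (TLoc.of ε k d r hn x))) ∧
      -- quotients `D / E` of `(φ, Γ)`-modules of the same rank
      (∀ (d : ℕ) (D E : Type*) [AddCommGroup D] [Module (Robba p) D] [AddCommGroup E]
        [Module (Robba p) E] (hD : GenPhiGamma p D) (hE : GenPhiGamma p E)
        (_ : Module.Basis (Fin d) (Robba p) D) (_ : Module.Basis (Fin d) (Robba p) E)
        (j : E →ₗ[Robba p] D), Function.Injective j → (∀ x, j (hE.phi x) = hD.phi (j x)) →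
        (∀ γ x, j (hE.act γ x) = hD.act γ (j x)) →
        (∃ k : ℕ, ∀ x : D, tElt p ^ k • x ∈ LinearMap.range j) ∧
        ∃ r₀ : Radius p, ∀ r : Radius p, r₀ ≤ r →
          (∃! M, IsModel hD d r M) ∧ (∃! M, IsModel hE d r M) ∧
          Nonempty (QuotModel hD hE j d r) ∧
          ∀ Q : QuotModel hD hE j d r,
            (∀ (n : ℕ) (hn : nOf p r ≤ n), Function.Injective (Q.dif ε hn)) ∧
            -- (1)
            Function.Bijective (fun (y : Q.Quo) (n : Idx p r) => Q.of ε n.2 y) ∧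
            (∀ k : ℕ, (∀ x : D, tElt p ^ k • x ∈ LinearMap.range j) →
              (∀ y : Q.Quo, tR r ^ k • y = 0) ∧
              ∀ (n : ℕ) (hn : nOf p r ≤ n),
                (∀ y : Q.Loc ε hn, (X : (Kn ε n)⟦X⟧) ^ k • y = 0) ∧
                ∀ (a : (Kn ε (nMin p r))⟦X⟧) (f : RobbaR p r),
                  (Ideal.Quotient.mk _ f : RQ k r) = δ k r (Ideal.Quotient.mk _ a) →
                  ∀ y : Q.Quo, Q.of ε hn (f • y) = inclPS ε (nMin_le hn) a • Q.of ε hn y) ∧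
            (∀ (n : ℕ) (hn : nOf p r ≤ n), ∃ act : Gam p →* AddMonoid.End (Q.Loc ε hn),
              ∀ γ : Gam p,
                (∀ (a : (Kn ε n)⟦X⟧) (y : Q.Loc ε hn),
                  act γ (a • y) = gamPS ε n γ a • act γ y) ∧
                ∀ (x : D) (hx : x ∈ Q.MD),
                  Q.of ε hn (Q.cls (Q.isModelD.act_mem γ x hx)) =
                    act γ (Q.of ε hn (Q.cls hx))) ∧
            -- (2)
            (∀ (r' : Radius p) (h : r ≤ r') (Q' : QuotModel hD hE j d r'),
              ∃ res : Q.Quo →ₛₗ[resR h] Q'.Quo,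
                (∀ (x : D) (hx : x ∈ Q.MD), ∃ hx' : x ∈ Q'.MD, res (Q.cls hx) = Q'.cls hx') ∧
                ∀ (n : ℕ) (hn : nOf p r ≤ n) (hn' : nOf p r' ≤ n),
                  ∃ cmp : Q.Loc ε hn ≃ₗ[(Kn ε n)⟦X⟧] Q'.Loc ε hn',
                    ∀ y : Q.Quo, Q'.of ε hn' (res y) = cmp (Q.of ε hn y)) ∧
            -- (3)
            (∀ Q' : QuotModel hD hE j d r.frob,
              ∃ φ : Q.Quo →ₛₗ[frobR r] Q'.Quo,
                (∀ (x : D) (hx : x ∈ Q.MD), ∃ hx' : hD.phi x ∈ Q'.MD,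
                  φ (Q.cls hx) = Q'.cls hx') ∧
                ∀ (n : ℕ) (hn : nOf p r ≤ n) (hn' : nOf p r.frob ≤ (n + 1 : ℕ)),
                  ∃ φn : Q.Loc ε hn →ₛₗ[inclPS ε (Nat.le_succ n)] Q'.Loc ε hn',
                    Function.Injective φn ∧ Function.Bijective (Ext.lift φn) ∧
                    ∀ y : Q.Quo, Q'.of ε hn' (φ y) = φn (Q.of ε hn y))) := by
  refine ⟨fun k r => delta ε k r, fun k r => ⟨fun n hn a => iotaQ_delta ε k r hn a,
    fun δ' h => delta_unique ε k r δ' h, fun γ a => delta_gamKT ε k r γ a⟩, ?_, ?_⟩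
  · intro k d S _ _ _ _ hS e
    refine ⟨exists_torsionModel ε hS e, fun r₀ M r hr => ⟨M.lift_phi_bijective hr,
      fun n hn => ⟨TLoc.basis ε k d r hn⟩, TLoc.of_bijective ε k d r,
      fun n hn a x => TLoc.of_delta_smul ε hn a x, fun n hn => M.exists_act hr ε hn,
      fun r' h n hn hn' => TLoc.exists_cmp ε h hn hn',
      fun n hn hn' => M.exists_phi hr ε hn hn'⟩⟩
  · intro d D E _ _ _ _ hD hE b c j hinj hj hjγ
    obtain ⟨r₁, hb⟩ := exists_isModelBasis hD b
    obtain ⟨r₂, hc⟩ := exists_isModelBasis hE c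
    have hk := exists_tElt_pow_smul_mem_range ε (hb _ (le_max_left r₁ r₂))
      (hc _ (le_max_right r₁ r₂)) hinj hj hjγ
    refine ⟨hk, max r₁ r₂, fun r hr => ?_⟩
    replace hb := hb r ((le_max_left _ _).trans hr)
    replace hc := hc r ((le_max_right _ _).trans hr)
    refine ⟨hb.existsUnique, hc.existsUnique, hb.nonempty_quotModel hc hj, fun Q => ?_⟩
    obtain ⟨k, hk⟩ := hk
    obtain ⟨v, huv, hvu⟩ := Q.exists_quasi_inverse hinj hj hk
    refine ⟨fun n hn => QuotModel.dif_injective ε hvu hn, QuotModel.of_bijective ε huv hvu,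
      fun l hl => ?_, fun n hn => QuotModel.exists_act ε hjγ hn,
      fun r' h Q' => QuotModel.exists_res ε h Q', fun Q' => QuotModel.exists_phi ε hj Q'⟩
    obtain ⟨w, hw, -⟩ := Q.exists_quasi_inverse hinj hj hl
    exact ⟨QuotModel.tR_pow_smul_eq_zero hw, fun n hn =>
      ⟨QuotModel.X_pow_smul_eq_zero ε hw hn, fun a f h y =>
        QuotModel.of_smul_of_delta ε hw hn h y⟩⟩
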